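/- **Conventions.** Repeated indices are summed; $g=\mathrm{diag}(1,-1,-1,-1)$; $\epsilon_{ab}=-\epsilon^{ab}$ is antisymmetric with $\epsilon_{12}=1$ (also used as $\epsilon_{jk}$ for $SU(2)$ indices $j,k\in\{1,2\}$), $\psi^a=\epsilon^{ab}\psi_b$; $\sigma^\mu$ are the Pauli matrices with $\sigma^0=\mathbf 1$. For $m\ge 0$, $D_m(x)=\frac{i}{(2\pi)^3}\int\frac{d^3q}{2\omega}\,(e^{-ip\cdot x}-e^{ip\cdot x})$, $p=(\omega,q)$, $\omega=\sqrt{|q|^2+m^2}$, is the Pauli–Jordan causal distribution. Fields are distributions on $\mathbb R^4$ with values in a complex unital $*$-algebra; for a field $\phi$, $\phi^*$ (or $\bar\phi$) is the adjoint field, and $[P_\mu,\phi]=-i\partial_\mu\phi$. **The multiplet.** Consider fields $(z,D,F_{ab}=F_{ba},C_{jk}=C_{kj},\lambda_{ja},\chi_{ja})$, with $z,D,F,C$ Bosonic and $\lambda,\chi$ Fermionic, in a $*$-algebra carrying unitary representations $U_{a,A}$ of the universal cover of the proper orthochronous Poincaré group and $V_u$ of $SU(2)$, commuting with each other. Each Weyl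 index $a$ transforms with $A\in SL(2,\mathbb C)$ and each index $j$ with $u\in SU(2)$ (so $z,D$ are scalars for both groups, $F$ is an $SU(2)$ scalar, $C$ a Lorentz scalar). Let $P_\mu=P_\mu^\dagger$, and let $Q_{ja}$, $\bar Q_{j\bar a}=Q_{ja}^\dagger$ be covariant supercharges with $[Q_{ja},P_\mu]=0$, $\{Q_{ja},Q_{kb}\}=0$, $\{Q_{ja},\bar Q_{k\bar b}\}=2\delta_{jk}\sigma^\mu_{a\bar b}P_\mu$, acting by $$i[Q_{ja},z]=\chi_{ja},\quad[\bar Q_{j\bar a},z]=0,\quad [Q_{ja},F_{bc}]=\epsilon_{ab}\lambda_{jc}+\epsilon_{ac}\lambda_{jb},\quad [\bar Q_{j\bar a},F_{bc}]=-i\epsilon_{jk}(\sigma^\mu_{c\bar a}\partial_\mu\chi_{kb}+\sigma^\mu_{b\bar a}\partial_\mu\chi_{kc}),$$ $$[Q_{ja},C_{kl}]=-(\epsilon_{jk}\lambda_{la}+\epsilon_{jl}\lambda_{ka}),\quad [\bar Q_{j\bar a},C_{kl}]=i\sigma^\mu_{b\bar a}\partial_\mu(\delta_{jk}\chi_l^b+\delta_{jl}\chi_k^b),\quad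 [Q_{ja},D]=0,\quad [\bar Q_{j\bar a},D]=2i\epsilon_{jk}\sigma^\mu_{b\bar a}\partial_\mu\lambda_k^b,$$ $$\{Q_{ja},\chi_{kb}\}=\epsilon_{jk}F_{ab}+\epsilon_{ab}C_{jk},\quad \{Q_{ja},\bar\chi_{k\bar b}\}=2\delta_{jk}\sigma^\mu_{a\bar b}\partial_\mu z^*,\quad \{Q_{ja},\lambda_{kb}\}=\epsilon_{jk}\epsilon_{ab}D,$$ $$\{\bar Q_{j\bar b},\lambda_{ka}\}=i(\delta_{jk}\sigma^\mu_{c\bar b}\epsilon^{cd}\partial_\mu F_{ad}+\epsilon_{jl}\sigma^\mu_{a\bar b}\partial_\mu C_{lk}).$$ The fields are free: every causal (anti)commutator (anticommutator for two Fermionic fields, commutator otherwise; adjoint fields included) equals $p(\partial)D_m(x-y)$ times the identity, for some polynomial $p$ with constant complex coefficients. **Theorem.** Let $m\ge0$ and suppose that $z$ is a complex scalar field of mass $m$: $(\partial^2+m^2)z=0$, $[z(x),z(y)]=0$, $[z(x),z^*(y)]=-iD_m(x-y)$. Then there is $\alpha\in\mathbb C$ such that $$[F_{ab}(x),F_{cd}(y)]=i\alpha(\epsilon_{ac}\epsilon_{bd}+\epsilon_{ad}\epsilon_{bc})D_m(x-y),$$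 $$[F_{ab}(x),F^*_{\bar c\bar d}(y)]=2i(\sigma^\mu_{a\bar c}\sigma^\nu_{b\bar d}+\sigma^\mu_{a\bar d}\sigma^\nu_{b\bar c})\partial_\mu\partial_\nu D_m(x-y),$$ $$[C_{jk}(x),C_{ln}(y)]=-i\alpha(\epsilon_{jl}\epsilon_{kn}+\epsilon_{jn}\epsilon_{kl})D_m(x-y),$$ $$[C_{jk}(x),C^*_{ln}(y)]=-2im^2(\delta_{jl}\delta_{kn}+\delta_{jn}\delta_{kl})D_m(x-y),$$ $$[D(x),D^*(y)]=-4im^4D_m(x-y),\qquad [z(x),D(y)]=\alpha D_m(x-y),$$ $$\{\chi_{ja}(x),\bar\chi_{k\bar b}(y)\}=2\delta_{jk}\sigma^\mu_{a\bar b}\partial_\mu D_m(x-y),\qquad \{\lambda_{ja}(x),\bar\lambda_{k\bar b}(y)\}=2\delta_{jk}m^2\sigma^\mu_{a\bar b}\partial_\mu D_m(x-y),$$ $$\{\chi_{ja}(x),\lambda_{kb}(y)\}=-i\alpha\,\epsilon_{ab}\epsilon_{jk}D_m(x-y),$$ and all other (anti)commutators, up to order and adjoints, vanish. The parameter $\alpha$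 is free: for every $m\ge0$ and $\alpha\in\mathbb C$ there is such a multiplet, in a nontrivial $*$-algebra, with exactly these relations. -/

import Mathlib

open scoped SchwartzMap

namespace N2

noncomputable section

/-! ### Minkowski space, spinor conventions -/

/-- Minkowski space `ℝ⁴` (contravariant coordinates `x⁰, x¹, x², x³`) with Lebesgue measure. -/
abbrev Spacetime : Type := EuclideanSpace ℝ (Fin 4)

/-- Complex Schwartz test functions on Minkowski space. -/
abbrev Test : Type := 𝓢(Spacetime, ℂ)

/-- The diagonal `(1, -1, -1, -1)` of the Minkowski metric. -/
def g (μ : Fin 4) : ℝ := if μ = 0 then 1 else -1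

/-- The Minkowski product. -/
def mink (p x : Spacetime) : ℝ := ∑ μ, g μ * p μ * x μ

/-- `ε_{12} = 1`, antisymmetric (used for Weyl indices and for `SU(2)` indices). -/
def eps : Matrix (Fin 2) (Fin 2) ℂ := !![0, 1; -1, 0]

/-- `ε^{ab} = - ε_{ab}`. -/
def epsUp : Matrix (Fin 2) (Fin 2) ℂ := -eps

/-- The Kronecker symbol. -/
def delta (j k : Fin 2) : ℂ := if j = k then 1 else 0

/-- The Pauli matrices `σ^μ`, with `σ⁰ = 1`. -/
def sigma : Fin 4 → Matrix (Fin 2) (Fin 2) ℂ :=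
  ![1, !![0, 1; 1, 0], !![0, -Complex.I; Complex.I, 0], !![1, 0; 0, -1]]

/-- The matrix `δ(A)` of the Lorentz transformation covered by `A ∈ SL(2,ℂ)`. It is characterized by
`A (σ^μ x_μ) A^† = σ^μ (δ(A) x)_μ`. -/
def lorentz (A : Matrix.SpecialLinearGroup (Fin 2) ℂ) : Matrix (Fin 4) (Fin 4) ℝ :=
  Matrix.of fun μ ν =>
    (1 / 2) * g μ * g ν *
      (Matrix.trace (sigma μ * (A : Matrix (Fin 2) (Fin 2) ℂ) * sigma ν *
        (A : Matrix (Fin 2) (Fin 2) ℂ).conjTranspose)).re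

/-- The homogeneous action `x ↦ δ(A) x`. -/
def lorentzAct (A : Matrix.SpecialLinearGroup (Fin 2) ℂ) (x : Spacetime) : Spacetime :=
  WithLp.toLp 2 ((lorentz A).mulVec x.ofLp)

/-- The action `x ↦ δ(A) x + a` of `(a, A)`, an element of the universal covering group of the
proper orthochronous Poincaré group. -/
def poincareAct (a : Spacetime) (A : Matrix.SpecialLinearGroup (Fin 2) ℂ) (x : Spacetime) :
    Spacetime :=
  lorentzAct A x + a

/-! ### Test functions and distributional kernels -/

/-- The partial derivative `∂_μ = ∂/∂x^μ` on test functions. -/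
def dTest (μ : Fin 4) : Test →ₗ[ℂ] Test :=
  (LineDeriv.lineDerivOpCLM ℂ Test (EuclideanSpace.single μ (1 : ℝ))).toLinearMap

/-- Pointwise complex conjugate of a test function. -/
def conjTest (f : Test) : Test :=
  SchwartzMap.postcompCLM (𝕜 := ℝ) (Complex.conjCLE : ℂ →L[ℝ] ℂ) f

theorem conjTest_apply (f : Test) (x : Spacetime) : conjTest f x = (starRingEnd ℂ) (f x) := rfl

/-- `f̃(p) = ∫ f(x) e^{-i p·x} d⁴x`. -/
def minkFourier (f : Test) (p : Spacetime) : ℂ :=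
  ∫ x : Spacetime, Complex.exp (-Complex.I * (mink p x : ℂ)) * f x

/-- The energy `ω(q) = (|q|² + m²)^{1/2}`. -/
def energy (m : ℝ) (q : EuclideanSpace ℝ (Fin 3)) : ℝ := Real.sqrt (‖q‖ ^ 2 + m ^ 2)

/-- The point `(ω(q), q)` of the upper mass hyperboloid. -/
def shell (m : ℝ) (q : EuclideanSpace ℝ (Fin 3)) : Spacetime :=
  WithLp.toLp 2 ![energy m q, q 0, q 1, q 2]

/-- Kernels `T(x,y)`, smeared as `T f h = ∫∫ T(x,y) f(x) h(y) dx dy`. -/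
abbrev Kernel : Type := Test → Test → ℂ

/-- The kernel `D_m(x-y)`, where `D_m` is the Pauli-Jordan causal distribution of mass `m`,
`D_m(x) = i (2π)^{-3} ∫ d³q / (2ω(q)) (e^{-i p·x} - e^{i p·x})`, `p = (ω(q), q)`
(equivalently `(□ + m²) D_m = 0`, `D_m = 0` and `∂_0 D_m = δ³` at time zero). -/
def pauliJordan (m : ℝ) : Kernel := fun f h =>
  Complex.I / ((2 * Real.pi : ℝ) : ℂ) ^ 3 *
    ∫ q : EuclideanSpace ℝ (Fin 3), (1 / (2 * energy m q) : ℂ) *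
      (minkFourier f (shell m q) * minkFourier h (-shell m q)
        - minkFourier f (-shell m q) * minkFourier h (shell m q))

/-- The distributional derivative `∂T/∂x^μ` of a kernel in its first variable; for `T(x-y)` this is
`(∂_μ T)(x-y)`. -/
def dKer (μ : Fin 4) (T : Kernel) : Kernel := fun f h => -T (dTest μ f) h

/-- The monomial `∂_0^{s₀} ∂_1^{s₁} ∂_2^{s₂} ∂_3^{s₃}` applied to a kernel. -/
def dKerPow (s : Fin 4 →₀ ℕ) (T : Kernel) : Kernel :=
  (dKer 0)^[s 0] ((dKer 1)^[s 1] ((dKer 2)^[s 2] ((dKer 3)^[s 3] T)))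

/-- `p(∂) T` for a polynomial `p` with constant coefficients. -/
def polyKer (p : MvPolynomial (Fin 4) ℂ) (T : Kernel) : Kernel := fun f h =>
  ∑ s ∈ p.support, p.coeff s * dKerPow s T f h

/-! ### Fields with values in a `*`-algebra -/

section Fields

variable {𝒜 : Type*} [Ring 𝒜] [StarRing 𝒜] [Algebra ℂ 𝒜] [StarModule ℂ 𝒜]

/-- Commutator. -/
def comm (x y : 𝒜) : 𝒜 := x * y - y * x

/-- Anticommutator. -/
def acomm (x y : 𝒜) : 𝒜 := x * y + y * x

/-- The derivative `∂_μ φ` of a field, `(∂_μ φ)(f) = - φ(∂_μ f)`. -/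
def dField (μ : Fin 4) (φ : Test →ₗ[ℂ] 𝒜) : Test →ₗ[ℂ] 𝒜 := -(φ ∘ₗ dTest μ)

/-- `σ^μ_{a b̄} ∂_μ φ`. -/
def slash (a b : Fin 2) (φ : Test →ₗ[ℂ] 𝒜) : Test →ₗ[ℂ] 𝒜 := ∑ μ, sigma μ a b • dField μ φ

/-- The adjoint field `φ^*(x) = φ(x)^†`, that is `φ^*(f) = φ(f̄)^†`. -/
def adj (φ : Test →ₗ[ℂ] 𝒜) : Test →ₗ[ℂ] 𝒜 where
  toFun f := star (φ (conjTest f))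
  map_add' f h := by
    have : conjTest (f + h) = conjTest f + conjTest h := by
      ext x; simp [conjTest_apply]
    rw [this, map_add, star_add]
  map_smul' c f := by
    have : conjTest (c • f) = (starRingEnd ℂ) c • conjTest f := by
      ext x; simp [conjTest_apply]
    rw [this, map_smul, star_smul]
    simp

end Fields

/-- The `N = 2` multiplet `(z, D, F_{ab}, C_{jk}, λ_{ja}, χ_{ja})` in a complex unital `*`-algebra
`𝒜` (for instance the adjointable operators on a common invariant domain carrying a nondegenerate
Hermitian form): fields, unitary representations of the Poincaré covering group and of `SU(2)`,
generators of translations, and supercharges without central charges. -/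
structure Multiplet (𝒜 : Type*) [Ring 𝒜] [StarRing 𝒜] [Algebra ℂ 𝒜] [StarModule ℂ 𝒜] where
  z : Test →ₗ[ℂ] 𝒜
  D : Test →ₗ[ℂ] 𝒜
  F : Fin 2 → Fin 2 → Test →ₗ[ℂ] 𝒜
  C : Fin 2 → Fin 2 → Test →ₗ[ℂ] 𝒜
  lam : Fin 2 → Fin 2 → Test →ₗ[ℂ] 𝒜
  chi : Fin 2 → Fin 2 → Test →ₗ[ℂ] 𝒜
  F_symm : ∀ a b, F a b = F b a
  C_symm : ∀ j k, C j k = C k j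
  /-- The representation `U_{a,A}` of the Poincaré covering group. -/
  U : Spacetime → Matrix.SpecialLinearGroup (Fin 2) ℂ → unitary 𝒜
  /-- The representation of `SU(2)`. -/
  V : Matrix.specialUnitaryGroup (Fin 2) ℂ →* unitary 𝒜
  U_mul : ∀ a A b B, U a A * U b B = U (a + lorentzAct A b) (A * B)
  U_V_comm : ∀ a A u, U a A * V u = V u * U a A
  /-- The generators `P_μ` of translations. -/
  P : Fin 4 → 𝒜
  /-- The supercharges `Q_{ja}`; `Q̄_{jā}` is `star (Q j a)`. -/
  Q : Fin 2 → Fin 2 → 𝒜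
  -- Poincaré covariance: `U⁻¹ φ(x) U = S(A) φ(δ(A)⁻¹(x - a))`, smeared with `f`
  z_poincare : ∀ a A (f h : Test), (∀ x, h x = f (poincareAct a A x)) →
    star (U a A : 𝒜) * z f * (U a A : 𝒜) = z h
  D_poincare : ∀ a A (f h : Test), (∀ x, h x = f (poincareAct a A x)) →
    star (U a A : 𝒜) * D f * (U a A : 𝒜) = D h
  F_poincare : ∀ a A (f h : Test), (∀ x, h x = f (poincareAct a A x)) → ∀ b c,
    star (U a A : 𝒜) * F b c f * (U a A : 𝒜) = ∑ b', ∑ c', (A.1 b b' * A.1 c c') • F b' c' h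
  C_poincare : ∀ a A (f h : Test), (∀ x, h x = f (poincareAct a A x)) → ∀ j k,
    star (U a A : 𝒜) * C j k f * (U a A : 𝒜) = C j k h
  lam_poincare : ∀ a A (f h : Test), (∀ x, h x = f (poincareAct a A x)) → ∀ j b,
    star (U a A : 𝒜) * lam j b f * (U a A : 𝒜) = ∑ b', A.1 b b' • lam j b' h
  chi_poincare : ∀ a A (f h : Test), (∀ x, h x = f (poincareAct a A x)) → ∀ j b,
    star (U a A : 𝒜) * chi j b f * (U a A : 𝒜) = ∑ b', A.1 b b' • chi j b' h
  -- `SU(2)` covariance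
  z_su2 : ∀ u f, star (V u : 𝒜) * z f * (V u : 𝒜) = z f
  D_su2 : ∀ u f, star (V u : 𝒜) * D f * (V u : 𝒜) = D f
  F_su2 : ∀ u f a b, star (V u : 𝒜) * F a b f * (V u : 𝒜) = F a b f
  C_su2 : ∀ u f j k, star (V u : 𝒜) * C j k f * (V u : 𝒜)
    = ∑ l, ∑ n, (u.1 j l * u.1 k n) • C l n f
  lam_su2 : ∀ u f j a, star (V u : 𝒜) * lam j a f * (V u : 𝒜) = ∑ k, u.1 j k • lam k a f
  chi_su2 : ∀ u f j a, star (V u : 𝒜) * chi j a f * (V u : 𝒜) = ∑ k, u.1 j k • chi k a f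
  -- `[P_μ, φ] = - i ∂_μ φ`
  P_star : ∀ μ, star (P μ) = P μ
  P_z : ∀ μ f, comm (P μ) (z f) = -Complex.I • dField μ z f
  P_D : ∀ μ f, comm (P μ) (D f) = -Complex.I • dField μ D f
  P_F : ∀ μ f a b, comm (P μ) (F a b f) = -Complex.I • dField μ (F a b) f
  P_C : ∀ μ f j k, comm (P μ) (C j k f) = -Complex.I • dField μ (C j k) f
  P_lam : ∀ μ f j a, comm (P μ) (lam j a f) = -Complex.I • dField μ (lam j a) f
  P_chi : ∀ μ f j a, comm (P μ) (chi j a f) = -Complex.I • dField μ (chi j a) f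
  -- the supersymmetry algebra
  Q_P : ∀ j a μ, comm (Q j a) (P μ) = 0
  Q_lorentz : ∀ A j a, star (U 0 A : 𝒜) * Q j a * (U 0 A : 𝒜) = ∑ b, A.1 a b • Q j b
  Q_su2 : ∀ u j a, star (V u : 𝒜) * Q j a * (V u : 𝒜) = ∑ k, u.1 j k • Q k a
  Q_Q : ∀ j a k b, acomm (Q j a) (Q k b) = 0
  Q_Qbar : ∀ j a k b, acomm (Q j a) (star (Q k b)) = (2 * delta j k) • ∑ μ, sigma μ a b • P μ
  -- the action of the supercharges on the fields
  Q_z : ∀ j a f, Complex.I • comm (Q j a) (z f) = chi j a f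
  Qbar_z : ∀ j a f, comm (star (Q j a)) (z f) = 0
  Q_F : ∀ j a b c f, comm (Q j a) (F b c f) = eps a b • lam j c f + eps a c • lam j b f
  Qbar_F : ∀ j a b c f, comm (star (Q j a)) (F b c f)
    = -Complex.I • ∑ k, eps j k • (slash c a (chi k b) f + slash b a (chi k c) f)
  Q_C : ∀ j a k l f, comm (Q j a) (C k l f) = -(eps j k • lam l a f + eps j l • lam k a f)
  Qbar_C : ∀ j a k l f, comm (star (Q j a)) (C k l f)
    = Complex.I • ∑ b, ∑ c, epsUp b c •
        (delta j k • slash b a (chi l c) f + delta j l • slash b a (chi k c) f)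
  Q_D : ∀ j a f, comm (Q j a) (D f) = 0
  Qbar_D : ∀ j a f, comm (star (Q j a)) (D f)
    = (2 * Complex.I) • ∑ k, eps j k • ∑ b, ∑ c, epsUp b c • slash b a (lam k c) f
  Q_chi : ∀ j a k b f, acomm (Q j a) (chi k b f) = eps j k • F a b f + eps a b • C j k f
  Q_chibar : ∀ j a k b f, acomm (Q j a) (adj (chi k b) f)
    = (2 * delta j k) • slash a b (adj z) f
  Q_lam : ∀ j a k b f, acomm (Q j a) (lam k b f) = (eps j k * eps a b) • D f
  Qbar_lam : ∀ j b k a f, acomm (star (Q j b)) (lam k a f)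
    = Complex.I • (delta j k • ∑ c, ∑ d, epsUp c d • slash c b (F a d) f
        + ∑ l, eps j l • slash a b (C l k) f)

/-- Names of the component fields. -/
inductive Comp : Type
  | z : Comp
  | D : Comp
  | F (a b : Fin 2) : Comp
  | C (j k : Fin 2) : Comp
  | lam (j a : Fin 2) : Comp
  | chi (j a : Fin 2) : Comp

/-- Whether a component is Fermionic. -/
def Comp.fermi : Comp → Bool
  | .z => false
  | .D => false
  | .F _ _ => false
  | .C _ _ => false
  | .lam _ _ => true
  | .chi _ _ => true

/-- Pairs of kinds for which the (anti)commutator of two fields, neither starred, is listed. -/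
def Comp.listedPair : Comp → Comp → Prop
  | .F _ _, .F _ _ => True
  | .C _ _, .C _ _ => True
  | .z, .D => True
  | .D, .z => True
  | .chi _ _, .lam _ _ => True
  | .lam _ _, .chi _ _ => True
  | _, _ => False

/-- Pairs of kinds for which the (anti)commutator of a field with an adjoint field is listed:
both of the same kind. -/
def Comp.sameKind : Comp → Comp → Prop
  | .z, .z => True
  | .D, .D => True
  | .F _ _, .F _ _ => True
  | .C _ _, .C _ _ => True
  | .lam _ _, .lam _ _ => True
  | .chi _ _, .chi _ _ => True
  | _, _ => False

/-- A field of the multiplet (`false`) or its adjoint (`true`). -/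
abbrev FieldName : Type := Comp × Bool

/-- The pairs whose (anti)commutator is, up to order and adjoint, one of the nonzero ones. -/
def listed (a b : FieldName) : Prop :=
  if a.2 = b.2 then a.1.listedPair b.1 else a.1.sameKind b.1

namespace Multiplet

variable {𝒜 : Type*} [Ring 𝒜] [StarRing 𝒜] [Algebra ℂ 𝒜] [StarModule ℂ 𝒜]

/-- The component with a given name. -/
def comp (M : Multiplet 𝒜) : Comp → Test →ₗ[ℂ] 𝒜
  | .z => M.z
  | .D => M.D
  | .F a b => M.F a b
  | .C j k => M.C j k
  | .lam j a => M.lam j a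
  | .chi j a => M.chi j a

/-- The field, or adjoint field, with a given name. -/
def field (M : Multiplet 𝒜) (a : FieldName) : Test →ₗ[ℂ] 𝒜 :=
  if a.2 then adj (M.comp a.1) else M.comp a.1

/-- The causal (anti)commutator of two fields of the multiplet: the anticommutator if both are
Fermionic, the commutator otherwise. -/
def bracket (M : Multiplet 𝒜) (a b : FieldName) (f h : Test) : 𝒜 :=
  if a.1.fermi && b.1.fermi then acomm (M.field a f) (M.field b h)
  else comm (M.field a f) (M.field b h)

/-- The fields are free fields of mass `m`, i.e. all causal (anti)commutators are of the form
`p(∂) D_m(x-y)` times the identity, with a polynomial `p` in the partial derivatives. -/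
def IsFree (M : Multiplet 𝒜) (m : ℝ) : Prop :=
  ∀ a b : FieldName, ∃ p : MvPolynomial (Fin 4) ℂ, ∀ f h : Test,
    M.bracket a b f h = polyKer p (pauliJordan m) f h • (1 : 𝒜)

/-- `z` is a complex scalar field of mass `m`: it satisfies the Klein-Gordon equation,
`[z(x), z(y)] = 0` and `[z(x), z^*(y)] = - i D_m(x-y)`. -/
structure IsScalarOfMass (M : Multiplet 𝒜) (m : ℝ) : Prop where
  klein_gordon : ∀ f, ∑ μ, (g μ : ℂ) • dField μ (dField μ M.z) f + ((m ^ 2 : ℝ) : ℂ) • M.z f = 0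
  z_z : ∀ f h, comm (M.z f) (M.z h) = 0
  z_zstar : ∀ f h, comm (M.z f) (adj M.z h) = (-Complex.I * pauliJordan m f h) • (1 : 𝒜)

/-- The list of causal (anti)commutation relations of the multiplet, with parameter `α`. -/
structure CausalRelations (M : Multiplet 𝒜) (m : ℝ) (α : ℂ) : Prop where
  F_F : ∀ a b c d f h, comm (M.F a b f) (M.F c d h)
    = (Complex.I * α * (eps a c * eps b d + eps a d * eps b c) * pauliJordan m f h) • (1 : 𝒜)
  F_Fstar : ∀ a b c d f h, comm (M.F a b f) (adj (M.F c d) h)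
    = (2 * Complex.I * ∑ μ, ∑ ν, (sigma μ a c * sigma ν b d + sigma μ a d * sigma ν b c) *
        dKer μ (dKer ν (pauliJordan m)) f h) • (1 : 𝒜)
  C_C : ∀ j k l n f h, comm (M.C j k f) (M.C l n h)
    = (-Complex.I * α * (eps j l * eps k n + eps j n * eps k l) * pauliJordan m f h) • (1 : 𝒜)
  C_Cstar : ∀ j k l n f h, comm (M.C j k f) (adj (M.C l n) h)
    = (-2 * Complex.I * (m : ℂ) ^ 2 * (delta j l * delta k n + delta j n * delta k l) *
        pauliJordan m f h) • (1 : 𝒜)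
  D_Dstar : ∀ f h, comm (M.D f) (adj M.D h)
    = (-4 * Complex.I * (m : ℂ) ^ 4 * pauliJordan m f h) • (1 : 𝒜)
  z_D : ∀ f h, comm (M.z f) (M.D h) = (α * pauliJordan m f h) • (1 : 𝒜)
  chi_chibar : ∀ j a k b f h, acomm (M.chi j a f) (adj (M.chi k b) h)
    = (2 * delta j k * ∑ μ, sigma μ a b * dKer μ (pauliJordan m) f h) • (1 : 𝒜)
  lam_lambar : ∀ j a k b f h, acomm (M.lam j a f) (adj (M.lam k b) h)
    = (2 * delta j k * (m : ℂ) ^ 2 * ∑ μ, sigma μ a b * dKer μ (pauliJordan m) f h) • (1 : 𝒜)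
  chi_lam : ∀ j a k b f h, acomm (M.chi j a f) (M.lam k b h)
    = (-Complex.I * α * eps a b * eps j k * pauliJordan m f h) • (1 : 𝒜)
  others : ∀ a b : FieldName, ¬ listed a b → ∀ f h, M.bracket a b f h = 0

end Multiplet

end

end N2

namespace N2

noncomputable section

open MeasureTheory Complex
open scoped FourierTransform LineDeriv

/-! ### The Fourier transform on Minkowski space -/

/-! The two halves of the theorem are independent.

Uniqueness. Every causal bracket is a multiple of the identity, hence unchanged under conjugation by
a unitary. The element -1 of SU(2) reverses the sign of Fermionic fields and fixes Bosonic ones, so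
a Bose–Fermi commutator equals its own negative and vanishes (`IsFree.comm_bose_fermi`). By the
graded Jacobi identity (`acomm_comm_of_comm_eq_zero`) each relation [X, Y] = 0 of this kind yields
{[Q, X], Y} = -[X, {Q, Y}]. Applied to pairs of components, starting with those containing z, this
reduces the whole table to [z, z*] and [z, φ] with φ among F, C, D. There is no SU(2)-invariant
symmetric tensor C_{jk}, so [z, C] = 0. A symmetric spinor fixed by the little group of a point of
the shell is zero, so [z, F] = 0 (`eq_zero_of_symmetric_covariant`). Finally [z, D] is a Lorentz
invariant kernel p(∂)D_m, whose symbol is constant on the sheets of the shell; antisymmetry of [F,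
F] forces the same constant on both sheets, and this constant is α (`IsFree.exists_z_D`). The powers
of m² come from det(σ·k) = k² = m² on the shell (`sum_epsUp_slT`).

Two analytic facts support the passage from kernels to symbols. The Pauli–Jordan form is Lorentz
invariant, because d³q/2ω is (`measurePreserving_lorentzAct_shellMeasure`), and it determines a
continuous multiplier at the shell points of positive energy and at their negatives
(`symbol_eq_zero`).

Existence. The asserted brackets are taken as the definition of bilinear forms on the space of
components smeared with test functions restricted to the shell: a chiral form, linear in α, between
two fields, and a mixed form between a field and an adjoint. The charges, translations, Lorentz
group and SU(2) act linearly on this space, and the supersymmetry algebra holds there as finite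
linear algebra with the symbol σ·k (`Fer.q_qbar`, `Bos.q_qbar`). Both forms are invariant under the
charges (`Bos.chiral_q`, `Bos.chiral_qbar`, `Bos.mixed_q`, `Bos.mixed_qbar`). The chiral form is
invariant for every α, independently of the mixed one, so α is free.

Invariance of the forms lets the action extend to the super Weyl algebra of the doubled space of
fields and adjoints: the fields act by left multiplication, P by even derivations, Q by odd ones
(`SuperWeyl.exists_isOddDer`), the groups by automorphisms. This algebra is nonzero because it maps
to differential operators on polynomials tensored with a Clifford algebra (`SuperWeyl.nontrivial`).
Adjoints are obtained algebraically: with E the endomorphisms of the Weyl algebra, E ⊕ E^op with the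
exchange of summands is a *-algebra, and each operator is paired with the one that is to be its
adjoint. No positivity is demanded, so nothing further is needed. -/

theorem g_mul_self (μ : Fin 4) : g μ * g μ = 1 := by
  unfold g; split_ifs <;> norm_num

/-- The linear change of variables relating `minkFourier` to the Euclidean Fourier transform. -/
def momentumScale : Spacetime ≃L[ℝ] Spacetime :=
  LinearEquiv.toContinuousLinearEquiv
    { toFun := fun p => WithLp.toLp 2 fun μ => g μ * p μ / (2 * Real.pi)
      invFun := fun ξ => WithLp.toLp 2 fun μ => 2 * Real.pi * (g μ * ξ μ)
      map_add' := fun p r => by ext μ; simp; ring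
      map_smul' := fun c p => by ext μ; simp; ring
      left_inv := fun p => by
        ext μ
        have := g_mul_self μ
        simp only
        field_simp
        linear_combination p.ofLp μ * this
      right_inv := fun p => by
        ext μ
        have := g_mul_self μ
        simp only
        field_simp
        linear_combination p.ofLp μ * this }

theorem momentumScale_apply (p : Spacetime) (μ : Fin 4) :
    momentumScale p μ = g μ * p μ / (2 * Real.pi) := rfl

theorem inner_momentumScale (x p : Spacetime) :
    inner ℝ x (momentumScale p) = mink p x / (2 * Real.pi) := by
  simp only [PiLp.inner_apply, momentumScale_apply, mink, Finset.sum_div]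
  refine Finset.sum_congr rfl fun μ _ => ?_
  simp
  ring

/-- `minkFourier f` as a Schwartz function of the momentum. -/
def fourierMink (f : Test) : Test :=
  SchwartzMap.compCLMOfContinuousLinearEquiv ℂ momentumScale (𝓕 f)

theorem fourierMink_apply (f : Test) (p : Spacetime) : fourierMink f p = minkFourier f p := by
  change 𝓕 f (momentumScale p) = _
  rw [SchwartzMap.fourier_coe, Real.fourier_eq']
  unfold minkFourier
  congr 1
  ext x
  rw [inner_momentumScale, smul_eq_mul]
  congr 2
  push_cast
  field_simp

/-- The Fourier transform is onto the Schwartz functions, so bump functions in momentum space may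
serve as probes of a kernel; `symbol_eq_zero` relies on this. -/
theorem exists_minkFourier_eq (u : Test) : ∃ f : Test, ∀ p, minkFourier f p = u p := by
  refine ⟨𝓕⁻ (SchwartzMap.compCLMOfContinuousLinearEquiv ℂ momentumScale.symm u), fun p => ?_⟩
  rw [← fourierMink_apply]
  simp [fourierMink]

theorem minkFourier_add (f h : Test) (p : Spacetime) :
    minkFourier (f + h) p = minkFourier f p + minkFourier h p := by
  simp only [← fourierMink_apply, fourierMink, FourierTransform.fourier_add, map_add]; rfl

theorem minkFourier_smul (c : ℂ) (f : Test) (p : Spacetime) :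
    minkFourier (c • f) p = c * minkFourier f p := by
  simp only [← fourierMink_apply, fourierMink, FourierTransform.fourier_smul, map_smul]; rfl

theorem minkFourier_neg (f : Test) (p : Spacetime) :
    minkFourier (-f) p = -minkFourier f p := by
  rw [← neg_one_smul ℂ f, minkFourier_smul, neg_one_mul]

theorem minkFourier_dTest (μ : Fin 4) (f : Test) (p : Spacetime) :
    minkFourier (dTest μ f) p = I * (g μ * p μ : ℝ) * minkFourier f p := by
  rw [← fourierMink_apply, ← fourierMink_apply]
  change 𝓕 (∂_{EuclideanSpace.single μ (1 : ℝ)} f) (momentumScale p) =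
    _ * 𝓕 f (momentumScale p)
  rw [SchwartzMap.fourier_lineDerivOp_eq]
  have : (fun x : Spacetime =>
      inner ℝ x (EuclideanSpace.single μ (1 : ℝ))).HasTemperateGrowth := by fun_prop
  simp only [smul_apply, SchwartzMap.smulLeftCLM_apply_apply this]
  have h2 : inner ℝ (momentumScale p) (EuclideanSpace.single μ (1 : ℝ))
      = g μ * p μ / (2 * Real.pi) := by
    rw [EuclideanSpace.inner_single_right]; simp [momentumScale_apply]
  rw [h2]
  simp only [smul_eq_mul, Complex.real_smul]
  push_cast
  field_simp

theorem mink_neg_left (p x : Spacetime) : mink (-p) x = -mink p x := by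
  simp [mink, Finset.sum_neg_distrib]

theorem minkFourier_conjTest (f : Test) (p : Spacetime) :
    minkFourier (conjTest f) p = (starRingEnd ℂ) (minkFourier f (-p)) := by
  unfold minkFourier
  rw [← integral_conj]
  congr 1
  ext x
  simp only [conjTest_apply, map_mul, ← Complex.exp_conj, mink_neg_left, map_neg, Complex.conj_I,
    Complex.conj_ofReal]
  congr 2
  push_cast
  ring

end

end N2

namespace N2

noncomputable section

open MeasureTheory Complex
open scoped FourierTransform LineDeriv

/-! ### The action of `SL(2,ℂ)` on Minkowski space -/

/-- The Hermitian matrix `σ^μ x_μ`. -/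
def sig (x : Spacetime) : Matrix (Fin 2) (Fin 2) ℂ :=
  ∑ μ, ((g μ * x μ : ℝ) : ℂ) • sigma μ

theorem sig_eq (x : Spacetime) :
    sig x = !![(x 0 - x 3 : ℂ), -x 1 + I * x 2; -x 1 - I * x 2, x 0 + x 3] := by
  ext i j
  fin_cases i <;> fin_cases j <;>
    simp [sig, Fin.sum_univ_four, sigma, g] <;> ring

/-- Vectors are compared through their Hermitian matrices, so that identities about Lorentz
transformations become identities of 2×2 matrices. -/
theorem sig_injective : Function.Injective sig := by
  intro x y h
  rw [sig_eq, sig_eq] at h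
  have h00 := congrArg Complex.re (congrFun (congrFun h 0) 0)
  have h11 := congrArg Complex.re (congrFun (congrFun h 1) 1)
  have h01 := congrArg Complex.re (congrFun (congrFun h 0) 1)
  have h01' := congrArg Complex.im (congrFun (congrFun h 0) 1)
  simp at h00 h11 h01 h01'
  ext i
  fin_cases i <;> simp <;> linarith

theorem sig_conjTranspose (x : Spacetime) : (sig x).conjTranspose = sig x := by
  rw [sig_eq]
  ext i j
  fin_cases i <;> fin_cases j <;> simp [sub_eq_add_neg]

/-- The Pauli matrices are an orthogonal basis for the trace form, each of square norm 2, and the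
coefficients of a Hermitian matrix are real. -/
theorem pauli_expansion (B : Matrix (Fin 2) (Fin 2) ℂ) (hB : B.conjTranspose = B) :
    ∑ μ, (((1 / 2) * (Matrix.trace (sigma μ * B)).re : ℝ) : ℂ) • sigma μ = B := by
  have h00 := congrFun (congrFun hB 0) 0
  have h11 := congrFun (congrFun hB 1) 1
  have h01 := congrFun (congrFun hB 0) 1
  simp only [Matrix.conjTranspose_apply, Complex.ext_iff, star_def, Complex.conj_re,
    Complex.conj_im] at h00 h11 h01
  ext i j
  fin_cases i <;> fin_cases j <;>
    simp [Fin.sum_univ_four, sigma, Matrix.trace_fin_two, Complex.ext_iff, Matrix.vecMul,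
      dotProduct, Fin.sum_univ_two] <;>
    constructor <;> linarith [h00.2, h11.2, h01.1, h01.2]

theorem lorentzAct_apply (A : Matrix.SpecialLinearGroup (Fin 2) ℂ) (x : Spacetime) (μ : Fin 4) :
    lorentzAct A x μ = ∑ ν, lorentz A μ ν * x ν := rfl

/-- The entries of `lorentz A` are, up to the metric signs, the Pauli coefficients of A σ^ν A†. The
group law, invariance of the metric and covariance of σ·∂ all follow from this formula. -/
theorem sig_lorentzAct (A : Matrix.SpecialLinearGroup (Fin 2) ℂ) (x : Spacetime) :
    sig (lorentzAct A x) = A.1 * sig x * A.1.conjTranspose := by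
  rw [← pauli_expansion (A.1 * sig x * A.1.conjTranspose)]
  · unfold sig
    refine Finset.sum_congr rfl fun μ _ => ?_
    congr 2
    rw [lorentzAct_apply, Finset.mul_sum]
    simp only [Matrix.sum_mul, Matrix.trace_sum, Complex.re_sum, Finset.mul_sum]
    refine Finset.sum_congr rfl fun ν _ => ?_
    simp only [lorentz, Matrix.of_apply, Matrix.mul_smul, Matrix.smul_mul, Matrix.trace_smul,
      smul_eq_mul, Complex.re_ofReal_mul, ← Matrix.mul_assoc]
    linear_combination (1 / 2 * g ν * x ν *
      (Matrix.trace (sigma μ * A.1 * sigma ν * A.1.conjTranspose)).re) * g_mul_self μ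
  · simp [Matrix.conjTranspose_mul, sig_conjTranspose, Matrix.mul_assoc]

theorem lorentzAct_mul (A B : Matrix.SpecialLinearGroup (Fin 2) ℂ) (x : Spacetime) :
    lorentzAct (A * B) x = lorentzAct A (lorentzAct B x) := by
  apply sig_injective
  simp [sig_lorentzAct, Matrix.conjTranspose_mul, Matrix.mul_assoc]

theorem lorentzAct_one (x : Spacetime) : lorentzAct 1 x = x := by
  apply sig_injective
  simp [sig_lorentzAct]

theorem lorentzAct_add (A : Matrix.SpecialLinearGroup (Fin 2) ℂ) (x y : Spacetime) :
    lorentzAct A (x + y) = lorentzAct A x + lorentzAct A y := by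
  ext μ
  simp [lorentzAct_apply, mul_add, Finset.sum_add_distrib]

theorem lorentzAct_smul (A : Matrix.SpecialLinearGroup (Fin 2) ℂ) (c : ℝ) (x : Spacetime) :
    lorentzAct A (c • x) = c • lorentzAct A x := by
  ext μ
  simp [lorentzAct_apply, Finset.mul_sum, mul_left_comm]

theorem lorentzAct_neg (A : Matrix.SpecialLinearGroup (Fin 2) ℂ) (x : Spacetime) :
    lorentzAct A (-x) = -lorentzAct A x := by
  simpa using lorentzAct_smul A (-1) x

/-- The Lorentz transformation covered by `A` as a linear equivalence. -/
def lorentzEquiv (A : Matrix.SpecialLinearGroup (Fin 2) ℂ) : Spacetime ≃L[ℝ] Spacetime :=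
  LinearEquiv.toContinuousLinearEquiv
    { toFun := lorentzAct A
      invFun := lorentzAct A⁻¹
      map_add' := lorentzAct_add A
      map_smul' := lorentzAct_smul A
      left_inv := fun x => by rw [← lorentzAct_mul, inv_mul_cancel, lorentzAct_one]
      right_inv := fun x => by rw [← lorentzAct_mul, mul_inv_cancel, lorentzAct_one] }

theorem lorentzEquiv_apply (A : Matrix.SpecialLinearGroup (Fin 2) ℂ) (x : Spacetime) :
    lorentzEquiv A x = lorentzAct A x := rfl

/-- Source of every power of the mass: on the shell the determinant is m². -/
theorem det_sig (x : Spacetime) : (sig x).det = (mink x x : ℝ) := by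
  rw [sig_eq, Matrix.det_fin_two]
  simp [mink, Fin.sum_univ_four, g]
  linear_combination (x 2 : ℂ) ^ 2 * Complex.I_sq

theorem mink_comm (x y : Spacetime) : mink x y = mink y x := by
  simp only [mink, mul_right_comm]

theorem mink_add_left (x y w : Spacetime) : mink (x + y) w = mink x w + mink y w := by
  simp [mink, ← Finset.sum_add_distrib, mul_add, add_mul]

theorem mink_add_right (x y w : Spacetime) : mink x (y + w) = mink x y + mink x w := by
  rw [mink_comm, mink_add_left, mink_comm y, mink_comm w]

theorem mink_lorentzAct_self (A : Matrix.SpecialLinearGroup (Fin 2) ℂ) (x : Spacetime) :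
    mink (lorentzAct A x) (lorentzAct A x) = mink x x := by
  have h := det_sig (lorentzAct A x)
  rw [sig_lorentzAct, Matrix.det_mul, Matrix.det_mul, Matrix.det_conjTranspose, A.2,
    det_sig] at h
  simpa using (Complex.ofReal_injective (by simpa using h)).symm

/-- Polarization of the invariance of the determinant. -/
theorem mink_lorentzAct (A : Matrix.SpecialLinearGroup (Fin 2) ℂ) (x y : Spacetime) :
    mink (lorentzAct A x) (lorentzAct A y) = mink x y := by
  have h := mink_lorentzAct_self A (x + y)
  simp only [lorentzAct_add, mink_add_left, mink_add_right] at h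
  have h1 := mink_lorentzAct_self A x
  have h2 := mink_lorentzAct_self A y
  rw [mink_comm (lorentzAct A y) (lorentzAct A x), mink_comm y x] at h
  linarith

theorem mink_single (μ ν : Fin 4) :
    mink (EuclideanSpace.single μ 1) (EuclideanSpace.single ν 1) = if μ = ν then g μ else 0 := by
  simp [mink, eq_comm (a := μ)]
  split_ifs with h <;> simp [h]

theorem mink_lorentzAct_single (A : Matrix.SpecialLinearGroup (Fin 2) ℂ) (μ ν : Fin 4) :
    mink (lorentzAct A (EuclideanSpace.single μ 1)) (lorentzAct A (EuclideanSpace.single ν 1))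
      = ((lorentz A).transpose * Matrix.diagonal g * lorentz A) μ ν := by
  have h : ∀ κ (ρ : Fin 4), lorentzAct A (EuclideanSpace.single κ 1) ρ = lorentz A ρ κ := by
    intro κ ρ; simp [lorentzAct_apply]
  rw [Matrix.mul_apply]
  simp only [mink, h, Matrix.mul_diagonal, Matrix.transpose_apply]
  exact Finset.sum_congr rfl fun _ _ => by ring

/-- The sign of the determinant is irrelevant: its absolute value alone decides whether Lebesgue
measure is preserved. -/
theorem lorentz_det_sq (A : Matrix.SpecialLinearGroup (Fin 2) ℂ) : (lorentz A).det ^ 2 = 1 := by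
  have h : (lorentz A).transpose * Matrix.diagonal g * lorentz A = Matrix.diagonal g := by
    ext μ ν
    rw [← mink_lorentzAct_single, mink_lorentzAct, mink_single, Matrix.diagonal_apply]
  have h2 := congrArg Matrix.det h
  rw [Matrix.det_mul, Matrix.det_mul, Matrix.det_transpose] at h2
  have h3 : (Matrix.diagonal g).det ≠ 0 := by
    rw [Matrix.det_diagonal]; simp [Fin.prod_univ_four, g]
  apply mul_right_cancel₀ h3
  linear_combination h2

theorem measurePreserving_lorentzAct (A : Matrix.SpecialLinearGroup (Fin 2) ℂ) :
    MeasurePreserving (lorentzAct A) volume volume := by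
  have hdet : LinearMap.det ((lorentzEquiv A : Spacetime →L[ℝ] Spacetime) :
      Spacetime →ₗ[ℝ] Spacetime) = (lorentz A).det := by
    rw [← LinearMap.det_toMatrix (EuclideanSpace.basisFun (Fin 4) ℝ).toBasis]
    congr 1
    ext μ ν
    simp [LinearMap.toMatrix_apply, lorentzEquiv_apply, lorentzAct_apply]
  have habs : |(lorentz A).det| = 1 := by
    rw [← sq_eq_sq₀ (abs_nonneg _) zero_le_one, sq_abs, lorentz_det_sq, one_pow]
  have hne : (lorentz A).det ≠ 0 := by
    intro h0; rw [h0] at habs; simp at habs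
  refine ⟨(lorentzEquiv A).continuous.measurable, ?_⟩
  have := Measure.map_linearMap_addHaar_eq_smul_addHaar (volume : Measure Spacetime)
    (f := ((lorentzEquiv A : Spacetime →L[ℝ] Spacetime) : Spacetime →ₗ[ℝ] Spacetime))
    (by rw [hdet]; exact hne)
  rw [hdet, abs_inv, habs, inv_one, ENNReal.ofReal_one, one_smul] at this
  exact this

/-- Change of variables y = δ(A)x + a. Since p·x = δ(A)p·δ(A)x, the momentum moves by A rather than
by its inverse. -/
theorem minkFourier_poincare (a : Spacetime) (A : Matrix.SpecialLinearGroup (Fin 2) ℂ)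
    (f h : Test) (hh : ∀ x, h x = f (poincareAct a A x)) (p : Spacetime) :
    minkFourier h p
      = cexp (I * (mink (lorentzAct A p) a : ℂ)) * minkFourier f (lorentzAct A p) := by
  unfold minkFourier
  rw [← integral_const_mul]
  have hmp : MeasurePreserving (poincareAct a A) volume volume :=
    (measurePreserving_add_right volume a).comp (measurePreserving_lorentzAct A)
  have hemb : MeasurableEmbedding (poincareAct a A) :=
    (measurableEmbedding_addRight a).comp
      (lorentzEquiv A).toHomeomorph.toMeasurableEquiv.measurableEmbedding
  rw [← hmp.integral_comp hemb fun y =>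
    cexp (I * (mink (lorentzAct A p) a : ℂ)) * (cexp (-I * (mink (lorentzAct A p) y : ℂ)) * f y)]
  congr 1
  ext x
  rw [hh, ← mul_assoc, ← Complex.exp_add]
  congr 2
  rw [poincareAct, mink_add_right, mink_lorentzAct]
  push_cast
  ring

end

end N2

namespace N2

noncomputable section

open MeasureTheory Complex
open scoped FourierTransform LineDeriv

/-! ### The mass shell and its invariant measure -/

theorem energy_nonneg (m : ℝ) (q : EuclideanSpace ℝ (Fin 3)) : 0 ≤ energy m q := Real.sqrt_nonneg _

theorem energy_sq (m : ℝ) (q : EuclideanSpace ℝ (Fin 3)) :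
    energy m q ^ 2 = q 0 ^ 2 + q 1 ^ 2 + q 2 ^ 2 + m ^ 2 := by
  rw [energy, Real.sq_sqrt (by positivity), EuclideanSpace.norm_sq_eq]
  simp [Fin.sum_univ_three]

theorem continuous_energy (m : ℝ) : Continuous (energy m) := by
  unfold energy; fun_prop

theorem continuous_shell (m : ℝ) : Continuous (shell m) := by
  unfold shell
  refine (PiLp.continuous_toLp 2 _).comp (continuous_pi fun i => ?_)
  have := continuous_energy m
  fin_cases i <;> simp <;> fun_prop

theorem shell_zero (m : ℝ) (q : EuclideanSpace ℝ (Fin 3)) : shell m q 0 = energy m q := rfl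
theorem shell_one (m : ℝ) (q : EuclideanSpace ℝ (Fin 3)) : shell m q 1 = q 0 := rfl
theorem shell_two (m : ℝ) (q : EuclideanSpace ℝ (Fin 3)) : shell m q 2 = q 1 := rfl
theorem shell_three (m : ℝ) (q : EuclideanSpace ℝ (Fin 3)) : shell m q 3 = q 2 := rfl

theorem mink_self (x : Spacetime) : mink x x = x 0 ^ 2 - x 1 ^ 2 - x 2 ^ 2 - x 3 ^ 2 := by
  simp [mink, Fin.sum_univ_four, g]; ring

theorem mink_shell (m : ℝ) (q : EuclideanSpace ℝ (Fin 3)) :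
    mink (shell m q) (shell m q) = m ^ 2 := by
  rw [mink_self, shell_zero, shell_one, shell_two, shell_three, energy_sq]; ring

/-- The spatial part of a four-vector. -/
def spatial (k : Spacetime) : EuclideanSpace ℝ (Fin 3) := WithLp.toLp 2 ![k 1, k 2, k 3]

theorem shell_spatial {m : ℝ} {k : Spacetime} (h0 : 0 ≤ k 0) (hk : mink k k = m ^ 2) :
    shell m (spatial k) = k := by
  have he : energy m (spatial k) = k 0 := by
    rw [← sq_eq_sq₀ (energy_nonneg _ _) h0, energy_sq]
    rw [mink_self] at hk
    change k 1 ^ 2 + k 2 ^ 2 + k 3 ^ 2 + m ^ 2 = k 0 ^ 2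
    linarith
  ext i
  fin_cases i
  · exact he
  · rfl
  · rfl
  · rfl

/-- The Lorentz invariant measure `d³q / 2ω(q)` on the upper mass shell. -/
def shellMeasure (m : ℝ) : Measure Spacetime :=
  ((volume : Measure (EuclideanSpace ℝ (Fin 3))).withDensity
    fun q => ENNReal.ofReal (1 / (2 * energy m q))).map (shell m)

/-- Substitution β = √(M + t²) + t, for which dt/√(M + t²) = dβ/β; it maps ℝ bijectively onto (0, ∞)
with inverse t = (β - M/β)/2. In the application t is the third momentum component and M = m² + |r|²
with r the transverse momentum. -/
theorem lintegral_light_cone {M : ℝ} (hM : 0 < M) (G : ℝ → ENNReal) :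
    ∫⁻ t : ℝ, ENNReal.ofReal (1 / (2 * Real.sqrt (M + t ^ 2))) * G (Real.sqrt (M + t ^ 2) + t)
      = ∫⁻ β in Set.Ioi (0 : ℝ), ENNReal.ofReal (1 / (2 * β)) * G β := by
  have hpos : ∀ t : ℝ, 0 < M + t ^ 2 := fun t => by positivity
  have hf : ∀ t : ℝ, 0 < Real.sqrt (M + t ^ 2) + t := by
    intro t
    have : |t| < Real.sqrt (M + t ^ 2) := by
      rw [← Real.sqrt_sq_eq_abs]; exact Real.sqrt_lt_sqrt (by positivity) (by linarith)
    linarith [neg_abs_le t]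
  have himg : (fun t : ℝ => Real.sqrt (M + t ^ 2) + t) '' Set.univ = Set.Ioi 0 := by
    ext y
    simp only [Set.image_univ, Set.mem_range, Set.mem_Ioi]
    constructor
    · rintro ⟨t, rfl⟩; exact hf t
    · intro hy
      refine ⟨(y - M / y) / 2, ?_⟩
      have : M + ((y - M / y) / 2) ^ 2 = ((y + M / y) / 2) ^ 2 := by field_simp; ring
      rw [this, Real.sqrt_sq (by positivity)]
      ring
  have hinj : Set.InjOn (fun t : ℝ => Real.sqrt (M + t ^ 2) + t) Set.univ := by
    have hinv : ∀ t : ℝ, t = ((Real.sqrt (M + t ^ 2) + t) - M / (Real.sqrt (M + t ^ 2) + t)) / 2 := by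
      intro t
      have h1 := hf t
      have h2 := Real.sq_sqrt (hpos t).le
      field_simp
      linarith
    intro s _ t _ hst
    simp only at hst
    rw [hinv s, hinv t, hst]
  have hder : ∀ t ∈ (Set.univ : Set ℝ), HasDerivWithinAt
      (fun t : ℝ => Real.sqrt (M + t ^ 2) + t)
      ((Real.sqrt (M + t ^ 2) + t) / Real.sqrt (M + t ^ 2)) Set.univ t := by
    intro t _
    have h1 : HasDerivAt (fun t : ℝ => M + t ^ 2) (2 * t) t := by
      simpa using (hasDerivAt_pow 2 t).const_add M
    have h2 := (h1.sqrt (hpos t).ne').add (hasDerivAt_id t)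
    refine HasDerivAt.hasDerivWithinAt (h2.congr_deriv ?_)
    have := Real.sqrt_pos.2 (hpos t)
    field_simp
    ring
  have key := lintegral_image_eq_lintegral_abs_deriv_mul MeasurableSet.univ hder hinj
    fun β => ENNReal.ofReal (1 / (2 * β)) * G β
  rw [himg, setLIntegral_univ] at key
  rw [key]
  refine lintegral_congr fun t => ?_
  have h1 := hf t
  have h2 := Real.sqrt_pos.2 (hpos t)
  rw [← mul_assoc, ← ENNReal.ofReal_mul (abs_nonneg _), abs_of_pos (by positivity)]
  congr 2
  field_simp

/-- The point of the mass shell with transverse momentum `r` and light-cone component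
`p⁰ + p³ = β`. -/
def lightCone (m : ℝ) (r : Fin 2 → ℝ) (β : ℝ) : Spacetime :=
  WithLp.toLp 2 ![(β + (m ^ 2 + r 0 ^ 2 + r 1 ^ 2) / β) / 2, r 0, r 1,
    (β - (m ^ 2 + r 0 ^ 2 + r 1 ^ 2) / β) / 2]

theorem measurable_lightCone (m : ℝ) :
    Measurable (fun x : (Fin 2 → ℝ) × ℝ => lightCone m x.1 x.2) := by
  unfold lightCone
  refine (PiLp.continuous_toLp 2 _).measurable.comp (measurable_pi_lambda _ fun i => ?_)
  fin_cases i <;> simp <;> fun_prop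

theorem lintegral_shellMeasure (m : ℝ) {F : Spacetime → ENNReal} (hF : Measurable F) :
    ∫⁻ k, F k ∂shellMeasure m
      = ∫⁻ q, ENNReal.ofReal (1 / (2 * energy m q)) * F (shell m q) := by
  have hd : Measurable fun q => ENNReal.ofReal (1 / (2 * energy m q)) := by
    have := (continuous_energy m).measurable
    fun_prop
  rw [shellMeasure, lintegral_map hF (continuous_shell m).measurable,
    lintegral_withDensity_eq_lintegral_mul _ hd
      (g := fun q => F (shell m q)) (hF.comp (continuous_shell m).measurable)]
  rfl

/-- In light-cone coordinates d³q/2ω becomes d²r dβ/2β, whose density does not depend on r.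
Translations of r, which are the action of the upper unipotent matrices, therefore preserve it
visibly. -/
theorem lintegral_shellMeasure_lightCone (m : ℝ) {F : Spacetime → ENNReal} (hF : Measurable F) :
    ∫⁻ k, F k ∂shellMeasure m
      = ∫⁻ β in Set.Ioi (0 : ℝ), ∫⁻ r : Fin 2 → ℝ,
          ENNReal.ofReal (1 / (2 * β)) * F (lightCone m r β) := by
  rw [lintegral_shellMeasure m hF]
  have hG : Measurable fun q : EuclideanSpace ℝ (Fin 3) =>
      ENNReal.ofReal (1 / (2 * energy m q)) * F (shell m q) := by
    have h1 := (continuous_energy m).measurable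
    have h2 := hF.comp (continuous_shell m).measurable
    exact (by fun_prop : Measurable fun q => ENNReal.ofReal (1 / (2 * energy m q))).mul h2
  have e := ((PiLp.volume_preserving_toLp (Fin 3)).comp
    (volume_preserving_piFinSuccAbove (fun _ : Fin 3 => ℝ) 2).symm)
  rw [← e.lintegral_comp hG, Measure.volume_eq_prod]
  refine (lintegral_prod_symm' _ (hG.comp e.measurable)).trans ?_
  have hswap : ∫⁻ β in Set.Ioi (0 : ℝ), ∫⁻ r : Fin 2 → ℝ,
      ENNReal.ofReal (1 / (2 * β)) * F (lightCone m r β) = ∫⁻ r : Fin 2 → ℝ,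
      ∫⁻ β in Set.Ioi (0 : ℝ), ENNReal.ofReal (1 / (2 * β)) * F (lightCone m r β) := by
    refine lintegral_lintegral_swap (Measurable.aemeasurable ?_)
    refine Measurable.mul (by fun_prop) ?_
    exact (hF.comp (measurable_lightCone m)).comp measurable_swap
  rw [hswap]
  · refine lintegral_congr_ae ?_
    -- The substitution needs m² + |r|² > 0, which fails only at r = 0 in the massless case; that
    -- point is null.
    have hae : ∀ᵐ r : Fin 2 → ℝ, r ≠ 0 := by
      rw [ae_iff]; simp
    filter_upwards [hae] with r hr
    have hM : 0 < m ^ 2 + r 0 ^ 2 + r 1 ^ 2 := by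
      by_contra hcon
      apply hr
      ext i
      fin_cases i <;> simp <;> nlinarith [sq_nonneg m, sq_nonneg (r 0), sq_nonneg (r 1)]
    rw [← lintegral_light_cone hM fun β => F (lightCone m r β)]
    refine lintegral_congr fun t => ?_
    have hsq := Real.sqrt_pos.2 (show 0 < m ^ 2 + r 0 ^ 2 + r 1 ^ 2 + t ^ 2 by positivity)
    have hsq2 := Real.sq_sqrt (show 0 ≤ m ^ 2 + r 0 ^ 2 + r 1 ^ 2 + t ^ 2 by positivity)
    have hq : ∀ i, (WithLp.toLp 2 ((MeasurableEquiv.piFinSuccAbove (fun _ : Fin 3 => ℝ) 2).symm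
        (t, r)) : EuclideanSpace ℝ (Fin 3)) i = ![r 0, r 1, t] i := by
      intro i
      fin_cases i <;> rfl
    have hen : energy m (WithLp.toLp 2 ((MeasurableEquiv.piFinSuccAbove (fun _ : Fin 3 => ℝ) 2).symm
        (t, r)) : EuclideanSpace ℝ (Fin 3)) = Real.sqrt (m ^ 2 + r 0 ^ 2 + r 1 ^ 2 + t ^ 2) := by
      rw [← sq_eq_sq₀ (energy_nonneg _ _) hsq.le, energy_sq, hsq2, hq, hq, hq]
      simp
      ring
    have hβ : 0 < Real.sqrt (m ^ 2 + r 0 ^ 2 + r 1 ^ 2 + t ^ 2) + t := by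
      have : |t| < Real.sqrt (m ^ 2 + r 0 ^ 2 + r 1 ^ 2 + t ^ 2) := by
        rw [← Real.sqrt_sq_eq_abs]; exact Real.sqrt_lt_sqrt (by positivity) (by linarith)
      linarith [neg_abs_le t]
    simp only [Function.comp_apply, hen]
    congr 2
    ext i
    fin_cases i
    · change energy m _ = (_ + _ / _) / 2
      rw [hen]
      field_simp
      linarith
    · exact hq 0
    · exact hq 1
    · refine (hq 2).trans ?_
      change t = (_ - _ / _) / 2
      field_simp
      linarith

/-- The upper triangular unipotent matrices. -/
def slUpper (c : ℂ) : Matrix.SpecialLinearGroup (Fin 2) ℂ :=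
  ⟨!![1, c; 0, 1], by simp [Matrix.det_fin_two]⟩

/-- The lower triangular unipotent matrices. -/
def slLower (c : ℂ) : Matrix.SpecialLinearGroup (Fin 2) ℂ :=
  ⟨!![1, 0; c, 1], by simp [Matrix.det_fin_two]⟩

/-- The Weyl element. -/
def slWeyl : Matrix.SpecialLinearGroup (Fin 2) ℂ :=
  ⟨!![0, 1; -1, 0], by simp [Matrix.det_fin_two]⟩

@[simp] theorem slUpper_coe (c : ℂ) : (slUpper c).1 = !![1, c; 0, 1] := rfl
@[simp] theorem slLower_coe (c : ℂ) : (slLower c).1 = !![1, 0; c, 1] := rfl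
@[simp] theorem slWeyl_coe : slWeyl.1 = !![0, 1; -1, 0] := rfl

/-- An upper unipotent matrix fixes the lower right entry β = k⁰ + k³ of σ·k and adds cβ to the
off-diagonal one: for fixed β it translates the transverse momentum. -/
theorem map_lorentzAct_upper (m : ℝ) (c : ℂ) {F : Spacetime → ENNReal} (hF : Measurable F) :
    ∫⁻ k, F (lorentzAct (slUpper c) k) ∂shellMeasure m = ∫⁻ k, F k ∂shellMeasure m := by
  rw [lintegral_shellMeasure_lightCone m hF, lintegral_shellMeasure_lightCone m
    (F := fun k => F (lorentzAct (slUpper c) k)) (hF.comp (lorentzEquiv (slUpper c)).continuous.measurable)]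
  refine setLIntegral_congr_fun measurableSet_Ioi fun β hβ => ?_
  have hβ : 0 < β := hβ
  have hpt : ∀ r : Fin 2 → ℝ, lorentzAct (slUpper c) (lightCone m r β)
      = lightCone m (r + ![-(c.re * β), c.im * β]) β := by
    intro r
    apply sig_injective
    rw [sig_lorentzAct, sig_eq, sig_eq, slUpper_coe]
    have hβ' : (β : ℂ) ≠ 0 := by exact_mod_cast hβ.ne'
    ext i j
    obtain ⟨c1, c2⟩ := c
    fin_cases i <;> fin_cases j <;>
      simp [lightCone, Matrix.mul_apply, Fin.sum_univ_two, Complex.ext_iff, pow_two] <;>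
      (try constructor) <;> (try field_simp) <;> first | ring1 | (ring_nf; simp)
  simp only [hpt]
  exact lintegral_add_right_eq_self (μ := (volume : Measure (Fin 2 → ℝ)))
    (fun r => ENNReal.ofReal (1 / (2 * β)) * F (lightCone m r β)) _

/-- The Weyl element acts as the spatial rotation diag(-1, 1, -1), an isometry that leaves ω
unchanged. -/
theorem map_lorentzAct_weyl (m : ℝ) {F : Spacetime → ENNReal} (hF : Measurable F) :
    ∫⁻ k, F (lorentzAct slWeyl k) ∂shellMeasure m = ∫⁻ k, F k ∂shellMeasure m := by
  rw [lintegral_shellMeasure m hF, lintegral_shellMeasure m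
    (F := fun k => F (lorentzAct slWeyl k)) (hF.comp (lorentzEquiv slWeyl).continuous.measurable)]
  let R : EuclideanSpace ℝ (Fin 3) ≃ₗᵢ[ℝ] EuclideanSpace ℝ (Fin 3) :=
    LinearIsometryEquiv.piLpCongrRight 2
      ![LinearIsometryEquiv.neg ℝ, LinearIsometryEquiv.refl ℝ ℝ, LinearIsometryEquiv.neg ℝ]
  have hG : Measurable fun q : EuclideanSpace ℝ (Fin 3) =>
      ENNReal.ofReal (1 / (2 * energy m q)) * F (shell m q) := by
    have h1 := (continuous_energy m).measurable
    exact (by fun_prop : Measurable fun q => ENNReal.ofReal (1 / (2 * energy m q))).mul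
      (hF.comp (continuous_shell m).measurable)
  rw [← R.measurePreserving.lintegral_comp hG]
  refine lintegral_congr fun q => ?_
  have hen : energy m (R q) = energy m q := by simp [energy]
  rw [hen]
  congr 2
  apply sig_injective
  rw [sig_lorentzAct, sig_eq, sig_eq, slWeyl_coe, shell_zero, shell_one, shell_two, shell_three,
    shell_zero, shell_one, shell_two, shell_three, hen]
  have h0 : R q 0 = -q 0 := rfl
  have h1 : R q 1 = q 1 := rfl
  have h2 : R q 2 = -q 2 := rfl
  rw [h0, h1, h2]
  ext i j
  fin_cases i <;> fin_cases j <;>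
    simp [Matrix.mul_apply, Fin.sum_univ_two, Complex.ext_iff, sub_eq_add_neg]

/-- The subgroup of `SL(2,ℂ)` preserving the measure on the mass shell. -/
def shellStabilizer (m : ℝ) : Submonoid (Matrix.SpecialLinearGroup (Fin 2) ℂ) where
  carrier := {A | ∀ F : Spacetime → ENNReal, Measurable F →
    ∫⁻ k, F (lorentzAct A k) ∂shellMeasure m = ∫⁻ k, F k ∂shellMeasure m}
  one_mem' F _ := by simp only [lorentzAct_one]
  mul_mem' {A B} hA hB F hF := by
    simp only [lorentzAct_mul]
    rw [hB (fun k => F (lorentzAct A k)) (hF.comp (lorentzEquiv A).continuous.measurable), hA F hF]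

/-- Upper unipotents and the Weyl element generate SL(2,ℂ). A matrix with nonzero lower left entry
is a product upper · lower · upper; any other becomes one of these after right multiplication by a
lower unipotent. -/
theorem shellStabilizer_eq_top (m : ℝ) : shellStabilizer m = ⊤ := by
  have hU : ∀ c : ℂ, slUpper c ∈ shellStabilizer m :=
    fun c F hF => map_lorentzAct_upper m c hF
  have hJ : slWeyl ∈ shellStabilizer m := fun F hF => map_lorentzAct_weyl m hF
  have hL : ∀ c : ℂ, slLower c ∈ shellStabilizer m := by
    intro c
    -- The Weyl element has square -1, so its cube is its inverse; only products are available in a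
    -- submonoid.
    have h3 := mul_mem (mul_mem hJ (hU (-c))) (mul_mem hJ (mul_mem hJ hJ))
    have : slWeyl * slUpper (-c) * (slWeyl * (slWeyl * slWeyl)) = slLower c := by
      ext i j
      fin_cases i <;> fin_cases j <;>
        simp [Matrix.mul_apply, Fin.sum_univ_two]
    rwa [this] at h3
  have hgen : ∀ A : Matrix.SpecialLinearGroup (Fin 2) ℂ, A.1 1 0 ≠ 0 → A ∈ shellStabilizer m := by
    intro A hc
    have h3 := mul_mem (mul_mem (hU ((A.1 0 0 - 1) / A.1 1 0)) (hL (A.1 1 0)))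
      (hU ((A.1 1 1 - 1) / A.1 1 0))
    have : slUpper ((A.1 0 0 - 1) / A.1 1 0) * slLower (A.1 1 0)
        * slUpper ((A.1 1 1 - 1) / A.1 1 0) = A := by
      have hdet := A.2
      rw [Matrix.det_fin_two] at hdet
      ext i j
      fin_cases i <;> fin_cases j <;>
        simp [Matrix.mul_apply, Fin.sum_univ_two] <;> field_simp
      · ring
      · linear_combination hdet
      · ring
    rwa [this] at h3
  rw [eq_top_iff]
  intro A _
  by_cases hc : A.1 1 0 = 0
  · have hdet := A.2
    rw [Matrix.det_fin_two, hc] at hdet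
    have hd : A.1 1 1 ≠ 0 := by rintro hd; simp [hd] at hdet
    have h3 := mul_mem (hgen (A * slLower 1)
      (by simpa [Matrix.mul_apply, Fin.sum_univ_two, hc] using hd)) (hL (-1))
    have : A * slLower 1 * slLower (-1) = A := by
      ext i j
      fin_cases i <;> fin_cases j <;> simp [Matrix.mul_apply, Fin.sum_univ_two]
    rwa [this] at h3
  · exact hgen A hc

theorem measurePreserving_lorentzAct_shellMeasure (m : ℝ)
    (A : Matrix.SpecialLinearGroup (Fin 2) ℂ) :
    MeasurePreserving (lorentzAct A) (shellMeasure m) (shellMeasure m) := by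
  have hmeas : Measurable (lorentzAct A) := (lorentzEquiv A).continuous.measurable
  refine ⟨hmeas, Measure.ext fun s hs => ?_⟩
  have hA : A ∈ shellStabilizer m := by rw [shellStabilizer_eq_top]; trivial
  have := hA (s.indicator 1) (measurable_one.indicator hs)
  rw [Measure.map_apply hmeas hs, ← lintegral_indicator_one hs, ← this,
    ← lintegral_indicator_one (hmeas hs)]
  rfl

/-- Integrals over the mass shell are Lorentz invariant. -/
theorem integral_shell_lorentz (m : ℝ) (A : Matrix.SpecialLinearGroup (Fin 2) ℂ)
    (F : Spacetime → ℂ) (hF : Measurable F) :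
    ∫ q, (1 / (2 * energy m q) : ℂ) * F (lorentzAct A (shell m q))
      = ∫ q, (1 / (2 * energy m q) : ℂ) * F (shell m q) := by
  have key : ∀ F : Spacetime → ℂ, Measurable F →
      ∫ q, (1 / (2 * energy m q) : ℂ) * F (shell m q) = ∫ k, F k ∂shellMeasure m := by
    intro F hF
    have hd : Measurable fun q => (1 / (2 * energy m q)).toNNReal := by
      have := (continuous_energy m).measurable
      fun_prop
    rw [shellMeasure, integral_map (continuous_shell m).aemeasurable hF.aestronglyMeasurable]
    change _ = ∫ q, F (shell m q) ∂volume.withDensity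
      fun q => (((1 / (2 * energy m q)).toNNReal : NNReal) : ENNReal)
    rw [integral_withDensity_eq_integral_smul hd]
    congr 1
    ext q
    have : 0 ≤ 1 / (2 * energy m q) := by have := energy_nonneg m q; positivity
    rw [NNReal.smul_def, Real.coe_toNNReal _ this, Complex.real_smul]
    push_cast
    rfl
  rw [key F hF, key (fun k => F (lorentzAct A k))
    (hF.comp (lorentzEquiv A).continuous.measurable)]
  exact (measurePreserving_lorentzAct_shellMeasure m A).integral_comp
    (lorentzEquiv A).toHomeomorph.toMeasurableEquiv.measurableEmbedding F

end

end N2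

namespace N2

noncomputable section

open MeasureTheory Complex
open scoped FourierTransform LineDeriv

/-! ### The Pauli-Jordan form -/

theorem norm_le_norm_shell (m : ℝ) (q : EuclideanSpace ℝ (Fin 3)) : ‖q‖ ≤ ‖shell m q‖ := by
  rw [← sq_le_sq₀ (norm_nonneg _) (norm_nonneg _), EuclideanSpace.norm_sq_eq,
    EuclideanSpace.norm_sq_eq, Fin.sum_univ_three, Fin.sum_univ_four, shell_one, shell_two,
    shell_three]
  have := sq_nonneg ‖shell m q 0‖
  linarith

theorem norm_le_energy (m : ℝ) (q : EuclideanSpace ℝ (Fin 3)) : ‖q‖ ≤ energy m q := by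
  rw [energy]
  exact Real.le_sqrt_of_sq_le (by nlinarith [sq_nonneg m])

/-- In polar coordinates the radial factor y² leaves y/(1 + y³), which is at most 2/(1 + y²). -/
theorem integrable_shell_weight :
    Integrable fun q : EuclideanSpace ℝ (Fin 3) => ‖q‖⁻¹ * (1 + ‖q‖ ^ 3)⁻¹ := by
  refine (integrable_fun_norm_addHaar (volume : Measure (EuclideanSpace ℝ (Fin 3)))
    (f := fun y : ℝ => y⁻¹ * (1 + y ^ 3)⁻¹)).2 ?_
  have hfin : Module.finrank ℝ (EuclideanSpace ℝ (Fin 3)) - 1 = 2 := by simp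
  rw [hfin]
  refine (((integrable_inv_one_add_sq).const_mul 2).integrableOn (s := Set.Ioi 0)).mono' ?_ ?_
  · refine Measurable.aestronglyMeasurable ?_
    fun_prop
  · filter_upwards [ae_restrict_mem measurableSet_Ioi] with y hy
    have hy : 0 < y := hy
    have h1 : 0 ≤ y ^ 2 • (y⁻¹ * (1 + y ^ 3)⁻¹) := by simp only [smul_eq_mul]; positivity
    rw [Real.norm_of_nonneg h1, smul_eq_mul]
    have h2 : y ^ 2 * (y⁻¹ * (1 + y ^ 3)⁻¹) = y / (1 + y ^ 3) := by field_simp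
    rw [h2, ← div_eq_mul_inv, div_le_div_iff₀ (by positivity) (by positivity)]
    nlinarith [pow_pos hy 3, sq_nonneg (y - 1), pow_pos hy 2]

/-- The bound 1/(2ω) ≤ 1/‖q‖ holds for every m and takes care of the singularity at q = 0 in the
massless case. -/
theorem integrable_shell_of_bound (m : ℝ) {w : EuclideanSpace ℝ (Fin 3) → ℂ} (hw : Continuous w)
    {B : ℝ} (hB : ∀ q, ‖w q‖ * (1 + ‖q‖ ^ 3) ≤ B) :
    Integrable fun q => (1 / (2 * energy m q) : ℂ) * w q := by
  refine (integrable_shell_weight.const_mul B).mono' ?_ ?_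
  · refine Measurable.aestronglyMeasurable ?_
    have h1 := (continuous_energy m).measurable
    have h2 := hw.measurable
    fun_prop
  · have hae : ∀ᵐ q : EuclideanSpace ℝ (Fin 3), q ≠ 0 := by
      rw [ae_iff]; simp
    filter_upwards [hae] with q hq
    have hq0 : 0 < ‖q‖ := norm_pos_iff.2 hq
    have he : 0 < energy m q := hq0.trans_le (norm_le_energy m q)
    rw [norm_mul]
    have h1 : ‖(1 / (2 * energy m q) : ℂ)‖ = (2 * energy m q)⁻¹ := by
      rw [show (1 / (2 * energy m q) : ℂ) = ((2 * energy m q)⁻¹ : ℝ) by push_cast; ring,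
        Complex.norm_real, Real.norm_of_nonneg (by positivity)]
    have h2 : (2 * energy m q)⁻¹ ≤ ‖q‖⁻¹ :=
      inv_anti₀ hq0 (by linarith [norm_le_energy m q])
    have h3 : ‖w q‖ ≤ B * (1 + ‖q‖ ^ 3)⁻¹ := by
      rw [← div_eq_mul_inv, le_div_iff₀ (by positivity)]
      exact hB q
    rw [h1, mul_left_comm]
    exact mul_le_mul h2 h3 (norm_nonneg _) (by positivity)

theorem continuous_neg_shell (m : ℝ) : Continuous fun q => -shell m q :=
  (continuous_shell m).neg

/-- Cubic decay of one factor and boundedness of the other suffice, since ‖q‖ is at most the norm of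
the shell point. -/
theorem integrable_shell_test (m : ℝ) (u v : Test) :
    Integrable fun q => (1 / (2 * energy m q) : ℂ) *
      (u (shell m q) * v (-shell m q) - u (-shell m q) * v (shell m q)) := by
  obtain ⟨C0, _, hC0⟩ := u.decay 0 0
  obtain ⟨C3, _, hC3⟩ := u.decay 3 0
  obtain ⟨E0, _, hE0⟩ := v.decay 0 0
  have c1 := continuous_shell m
  have c2 := continuous_neg_shell m
  have hu := u.continuous
  have hv := v.continuous
  simp only [pow_zero, one_mul, norm_iteratedFDeriv_zero] at hC0 hC3 hE0
  have hcont : Continuous fun q =>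
      u (shell m q) * v (-shell m q) - u (-shell m q) * v (shell m q) := by fun_prop
  refine integrable_shell_of_bound m hcont (B := 2 * ((C0 + C3) * E0)) fun q => ?_
  have hE : 0 ≤ E0 := (norm_nonneg _).trans (hE0 0)
  have hb : ∀ k : Spacetime, ‖q‖ ≤ ‖k‖ → ‖u k * v (-k)‖ * (1 + ‖q‖ ^ 3) ≤ (C0 + C3) * E0 := by
    intro k hk
    have h1 : ‖u k‖ * (1 + ‖q‖ ^ 3) ≤ C0 + C3 := by
      have h3 : ‖q‖ ^ 3 ≤ ‖k‖ ^ 3 := pow_le_pow_left₀ (norm_nonneg _) hk 3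
      have h4 := mul_le_mul_of_nonneg_left h3 (norm_nonneg (u k))
      linarith [hC0 k, hC3 k, mul_comm ‖u k‖ (‖k‖ ^ 3)]
    rw [norm_mul, mul_right_comm]
    exact mul_le_mul h1 (hE0 _) (norm_nonneg _)
      ((mul_nonneg (norm_nonneg _) (by positivity)).trans h1)
  have hk := norm_le_norm_shell m q
  have h1 := hb _ hk
  have h2 := hb (-shell m q) (by rwa [norm_neg])
  rw [neg_neg] at h2
  have h3 := norm_sub_le (u (shell m q) * v (-shell m q)) (u (-shell m q) * v (shell m q))
  have h4 : (0 : ℝ) ≤ 1 + ‖q‖ ^ 3 := by positivity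
  nlinarith [mul_le_mul_of_nonneg_right h3 h4]

/-- The Pauli-Jordan form on functions of the momentum. -/
def shellPair (m : ℝ) (t s : Spacetime → ℂ) : ℂ :=
  I / ((2 * Real.pi : ℝ) : ℂ) ^ 3 *
    ∫ q : EuclideanSpace ℝ (Fin 3), (1 / (2 * energy m q) : ℂ) *
      (t (shell m q) * s (-shell m q) - t (-shell m q) * s (shell m q))

theorem pauliJordan_eq (m : ℝ) (f h : Test) :
    pauliJordan m f h = shellPair m (minkFourier f) (minkFourier h) := rfl

/-- The form sees only the mass hyperboloid. This is what allows k² = m² to be used under the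
integral and, later, the replacement of test functions by their on-shell restrictions. -/
theorem shellPair_congr {m : ℝ} {t t' s s' : Spacetime → ℂ}
    (h1 : ∀ k, mink k k = m ^ 2 → t k = t' k) (h2 : ∀ k, mink k k = m ^ 2 → s k = s' k) :
    shellPair m t s = shellPair m t' s' := by
  unfold shellPair
  congr 2
  ext q
  have e1 := mink_shell m q
  have e2 : mink (-shell m q) (-shell m q) = m ^ 2 := by
    rw [mink_neg_left, mink_comm, mink_neg_left, neg_neg, e1]
  rw [h1 _ e1, h1 _ e2, h2 _ e1, h2 _ e2]

theorem shellPair_swap (m : ℝ) (t s : Spacetime → ℂ) : shellPair m s t = -shellPair m t s := by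
  unfold shellPair
  rw [← mul_neg, ← integral_neg]
  congr 2
  ext q
  ring

theorem shellPair_const_mul (m : ℝ) (c : ℂ) (t s : Spacetime → ℂ) :
    shellPair m (fun k => c * t k) s = c * shellPair m t s := by
  unfold shellPair
  rw [mul_left_comm c, ← integral_const_mul c]
  congr 2
  ext q
  ring

theorem shellPair_add (m : ℝ) (t t' s : Test) :
    shellPair m (fun k => t k + t' k) s = shellPair m t s + shellPair m t' s := by
  unfold shellPair
  rw [← mul_add, ← integral_add (integrable_shell_test m t s) (integrable_shell_test m t' s)]
  congr 2
  ext q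
  ring

/-- The two arguments are evaluated at opposite momenta, so an odd multiplier changes sides with a
sign: integration by parts in momentum space. -/
theorem shellPair_mul_odd (m : ℝ) (w : Spacetime → ℂ) (hw : ∀ k, w (-k) = -w k)
    (t s : Spacetime → ℂ) :
    shellPair m (fun k => w k * t k) s = -shellPair m t fun k => w k * s k := by
  unfold shellPair
  rw [← mul_neg, ← integral_neg]
  congr 2
  ext q
  simp only [hw]
  ring

theorem shellPair_conj (m : ℝ) (t s : Spacetime → ℂ) :
    (starRingEnd ℂ) (shellPair m t s)
      = shellPair m (fun k => (starRingEnd ℂ) (t (-k))) fun k => (starRingEnd ℂ) (s (-k)) := by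
  unfold shellPair
  rw [map_mul, ← integral_conj, map_div₀, Complex.conj_I, neg_div, neg_mul, ← mul_neg,
    ← integral_neg]
  congr 1
  · rw [map_pow, Complex.conj_ofReal]
  · congr 1
    ext q
    simp only [map_mul, map_sub, map_div₀, map_one, Complex.conj_ofReal, neg_neg, map_ofNat]
    ring

theorem shellPair_lorentz (m : ℝ) (A : Matrix.SpecialLinearGroup (Fin 2) ℂ)
    {t s : Spacetime → ℂ} (ht : Measurable t) (hs : Measurable s) :
    shellPair m (fun k => t (lorentzAct A k)) (fun k => s (lorentzAct A k)) = shellPair m t s := by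
  unfold shellPair
  congr 1
  simp only [lorentzAct_neg]
  exact integral_shell_lorentz m A (fun k => t k * s (-k) - t (-k) * s k)
    (by fun_prop)

/-- The Pauli-Jordan form separates symbols on the upper mass shell. -/
theorem symbol_eq_zero_of_shellPair {m : ℝ} {G : Spacetime → ℂ} (hG : Continuous G)
    (h : ∀ u v : Test, shellPair m (fun k => G k * u k) v = 0)
    {q : EuclideanSpace ℝ (Fin 3)} (he : 0 < energy m q) : G (shell m q) = 0 := by
  by_contra hne
  set k₀ := shell m q with hk₀
  set c := (starRingEnd ℂ) (G k₀)
  have hpos : 0 < (c * G k₀).re := by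
    rw [mul_comm, Complex.mul_conj, Complex.ofReal_re]
    exact Complex.normSq_pos.2 hne
  have hcont : Continuous fun k : Spacetime => (c * G k).re := by fun_prop
  have hopen : IsOpen {k : Spacetime | 0 < (c * G k).re ∧ 0 < k 0} :=
    (isOpen_lt continuous_const hcont).inter (isOpen_lt continuous_const
      (by fun_prop : Continuous fun k : Spacetime => k 0))
  obtain ⟨ε, hε, hball⟩ := Metric.isOpen_iff.1 hopen k₀ ⟨hpos, he⟩
  let b : ContDiffBump k₀ := ⟨ε / 4, ε / 2, by positivity, by linarith⟩
  have hb : ∀ k, b k ≠ 0 → 0 < (c * G k).re ∧ 0 < k 0 := by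
    intro k hk
    refine hball ?_
    have : k ∈ Function.support b := hk
    rw [b.support_eq] at this
    exact Metric.ball_subset_ball (by change ε / 2 ≤ ε; linarith) this
  have hbs : ContDiff ℝ (⊤ : ℕ∞) fun k : Spacetime => ((b k : ℝ) : ℂ) :=
    Complex.ofRealCLM.contDiff.comp b.contDiff
  have hbc : HasCompactSupport fun k : Spacetime => ((b k : ℝ) : ℂ) :=
    b.hasCompactSupport.comp_left (g := fun x : ℝ => (x : ℂ)) Complex.ofReal_zero
  let u : Test := hbc.toSchwartzMap hbs
  -- At minus a shell point the factor -k⁰ equals ω and cancels the density 1/(2ω). The bump lives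
  -- where k⁰ > 0, so the second term of the form drops out.
  let R : Spacetime → ℂ := fun k => ((-(k 0) * b (-k) : ℝ) : ℂ)
  have hRs : ContDiff ℝ (⊤ : ℕ∞) R := by
    refine Complex.ofRealCLM.contDiff.comp (ContDiff.mul ?_ (b.contDiff.comp contDiff_neg))
    exact (contDiff_piLp_apply (p := 2) (i := (0 : Fin 4))).neg
  have hRc : HasCompactSupport R := by
    have h1 : HasCompactSupport fun k : Spacetime => b (-k) :=
      b.hasCompactSupport.comp_homeomorph (Homeomorph.neg Spacetime)
    have h2 : HasCompactSupport fun k : Spacetime => -(k 0) * b (-k) := h1.mul_left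
    exact h2.comp_left (g := fun x : ℝ => (x : ℂ)) Complex.ofReal_zero
  let v : Test := hRc.toSchwartzMap hRs
  have hu : ∀ k, u k = ((b k : ℝ) : ℂ) := fun _ => rfl
  have hv : ∀ k, v k = ((-(k 0) * b (-k) : ℝ) : ℂ) := fun _ => rfl
  have key := h u v
  unfold shellPair at key
  have hI : I / ((2 * Real.pi : ℝ) : ℂ) ^ 3 ≠ 0 := by
    refine div_ne_zero I_ne_zero (pow_ne_zero 3 ?_)
    exact_mod_cast (by positivity : (2 * Real.pi) ≠ 0)
  have key2 := (mul_eq_zero.1 key).resolve_left hI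
  have hint : ∀ p, (1 / (2 * energy m p) : ℂ) *
      ((fun k => G k * u k) (shell m p) * v (-shell m p)
        - (fun k => G k * u k) (-shell m p) * v (shell m p))
      = (1 / 2) * (G (shell m p) * ((b (shell m p) ^ 2 : ℝ) : ℂ)) := by
    intro p
    have hz : b (-shell m p) = 0 := by
      by_contra hc
      have := (hb _ hc).2
      have h2 := energy_nonneg m p
      rw [PiLp.neg_apply, shell_zero] at this
      linarith
    simp only [hu, hv, hz, neg_neg, PiLp.neg_apply, shell_zero]
    by_cases hz2 : b (shell m p) = 0
    · simp [hz2]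
    · have h3 := (hb _ hz2).2
      rw [shell_zero] at h3
      have h4 : (energy m p : ℂ) ≠ 0 := Complex.ofReal_ne_zero.2 h3.ne'
      push_cast
      field_simp
      ring
  simp only [hint] at key2
  have hbcont : Continuous fun p => b (shell m p) := b.continuous.comp (continuous_shell m)
  have hcpt : HasCompactSupport fun p => b (shell m p) := by
    refine HasCompactSupport.intro
      (isCompact_closedBall (0 : EuclideanSpace ℝ (Fin 3)) (‖k₀‖ + ε)) fun p hp => ?_
    by_contra hc
    have hm : shell m p ∈ Function.support b := hc
    rw [b.support_eq] at hm
    have h1 : ‖shell m p‖ < ‖k₀‖ + ε / 2 := by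
      have := norm_sub_norm_le (shell m p) k₀
      have h2 : ‖shell m p - k₀‖ < ε / 2 := by simpa [dist_eq_norm] using hm
      linarith
    apply hp
    rw [mem_closedBall_zero_iff]
    linarith [norm_le_norm_shell m p]
  have hGs := hG.comp (continuous_shell m)
  -- With c the conjugate of G at the chosen point, the real part is positive on the support of the
  -- bump. Thus Φ is continuous, nonnegative and not identically zero, yet its integral is forced to
  -- vanish.
  let Φ : EuclideanSpace ℝ (Fin 3) → ℝ := fun p => (c * G (shell m p)).re * b (shell m p) ^ 2
  have hΦ0 : ∫ p, Φ p = 0 := by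
    have hcc : Continuous fun p => (1 / 2 : ℂ) * (G (shell m p) * ((b (shell m p) ^ 2 : ℝ) : ℂ)) := by
      have h1 : Continuous fun p => G (shell m p) := hGs
      exact continuous_const.mul (h1.mul (Complex.continuous_ofReal.comp (hbcont.pow 2)))
    have hi : Integrable fun p => (2 * c) *
        ((1 / 2 : ℂ) * (G (shell m p) * ((b (shell m p) ^ 2 : ℝ) : ℂ))) := by
      refine (hcc.integrable_of_hasCompactSupport ?_).const_mul _
      refine hcpt.mono fun p hp => ?_
      contrapose! hp
      simp only [Function.mem_support, not_not] at hp
      simp [hp]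
    have h1 := integral_const_mul (μ := volume) (2 * c) fun p =>
      (1 / 2 : ℂ) * (G (shell m p) * ((b (shell m p) ^ 2 : ℝ) : ℂ))
    rw [key2, mul_zero] at h1
    have h2 := integral_re (𝕜 := ℂ) hi
    rw [h1] at h2
    simp only [RCLike.re_to_complex, Complex.zero_re] at h2
    rw [← h2]
    congr 1
    ext p
    have : 2 * c * (1 / 2 * (G (shell m p) * ((b (shell m p) ^ 2 : ℝ) : ℂ)))
        = c * G (shell m p) * ((b (shell m p) ^ 2 : ℝ) : ℂ) := by ring
    rw [this, Complex.re_mul_ofReal]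
  have hΦc : Continuous Φ := by
    have h1 : Continuous fun p => G (shell m p) := hGs
    exact (Complex.continuous_re.comp (continuous_const.mul h1)).mul (hbcont.pow 2)
  have hΦs : HasCompactSupport Φ := by
    refine hcpt.mono fun p hp => ?_
    contrapose! hp
    simp only [Function.mem_support, not_not] at hp
    simp [Φ, hp]
  have hΦn : 0 ≤ Φ := by
    intro p
    by_cases hz : b (shell m p) = 0
    · simp [Φ, hz]
    · exact mul_nonneg (hb _ hz).1.le (sq_nonneg _)
  have hΦq : Φ q ≠ 0 := by
    have hb1 : b k₀ = 1 := b.one_of_mem_closedBall (Metric.mem_closedBall_self (by positivity))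
    have : Φ q = (c * G k₀).re := by simp only [Φ, ← hk₀, hb1]; ring
    rw [this]
    exact hpos.ne'
  have := hΦc.integral_pos_of_hasCompactSupport_nonneg_nonzero (μ := volume) hΦs hΦn hΦq
  exact this.ne' hΦ0

end

end N2

namespace N2

noncomputable section

open MeasureTheory Complex
open scoped FourierTransform LineDeriv

/-! ### Operators on test functions -/

theorem antilipschitz_poincareAct (a : Spacetime) (A : Matrix.SpecialLinearGroup (Fin 2) ℂ) :
    AntilipschitzWith ‖((lorentzEquiv A).symm : Spacetime →L[ℝ] Spacetime)‖₊ (poincareAct a A) := by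
  refine AntilipschitzWith.of_le_mul_dist fun x y => ?_
  have := (lorentzEquiv A).antilipschitz.le_mul_dist x y
  rw [poincareAct, poincareAct, dist_add_right]
  exact this

theorem hasTemperateGrowth_poincareAct (a : Spacetime) (A : Matrix.SpecialLinearGroup (Fin 2) ℂ) :
    (poincareAct a A).HasTemperateGrowth :=
  (lorentzEquiv A).toContinuousLinearMap.hasTemperateGrowth.add (.const a)

/-- Composition of a test function with a Poincaré transformation. -/
def compPoincare (a : Spacetime) (A : Matrix.SpecialLinearGroup (Fin 2) ℂ) : Test →ₗ[ℂ] Test :=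
  (SchwartzMap.compCLMOfAntilipschitz ℂ (hasTemperateGrowth_poincareAct a A)
    (antilipschitz_poincareAct a A)).toLinearMap

theorem compPoincare_apply (a : Spacetime) (A : Matrix.SpecialLinearGroup (Fin 2) ℂ) (f : Test)
    (x : Spacetime) : compPoincare a A f x = f (poincareAct a A x) := rfl

theorem minkFourier_compPoincare_zero (A : Matrix.SpecialLinearGroup (Fin 2) ℂ) (f : Test)
    (k : Spacetime) : minkFourier (compPoincare 0 A f) k = minkFourier f (lorentzAct A k) := by
  rw [minkFourier_poincare 0 A f _ (compPoincare_apply 0 A f)]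
  simp [mink]

theorem continuous_minkFourier (f : Test) : Continuous (minkFourier f) := by
  have : minkFourier f = fourierMink f := funext fun p => (fourierMink_apply f p).symm
  rw [this]; exact (fourierMink f).continuous

theorem pauliJordan_lorentz (m : ℝ) (A : Matrix.SpecialLinearGroup (Fin 2) ℂ) (f h : Test) :
    pauliJordan m (compPoincare 0 A f) (compPoincare 0 A h) = pauliJordan m f h := by
  rw [pauliJordan_eq, pauliJordan_eq, ← shellPair_lorentz m A
    (continuous_minkFourier f).measurable (continuous_minkFourier h).measurable]
  simp only [← minkFourier_compPoincare_zero]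

theorem pauliJordan_congr {m : ℝ} {f f' h h' : Test}
    (h1 : ∀ k, mink k k = m ^ 2 → minkFourier f k = minkFourier f' k)
    (h2 : ∀ k, mink k k = m ^ 2 → minkFourier h k = minkFourier h' k) :
    pauliJordan m f h = pauliJordan m f' h' :=
  shellPair_congr h1 h2

theorem pauliJordan_swap (m : ℝ) (f h : Test) : pauliJordan m h f = -pauliJordan m f h :=
  shellPair_swap m _ _

/-- The Pauli-Jordan form as a bilinear form on test functions. -/
def pauliJordanForm (m : ℝ) : Test →ₗ[ℂ] Test →ₗ[ℂ] ℂ :=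
  have hadd : ∀ f f' h, pauliJordan m (f + f') h = pauliJordan m f h + pauliJordan m f' h := by
    intro f f' h
    have := shellPair_add m (fourierMink f) (fourierMink f') (fourierMink h)
    simp only [fourierMink_apply, ← minkFourier_add] at this
    have e : (fourierMink h : Spacetime → ℂ) = minkFourier h := funext (fourierMink_apply h)
    have e1 : (fourierMink f : Spacetime → ℂ) = minkFourier f := funext (fourierMink_apply f)
    have e2 : (fourierMink f' : Spacetime → ℂ) = minkFourier f' := funext (fourierMink_apply f')
    rw [e, e1, e2] at this
    exact this
  have hsmul : ∀ (c : ℂ) f h, pauliJordan m (c • f) h = c * pauliJordan m f h := by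
    intro c f h
    rw [pauliJordan_eq, pauliJordan_eq, ← shellPair_const_mul]
    exact shellPair_congr (fun k _ => minkFourier_smul c f k) fun _ _ => rfl
  LinearMap.mk₂ ℂ (pauliJordan m) hadd hsmul
    (fun f h h' => by
      rw [pauliJordan_swap, hadd, pauliJordan_swap m f h, pauliJordan_swap m f h', neg_add_rev,
        neg_neg, neg_neg, add_comm])
    (fun c f h => by
      rw [pauliJordan_swap, hsmul, pauliJordan_swap m f h]; simp)

theorem pauliJordanForm_apply (m : ℝ) (f h : Test) :
    pauliJordanForm m f h = pauliJordan m f h := rfl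

theorem pauliJordan_conj (m : ℝ) (f h : Test) :
    (starRingEnd ℂ) (pauliJordan m f h) = pauliJordan m (conjTest f) (conjTest h) := by
  rw [pauliJordan_eq, shellPair_conj, pauliJordan_eq]
  exact shellPair_congr (fun k _ => (minkFourier_conjTest f k).symm)
    fun k _ => (minkFourier_conjTest h k).symm

/-- The operator `σ^μ_{ab} ∂_μ`, transposed to test functions. -/
def slT (a b : Fin 2) : Test →ₗ[ℂ] Test := -∑ μ, sigma μ a b • dTest μ

theorem minkFourier_sum {ι : Type*} (s : Finset ι) (f : ι → Test) (k : Spacetime) :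
    minkFourier (∑ i ∈ s, f i) k = ∑ i ∈ s, minkFourier (f i) k := by
  classical
  induction s using Finset.induction_on with
  | empty =>
    simp only [Finset.sum_empty]
    have := minkFourier_smul 0 0 k
    simpa using this
  | insert i s hi ih => rw [Finset.sum_insert hi, Finset.sum_insert hi, minkFourier_add, ih]

theorem minkFourier_slT (a b : Fin 2) (f : Test) (k : Spacetime) :
    minkFourier (slT a b f) k = -I * sig k a b * minkFourier f k := by
  simp only [slT, LinearMap.neg_apply, LinearMap.sum_apply, LinearMap.smul_apply, minkFourier_neg,
    minkFourier_sum, minkFourier_smul, minkFourier_dTest, sig, Matrix.sum_apply, Matrix.smul_apply,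
    smul_eq_mul, Finset.mul_sum, Finset.sum_mul, ← Finset.sum_neg_distrib]
  exact Finset.sum_congr rfl fun μ _ => by ring

theorem slash_apply {𝒜 : Type*} [Ring 𝒜] [Algebra ℂ 𝒜] (a b : Fin 2) (φ : Test →ₗ[ℂ] 𝒜)
    (f : Test) : slash a b φ f = φ (slT a b f) := by
  simp [slash, dField, slT, LinearMap.sum_apply, map_sum]

theorem sig_neg (k : Spacetime) : sig (-k) = -sig k := by
  rw [sig_eq, sig_eq]
  ext i j
  fin_cases i <;> fin_cases j <;> simp <;> ring

theorem pauliJordan_slT (m : ℝ) (a b : Fin 2) (f h : Test) :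
    pauliJordan m f (slT a b h) = -pauliJordan m (slT a b f) h := by
  have h1 := shellPair_mul_odd m (fun k => -I * sig k a b) (fun k => by simp [sig_neg])
    (minkFourier f) (minkFourier h)
  simp only [← minkFourier_slT] at h1
  rw [pauliJordan_eq m (slT a b f) h, h1, neg_neg]
  rfl

theorem pauliJordan_slT_comm (m : ℝ) (a b c d : Fin 2) (f h : Test) :
    pauliJordan m (slT a b (slT c d f)) h = pauliJordan m (slT c d (slT a b f)) h := by
  refine pauliJordan_congr (fun k _ => ?_) fun _ _ => rfl
  simp only [minkFourier_slT]; ring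

/-- On the shell this is det(σ·k) = m²; each derivative contributes a factor -i, and the product of
two of them gives the minus sign. -/
theorem pauliJordan_slT_det (m : ℝ) (f h : Test) :
    pauliJordan m (slT 0 0 (slT 1 1 f)) h
      = pauliJordan m (slT 0 1 (slT 1 0 f)) h - m ^ 2 * pauliJordan m f h := by
  have h1 : pauliJordan m (slT 0 0 (slT 1 1 f)) h
      = pauliJordan m (slT 0 1 (slT 1 0 f) - (m ^ 2 : ℂ) • f) h := by
    refine pauliJordan_congr (fun k hk => ?_) fun _ _ => rfl
    have hd := det_sig k
    rw [Matrix.det_fin_two, hk] at hd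
    rw [sub_eq_add_neg, minkFourier_add, minkFourier_neg, minkFourier_smul]
    simp only [minkFourier_slT]
    push_cast at hd
    linear_combination minkFourier f k * (-hd) + minkFourier f k * (sig k 0 0 * sig k 1 1 -
      sig k 0 1 * sig k 1 0) * Complex.I_sq
  rw [h1, ← pauliJordanForm_apply, map_sub, map_smul]
  rfl

theorem sum_sigma_dKer (m : ℝ) (a b : Fin 2) (f h : Test) :
    ∑ μ, sigma μ a b * dKer μ (pauliJordan m) f h = pauliJordan m (slT a b f) h := by
  rw [← pauliJordanForm_apply, slT]
  simp only [LinearMap.neg_apply, LinearMap.sum_apply, LinearMap.smul_apply, map_neg, map_sum,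
    map_smul, smul_eq_mul, dKer, mul_neg, Finset.sum_neg_distrib, pauliJordanForm_apply]

theorem sum_sigma_sigma_dKer (m : ℝ) (a b c d : Fin 2) (f h : Test) :
    ∑ μ, ∑ ν, sigma μ a b * sigma ν c d * dKer μ (dKer ν (pauliJordan m)) f h
      = pauliJordan m (slT a b (slT c d f)) h := by
  rw [pauliJordan_slT_comm, ← sum_sigma_dKer, Finset.sum_comm]
  refine Finset.sum_congr rfl fun ν _ => ?_
  simp only [mul_assoc, mul_left_comm _ (sigma ν c d)]
  rw [← Finset.mul_sum]
  congr 1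
  simp only [dKer]
  rw [← pauliJordanForm_apply]
  simp only [slT, LinearMap.neg_apply, LinearMap.sum_apply, LinearMap.smul_apply, map_neg, map_sum,
    map_smul, smul_eq_mul, pauliJordanForm_apply, neg_neg]

/-- The constant coefficient operator `p(∂)`, transposed to test functions. -/
def polyTest (p : MvPolynomial (Fin 4) ℂ) (f : Test) : Test :=
  ∑ s ∈ p.support, p.coeff s • ((-dTest 3 : Test →ₗ[ℂ] Test)^[s 3]
    ((-dTest 2 : Test →ₗ[ℂ] Test)^[s 2] ((-dTest 1 : Test →ₗ[ℂ] Test)^[s 1]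
      ((-dTest 0 : Test →ₗ[ℂ] Test)^[s 0] f))))

/-- The symbol of `p(∂)`. -/
def symbol (p : MvPolynomial (Fin 4) ℂ) (k : Spacetime) : ℂ :=
  MvPolynomial.eval (fun μ => -I * (g μ * k μ : ℝ)) p

theorem continuous_symbol (p : MvPolynomial (Fin 4) ℂ) : Continuous (symbol p) := by
  unfold symbol
  refine (MvPolynomial.continuous_eval p).comp ?_
  fun_prop

theorem minkFourier_iterate (μ : Fin 4) (n : ℕ) (f : Test) (k : Spacetime) :
    minkFourier ((-dTest μ : Test →ₗ[ℂ] Test)^[n] f) k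
      = (-I * (g μ * k μ : ℝ)) ^ n * minkFourier f k := by
  induction n with
  | zero => simp
  | succ n ih =>
    rw [Function.iterate_succ_apply', LinearMap.neg_apply, minkFourier_neg, minkFourier_dTest, ih]
    ring

theorem minkFourier_polyTest (p : MvPolynomial (Fin 4) ℂ) (f : Test) (k : Spacetime) :
    minkFourier (polyTest p f) k = symbol p k * minkFourier f k := by
  rw [polyTest, minkFourier_sum, symbol, MvPolynomial.eval_eq', Finset.sum_mul]
  refine Finset.sum_congr rfl fun s _ => ?_
  simp only [minkFourier_smul, minkFourier_iterate, Fin.prod_univ_four]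
  ring

theorem dKer_iterate (μ : Fin 4) (n : ℕ) (T : Kernel) (hT : ∀ f h, T (-f) h = -T f h)
    (f h : Test) : (dKer μ)^[n] T f h = T ((-dTest μ : Test →ₗ[ℂ] Test)^[n] f) h := by
  induction n generalizing f with
  | zero => rfl
  | succ n ih =>
    rw [Function.iterate_succ_apply', Function.iterate_succ_apply]
    change -((dKer μ)^[n] T (dTest μ f) h) = _
    rw [ih, LinearMap.neg_apply, ← hT]
    congr 1
    rw [← Module.End.coe_pow, map_neg]

/-- Bridge from freeness to symbols. The outermost kernel derivative acts on the test function
first, which is why ∂₀ stands innermost in `polyTest`. -/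
theorem polyKer_pauliJordan (m : ℝ) (p : MvPolynomial (Fin 4) ℂ) (f h : Test) :
    polyKer p (pauliJordan m) f h = pauliJordan m (polyTest p f) h := by
  have hneg : ∀ f h, pauliJordan m (-f) h = -pauliJordan m f h := fun f h => by
    simp only [← pauliJordanForm_apply, map_neg, LinearMap.neg_apply]
  have hpow : ∀ (μ : Fin 4) (n : ℕ) (T : Kernel), (∀ f h, T (-f) h = -T f h) →
      ∀ f h, (dKer μ)^[n] T (-f) h = -(dKer μ)^[n] T f h := by
    intro μ n T hT f h
    rw [dKer_iterate μ n T hT, dKer_iterate μ n T hT, ← hT, ← Module.End.coe_pow, map_neg]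
  have e3 := fun n => hpow 3 n (pauliJordan m) hneg
  have e2 := fun n n' => hpow 2 n _ (e3 n')
  have e1 := fun n n' n'' => hpow 1 n _ (e2 n' n'')
  rw [polyKer, polyTest, ← pauliJordanForm_apply]
  simp only [map_sum, LinearMap.sum_apply, map_smul, LinearMap.smul_apply, smul_eq_mul]
  refine Finset.sum_congr rfl fun s _ => ?_
  congr 1
  rw [dKerPow, dKer_iterate 0 _ _ (e1 _ _ _), dKer_iterate 1 _ _ (e2 _ _),
    dKer_iterate 2 _ _ (e3 _), dKer_iterate 3 _ _ hneg]
  rfl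

/-- Two families of test functions with the same pairings have the same symbols on the shell. -/
theorem symbol_eq_zero {m : ℝ} {G : Spacetime → ℂ} (hG : Continuous G) (X : Test → Test)
    (hX : ∀ f k, minkFourier (X f) k = G k * minkFourier f k)
    (h : ∀ f h, pauliJordan m (X f) h = 0) {q : EuclideanSpace ℝ (Fin 3)}
    (hq : 0 < energy m q) :
    G (shell m q) = 0 ∧ G (-shell m q) = 0 := by
  have h1 : ∀ u v : Test, shellPair m (fun k => G k * u k) v = 0 := by
    intro u v
    obtain ⟨f, hf⟩ := exists_minkFourier_eq u
    obtain ⟨w, hw⟩ := exists_minkFourier_eq v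
    rw [← h f w, pauliJordan_eq]
    exact shellPair_congr (fun k _ => by rw [hX, hf]) fun k _ => (hw k).symm
  refine ⟨symbol_eq_zero_of_shellPair hG h1 hq, ?_⟩
  -- The other sheet is reached by exchanging the two arguments, which turns the multiplier G(k)
  -- into G(-k).
  refine symbol_eq_zero_of_shellPair (G := fun k => G (-k)) (m := m) (by fun_prop) ?_ hq
  intro u v
  have h2 := h1 v u
  have h3 : shellPair m (fun k => G (-k) * u k) v = -shellPair m (fun k => G k * v k) u := by
    unfold shellPair
    rw [← mul_neg, ← integral_neg]
    congr 2
    ext q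
    simp only [neg_neg]
    ring
  rw [h3, h2, neg_zero]

end

end N2

namespace N2

noncomputable section

open MeasureTheory Complex

/-! ### Graded brackets and adjoint fields -/

section Brackets

variable {𝒜 : Type*} [Ring 𝒜]

/-- The graded Jacobi identity {[Q, X], Y} + [X, {Q, Y}] = {Q, [X, Y]} for Q, Y odd and X even.
Every bracket found by supersymmetry comes from one application of it. -/
theorem acomm_comm_of_comm_eq_zero (Q : 𝒜) {X Y : 𝒜} (h : comm X Y = 0) :
    acomm (comm Q X) Y = -comm X (acomm Q Y) := by
  have h' : X * Y = Y * X := sub_eq_zero.1 h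
  have e : acomm (comm Q X) Y + comm X (acomm Q Y) = acomm Q (comm X Y) := by
    simp only [acomm, comm]; noncomm_ring
  rw [h] at e
  rw [eq_neg_iff_add_eq_zero, e]
  simp [acomm]

theorem comm_swap (x y : 𝒜) : comm y x = -comm x y := by simp [comm]

theorem acomm_swap (x y : 𝒜) : acomm y x = acomm x y := by simp [acomm, add_comm]

theorem comm_add_right (x y w : 𝒜) : comm x (y + w) = comm x y + comm x w := by
  simp only [comm]; noncomm_ring

theorem comm_neg_right (x y : 𝒜) : comm x (-y) = -comm x y := by
  simp only [comm]; noncomm_ring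

theorem acomm_add_left (x y w : 𝒜) : acomm (x + y) w = acomm x w + acomm y w := by
  simp only [acomm]; noncomm_ring

theorem acomm_neg_left (x y : 𝒜) : acomm (-x) y = -acomm x y := by
  simp only [acomm]; noncomm_ring

theorem acomm_zero_left (x : 𝒜) : acomm 0 x = 0 := by simp [acomm]

theorem comm_sum_right {ι : Type*} (s : Finset ι) (x : 𝒜) (y : ι → 𝒜) :
    comm x (∑ i ∈ s, y i) = ∑ i ∈ s, comm x (y i) := by
  simp [comm, Finset.mul_sum, Finset.sum_mul]

theorem acomm_sum_left {ι : Type*} (s : Finset ι) (x : ι → 𝒜) (y : 𝒜) :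
    acomm (∑ i ∈ s, x i) y = ∑ i ∈ s, acomm (x i) y := by
  simp [acomm, Finset.mul_sum, Finset.sum_mul, Finset.sum_add_distrib]

theorem comm_smul_right [Algebra ℂ 𝒜] (c : ℂ) (x y : 𝒜) : comm x (c • y) = c • comm x y := by
  simp [comm, smul_sub]

theorem acomm_smul_left [Algebra ℂ 𝒜] (c : ℂ) (x y : 𝒜) : acomm (c • x) y = c • acomm x y := by
  simp [acomm, smul_add]

theorem star_comm_eq [StarRing 𝒜] (x y : 𝒜) : star (comm x y) = comm (star y) (star x) := by simp [comm]

theorem star_acomm_eq [StarRing 𝒜] (x y : 𝒜) : star (acomm x y) = acomm (star x) (star y) := by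
  simp [acomm, add_comm]

variable [StarRing 𝒜] [Algebra ℂ 𝒜] [StarModule ℂ 𝒜]

theorem conjTest_conjTest (f : Test) : conjTest (conjTest f) = f := by
  ext x; simp [conjTest_apply]

theorem adj_apply (φ : Test →ₗ[ℂ] 𝒜) (f : Test) : adj φ f = star (φ (conjTest f)) := rfl

theorem star_apply (φ : Test →ₗ[ℂ] 𝒜) (f : Test) : star (φ f) = adj φ (conjTest f) := by
  rw [adj_apply, conjTest_conjTest]

theorem lineDeriv_conj_apply (f : Test) (μ : Fin 4) :
    dTest μ (conjTest f) = conjTest (dTest μ f) := by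
  ext x
  rw [conjTest_apply]
  change (LineDeriv.lineDerivOp (EuclideanSpace.single μ (1 : ℝ)) (conjTest f) : Test) x
    = (starRingEnd ℂ) ((LineDeriv.lineDerivOp (EuclideanSpace.single μ (1 : ℝ)) f : Test) x)
  rw [SchwartzMap.lineDerivOp_apply_eq_fderiv, SchwartzMap.lineDerivOp_apply_eq_fderiv]
  have h : HasFDerivAt (conjTest f) ((Complex.conjCLE : ℂ →L[ℝ] ℂ).comp (fderiv ℝ f x)) x :=
    (Complex.conjCLE : ℂ →L[ℝ] ℂ).hasFDerivAt.comp x f.differentiableAt.hasFDerivAt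
  rw [h.fderiv]
  rfl

theorem conj_sigma (μ : Fin 4) (a b : Fin 2) :
    (starRingEnd ℂ) (sigma μ a b) = sigma μ b a := by
  fin_cases μ <;> fin_cases a <;> fin_cases b <;> simp [sigma]

theorem conjTest_slT (a b : Fin 2) (f : Test) :
    conjTest (slT a b (conjTest f)) = slT b a f := by
  have hs : ∀ (c : ℂ) (f : Test), conjTest (c • f) = (starRingEnd ℂ) c • conjTest f := by
    intro c f; ext x; simp [conjTest_apply]
  have ha : ∀ f h : Test, conjTest (f + h) = conjTest f + conjTest h := by
    intro f h; ext x; simp [conjTest_apply]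
  have hn : ∀ f : Test, conjTest (-f) = -conjTest f := by
    intro f; ext x; simp [conjTest_apply]
  simp only [slT, LinearMap.neg_apply, LinearMap.add_apply, LinearMap.smul_apply,
    Fin.sum_univ_four, hs, ha, hn, lineDeriv_conj_apply, conjTest_conjTest, conj_sigma]

theorem star_apply_slT (φ : Test →ₗ[ℂ] 𝒜) (a b : Fin 2) (f : Test) :
    star (φ (slT a b (conjTest f))) = adj φ (slT b a f) := by
  rw [star_apply, conjTest_slT]

/-- Separation of the two irreducible parts of `ε_{jk} X_{ab} + ε_{ab} Y_{jk}`. -/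
theorem separate_symmetric {E : Type*} [AddCommGroup E] [Module ℂ E] {X Y : Fin 2 → Fin 2 → E}
    {Z : Fin 2 → Fin 2 → Fin 2 → Fin 2 → E} (hX : ∀ a b, X a b = X b a) (hY : ∀ j k, Y j k = Y k j)
    (h : ∀ j a k b, eps j k • X a b + eps a b • Y j k = Z j a k b) :
    (∀ a b, X a b = (1 / 2 : ℂ) • (Z 0 a 1 b - Z 1 a 0 b)) ∧
      ∀ j k, Y j k = (1 / 2 : ℂ) • (Z j 0 k 1 - Z j 1 k 0) := by
  constructor
  · intro a b
    rw [← h, ← h, hY 1 0]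
    simp only [eps, Matrix.of_apply, Matrix.cons_val', Matrix.cons_val_zero, Matrix.cons_val_one,
      Matrix.cons_val_fin_one]
    module
  · intro j k
    rw [← h, ← h, hX 1 0]
    simp only [eps, Matrix.of_apply, Matrix.cons_val', Matrix.cons_val_zero, Matrix.cons_val_one,
      Matrix.cons_val_fin_one]
    module

end Brackets

@[simp] theorem eps_00 : eps 0 0 = 0 := rfl
@[simp] theorem eps_01 : eps 0 1 = 1 := rfl
@[simp] theorem eps_10 : eps 1 0 = -1 := rfl
@[simp] theorem eps_11 : eps 1 1 = 0 := rfl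
@[simp] theorem epsUp_00 : epsUp 0 0 = 0 := by simp [epsUp]
@[simp] theorem epsUp_01 : epsUp 0 1 = -1 := by simp [epsUp]
@[simp] theorem epsUp_10 : epsUp 1 0 = 1 := by simp [epsUp]
@[simp] theorem epsUp_11 : epsUp 1 1 = 0 := by simp [epsUp]
@[simp] theorem delta_self (j : Fin 2) : delta j j = 1 := by simp [delta]
@[simp] theorem delta_01 : delta 0 1 = 0 := by simp [delta]
@[simp] theorem delta_10 : delta 1 0 = 0 := by simp [delta]

theorem conj_eps (a b : Fin 2) : (starRingEnd ℂ) (eps a b) = eps a b := by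
  fin_cases a <;> fin_cases b <;> simp

theorem conj_epsUp (a b : Fin 2) : (starRingEnd ℂ) (epsUp a b) = epsUp a b := by
  fin_cases a <;> fin_cases b <;> simp

theorem conj_delta (a b : Fin 2) : (starRingEnd ℂ) (delta a b) = delta a b := by
  fin_cases a <;> fin_cases b <;> simp

namespace Multiplet

variable {𝒜 : Type*} [Ring 𝒜] [StarRing 𝒜] [Algebra ℂ 𝒜] [StarModule ℂ 𝒜] (M : Multiplet 𝒜)

theorem comm_Q_z (j a : Fin 2) (f : Test) : comm (M.Q j a) (M.z f) = -I • M.chi j a f := by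
  rw [← M.Q_z, smul_smul]; simp

/-- The adjoint reverses a commutator, hence the sign, which is absent for anticommutators. Actions
on adjoint fields are read off from the conjugate charge in this way. -/
theorem comm_Q_adj (j a : Fin 2) (φ : Test →ₗ[ℂ] 𝒜) (f : Test) :
    comm (M.Q j a) (adj φ f) = -star (comm (star (M.Q j a)) (φ (conjTest f))) := by
  rw [star_comm_eq, star_star, comm_swap, adj_apply]

theorem acomm_Q_adj (j a : Fin 2) (φ : Test →ₗ[ℂ] 𝒜) (f : Test) :
    acomm (M.Q j a) (adj φ f) = star (acomm (star (M.Q j a)) (φ (conjTest f))) := by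
  rw [star_acomm_eq, star_star, adj_apply]

theorem acomm_Qbar_adj (j a : Fin 2) (φ : Test →ₗ[ℂ] 𝒜) (f : Test) :
    acomm (star (M.Q j a)) (adj φ f) = star (acomm (M.Q j a) (φ (conjTest f))) := by
  rw [star_acomm_eq, adj_apply]

theorem Q_Fstar (j a b c : Fin 2) (f : Test) : comm (M.Q j a) (adj (M.F b c) f)
    = -I • ∑ k, eps j k • (adj (M.chi k b) (slT a c f) + adj (M.chi k c) (slT a b f)) := by
  rw [comm_Q_adj, M.Qbar_F]
  simp only [slash_apply, star_smul, star_sum, star_add, star_apply_slT, star_def, conj_eps,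
    star_neg, conj_I, neg_neg, neg_smul]

theorem Q_Cstar (j a k l : Fin 2) (f : Test) : comm (M.Q j a) (adj (M.C k l) f)
    = I • ∑ b, ∑ c, epsUp b c • (delta j k • adj (M.chi l c) (slT a b f)
        + delta j l • adj (M.chi k c) (slT a b f)) := by
  rw [comm_Q_adj, M.Qbar_C]
  simp only [slash_apply, star_smul, star_sum, star_add, star_apply_slT, star_def, conj_epsUp,
    conj_delta, conj_I, neg_smul, neg_neg]

theorem Q_Dstar (j a : Fin 2) (f : Test) : comm (M.Q j a) (adj M.D f)
    = (2 * I) • ∑ k, eps j k • ∑ b, ∑ c, epsUp b c • adj (M.lam k c) (slT a b f) := by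
  rw [comm_Q_adj, M.Qbar_D]
  simp only [slash_apply, star_smul, star_sum, star_apply_slT, star_def, conj_epsUp,
    conj_eps, conj_I, map_mul, map_ofNat, mul_neg, neg_smul, neg_neg]

theorem Q_lamstar (j b k a : Fin 2) (f : Test) : acomm (M.Q j b) (adj (M.lam k a) f)
    = -I • (delta j k • ∑ c, ∑ d, epsUp c d • adj (M.F a d) (slT b c f)
        + ∑ l, eps j l • adj (M.C l k) (slT b a f)) := by
  rw [acomm_Q_adj, M.Qbar_lam]
  simp only [slash_apply, star_smul, star_sum, star_add, star_apply_slT, star_def, conj_epsUp,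
    conj_eps, conj_delta, conj_I]

theorem Qbar_chistar (j a k b : Fin 2) (f : Test) : acomm (star (M.Q j a)) (adj (M.chi k b) f)
    = eps j k • adj (M.F a b) f + eps a b • adj (M.C j k) f := by
  rw [acomm_Qbar_adj, M.Q_chi]
  simp only [star_smul, star_add, star_def, conj_eps, adj_apply]

theorem Qbar_lamstar (j a k b : Fin 2) (f : Test) : acomm (star (M.Q j a)) (adj (M.lam k b) f)
    = (eps j k * eps a b) • adj M.D f := by
  rw [acomm_Qbar_adj, M.Q_lam]
  simp only [star_smul, star_def, conj_eps, adj_apply, map_mul]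

end Multiplet

end

end N2

namespace N2

noncomputable section

open MeasureTheory Complex

/-! ### Lorentz covariant symbols on the mass shell -/

theorem eq_shell_or_neg {m : ℝ} {k : Spacetime} (hk : mink k k = m ^ 2) :
    ∃ q, k = shell m q ∨ k = -shell m q := by
  rcases le_total 0 (k 0) with h | h
  · exact ⟨spatial k, Or.inl (shell_spatial h hk).symm⟩
  · have hk' : mink (-k) (-k) = m ^ 2 := by
      rw [mink_neg_left, mink_comm, mink_neg_left, neg_neg, hk]
    have h' : 0 ≤ (-k) 0 := by rw [PiLp.neg_apply]; linarith
    exact ⟨spatial (-k), Or.inr (by rw [shell_spatial h' hk', neg_neg])⟩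

/-- The same constant is required on both sheets; with different constants the kernel would not be a
multiple of D_m. -/
theorem pauliJordan_polyTest_of_symbol {m : ℝ} {p : MvPolynomial (Fin 4) ℂ} {c : ℂ}
    (h : ∀ q, symbol p (shell m q) = c ∧ symbol p (-shell m q) = c) (f w : Test) :
    pauliJordan m (polyTest p f) w = c * pauliJordan m f w := by
  have h1 : pauliJordan m (polyTest p f) w = pauliJordan m (c • f) w := by
    refine pauliJordan_congr (fun k hk => ?_) fun _ _ => rfl
    rw [minkFourier_polyTest, minkFourier_smul]
    obtain ⟨q, rfl | rfl⟩ := eq_shell_or_neg hk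
    · rw [(h q).1]
    · rw [(h q).2]
  rw [h1, ← pauliJordanForm_apply, map_smul]
  rfl

/-- By Lorentz invariance of the Pauli–Jordan form the transformation of the second test function
can be undone. The difference of the two sides is then a single multiplication operator with
vanishing pairings, so its multiplier vanishes on the shell. -/
theorem symbol_covariant {ι : Type*} [Fintype ι] {m : ℝ} (p : ι → MvPolynomial (Fin 4) ℂ)
    (A : Matrix.SpecialLinearGroup (Fin 2) ℂ) (R : ι → ι → ℂ)
    (h : ∀ i f w, pauliJordan m (polyTest (p i) f) w
      = ∑ l, R i l * pauliJordan m (polyTest (p l) (compPoincare 0 A f)) (compPoincare 0 A w))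
    {q : EuclideanSpace ℝ (Fin 3)} (hq : 0 < energy m q) (i : ι) :
    symbol (p i) (shell m q) = ∑ l, R i l * symbol (p l) (lorentzAct A⁻¹ (shell m q)) ∧
      symbol (p i) (-shell m q) = ∑ l, R i l * symbol (p l) (-lorentzAct A⁻¹ (shell m q)) := by
  let G : Spacetime → ℂ := fun k =>
    symbol (p i) k - ∑ l, R i l * symbol (p l) (lorentzAct A⁻¹ k)
  let X : Test → Test := fun f => polyTest (p i) f
    + -∑ l, R i l • compPoincare 0 A⁻¹ (polyTest (p l) (compPoincare 0 A f))
  have hG : Continuous G := by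
    refine (continuous_symbol _).sub (continuous_finsetSum _ fun l _ => continuous_const.mul ?_)
    exact (continuous_symbol _).comp (lorentzEquiv A⁻¹).continuous
  have hX : ∀ f k, minkFourier (X f) k = G k * minkFourier f k := by
    intro f k
    simp only [X, G, minkFourier_add, minkFourier_neg, minkFourier_sum, minkFourier_smul,
      minkFourier_compPoincare_zero, minkFourier_polyTest, sub_mul, Finset.sum_mul]
    rw [← sub_eq_add_neg]
    congr 1
    refine Finset.sum_congr rfl fun l _ => ?_
    rw [← lorentzAct_mul, mul_inv_cancel, lorentzAct_one, mul_assoc]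
  have hcomp : ∀ w : Test, compPoincare 0 A⁻¹ (compPoincare 0 A w) = w := by
    intro w
    ext x
    simp only [compPoincare_apply, poincareAct, add_zero]
    rw [← lorentzAct_mul, mul_inv_cancel, lorentzAct_one]
  have hp : ∀ f w, pauliJordan m (X f) w = 0 := by
    intro f w
    have e : ∀ l, pauliJordan m (compPoincare 0 A⁻¹ (polyTest (p l) (compPoincare 0 A f))) w
        = pauliJordan m (polyTest (p l) (compPoincare 0 A f)) (compPoincare 0 A w) := by
      intro l
      rw [← pauliJordan_lorentz m A⁻¹ (polyTest (p l) (compPoincare 0 A f)), hcomp]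
    rw [← pauliJordanForm_apply]
    simp only [X, map_add, map_neg, map_sum, map_smul, LinearMap.add_apply, LinearMap.neg_apply,
      LinearMap.sum_apply, LinearMap.smul_apply, pauliJordanForm_apply, e, h i f w, smul_eq_mul]
    ring
  have := symbol_eq_zero hG X hX hp hq
  simp only [G, lorentzAct_neg] at this
  exact ⟨sub_eq_zero.1 this.1, sub_eq_zero.1 this.2⟩

theorem symbol_bind_neg (p : MvPolynomial (Fin 4) ℂ) (k : Spacetime) :
    symbol (MvPolynomial.bind₁ (fun i => -MvPolynomial.X i) p) k = symbol p (-k) := by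
  unfold symbol
  change MvPolynomial.eval₂Hom (RingHom.id ℂ) _ (MvPolynomial.bind₁ _ p) = _
  rw [MvPolynomial.eval₂Hom_bind₁]
  change MvPolynomial.eval _ p = _
  congr 2
  ext μ
  simp

/-- Transposing the kernel p(∂)D_m replaces p(k) by p(-k) and produces a sign, D_m being odd. -/
theorem pauliJordan_polyTest_bind_neg (m : ℝ) (p : MvPolynomial (Fin 4) ℂ) (f w : Test) :
    pauliJordan m (polyTest (MvPolynomial.bind₁ (fun i => -MvPolynomial.X i) p) f) w
      = -pauliJordan m (polyTest p w) f := by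
  simp only [pauliJordan_eq, funext (minkFourier_polyTest p w),
    funext (minkFourier_polyTest (MvPolynomial.bind₁ (fun i => -MvPolynomial.X i) p) f),
    symbol_bind_neg]
  unfold shellPair
  rw [← mul_neg, ← integral_neg]
  congr 2
  ext q
  simp only [neg_neg]
  ring

/-- As D_m is odd, an antisymmetric kernel has an even symbol. This ties together the two sheets,
which orthochronous transformations cannot connect. -/
theorem symbol_even {m : ℝ} (p : MvPolynomial (Fin 4) ℂ)
    (h : ∀ f w, pauliJordan m (polyTest p f) w = -pauliJordan m (polyTest p w) f)
    {q : EuclideanSpace ℝ (Fin 3)} (hq : 0 < energy m q) :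
    symbol p (shell m q) = symbol p (-shell m q) := by
  have hs := symbol_eq_zero (m := m) (G := fun k => symbol p k - symbol p (-k))
    ((continuous_symbol p).sub ((continuous_symbol p).comp continuous_neg))
    (fun f => polyTest p f + -polyTest (MvPolynomial.bind₁ (fun i => -MvPolynomial.X i) p) f)
    (fun f k => by
      rw [minkFourier_add, minkFourier_neg, minkFourier_polyTest, minkFourier_polyTest,
        symbol_bind_neg]
      ring)
    (fun f w => by
      rw [← pauliJordanForm_apply, map_add, map_neg]
      simp only [LinearMap.add_apply, LinearMap.neg_apply, pauliJordanForm_apply]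
      rw [pauliJordan_polyTest_bind_neg, ← h, add_neg_cancel]) hq
  exact sub_eq_zero.1 hs.1

/-- The point of the mass shell with `σ^μ k_μ = diag(1, m²)`. -/
def basePoint (m : ℝ) : Spacetime := WithLp.toLp 2 ![(1 + m ^ 2) / 2, 0, 0, (m ^ 2 - 1) / 2]

theorem sig_basePoint (m : ℝ) : sig (basePoint m) = !![1, 0; 0, (m : ℂ) ^ 2] := by
  rw [sig_eq]
  ext i j
  fin_cases i <;> fin_cases j <;> simp [basePoint] <;> ring

theorem basePoint_eq_shell (m : ℝ) : ∃ q, shell m q = basePoint m ∧ 0 < energy m q := by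
  have h : shell m (spatial (basePoint m)) = basePoint m := by
    refine shell_spatial ?_ ?_
    · simp [basePoint]; positivity
    · rw [mink_self]; simp [basePoint]; ring
  refine ⟨_, h, ?_⟩
  rw [← shell_zero, h]
  simp [basePoint]; positivity

/-- A is the lower triangular Cholesky-type factor: σ·k = A diag(1, m²) A† with the square of its
upper left entry equal to ω - k³. The condition on q makes that entry positive for massless momenta
too, so a single argument covers all m. -/
theorem exists_lorentzAct_basePoint {m : ℝ} {q : EuclideanSpace ℝ (Fin 3)} (hq : q 0 ≠ 0) :
    ∃ A, lorentzAct A (basePoint m) = shell m q := by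
  have he := energy_sq m q
  have hpos : 0 < energy m q - q 2 := by
    have h0 : 0 < q 0 ^ 2 := by positivity
    have : |q 2| < energy m q :=
      abs_lt_of_sq_lt_sq (by nlinarith [sq_nonneg (q 1), sq_nonneg m]) (energy_nonneg m q)
    linarith [le_abs_self (q 2)]
  have ha := Real.sqrt_pos.2 hpos
  have hsq := Real.sq_sqrt hpos.le
  set a := Real.sqrt (energy m q - q 2) with hadef
  have ha' : (a : ℂ) ≠ 0 := Complex.ofReal_ne_zero.2 ha.ne'
  obtain ⟨A, hA⟩ : ∃ A : Matrix.SpecialLinearGroup (Fin 2) ℂ,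
      A.1 = !![(a : ℂ), 0; (-q 0 - I * q 1) / a, 1 / a] :=
    ⟨⟨_, by rw [Matrix.det_fin_two]; simp [ha']⟩, rfl⟩
  refine ⟨A, ?_⟩
  · apply sig_injective
    rw [sig_lorentzAct, hA, sig_basePoint, sig_eq, shell_zero, shell_one, shell_two, shell_three]
    have h1 : (a : ℂ) ^ 2 = energy m q - q 2 := by exact_mod_cast hsq
    have h2 : (energy m q : ℂ) ^ 2 = q 0 ^ 2 + q 1 ^ 2 + q 2 ^ 2 + m ^ 2 := by exact_mod_cast he
    ext i j
    fin_cases i <;> fin_cases j <;> simp [Matrix.mul_apply, Fin.sum_univ_two]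
    · rw [← h1]; ring
    · field_simp
    · field_simp
    · field_simp
      rw [h1]
      linear_combination -h2 - (q 1 : ℂ) ^ 2 * Complex.I_sq

theorem dense_coordinate_ne_zero : Dense {q : EuclideanSpace ℝ (Fin 3) | q 0 ≠ 0} := by
  have hopen : IsOpenMap fun q : EuclideanSpace ℝ (Fin 3) => q 0 := by
    have hs : Function.Surjective (EuclideanSpace.proj (0 : Fin 3) :
        EuclideanSpace ℝ (Fin 3) →L[ℝ] ℝ) := fun x => ⟨EuclideanSpace.single 0 x, by simp⟩
    exact (EuclideanSpace.proj (0 : Fin 3) : EuclideanSpace ℝ (Fin 3) →L[ℝ] ℝ).isOpenMap hs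
  exact (dense_compl_singleton (0 : ℝ)).preimage hopen

/-- Continuity of symbols recovers the momenta left out by the factorization, including the apex of
the cone when m = 0. -/
theorem eq_of_eq_on_dense_shell {m : ℝ} (p : MvPolynomial (Fin 4) ℂ) {c : ℂ}
    (h : ∀ q : EuclideanSpace ℝ (Fin 3), q 0 ≠ 0 →
      symbol p (shell m q) = c ∧ symbol p (-shell m q) = c)
    (q : EuclideanSpace ℝ (Fin 3)) : symbol p (shell m q) = c ∧ symbol p (-shell m q) = c := by
  have h1 := Continuous.ext_on dense_coordinate_ne_zero
    ((continuous_symbol p).comp (continuous_shell m)) (continuous_const (y := c))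
    fun q hq => (h q hq).1
  have h2 := Continuous.ext_on dense_coordinate_ne_zero
    ((continuous_symbol p).comp (continuous_neg_shell m)) (continuous_const (y := c))
    fun q hq => (h q hq).2
  exact ⟨congrFun h1 q, congrFun h2 q⟩

theorem energy_pos_of_ne {m : ℝ} {q : EuclideanSpace ℝ (Fin 3)} (hq : q 0 ≠ 0) :
    0 < energy m q := by
  refine lt_of_lt_of_le (norm_pos_iff.2 ?_) (norm_le_energy m q)
  rintro rfl
  simp at hq

/-- A Lorentz invariant odd kernel `p(∂) D_m` is a multiple of `D_m`. -/
theorem exists_scalar_of_invariant {m : ℝ} (p : MvPolynomial (Fin 4) ℂ)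
    (h : ∀ A f w, pauliJordan m (polyTest p f) w
      = pauliJordan m (polyTest p (compPoincare 0 A f)) (compPoincare 0 A w))
    (hodd : ∀ f w, pauliJordan m (polyTest p f) w = -pauliJordan m (polyTest p w) f) :
    ∃ c : ℂ, ∀ f w, pauliJordan m (polyTest p f) w = c * pauliJordan m f w := by
  refine ⟨symbol p (basePoint m), pauliJordan_polyTest_of_symbol (eq_of_eq_on_dense_shell p ?_)⟩
  intro q hq
  obtain ⟨A, hA⟩ := exists_lorentzAct_basePoint (m := m) hq
  have hA' : lorentzAct A⁻¹ (shell m q) = basePoint m := by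
    rw [← hA, ← lorentzAct_mul, inv_mul_cancel, lorentzAct_one]
  have hpos := energy_pos_of_ne (m := m) hq
  have := symbol_covariant (ι := Unit) (m := m) (fun _ => p) A (fun _ _ => 1)
    (fun _ f w => by simpa using h A f w) hpos ()
  simp only [Finset.univ_unique, Finset.sum_singleton, one_mul, hA'] at this
  exact ⟨this.1, (symbol_even p hodd hpos).symm.trans this.1⟩

/-- There is no Lorentz covariant kernel `p_{ab}(∂) D_m` with symmetric `p_{ab}`. -/
theorem eq_zero_of_symmetric_covariant {m : ℝ} (p : Fin 2 → Fin 2 → MvPolynomial (Fin 4) ℂ)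
    (hp : ∀ a b, p a b = p b a)
    (h : ∀ (A : Matrix.SpecialLinearGroup (Fin 2) ℂ) a b f w,
      pauliJordan m (polyTest (p a b) f) w = ∑ a', ∑ b', A.1 a a' * A.1 b b' *
        pauliJordan m (polyTest (p a' b') (compPoincare 0 A f)) (compPoincare 0 A w))
    (a b : Fin 2) (f w : Test) : pauliJordan m (polyTest (p a b) f) w = 0 := by
  have hcov := fun (A : Matrix.SpecialLinearGroup (Fin 2) ℂ) (q : EuclideanSpace ℝ (Fin 3))
      (hq : 0 < energy m q) (a b : Fin 2) =>
    symbol_covariant (ι := Fin 2 × Fin 2) (m := m) (fun i => p i.1 i.2) A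
      (fun i l => A.1 i.1 l.1 * A.1 i.2 l.2)
      (fun i f w => by simpa [Fintype.sum_prod_type] using h A i.1 i.2 f w) hq (a, b)
  simp only [Fintype.sum_prod_type, Fin.sum_univ_two] at hcov
  obtain ⟨q₀, hq₀, hpos⟩ := basePoint_eq_shell m
  have hstab : ∀ A : Matrix.SpecialLinearGroup (Fin 2) ℂ,
      A.1 * !![1, 0; 0, (m : ℂ) ^ 2] * A.1.conjTranspose = !![1, 0; 0, (m : ℂ) ^ 2] →
      lorentzAct A⁻¹ (basePoint m) = basePoint m := by
    intro A hA
    have : lorentzAct A (basePoint m) = basePoint m := by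
      apply sig_injective
      rw [sig_lorentzAct, sig_basePoint, hA]
    conv_lhs => rw [← this]
    rw [← lorentzAct_mul, inv_mul_cancel, lorentzAct_one]
  -- Little group argument: at the base point the symbol is a symmetric spinor invariant under the
  -- stabilizer of diag(1, m²), and two elements of that group already force it to vanish.
  have hbase : ∀ (ψ : Fin 2 → Fin 2 → ℂ), (∀ a b, ψ a b = ψ b a) →
      (∀ A : Matrix.SpecialLinearGroup (Fin 2) ℂ,
        A.1 * !![1, 0; 0, (m : ℂ) ^ 2] * A.1.conjTranspose = !![1, 0; 0, (m : ℂ) ^ 2] →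
        ∀ a b, ψ a b = A.1 a 0 * A.1 b 0 * ψ 0 0 + A.1 a 0 * A.1 b 1 * ψ 0 1 +
          (A.1 a 1 * A.1 b 0 * ψ 1 0 + A.1 a 1 * A.1 b 1 * ψ 1 1)) → ∀ a b, ψ a b = 0 := by
    intro ψ hs hψ
    -- This element multiplies both diagonal components by I² = -1.
    have hd := hψ ⟨!![I, 0; 0, -I], by simp [Matrix.det_fin_two]⟩ (by
      ext i j
      fin_cases i <;> fin_cases j <;> simp [Matrix.mul_apply, Fin.sum_univ_two] <;>
        linear_combination (-(m : ℂ) ^ 2) * Complex.I_sq)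
    have h00 := hd 0 0
    have h11 := hd 1 1
    simp at h00 h11
    have z00 : ψ 0 0 = 0 := by linear_combination h00 / 2
    have z11 : ψ 1 1 = 0 := by linear_combination h11 / 2
    have hm : 0 < 1 + m ^ 2 := by positivity
    set t := 1 / Real.sqrt (1 + m ^ 2) with ht
    have htpos : 0 < t := by have := Real.sqrt_pos.2 hm; positivity
    have ht2 : t ^ 2 * (1 + m ^ 2) = 1 := by
      rw [ht, div_pow, Real.sq_sqrt hm.le]; field_simp
    have ht2' : (t : ℂ) ^ 2 * (1 + (m : ℂ) ^ 2) = 1 := by exact_mod_cast ht2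
    -- Chosen to lie in the little group for all m: t normalizes the determinant t²(1 + m²), and m =
    -- 0 gives the parabolic matrix with t = 1. Once the diagonal components are gone, invariance of
    -- the first of them reads 0 = 2t²ψ₀₁.
    have hr := hψ ⟨!![(t : ℂ), t; -(m : ℂ) ^ 2 * t, t], by
      rw [Matrix.det_fin_two]; simp; linear_combination ht2'⟩ (by
      ext i j
      fin_cases i <;> fin_cases j <;> simp [Matrix.mul_apply, Fin.sum_univ_two]
      · linear_combination ht2'
      · ring
      · ring
      · linear_combination (m : ℂ) ^ 2 * ht2') 0 0
    simp [z00, z11, hs 1 0] at hr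
    have hne : (t : ℂ) ≠ 0 := Complex.ofReal_ne_zero.2 htpos.ne'
    have z01 : ψ 0 1 = 0 := by
      have : (2 * (t : ℂ) ^ 2) * ψ 0 1 = 0 := by linear_combination -hr
      exact (mul_eq_zero.1 this).resolve_left (mul_ne_zero two_ne_zero (pow_ne_zero 2 hne))
    intro a b
    fin_cases a <;> fin_cases b
    · exact z00
    · exact z01
    · exact (hs 1 0).trans z01
    · exact z11
  have hb1 := hbase (fun a b => symbol (p a b) (basePoint m)) (fun a b => by rw [hp])
    fun A hA a b => by
      have := (hcov A q₀ hpos a b).1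
      rw [hq₀, hstab A hA] at this
      exact this
  have hb2 := hbase (fun a b => symbol (p a b) (-basePoint m)) (fun a b => by rw [hp])
    fun A hA a b => by
      have := (hcov A q₀ hpos a b).2
      rw [hq₀, hstab A hA] at this
      exact this
  rw [pauliJordan_polyTest_of_symbol (c := 0) (eq_of_eq_on_dense_shell (p a b) ?_), zero_mul]
  intro q hq
  obtain ⟨A, hA⟩ := exists_lorentzAct_basePoint (m := m) hq
  have hA' : lorentzAct A⁻¹ (shell m q) = basePoint m := by
    rw [← hA, ← lorentzAct_mul, inv_mul_cancel, lorentzAct_one]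
  have := hcov A q (energy_pos_of_ne hq) a b
  simpa only [hA', hb1, hb2, mul_zero, add_zero] using this

end

end N2

namespace N2

noncomputable section

open MeasureTheory Complex

/-! ### The causal relations of a free multiplet -/

section Conjugation

variable {𝒜 : Type*} [Ring 𝒜]

theorem eq_zero_of_eq_neg_self [Algebra ℂ 𝒜] {x : 𝒜} (hx : x = -x) : x = 0 := by
  have h3 : (2 : ℂ) • x = 0 := by
    rw [two_smul]; nth_rewrite 1 [hx]; rw [neg_add_cancel]
  exact (smul_eq_zero.1 h3).resolve_left two_ne_zero

variable [StarRing 𝒜]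

/-- A commutator that is a multiple of 1 survives conjugation. Covariance of the fields thereby
becomes covariance of their numerical kernels. -/
theorem comm_conj_unitary [Algebra ℂ 𝒜] (u : unitary 𝒜) {x y : 𝒜} {c : ℂ} (h : comm x y = c • 1) :
    comm (star (u : 𝒜) * x * u) (star (u : 𝒜) * y * u) = c • 1 := by
  have hu : (u : 𝒜) * star (u : 𝒜) = 1 := Unitary.coe_mul_star_self u
  have hu' : star (u : 𝒜) * (u : 𝒜) = 1 := Unitary.coe_star_mul_self u
  have e : ∀ x y : 𝒜, star (u : 𝒜) * x * u * (star (u : 𝒜) * y * u)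
      = star (u : 𝒜) * (x * y) * u := by
    intro x y
    calc _ = star (u : 𝒜) * x * ((u : 𝒜) * star (u : 𝒜)) * y * u := by noncomm_ring
      _ = _ := by rw [hu]; noncomm_ring
  unfold comm at *
  rw [e, e, ← sub_mul, ← mul_sub, h, mul_smul_comm, mul_one, smul_mul_assoc, hu']

theorem star_conj_unitary (u : unitary 𝒜) (x : 𝒜) :
    star (u : 𝒜) * star x * u = star (star (u : 𝒜) * x * u) := by
  simp [mul_assoc]

end Conjugation

namespace Multiplet

variable {𝒜 : Type*} [Ring 𝒜] [StarRing 𝒜] [Algebra ℂ 𝒜] [StarModule ℂ 𝒜] {M : Multiplet 𝒜}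

/-- The central element `-1` of `SU(2)`. -/
def su2NegOne : Matrix.specialUnitaryGroup (Fin 2) ℂ :=
  ⟨-1, Matrix.mem_specialUnitaryGroup_iff.2
    ⟨Matrix.mem_unitaryGroup_iff.2 (by simp), by simp [Matrix.det_neg]⟩⟩

theorem su2NegOne_conj_comp (c : Comp) (f : Test) :
    star (M.V su2NegOne : 𝒜) * M.comp c f * (M.V su2NegOne : 𝒜)
      = (if c.fermi then (-1 : ℂ) else 1) • M.comp c f := by
  have e : ∀ i j, (su2NegOne.1 : Matrix (Fin 2) (Fin 2) ℂ) i j = if i = j then -1 else 0 := by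
    intro i j
    change (-1 : Matrix (Fin 2) (Fin 2) ℂ) i j = _
    rw [Matrix.neg_apply, Matrix.one_apply]
    split_ifs <;> simp
  cases c <;> simp only [comp, Comp.fermi]
  · simpa using M.z_su2 _ f
  · simpa using M.D_su2 _ f
  · simpa using M.F_su2 _ f _ _
  · rw [M.C_su2]; simp [e]
  · rw [M.lam_su2]; simp [e]
  · rw [M.chi_su2]; simp [e]

theorem su2NegOne_conj_field (a : FieldName) (f : Test) :
    star (M.V su2NegOne : 𝒜) * M.field a f * (M.V su2NegOne : 𝒜)
      = (if a.1.fermi then (-1 : ℂ) else 1) • M.field a f := by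
  obtain ⟨c, _ | _⟩ := a
  · exact su2NegOne_conj_comp (M := M) c f
  · simp only [field, if_true, adj_apply, star_conj_unitary]
    rw [su2NegOne_conj_comp]
    split_ifs <;> simp

/-- Conjugation by the image of -1 ∈ SU(2) reverses the Fermionic factor only, whereas the bracket
is a c-number. These vanishing commutators are the input of all Jacobi identities below. -/
theorem IsFree.comm_bose_fermi {m : ℝ} (hM : M.IsFree m) (a b : FieldName)
    (ha : a.1.fermi = false) (hb : b.1.fermi = true) (f h : Test) :
    comm (M.field a f) (M.field b h) = 0 := by
  obtain ⟨p, hp⟩ := hM a b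
  have h1 := hp f h
  simp only [bracket, ha, hb, Bool.false_and, Bool.false_eq_true, if_false] at h1
  have h2 := comm_conj_unitary (M.V su2NegOne) h1
  rw [su2NegOne_conj_field, su2NegOne_conj_field, ha, hb, ← h1] at h2
  simp only [Bool.false_eq_true, if_false, if_true, one_smul, neg_smul, comm_neg_right] at h2
  exact eq_zero_of_eq_neg_self h2.symm

theorem IsFree.z_chi {m : ℝ} (hM : M.IsFree m) (k b : Fin 2) (f h : Test) :
    comm (M.z f) (M.chi k b h) = 0 :=
  hM.comm_bose_fermi (.z, false) (.chi k b, false) rfl rfl f h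

theorem IsFree.z_lam {m : ℝ} (hM : M.IsFree m) (k b : Fin 2) (f h : Test) :
    comm (M.z f) (M.lam k b h) = 0 :=
  hM.comm_bose_fermi (.z, false) (.lam k b, false) rfl rfl f h

theorem IsFree.z_chistar {m : ℝ} (hM : M.IsFree m) (k b : Fin 2) (f h : Test) :
    comm (M.z f) (adj (M.chi k b) h) = 0 :=
  hM.comm_bose_fermi (.z, false) (.chi k b, true) rfl rfl f h

theorem IsFree.z_lamstar {m : ℝ} (hM : M.IsFree m) (k b : Fin 2) (f h : Test) :
    comm (M.z f) (adj (M.lam k b) h) = 0 :=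
  hM.comm_bose_fermi (.z, false) (.lam k b, true) rfl rfl f h

/-- Since [Q̄, z] = 0, acting with Q̄ on [z, χ*] = 0 leaves [z, {Q̄, χ*}] = 0, which contains F* and
C* in different symmetry types. -/
theorem IsFree.z_Fstar_and_z_Cstar {m : ℝ} (hM : M.IsFree m) (f h : Test) :
    (∀ a b, comm (M.z f) (adj (M.F a b) h) = 0) ∧ ∀ j k, comm (M.z f) (adj (M.C j k) h) = 0 := by
  have := separate_symmetric (X := fun a b => comm (M.z f) (adj (M.F a b) h))
    (Y := fun j k => comm (M.z f) (adj (M.C j k) h)) (Z := fun _ _ _ _ => 0)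
    (fun a b => by rw [M.F_symm]) (fun j k => by rw [M.C_symm]) fun j a k b => by
      have e := acomm_comm_of_comm_eq_zero (star (M.Q j a)) (hM.z_chistar k b f h)
      rw [M.Qbar_z, acomm_zero_left, Qbar_chistar, comm_add_right, comm_smul_right,
        comm_smul_right] at e
      exact neg_eq_zero.1 e.symm
  simpa using this

theorem IsFree.z_Dstar {m : ℝ} (hM : M.IsFree m) (f h : Test) : comm (M.z f) (adj M.D h) = 0 := by
  have e := acomm_comm_of_comm_eq_zero (star (M.Q 0 0)) (hM.z_lamstar 1 1 f h)
  rw [M.Qbar_z, acomm_zero_left, Qbar_lamstar, comm_smul_right] at e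
  simpa using e.symm

/-- SU(2) has no invariant in the symmetric square of its defining representation. Concretely,
diag(i, -i) reverses the diagonal components, and the rotation exchanging the basis vectors up to
sign reverses the off-diagonal one. -/
theorem IsFree.z_C {m : ℝ} (hM : M.IsFree m) (j k : Fin 2) (f h : Test) :
    comm (M.z f) (M.C j k h) = 0 := by
  have key : ∀ u : Matrix.specialUnitaryGroup (Fin 2) ℂ, ∀ j k,
      comm (M.z f) (M.C j k h) = ∑ l, ∑ n, (u.1 j l * u.1 k n) • comm (M.z f) (M.C l n h) := by
    intro u j k
    obtain ⟨p, hp⟩ := hM (.z, false) (.C j k, false)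
    have h1 : comm (M.z f) (M.C j k h) = _ := hp f h
    have h2 := comm_conj_unitary (M.V u) h1
    rw [M.z_su2, M.C_su2] at h2
    rw [h1, ← h2]
    simp only [comm_sum_right, comm_smul_right]
  obtain ⟨u, hu⟩ : ∃ u : Matrix.specialUnitaryGroup (Fin 2) ℂ, u.1 = !![I, 0; 0, -I] := by
    refine ⟨⟨_, Matrix.mem_specialUnitaryGroup_iff.2 ⟨Matrix.mem_unitaryGroup_iff.2 ?_, ?_⟩⟩, rfl⟩
    · ext i j
      fin_cases i <;> fin_cases j <;> simp [Matrix.mul_apply, Fin.sum_univ_two, Matrix.star_apply]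
    · simp [Matrix.det_fin_two]
  obtain ⟨v, hv⟩ : ∃ u : Matrix.specialUnitaryGroup (Fin 2) ℂ, u.1 = !![0, 1; -1, 0] := by
    refine ⟨⟨_, Matrix.mem_specialUnitaryGroup_iff.2 ⟨Matrix.mem_unitaryGroup_iff.2 ?_, ?_⟩⟩, rfl⟩
    · ext i j
      fin_cases i <;> fin_cases j <;> simp [Matrix.mul_apply, Fin.sum_univ_two, Matrix.star_apply]
    · simp [Matrix.det_fin_two]
  have h00 := key u 0 0
  have h11 := key u 1 1
  have h01 := key v 0 1
  simp [hu, hv, Fin.sum_univ_two] at h00 h11 h01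
  have z00 := eq_zero_of_eq_neg_self h00
  have z11 := eq_zero_of_eq_neg_self h11
  rw [M.C_symm 1 0] at h01
  have z01 := eq_zero_of_eq_neg_self h01
  fin_cases j <;> fin_cases k
  · exact z00
  · exact z01
  · exact (congrArg (fun φ => comm (M.z f) (φ h)) (M.C_symm 1 0)).trans z01
  · exact z11

/-- SU(2) gives no information on an isospin singlet; here Lorentz covariance excludes a symmetric
spinor kernel. -/
theorem IsFree.z_F [Nontrivial 𝒜] {m : ℝ} (hM : M.IsFree m)
    (a b : Fin 2) (f h : Test) : comm (M.z f) (M.F a b h) = 0 := by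
  choose p hp using fun a b => hM (.z, false) (.F a b, false)
  -- Polynomials are chosen separately for F_{ab} and F_{ba} and need not coincide, so one of each
  -- pair is discarded to obtain a symmetric family.
  let p' : Fin 2 → Fin 2 → MvPolynomial (Fin 4) ℂ := fun a b => if a ≤ b then p a b else p b a
  have hp' : ∀ a b f h, comm (M.z f) (M.F a b h) = pauliJordan m (polyTest (p' a b) f) h • 1 := by
    intro a b f h
    simp only [p', ← polyKer_pauliJordan]
    split_ifs
    · exact hp a b f h
    · rw [M.F_symm]; exact hp b a f h
  rw [hp', eq_zero_of_symmetric_covariant p', zero_smul]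
  · intro a b
    rcases lt_trichotomy a b with h | rfl | h
    · simp [p', h.le, not_le.2 h]
    · rfl
    · simp [p', h.le, not_le.2 h]
  · intro A a b f h
    apply smul_left_injective ℂ (one_ne_zero (α := 𝒜))
    simp only
    rw [← comm_conj_unitary (M.U 0 A) (hp' a b f h),
      M.z_poincare 0 A f _ (compPoincare_apply 0 A f),
      M.F_poincare 0 A h _ (compPoincare_apply 0 A h)]
    simp only [comm_sum_right, comm_smul_right, hp', Finset.sum_smul, mul_smul]

end Multiplet

end

end N2

/-! ### The remaining brackets, obtained by acting with supercharges. -/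

namespace N2

noncomputable section

open MeasureTheory Complex

/-- Contraction with ε turns one factor σ·∂ into the adjugate of the other, and a matrix times its
adjugate is the determinant, here -∂² = m² on the shell. Each mass factor in the relations arises
from this contraction. -/
theorem sum_epsUp_slT (m : ℝ) (a d : Fin 2) (f h : Test) :
    ∑ b, ∑ c, epsUp b c * pauliJordan m (slT a b (slT d c f)) h
      = eps a d * m ^ 2 * pauliJordan m f h := by
  have h1 := pauliJordan_slT_comm m 1 1 0 0 f h
  have h2 := pauliJordan_slT_comm m 1 0 0 1 f h
  have h3 := pauliJordan_slT_comm m 0 1 0 0 f h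
  have h4 := pauliJordan_slT_comm m 1 1 1 0 f h
  have h5 := pauliJordan_slT_det m f h
  fin_cases a <;> fin_cases d <;> simp [Fin.sum_univ_two]
  · rw [h3]; ring
  · rw [h5]; ring
  · rw [h1, h2, h5]; ring
  · rw [h4]; ring

namespace Multiplet

variable {𝒜 : Type*} [Ring 𝒜] [StarRing 𝒜] [Algebra ℂ 𝒜] [StarModule ℂ 𝒜] {M : Multiplet 𝒜}
  {m : ℝ}

/-- Q applied to [z, λ] = 0. The kernel of [z, D] is still unknown at this stage, so it is left as
it stands. -/
theorem IsFree.chi_lam_eq (hM : M.IsFree m) (j a k b : Fin 2) (f h : Test) :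
    acomm (M.chi j a f) (M.lam k b h) = (-I * (eps j k * eps a b)) • comm (M.z f) (M.D h) := by
  have e := acomm_comm_of_comm_eq_zero (M.Q j a) (hM.z_lam k b f h)
  rw [comm_Q_z, acomm_smul_left, M.Q_lam, comm_smul_right] at e
  have e' := congrArg (fun x => I • x) e
  simp only [smul_smul, mul_neg, I_mul_I, neg_neg, one_smul] at e'
  rw [e', smul_neg, smul_smul, neg_mul, neg_smul]

/-- Q applied to [F, χ] = 0 produces {λ, χ} on one side and [F, F], [F, C] on the other. The
arguments of w come out interchanged because λ now carries the first test function; that interchange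
is what later shows w to be antisymmetric. -/
theorem IsFree.F_F_and_F_C (hM : M.IsFree m) {w : Test → Test → ℂ}
    (hw : ∀ f h, comm (M.z f) (M.D h) = w f h • 1) (b c : Fin 2) (f h : Test) :
    (∀ a d, comm (M.F b c f) (M.F a d h)
      = (-I * (eps b a * eps c d + eps b d * eps c a) * w h f) • 1) ∧
    ∀ j k, comm (M.F b c f) (M.C j k h) = 0 := by
  have := separate_symmetric (X := fun a d => comm (M.F b c f) (M.F a d h))
    (Y := fun j k => comm (M.F b c f) (M.C j k h))
    (Z := fun j a k d => (I * eps k j * (eps a b * eps d c + eps a c * eps d b) * w h f) • 1)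
    (fun a b => by simp only [M.F_symm a b]) (fun j k => by simp only [M.C_symm j k]) fun j a k d => by
      have e := acomm_comm_of_comm_eq_zero (M.Q j a)
        (hM.comm_bose_fermi (.F b c, false) (.chi k d, false) rfl rfl f h)
      change acomm (comm _ (M.F b c f)) (M.chi k d h)
        = -comm (M.F b c f) (acomm _ (M.chi k d h)) at e
      rw [M.Q_F, M.Q_chi, comm_add_right, comm_smul_right, comm_smul_right, acomm_add_left,
        acomm_smul_left, acomm_smul_left, acomm_swap, hM.chi_lam_eq, acomm_swap, hM.chi_lam_eq,
        hw] at e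
      rw [← neg_eq_iff_eq_neg.2 e]
      module
  refine ⟨fun a d => ?_, fun j k => ?_⟩
  · rw [this.1, ← sub_smul, smul_smul]
    congr 1
    fin_cases a <;> fin_cases b <;> fin_cases c <;> fin_cases d <;> simp <;> ring
  · rw [this.2, ← sub_smul, smul_smul]
    convert zero_smul ℂ (1 : 𝒜)
    ring

/-- Lorentz invariance of z and D makes the symbol constant along orbits. A constant that differed
between the sheets is excluded by antisymmetry of the kernel, which is inherited from the commutator
of F_{11} with F_{22}. -/
theorem IsFree.exists_z_D [Nontrivial 𝒜] (hM : M.IsFree m) :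
    ∃ α : ℂ, ∀ f h, comm (M.z f) (M.D h) = (α * pauliJordan m f h) • 1 := by
  have hinj := smul_left_injective ℂ (one_ne_zero (α := 𝒜))
  obtain ⟨p, hp⟩ := hM (.z, false) (.D, false)
  have hw : ∀ f h, comm (M.z f) (M.D h) = pauliJordan m (polyTest p f) h • 1 := by
    intro f h
    rw [← polyKer_pauliJordan]
    exact hp f h
  obtain ⟨c, hc⟩ := exists_scalar_of_invariant p (fun A f h => by
      apply hinj
      simp only
      rw [← hw (compPoincare 0 A f), ← M.z_poincare 0 A f _ (compPoincare_apply 0 A f),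
        ← M.D_poincare 0 A h _ (compPoincare_apply 0 A h),
        comm_conj_unitary (M.U 0 A) (hw f h)]) fun f h => by
      -- The same commutator is computed in both orders; comparison gives w(f, h) = -w(h, f).
      have h1 := ((hM.F_F_and_F_C hw 0 0 h f).1 1 1)
      have h2 := ((hM.F_F_and_F_C hw 1 1 f h).1 0 0)
      rw [comm_swap, h2, ← neg_smul] at h1
      have h3 := hinj h1
      simp only [eps_10, eps_01] at h3
      have h4 : (2 * I) * (pauliJordan m (polyTest p f) h + pauliJordan m (polyTest p h) f) = 0 := by
        linear_combination h3
      have := (mul_eq_zero.1 h4).resolve_left (mul_ne_zero two_ne_zero I_ne_zero)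
      linear_combination this
  exact ⟨c, fun f h => by rw [hw, hc]⟩

/-- Q applied to [z, χ*] = 0 returns [z, σ·∂ z*]. This is where the normalization of z enters the
table. -/
theorem chi_chistar (hM : M.IsFree m) (hz : M.IsScalarOfMass m) (j a k b : Fin 2) (f h : Test) :
    acomm (M.chi j a f) (adj (M.chi k b) h) = (2 * delta j k * pauliJordan m (slT a b f) h) • 1 := by
  have e := acomm_comm_of_comm_eq_zero (M.Q j a) (hM.z_chistar k b f h)
  rw [comm_Q_z, acomm_smul_left, M.Q_chibar, comm_smul_right, slash_apply, hz.z_zstar,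
    pauliJordan_slT] at e
  have e' := congrArg (fun x => I • x) e
  simp only [smul_smul, mul_neg, I_mul_I, neg_neg, one_smul] at e'
  rw [e', ← neg_smul, smul_smul]
  congr 1
  linear_combination (-2 * delta j k * pauliJordan m (slT a b f) h) * I_sq

theorem chistar_chi (hM : M.IsFree m) (hz : M.IsScalarOfMass m) (j a k b : Fin 2) (f h : Test) :
    acomm (adj (M.chi k b) h) (M.chi j a f) = (2 * delta j k * pauliJordan m (slT a b f) h) • 1 :=
  (acomm_swap _ _).trans (chi_chistar hM hz j a k b f h)

theorem chi_lamstar (hM : M.IsFree m) (j a k b : Fin 2) (f h : Test) :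
    acomm (M.chi j a f) (adj (M.lam k b) h) = 0 := by
  have e := acomm_comm_of_comm_eq_zero (M.Q j a) (hM.z_lamstar k b f h)
  rw [comm_Q_z, acomm_smul_left, Q_lamstar] at e
  simp only [comm_smul_right, comm_add_right, comm_sum_right, (hM.z_Fstar_and_z_Cstar _ _).1,
    (hM.z_Fstar_and_z_Cstar _ _).2, smul_zero, Finset.sum_const_zero, add_zero, neg_zero] at e
  simpa using e

theorem lamstar_chi (hM : M.IsFree m) (j a k b : Fin 2) (f h : Test) :
    acomm (adj (M.lam k b) h) (M.chi j a f) = 0 :=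
  (acomm_swap _ _).trans (chi_lamstar hM j a k b f h)

/-- Acting with Q on [z, χ] = 0 leaves only [z, F] and [z, C], both excluded by covariance. -/
theorem chi_chi [Nontrivial 𝒜] (hM : M.IsFree m) (j a k b : Fin 2) (f h : Test) :
    acomm (M.chi j a f) (M.chi k b h) = 0 := by
  have e := acomm_comm_of_comm_eq_zero (M.Q j a) (hM.z_chi k b f h)
  rw [comm_Q_z, acomm_smul_left, M.Q_chi] at e
  simpa [comm_smul_right, comm_add_right, hM.z_F, hM.z_C] using e

/-- D is the top component: [Q, D] = 0, so acting with Q on [D, χ] = 0 leaves only {Q, χ}. -/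
theorem D_F_and_D_C (hM : M.IsFree m) (f h : Test) :
    (∀ a b, comm (M.D f) (M.F a b h) = 0) ∧ ∀ j k, comm (M.D f) (M.C j k h) = 0 := by
  have := separate_symmetric (X := fun a b => comm (M.D f) (M.F a b h))
    (Y := fun j k => comm (M.D f) (M.C j k h)) (Z := fun _ _ _ _ => 0)
    (fun a b => by simp only [M.F_symm a b]) (fun j k => by simp only [M.C_symm j k]) fun j a k b => by
      have e := acomm_comm_of_comm_eq_zero (M.Q j a)
        (hM.comm_bose_fermi (.D, false) (.chi k b, false) rfl rfl f h)
      change acomm (comm _ (M.D f)) (M.chi k b h) = -comm (M.D f) (acomm _ (M.chi k b h)) at e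
      rw [M.Q_D, acomm_zero_left, M.Q_chi, comm_add_right, comm_smul_right,
        comm_smul_right] at e
      exact neg_eq_zero.1 e.symm
  simpa using this

theorem D_D (hM : M.IsFree m) (f h : Test) : comm (M.D f) (M.D h) = 0 := by
  have e := acomm_comm_of_comm_eq_zero (M.Q 0 0)
    (hM.comm_bose_fermi (.D, false) (.lam 1 1, false) rfl rfl f h)
  change acomm (comm _ (M.D f)) (M.lam 1 1 h) = -comm (M.D f) (acomm _ (M.lam 1 1 h)) at e
  rw [M.Q_D, acomm_zero_left, M.Q_lam, comm_smul_right] at e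
  simpa using e.symm

/-- The index different from a given one. -/
def flipIndex (c : Fin 2) : Fin 2 := if c = 0 then 1 else 0

theorem eps_flipIndex_ne_zero (c : Fin 2) : eps (flipIndex c) c ≠ 0 := by
  fin_cases c <;> simp [flipIndex]

/-- A diagonal component F_{cc} with the charge of the opposite Weyl index yields a single λ, up to
a nonzero factor, so brackets of λ can be solved for without separating symmetry types. -/
theorem acomm_comm_Q_F_diag (j c : Fin 2) (f : Test) (Y : 𝒜) :
    acomm (comm (M.Q j (flipIndex c)) (M.F c c f)) Y
      = (2 * eps (flipIndex c) c) • acomm (M.lam j c f) Y := by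
  rw [M.Q_F, ← two_smul ℂ, acomm_smul_left, acomm_smul_left, smul_smul]

theorem lam_lam (hM : M.IsFree m) (j c k d : Fin 2) (f h : Test) :
    acomm (M.lam j c f) (M.lam k d h) = 0 := by
  have e := acomm_comm_of_comm_eq_zero (M.Q j (flipIndex c))
    (hM.comm_bose_fermi (.F c c, false) (.lam k d, false) rfl rfl f h)
  change acomm (comm _ (M.F c c f)) (M.lam k d h)
    = -comm (M.F c c f) (acomm _ (M.lam k d h)) at e
  rw [acomm_comm_Q_F_diag, M.Q_lam, comm_smul_right, comm_swap, (D_F_and_D_C hM _ _).1, neg_zero,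
    smul_zero, neg_zero, smul_eq_zero] at e
  exact e.resolve_left (mul_ne_zero two_ne_zero (eps_flipIndex_ne_zero c))

theorem C_C_of_z_D (hM : M.IsFree m) {α : ℂ}
    (hα : ∀ f h, comm (M.z f) (M.D h) = (α * pauliJordan m f h) • 1) (l n j k : Fin 2)
    (f h : Test) : comm (M.C l n f) (M.C j k h)
      = (-I * α * (eps l j * eps n k + eps l k * eps n j) * pauliJordan m f h) • 1 := by
  have := (separate_symmetric (X := fun a d => comm (M.C l n f) (M.F a d h))
    (Y := fun j k => comm (M.C l n f) (M.C j k h))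
    (Z := fun j a k d => (-I * α * eps a d * (eps j l * eps k n + eps j n * eps k l) *
      pauliJordan m f h) • 1)
    (fun a b => by simp only [M.F_symm a b]) (fun j k => by simp only [M.C_symm j k]) fun j a k d => by
      have e := acomm_comm_of_comm_eq_zero (M.Q j a)
        (hM.comm_bose_fermi (.C l n, false) (.chi k d, false) rfl rfl f h)
      change acomm (comm _ (M.C l n f)) (M.chi k d h)
        = -comm (M.C l n f) (acomm _ (M.chi k d h)) at e
      rw [M.Q_C, M.Q_chi, comm_add_right, comm_smul_right, comm_smul_right, acomm_neg_left,
        acomm_add_left, acomm_smul_left, acomm_smul_left, acomm_swap, hM.chi_lam_eq, acomm_swap,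
        hM.chi_lam_eq, hα, pauliJordan_swap m f h] at e
      rw [← neg_eq_iff_eq_neg.2 e]
      rw [show eps d a = -eps a d by fin_cases a <;> fin_cases d <;> simp]
      module).2 j k
  rw [this, ← sub_smul, smul_smul]
  congr 1
  fin_cases j <;> fin_cases k <;> fin_cases l <;> fin_cases n <;> simp <;> ring

/-- Q sends F* to derivatives of χ*, so acting on [F*, χ] = 0 expresses the answer through second
derivatives of [z, z*]. The C part is their antisymmetrization and vanishes because derivatives
commute. -/
theorem F_Fstar_and_C_Fstar (hM : M.IsFree m) (hz : M.IsScalarOfMass m) (b c : Fin 2)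
    (f h : Test) :
    (∀ a d, comm (M.F a d h) (adj (M.F b c) f) = (2 * I *
      (pauliJordan m (slT a c (slT d b h)) f + pauliJordan m (slT a b (slT d c h)) f)) • 1) ∧
    ∀ j k, comm (M.C j k h) (adj (M.F b c) f) = 0 := by
  have := separate_symmetric (X := fun a d => comm (M.F a d h) (adj (M.F b c) f))
    (Y := fun j k => comm (M.C j k h) (adj (M.F b c) f))
    (Z := fun j a k d => (2 * I * eps j k *
      (pauliJordan m (slT a c (slT d b h)) f + pauliJordan m (slT a b (slT d c h)) f)) • 1)
    (fun a b => by simp only [M.F_symm a b]) (fun j k => by simp only [M.C_symm j k]) fun j a k d => by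
      have e := acomm_comm_of_comm_eq_zero (M.Q j a)
        (hM.comm_bose_fermi (.F b c, true) (.chi k d, false) rfl rfl f h)
      change acomm (comm _ (adj (M.F b c) f)) (M.chi k d h)
        = -comm (adj (M.F b c) f) (acomm _ (M.chi k d h)) at e
      rw [Q_Fstar, M.Q_chi, comm_add_right, comm_smul_right, comm_smul_right,
        comm_swap (M.F a d h), comm_swap (M.C j k h), acomm_smul_left, acomm_sum_left] at e
      simp only [acomm_smul_left, acomm_add_left, chistar_chi hM hz,
        pauliJordan_slT, Fin.sum_univ_two] at e
      have e2 : eps j k • comm (M.F a d h) (adj (M.F b c) f)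
        + eps a d • comm (M.C j k h) (adj (M.F b c) f)
        = -(eps j k • -comm (M.F a d h) (adj (M.F b c) f)
        + eps a d • -comm (M.C j k h) (adj (M.F b c) f)) := by module
      rw [e2, ← e]
      fin_cases j <;> fin_cases k <;> simp <;> module
  refine ⟨fun a d => ?_, fun j k => ?_⟩
  · rw [this.1, ← sub_smul, smul_smul]
    congr 1
    simp
    ring
  · rw [this.2, ← sub_smul, smul_smul, pauliJordan_slT_comm m 1 c 0 b,
      pauliJordan_slT_comm m 1 b 0 c]
    convert zero_smul ℂ (1 : 𝒜)
    ring

/-- The same argument with C*: its charge transform carries an extra ε^{bc}, so the two derivatives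
contract to ε_{ad} m², which has only a C part. -/
theorem F_Cstar_and_C_Cstar (hM : M.IsFree m) (hz : M.IsScalarOfMass m) (l n : Fin 2)
    (f h : Test) :
    (∀ a d, comm (M.F a d h) (adj (M.C l n) f) = 0) ∧
    ∀ j k, comm (M.C j k h) (adj (M.C l n) f) = (-2 * I * m ^ 2 *
      (delta j l * delta k n + delta j n * delta k l) * pauliJordan m h f) • 1 := by
  have := separate_symmetric (X := fun a d => comm (M.F a d h) (adj (M.C l n) f))
    (Y := fun j k => comm (M.C j k h) (adj (M.C l n) f))
    (Z := fun j a k d => (-2 * I * (delta j l * delta k n + delta j n * delta k l) *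
      (eps a d * m ^ 2 * pauliJordan m h f)) • 1)
    (fun a b => by simp only [M.F_symm a b]) (fun j k => by simp only [M.C_symm j k]) fun j a k d => by
      have e := acomm_comm_of_comm_eq_zero (M.Q j a)
        (hM.comm_bose_fermi (.C l n, true) (.chi k d, false) rfl rfl f h)
      change acomm (comm _ (adj (M.C l n) f)) (M.chi k d h)
        = -comm (adj (M.C l n) f) (acomm _ (M.chi k d h)) at e
      rw [Q_Cstar, M.Q_chi, comm_add_right, comm_smul_right, comm_smul_right,
        comm_swap (M.F a d h), comm_swap (M.C j k h), acomm_smul_left, acomm_sum_left] at e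
      simp only [acomm_smul_left, acomm_add_left, chistar_chi hM hz,
        pauliJordan_slT, Fin.sum_univ_two] at e
      have e2 : eps j k • comm (M.F a d h) (adj (M.C l n) f)
        + eps a d • comm (M.C j k h) (adj (M.C l n) f)
        = -(eps j k • -comm (M.F a d h) (adj (M.C l n) f)
        + eps a d • -comm (M.C j k h) (adj (M.C l n) f)) := by module
      rw [e2, ← e, ← sum_epsUp_slT]
      simp only [Fin.sum_univ_two]
      module
  refine ⟨fun a d => ?_, fun j k => ?_⟩
  · rw [this.1, ← sub_smul, smul_smul]
    convert zero_smul ℂ (1 : 𝒜)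
    simp
    ring
  · rw [this.2, ← sub_smul, smul_smul]
    congr 1
    simp
    ring

theorem F_Dstar_and_C_Dstar (hM : M.IsFree m) (f h : Test) :
    (∀ a d, comm (M.F a d h) (adj M.D f) = 0) ∧ ∀ j k, comm (M.C j k h) (adj M.D f) = 0 := by
  have := separate_symmetric (X := fun a d => comm (M.F a d h) (adj M.D f))
    (Y := fun j k => comm (M.C j k h) (adj M.D f)) (Z := fun j a k d => 0)
    (fun a b => by simp only [M.F_symm a b]) (fun j k => by simp only [M.C_symm j k]) fun j a k d => by
      have e := acomm_comm_of_comm_eq_zero (M.Q j a)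
        (hM.comm_bose_fermi (.D, true) (.chi k d, false) rfl rfl f h)
      change acomm (comm _ (adj M.D f)) (M.chi k d h)
        = -comm (adj M.D f) (acomm _ (M.chi k d h)) at e
      rw [Q_Dstar, M.Q_chi, comm_add_right, comm_smul_right, comm_smul_right,
        comm_swap (M.F a d h), comm_swap (M.C j k h), acomm_smul_left, acomm_sum_left] at e
      simp only [acomm_smul_left, acomm_sum_left, lamstar_chi hM,
        smul_zero, Finset.sum_const_zero, smul_neg] at e
      rw [eq_comm, neg_add, neg_neg, neg_neg] at e
      exact e
  simpa using this

/-- Acting with Q on [F_{cc}, λ*] = 0 gives third derivatives of D_m through [F, F*]. One pair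
contracts to m² and a single σ·∂ remains; the C* term does not contribute. -/
theorem lam_lamstar (hM : M.IsFree m) (hz : M.IsScalarOfMass m) (j c k d : Fin 2) (f h : Test) :
    acomm (M.lam j c f) (adj (M.lam k d) h)
      = (2 * delta j k * m ^ 2 * pauliJordan m (slT c d f) h) • 1 := by
  have e := acomm_comm_of_comm_eq_zero (M.Q j (flipIndex c))
    (hM.comm_bose_fermi (.F c c, false) (.lam k d, true) rfl rfl f h)
  change acomm (comm _ (M.F c c f)) (adj (M.lam k d) h)
    = -comm (M.F c c f) (acomm _ (adj (M.lam k d) h)) at e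
  have hd := sum_epsUp_slT m (flipIndex c) c (slT c d f) h
  rw [acomm_comm_Q_F_diag, Q_lamstar] at e
  simp only [comm_smul_right, comm_add_right, comm_sum_right,
    (F_Fstar_and_C_Fstar hM hz _ _ _ _).1, (F_Cstar_and_C_Cstar hM hz _ _ _ _).1,
    pauliJordan_slT] at e
  have hne : 2 * eps (flipIndex c) c ≠ 0 := mul_ne_zero two_ne_zero (eps_flipIndex_ne_zero c)
  apply smul_right_injective _ hne
  simp only
  rw [e]
  simp only [Fin.sum_univ_two, epsUp_00, epsUp_01, epsUp_10, epsUp_11] at hd ⊢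
  -- Derivatives are reordered so that the two contracted with ε become adjacent.
  have c1 : ∀ x y : Fin 2, pauliJordan m (slT (flipIndex c) x (slT c d (slT c y f))) h
      = pauliJordan m (slT (flipIndex c) x (slT c y (slT c d f))) h := by
    intro x y
    refine pauliJordan_congr (fun k _ => ?_) fun _ _ => rfl
    simp only [minkFourier_slT]; ring
  simp only [c1, smul_zero, zero_smul, add_zero, zero_add]
  rw [show ∀ x : ℂ, (2 * eps (flipIndex c) c) • ((2 * delta j k * (m : ℂ) ^ 2 * x) • (1 : 𝒜))
    = (4 * delta j k * (eps (flipIndex c) c * m ^ 2 * x)) • 1 by intro x; module, ← hd]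
  match_scalars
  linear_combination (-4 * delta j k * (pauliJordan m (slT (flipIndex c) 1 (slT c 0 (slT c d f))) h
    - pauliJordan m (slT (flipIndex c) 0 (slT c 1 (slT c d f))) h)) * I_sq

theorem lamstar_lam (hM : M.IsFree m) (hz : M.IsScalarOfMass m) (j c k d : Fin 2) (f h : Test) :
    acomm (adj (M.lam k d) h) (M.lam j c f)
      = (2 * delta j k * m ^ 2 * pauliJordan m (slT c d f) h) • 1 :=
  (acomm_swap _ _).trans (lam_lamstar hM hz j c k d f h)

/-- One m² is already present in {λ, λ*}; the contraction of the two derivatives supplies the other.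
-/
theorem D_Dstar (hM : M.IsFree m) (hz : M.IsScalarOfMass m) (f h : Test) :
    comm (M.D h) (adj M.D f) = (-4 * I * m ^ 4 * pauliJordan m h f) • 1 := by
  have e := acomm_comm_of_comm_eq_zero (M.Q 0 0)
    (hM.comm_bose_fermi (.D, true) (.lam 1 1, false) rfl rfl f h)
  change acomm (comm _ (adj M.D f)) (M.lam 1 1 h)
    = -comm (adj M.D f) (acomm _ (M.lam 1 1 h)) at e
  rw [Q_Dstar, M.Q_lam, comm_smul_right, comm_swap (M.D h)] at e
  simp only [acomm_smul_left, acomm_sum_left, lamstar_lam hM hz,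
    pauliJordan_slT] at e
  have hd := sum_epsUp_slT m 0 1 h f
  simp only [Fin.sum_univ_two, epsUp_00, epsUp_01, epsUp_10, epsUp_11, eps_00, eps_01,
    delta_self, delta_10] at hd e
  simp only [mul_one, one_smul, neg_neg] at e
  rw [← e, show -4 * I * (m : ℂ) ^ 4 * pauliJordan m h f
    = -4 * I * (m : ℂ) ^ 2 * (1 * m ^ 2 * pauliJordan m h f) by ring, ← hd]
  module

end Multiplet

end

end N2

/-! ### Assembly of the uniqueness statement. -/

namespace N2

noncomputable section

open MeasureTheory Complex

namespace Multiplet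

variable {𝒜 : Type*} [Ring 𝒜] [StarRing 𝒜] [Algebra ℂ 𝒜] [StarModule ℂ 𝒜] {M : Multiplet 𝒜}
  {m : ℝ}

theorem bracket_swap_eq_zero {a b : FieldName} (h : ∀ f w, M.bracket a b f w = 0) (f w : Test) :
    M.bracket b a f w = 0 := by
  have := h w f
  unfold bracket at *
  rw [Bool.and_comm]
  split_ifs at * with hc
  · rw [acomm_swap, this]
  · rw [comm_swap, this, neg_zero]

theorem field_not (c : Comp) (s : Bool) (f : Test) :
    M.field (c, !s) f = star (M.field (c, s) (conjTest f)) := by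
  cases s
  · rfl
  · change M.comp c f = star (adj (M.comp c) (conjTest f))
    rw [adj_apply, star_star, conjTest_conjTest]

theorem bracket_adj_eq_zero {c d : Comp} {s t : Bool}
    (h : ∀ f w, M.bracket (c, s) (d, t) f w = 0) (f w : Test) :
    M.bracket (c, !s) (d, !t) f w = 0 := by
  have := h (conjTest f) (conjTest w)
  unfold bracket at *
  rw [field_not, field_not]
  simp only at *
  split_ifs at * with hc
  · rw [← star_acomm_eq, this, star_zero]
  · rw [← star_comm_eq, comm_swap, this, neg_zero, star_zero]

/-- It suffices to check the vanishing of brackets with an unstarred first member. -/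
theorem bracket_eq_zero_of (h0 : ∀ c d, ¬ c.listedPair d → ∀ f w,
      M.bracket (c, false) (d, false) f w = 0)
    (h1 : ∀ c d, ¬ c.sameKind d → ∀ f w, M.bracket (c, false) (d, true) f w = 0)
    (a b : FieldName) (hab : ¬ listed a b) (f w : Test) : M.bracket a b f w = 0 := by
  obtain ⟨c, s⟩ := a
  obtain ⟨d, t⟩ := b
  cases s <;> cases t <;> simp only [listed, if_true, Bool.false_eq_true, Bool.true_eq_false,
    if_false] at hab
  · exact h0 c d hab f w
  · exact h1 c d hab f w
  · exact bracket_adj_eq_zero (s := false) (t := true) (h1 c d hab) f w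
  · exact bracket_adj_eq_zero (s := false) (t := false) (h0 c d hab) f w

theorem causalRelations_others [Nontrivial 𝒜] (hM : M.IsFree m) (hz : M.IsScalarOfMass m)
    {α : ℂ} (hα : ∀ f h, comm (M.z f) (M.D h) = (α * pauliJordan m f h) • 1)
    (a b : FieldName) (hab : ¬ listed a b) (f h : Test) : M.bracket a b f h = 0 := by
  have bf : ∀ a b : FieldName, a.1.fermi = false → b.1.fermi = true → ∀ f h,
      M.bracket a b f h = 0 := by
    intro a b ha hb f h
    rw [← hM.comm_bose_fermi a b ha hb f h]
    simp [bracket, ha, hb]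
  have h1 : ∀ c d : Comp, (∀ f w, M.bracket (c, false) (d, true) f w = 0) →
      ∀ f w, M.bracket (d, false) (c, true) f w = 0 := fun c d h =>
    bracket_swap_eq_zero (bracket_adj_eq_zero (s := false) (t := true) h)
  have zF : ∀ a b f w, M.bracket (.z, false) (.F a b, false) f w = 0 := hM.z_F
  have zC : ∀ a b f w, M.bracket (.z, false) (.C a b, false) f w = 0 := hM.z_C
  have DF : ∀ a b f w, M.bracket (.D, false) (.F a b, false) f w = 0 := fun a b f w =>
    (D_F_and_D_C hM f w).1 a b
  have DC : ∀ a b f w, M.bracket (.D, false) (.C a b, false) f w = 0 := fun a b f w =>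
    (D_F_and_D_C hM f w).2 a b
  have FC : ∀ a b c d f w, M.bracket (.F a b, false) (.C c d, false) f w = 0 := fun a b c d f w =>
    (hM.F_F_and_F_C hα a b f w).2 c d
  have zF' : ∀ a b f w, M.bracket (.z, false) (.F a b, true) f w = 0 := fun a b f w =>
    (hM.z_Fstar_and_z_Cstar f w).1 a b
  have zC' : ∀ a b f w, M.bracket (.z, false) (.C a b, true) f w = 0 := fun a b f w =>
    (hM.z_Fstar_and_z_Cstar f w).2 a b
  have zD' : ∀ f w, M.bracket (.z, false) (.D, true) f w = 0 := hM.z_Dstar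
  have FD' : ∀ a b f w, M.bracket (.F a b, false) (.D, true) f w = 0 := fun a b f w =>
    (F_Dstar_and_C_Dstar hM w f).1 a b
  have CD' : ∀ a b f w, M.bracket (.C a b, false) (.D, true) f w = 0 := fun a b f w =>
    (F_Dstar_and_C_Dstar hM w f).2 a b
  have CF' : ∀ a b c d f w, M.bracket (.C a b, false) (.F c d, true) f w = 0 :=
    fun a b c d f w => (F_Fstar_and_C_Fstar hM hz c d w f).2 a b
  have xl' : ∀ a b c d f w, M.bracket (.chi a b, false) (.lam c d, true) f w = 0 :=
    fun a b c d f w => chi_lamstar hM a b c d f w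
  have zz : ∀ f w, M.bracket (.z, false) (.z, false) f w = 0 := hz.z_z
  have DD : ∀ f w, M.bracket (.D, false) (.D, false) f w = 0 := D_D hM
  have ll : ∀ a b c d f w, M.bracket (.lam a b, false) (.lam c d, false) f w = 0 := lam_lam hM
  have xx : ∀ a b c d f w, M.bracket (.chi a b, false) (.chi c d, false) f w = 0 := chi_chi hM
  refine bracket_eq_zero_of ?_ ?_ a b hab f h
  · rintro c d hcd
    cases c <;> cases d <;> first
      | exact absurd trivial hcd
      | exact bf _ _ rfl rfl
      | exact bracket_swap_eq_zero (bf _ _ rfl rfl)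
      | with_reducible exact zz
      | with_reducible exact DD
      | with_reducible apply ll
      | with_reducible apply xx
      | with_reducible apply zF
      | with_reducible apply zC
      | with_reducible apply DF
      | with_reducible apply DC
      | with_reducible apply FC
      | with_reducible exact bracket_swap_eq_zero (zF _ _)
      | with_reducible exact bracket_swap_eq_zero (zC _ _)
      | with_reducible exact bracket_swap_eq_zero (DF _ _)
      | with_reducible exact bracket_swap_eq_zero (DC _ _)
      | with_reducible exact bracket_swap_eq_zero (FC _ _ _ _)
  · rintro c d hcd
    cases c <;> cases d <;> first
      | exact absurd trivial hcd
      | exact bf _ _ rfl rfl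
      | exact bracket_swap_eq_zero (bf _ _ rfl rfl)
      | with_reducible apply zF'
      | with_reducible apply zC'
      | with_reducible apply zD'
      | with_reducible apply FD'
      | with_reducible apply CD'
      | with_reducible apply CF'
      | with_reducible apply xl'
      | with_reducible exact h1 _ _ (zF' _ _)
      | with_reducible exact h1 _ _ (zC' _ _)
      | with_reducible exact h1 _ _ zD'
      | with_reducible exact h1 _ _ (FD' _ _)
      | with_reducible exact h1 _ _ (CD' _ _)
      | with_reducible exact h1 _ _ (CF' _ _ _ _)
      | with_reducible exact h1 _ _ (xl' _ _ _ _)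

theorem exists_causalRelations (hM : M.IsFree m) (hz : M.IsScalarOfMass m) :
    ∃ α : ℂ, M.CausalRelations m α := by
  -- In the zero algebra all relations hold trivially. Otherwise a multiple of 1 determines its
  -- coefficient, which is needed to compare kernels.
  rcases subsingleton_or_nontrivial 𝒜 with hs | hn
  · exact ⟨0, by constructor <;> intros <;> exact Subsingleton.elim _ _⟩
  obtain ⟨α, hα⟩ := hM.exists_z_D
  refine ⟨α, ?_, ?_, ?_, ?_, ?_, hα, ?_, ?_, ?_, causalRelations_others hM hz hα⟩
  · intro a b c d f h
    rw [(hM.F_F_and_F_C hα a b f h).1, pauliJordan_swap m f h]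
    congr 1; ring
  · intro a b c d f h
    rw [(F_Fstar_and_C_Fstar hM hz c d h f).1]
    simp only [add_mul, Finset.sum_add_distrib, sum_sigma_sigma_dKer]
    rw [add_comm]
  · exact C_C_of_z_D hM hα
  · intro j k l n f h
    exact (F_Cstar_and_C_Cstar hM hz l n h f).2 j k
  · exact fun f h => D_Dstar hM hz h f
  · intro j a k b f h
    rw [chi_chistar hM hz, sum_sigma_dKer]
  · intro j a k b f h
    rw [lam_lamstar hM hz, sum_sigma_dKer]
  · intro j a k b f h
    rw [hM.chi_lam_eq, hα, smul_smul]
    congr 1; ring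

end Multiplet

end

end N2

namespace N2

noncomputable section

/-! ### Super Weyl algebras and their derivations -/

section SuperWeyl

variable {V₀ V₁ : Type*} [AddCommGroup V₀] [Module ℂ V₀] [AddCommGroup V₁] [Module ℂ V₁]

/-- The defining relations of the super Weyl algebra of an antisymmetric form `ω₀` and a symmetric
form `ω₁`. -/
inductive SuperWeylRel (ω₀ : V₀ →ₗ[ℂ] V₀ →ₗ[ℂ] ℂ) (ω₁ : V₁ →ₗ[ℂ] V₁ →ₗ[ℂ] ℂ) :
    TensorAlgebra ℂ (V₀ × V₁) → TensorAlgebra ℂ (V₀ × V₁) → Prop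
  | even_even (v w : V₀) : SuperWeylRel ω₀ ω₁
      (TensorAlgebra.ι ℂ (v, 0) * TensorAlgebra.ι ℂ (w, 0)
        - TensorAlgebra.ι ℂ (w, 0) * TensorAlgebra.ι ℂ (v, 0)) (algebraMap ℂ _ (ω₀ v w))
  | even_odd (v : V₀) (w : V₁) : SuperWeylRel ω₀ ω₁
      (TensorAlgebra.ι ℂ (v, 0) * TensorAlgebra.ι ℂ (0, w)
        - TensorAlgebra.ι ℂ (0, w) * TensorAlgebra.ι ℂ (v, 0)) 0
  | odd_odd (v w : V₁) : SuperWeylRel ω₀ ω₁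
      (TensorAlgebra.ι ℂ (0, v) * TensorAlgebra.ι ℂ (0, w)
        + TensorAlgebra.ι ℂ (0, w) * TensorAlgebra.ι ℂ (0, v)) (algebraMap ℂ _ (ω₁ v w))

/-- The super Weyl algebra. -/
def SuperWeyl (ω₀ : V₀ →ₗ[ℂ] V₀ →ₗ[ℂ] ℂ) (ω₁ : V₁ →ₗ[ℂ] V₁ →ₗ[ℂ] ℂ) : Type _ :=
  RingQuot (SuperWeylRel ω₀ ω₁)

instance (ω₀ : V₀ →ₗ[ℂ] V₀ →ₗ[ℂ] ℂ) (ω₁ : V₁ →ₗ[ℂ] V₁ →ₗ[ℂ] ℂ) : Ring (SuperWeyl ω₀ ω₁) :=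
  inferInstanceAs (Ring (RingQuot (SuperWeylRel ω₀ ω₁)))

instance (ω₀ : V₀ →ₗ[ℂ] V₀ →ₗ[ℂ] ℂ) (ω₁ : V₁ →ₗ[ℂ] V₁ →ₗ[ℂ] ℂ) : Algebra ℂ (SuperWeyl ω₀ ω₁) :=
  inferInstanceAs (Algebra ℂ (RingQuot (SuperWeylRel ω₀ ω₁)))

/-- The projection from the tensor algebra. -/
def SuperWeyl.mk (ω₀ : V₀ →ₗ[ℂ] V₀ →ₗ[ℂ] ℂ) (ω₁ : V₁ →ₗ[ℂ] V₁ →ₗ[ℂ] ℂ) :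
    TensorAlgebra ℂ (V₀ × V₁) →ₐ[ℂ] SuperWeyl ω₀ ω₁ :=
  RingQuot.mkAlgHom ℂ (SuperWeylRel ω₀ ω₁)

namespace SuperWeyl

variable {ω₀ : V₀ →ₗ[ℂ] V₀ →ₗ[ℂ] ℂ} {ω₁ : V₁ →ₗ[ℂ] V₁ →ₗ[ℂ] ℂ}

/-- The even generators. -/
def ev : V₀ →ₗ[ℂ] SuperWeyl ω₀ ω₁ :=
  (mk ω₀ ω₁).toLinearMap ∘ₗ TensorAlgebra.ι ℂ ∘ₗ
    LinearMap.inl ℂ V₀ V₁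

/-- The odd generators. -/
def od : V₁ →ₗ[ℂ] SuperWeyl ω₀ ω₁ :=
  (mk ω₀ ω₁).toLinearMap ∘ₗ TensorAlgebra.ι ℂ ∘ₗ
    LinearMap.inr ℂ V₀ V₁

theorem mk_rel {x y : TensorAlgebra ℂ (V₀ × V₁)} (h : SuperWeylRel ω₀ ω₁ x y) :
    mk ω₀ ω₁ x = mk ω₀ ω₁ y :=
  RingQuot.mkAlgHom_rel ℂ h

theorem ev_ev (v w : V₀) : comm (ev v : SuperWeyl ω₀ ω₁) (ev w) = algebraMap ℂ _ (ω₀ v w) := by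
  have := mk_rel (SuperWeylRel.even_even (ω₀ := ω₀) (ω₁ := ω₁) v w)
  rwa [map_sub, map_mul, map_mul, AlgHom.commutes] at this

theorem ev_od (v : V₀) (w : V₁) : comm (ev v : SuperWeyl ω₀ ω₁) (od w) = 0 := by
  have := mk_rel (SuperWeylRel.even_odd (ω₀ := ω₀) (ω₁ := ω₁) v w)
  rwa [map_sub, map_mul, map_mul, map_zero] at this

theorem od_od (v w : V₁) : acomm (od v : SuperWeyl ω₀ ω₁) (od w) = algebraMap ℂ _ (ω₁ v w) := by
  have := mk_rel (SuperWeylRel.odd_odd (ω₀ := ω₀) (ω₁ := ω₁) v w)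
  rwa [map_add, map_mul, map_mul, AlgHom.commutes] at this

/-- The universal property. -/
theorem exists_lift {B : Type*} [Ring B] [Algebra ℂ B] (f₀ : V₀ →ₗ[ℂ] B) (f₁ : V₁ →ₗ[ℂ] B)
    (h₀ : ∀ v w, comm (f₀ v) (f₀ w) = algebraMap ℂ B (ω₀ v w))
    (h₀₁ : ∀ v w, comm (f₀ v) (f₁ w) = 0)
    (h₁ : ∀ v w, acomm (f₁ v) (f₁ w) = algebraMap ℂ B (ω₁ v w)) :
    ∃ φ : SuperWeyl ω₀ ω₁ →ₐ[ℂ] B, (∀ v, φ (ev v) = f₀ v) ∧ ∀ w, φ (od w) = f₁ w := by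
  have hrel : ∀ ⦃x y⦄, SuperWeylRel ω₀ ω₁ x y →
      TensorAlgebra.lift ℂ (f₀.coprod f₁) x = TensorAlgebra.lift ℂ (f₀.coprod f₁) y := by
    intro x y hxy
    cases hxy with
    | even_even v w => simpa [comm] using h₀ v w
    | even_odd v w => simpa [comm] using h₀₁ v w
    | odd_odd v w => simpa [acomm] using h₁ v w
  refine ⟨RingQuot.liftAlgHom ℂ ⟨_, hrel⟩, fun v => ?_, fun w => ?_⟩
  · refine (RingQuot.liftAlgHom_mkAlgHom_apply ℂ _ hrel _).trans ?_
    simp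
  · refine (RingQuot.liftAlgHom_mkAlgHom_apply ℂ _ hrel _).trans ?_
    simp

theorem induction {C : SuperWeyl ω₀ ω₁ → Prop} (hr : ∀ r : ℂ, C (algebraMap ℂ _ r))
    (h₀ : ∀ v, C (ev v)) (h₁ : ∀ w, C (od w)) (hadd : ∀ x y, C x → C y → C (x + y))
    (hmul : ∀ x y, C x → C y → C (x * y)) (x : SuperWeyl ω₀ ω₁) : C x := by
  obtain ⟨x, rfl⟩ : ∃ t, mk ω₀ ω₁ t = x := RingQuot.mkAlgHom_surjective ℂ (SuperWeylRel ω₀ ω₁) x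
  induction x using TensorAlgebra.induction with
  | algebraMap r => rw [AlgHom.commutes]; exact hr r
  | ι v =>
    have : v = (v.1, 0) + (0, v.2) := by simp
    rw [this, map_add, map_add]
    exact hadd _ _ (h₀ v.1) (h₁ v.2)
  | mul x y hx hy => rw [map_mul]; exact hmul _ _ hx hy
  | add x y hx hy => rw [map_add]; exact hadd _ _ hx hy

/-- A map that passes through left multiplication by generators up to a fixed left factor is
determined by its value at 1. Applied to differences, commutators and intertwining defects of
derivations, it reduces such identities to generators. -/
theorem linearMap_eq_zero {X : SuperWeyl ω₀ ω₁ →ₗ[ℂ] SuperWeyl ω₀ ω₁} (h1 : X 1 = 0)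
    (h₀ : ∀ v, ∃ y, ∀ x, X (ev v * x) = y * X x) (h₁ : ∀ w, ∃ y, ∀ x, X (od w * x) = y * X x) :
    X = 0 := by
  have : ∀ x, ∃ y, ∀ x', X (x * x') = y * X x' := by
    refine induction (fun r => ⟨algebraMap ℂ _ r, fun x => ?_⟩) h₀ h₁ ?_ ?_
    · rw [← Algebra.smul_def, map_smul, Algebra.smul_def]
    · rintro x y ⟨x', hx⟩ ⟨y', hy⟩
      exact ⟨x' + y', fun t => by rw [add_mul, map_add, hx, hy, add_mul]⟩
    · rintro x y ⟨x', hx⟩ ⟨y', hy⟩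
      exact ⟨x' * y', fun t => by rw [mul_assoc, hx, hy, mul_assoc]⟩
  ext x
  obtain ⟨y, hy⟩ := this x
  have := hy 1
  rw [mul_one, h1, mul_zero] at this
  exact this

/-- `X` is the even derivation extending `(p₀, p₁)`. -/
structure IsEvenDer (X : Module.End ℂ (SuperWeyl ω₀ ω₁)) (p₀ : V₀ →ₗ[ℂ] V₀) (p₁ : V₁ →ₗ[ℂ] V₁) :
    Prop where
  map_one : X 1 = 0
  map_ev : ∀ v x, X (ev v * x) = ev v * X x + ev (p₀ v) * x
  map_od : ∀ w x, X (od w * x) = od w * X x + od (p₁ w) * x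

/-- `X` is the odd derivation extending `(q₀, q₁)`. -/
structure IsOddDer (X : Module.End ℂ (SuperWeyl ω₀ ω₁)) (q₀ : V₀ →ₗ[ℂ] V₁) (q₁ : V₁ →ₗ[ℂ] V₀) :
    Prop where
  map_one : X 1 = 0
  map_ev : ∀ v x, X (ev v * x) = ev v * X x + od (q₀ v) * x
  map_od : ∀ w x, X (od w * x) = -(od w * X x) + ev (q₁ w) * x

/-- A derivation D is the corner entry of the homomorphism x ↦ [[x, Dx], [0, x]] into triangular
matrices. Infinitesimal invariance of the forms says exactly that the matrices assigned to the
generators satisfy the defining relations. -/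
theorem exists_isEvenDer {p₀ : V₀ →ₗ[ℂ] V₀} {p₁ : V₁ →ₗ[ℂ] V₁}
    (h₀ : ∀ v w, ω₀ (p₀ v) w + ω₀ v (p₀ w) = 0) (h₁ : ∀ v w, ω₁ (p₁ v) w + ω₁ v (p₁ w) = 0) :
    ∃ X : Module.End ℂ (SuperWeyl ω₀ ω₁), IsEvenDer X p₀ p₁ := by
  let f₀ : V₀ →ₗ[ℂ] Matrix (Fin 2) (Fin 2) (SuperWeyl ω₀ ω₁) :=
    { toFun := fun v => !![ev v, ev (p₀ v); 0, ev v]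
      map_add' := fun v w => by ext i j; fin_cases i <;> fin_cases j <;> simp
      map_smul' := fun c w => by ext i j; fin_cases i <;> fin_cases j <;> simp }
  let f₁ : V₁ →ₗ[ℂ] Matrix (Fin 2) (Fin 2) (SuperWeyl ω₀ ω₁) :=
    { toFun := fun v => !![od v, od (p₁ v); 0, od v]
      map_add' := fun v w => by ext i j; fin_cases i <;> fin_cases j <;> simp
      map_smul' := fun c w => by ext i j; fin_cases i <;> fin_cases j <;> simp }
  obtain ⟨φ, hφ₀, hφ₁⟩ := exists_lift (ω₀ := ω₀) (ω₁ := ω₁) f₀ f₁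
    (fun v w => by
      have e1 := ev_ev (ω₀ := ω₀) (ω₁ := ω₁) v w
      have e2 := ev_ev (ω₀ := ω₀) (ω₁ := ω₁) (p₀ v) w
      have e3 := ev_ev (ω₀ := ω₀) (ω₁ := ω₁) v (p₀ w)
      have e4 := congrArg₂ (· + ·) e2 e3
      simp only [← map_add, h₀, map_zero] at e4
      unfold comm at *
      ext i j
      fin_cases i <;> fin_cases j <;>
        simp [f₀, Matrix.algebraMap_matrix_apply]
      · exact e1
      · rw [← e4]; abel
      · exact e1)
    (fun v w => by
      have e1 := ev_od (ω₀ := ω₀) (ω₁ := ω₁) v w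
      have e2 := ev_od (ω₀ := ω₀) (ω₁ := ω₁) (p₀ v) w
      have e3 := ev_od (ω₀ := ω₀) (ω₁ := ω₁) v (p₁ w)
      have e4 := congrArg₂ (· + ·) e2 e3
      simp only [add_zero] at e4
      unfold comm at *
      ext i j
      fin_cases i <;> fin_cases j <;> simp [f₀, f₁]
      · exact e1
      · rw [← e4]; abel
      · exact e1)
    (fun v w => by
      have e1 := od_od (ω₀ := ω₀) (ω₁ := ω₁) v w
      have e2 := od_od (ω₀ := ω₀) (ω₁ := ω₁) (p₁ v) w
      have e3 := od_od (ω₀ := ω₀) (ω₁ := ω₁) v (p₁ w)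
      have e4 := congrArg₂ (· + ·) e2 e3
      simp only [← map_add, h₁, map_zero] at e4
      unfold acomm at *
      ext i j
      fin_cases i <;> fin_cases j <;>
        simp [f₁, Matrix.algebraMap_matrix_apply]
      · exact e1
      · rw [← e4]; abel
      · exact e1)
  -- With the lower row equal to (0, x), multiplicativity of φ gives the Leibniz rule for the upper
  -- right entry.
  have h11 : ∀ x, φ x 1 0 = 0 ∧ φ x 1 1 = x := by
    refine induction (fun r => ?_) (fun v => ?_) (fun w => ?_) ?_ ?_
    · rw [AlgHom.commutes]; simp [Matrix.algebraMap_matrix_apply]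
    · rw [hφ₀]; exact ⟨rfl, rfl⟩
    · rw [hφ₁]; exact ⟨rfl, rfl⟩
    · rintro x y ⟨hx, hx'⟩ ⟨hy, hy'⟩
      rw [map_add]; simp [hx, hy, hx', hy']
    · rintro x y ⟨hx, hx'⟩ ⟨hy, hy'⟩
      rw [map_mul]; simp [Matrix.mul_apply, Fin.sum_univ_two, hx, hx', hy, hy']
  refine ⟨Matrix.entryLinearMap ℂ _ (0 : Fin 2) (1 : Fin 2) ∘ₗ φ.toLinearMap, ?_, ?_, ?_⟩
  · simp
  · intro v x
    change φ (ev v * x) 0 1 = _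
    rw [map_mul, Matrix.mul_apply, Fin.sum_univ_two, hφ₀, (h11 x).2]
    rfl
  · intro v x
    change φ (od v * x) 0 1 = _
    rw [map_mul, Matrix.mul_apply, Fin.sum_univ_two, hφ₁, (h11 x).2]
    rfl

/-- As for even derivations, but the upper left entry carries the parity automorphism, so odd
generators appear there with a minus sign. One mixed condition on the forms is enough: the other
relations hold because even and odd generators commute. -/
theorem exists_isOddDer {q₀ : V₀ →ₗ[ℂ] V₁} {q₁ : V₁ →ₗ[ℂ] V₀}
    (h : ∀ v w, ω₁ (q₀ v) w + ω₀ v (q₁ w) = 0) :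
    ∃ X : Module.End ℂ (SuperWeyl ω₀ ω₁), IsOddDer X q₀ q₁ := by
  let f₀ : V₀ →ₗ[ℂ] Matrix (Fin 2) (Fin 2) (SuperWeyl ω₀ ω₁) :=
    { toFun := fun v => !![ev v, od (q₀ v); 0, ev v]
      map_add' := fun v w => by ext i j; fin_cases i <;> fin_cases j <;> simp
      map_smul' := fun c w => by ext i j; fin_cases i <;> fin_cases j <;> simp }
  let f₁ : V₁ →ₗ[ℂ] Matrix (Fin 2) (Fin 2) (SuperWeyl ω₀ ω₁) :=
    { toFun := fun v => !![-od v, ev (q₁ v); 0, od v]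
      map_add' := fun v w => by ext i j; fin_cases i <;> fin_cases j <;> simp [add_comm]
      map_smul' := fun c w => by ext i j; fin_cases i <;> fin_cases j <;> simp }
  obtain ⟨φ, hφ₀, hφ₁⟩ := exists_lift (ω₀ := ω₀) (ω₁ := ω₁) f₀ f₁
    (fun v w => by
      have e1 := ev_ev (ω₀ := ω₀) (ω₁ := ω₁) v w
      have e2 := ev_od (ω₀ := ω₀) (ω₁ := ω₁) w (q₀ v)
      have e3 := ev_od (ω₀ := ω₀) (ω₁ := ω₁) v (q₀ w)
      have e4 := congrArg₂ (· - ·) e3 e2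
      simp only [sub_zero] at e4
      unfold comm at *
      ext i j
      fin_cases i <;> fin_cases j <;>
        simp [f₀, Matrix.algebraMap_matrix_apply]
      · exact e1
      · rw [← e4]; abel
      · exact e1)
    (fun v w => by
      have e1 := ev_od (ω₀ := ω₀) (ω₁ := ω₁) v w
      have e2 := od_od (ω₀ := ω₀) (ω₁ := ω₁) (q₀ v) w
      have e3 := ev_ev (ω₀ := ω₀) (ω₁ := ω₁) v (q₁ w)
      have e4 := congrArg₂ (· + ·) e2 e3
      simp only [← map_add, h, map_zero] at e4
      unfold comm acomm at *
      ext i j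
      fin_cases i <;> fin_cases j <;> simp [f₀, f₁]
      · rw [neg_add_eq_zero, ← sub_eq_zero]; exact e1
      · rw [← e4]; abel
      · exact e1)
    (fun v w => by
      have e1 := od_od (ω₀ := ω₀) (ω₁ := ω₁) v w
      have e2 := ev_od (ω₀ := ω₀) (ω₁ := ω₁) (q₁ v) w
      have e3 := ev_od (ω₀ := ω₀) (ω₁ := ω₁) (q₁ w) v
      have e4 := congrArg₂ (· + ·) e2 e3
      simp only [add_zero] at e4
      unfold acomm comm at *
      ext i j
      fin_cases i <;> fin_cases j <;>
        simp [f₁, Matrix.algebraMap_matrix_apply]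
      · exact e1
      · rw [← e4]; abel
      · exact e1)
  have h11 : ∀ x, φ x 1 0 = 0 ∧ φ x 1 1 = x := by
    refine induction (fun r => ?_) (fun v => ?_) (fun w => ?_) ?_ ?_
    · rw [AlgHom.commutes]; simp [Matrix.algebraMap_matrix_apply]
    · rw [hφ₀]; exact ⟨rfl, rfl⟩
    · rw [hφ₁]; exact ⟨rfl, rfl⟩
    · rintro x y ⟨hx, hx'⟩ ⟨hy, hy'⟩
      rw [map_add]; simp [hx, hy, hx', hy']
    · rintro x y ⟨hx, hx'⟩ ⟨hy, hy'⟩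
      rw [map_mul]; simp [Matrix.mul_apply, Fin.sum_univ_two, hx, hx', hy, hy']
  refine ⟨Matrix.entryLinearMap ℂ _ (0 : Fin 2) (1 : Fin 2) ∘ₗ φ.toLinearMap, ?_, ?_, ?_⟩
  · simp
  · intro v x
    change φ (ev v * x) 0 1 = _
    rw [map_mul, Matrix.mul_apply, Fin.sum_univ_two, hφ₀, (h11 x).2]
    rfl
  · intro v x
    change φ (od v * x) 0 1 = _
    rw [map_mul, Matrix.mul_apply, Fin.sum_univ_two, hφ₁, (h11 x).2]
    exact congrArg (· + _) (neg_mul (od v) (φ x 0 1))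

end SuperWeyl

end SuperWeyl

end

end N2

/-! ### Calculus of derivations and nontriviality of the super Weyl algebra. -/

namespace N2

noncomputable section

namespace SuperWeyl

variable {V₀ V₁ : Type*} [AddCommGroup V₀] [Module ℂ V₀] [AddCommGroup V₁] [Module ℂ V₁]
  {ω₀ : V₀ →ₗ[ℂ] V₀ →ₗ[ℂ] ℂ} {ω₁ : V₁ →ₗ[ℂ] V₁ →ₗ[ℂ] ℂ}

theorem IsEvenDer.unique {X Y : Module.End ℂ (SuperWeyl ω₀ ω₁)} {p₀ : V₀ →ₗ[ℂ] V₀}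
    {p₁ : V₁ →ₗ[ℂ] V₁} (hX : IsEvenDer X p₀ p₁) (hY : IsEvenDer Y p₀ p₁) : X = Y := by
  rw [← sub_eq_zero]
  refine linearMap_eq_zero ?_ (fun v => ⟨ev v, fun x => ?_⟩) fun w => ⟨od w, fun x => ?_⟩
  · rw [LinearMap.sub_apply, hX.map_one, hY.map_one, sub_zero]
  · rw [LinearMap.sub_apply, LinearMap.sub_apply, hX.map_ev, hY.map_ev, mul_sub]; abel
  · rw [LinearMap.sub_apply, LinearMap.sub_apply, hX.map_od, hY.map_od, mul_sub]; abel

theorem IsEvenDer.zero : IsEvenDer (0 : Module.End ℂ (SuperWeyl ω₀ ω₁)) 0 0 :=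
  ⟨rfl, fun v x => by simp, fun w x => by simp⟩

theorem IsEvenDer.add {X Y : Module.End ℂ (SuperWeyl ω₀ ω₁)} {p₀ p₀' : V₀ →ₗ[ℂ] V₀}
    {p₁ p₁' : V₁ →ₗ[ℂ] V₁} (hX : IsEvenDer X p₀ p₁) (hY : IsEvenDer Y p₀' p₁') :
    IsEvenDer (X + Y) (p₀ + p₀') (p₁ + p₁') := by
  refine ⟨?_, fun v x => ?_, fun w x => ?_⟩
  · rw [LinearMap.add_apply, hX.map_one, hY.map_one, add_zero]
  · simp only [LinearMap.add_apply, hX.map_ev, hY.map_ev, map_add, mul_add, add_mul]; abel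
  · simp only [LinearMap.add_apply, hX.map_od, hY.map_od, map_add, mul_add, add_mul]; abel

theorem IsEvenDer.smul {X : Module.End ℂ (SuperWeyl ω₀ ω₁)} {p₀ : V₀ →ₗ[ℂ] V₀}
    {p₁ : V₁ →ₗ[ℂ] V₁} (c : ℂ) (hX : IsEvenDer X p₀ p₁) : IsEvenDer (c • X) (c • p₀) (c • p₁) := by
  refine ⟨?_, fun v x => ?_, fun w x => ?_⟩
  · rw [LinearMap.smul_apply, hX.map_one, smul_zero]
  · simp only [LinearMap.smul_apply, hX.map_ev, map_smul, smul_add, mul_smul_comm, smul_mul_assoc]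
  · simp only [LinearMap.smul_apply, hX.map_od, map_smul, smul_add, mul_smul_comm, smul_mul_assoc]

theorem IsEvenDer.sum {ι : Type*} (s : Finset ι) {X : ι → Module.End ℂ (SuperWeyl ω₀ ω₁)}
    {p₀ : ι → V₀ →ₗ[ℂ] V₀} {p₁ : ι → V₁ →ₗ[ℂ] V₁} (h : ∀ i, IsEvenDer (X i) (p₀ i) (p₁ i)) :
    IsEvenDer (∑ i ∈ s, X i) (∑ i ∈ s, p₀ i) (∑ i ∈ s, p₁ i) := by
  classical
  induction s using Finset.induction_on with
  | empty => simpa using IsEvenDer.zero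
  | insert i s hi ih => simpa [Finset.sum_insert hi] using (h i).add ih

/-- The anticommutator of odd derivations. -/
theorem IsOddDer.acomm {X Y : Module.End ℂ (SuperWeyl ω₀ ω₁)} {q₀ r₀ : V₀ →ₗ[ℂ] V₁}
    {q₁ r₁ : V₁ →ₗ[ℂ] V₀} (hX : IsOddDer X q₀ q₁) (hY : IsOddDer Y r₀ r₁) :
    IsEvenDer (N2.acomm X Y) (q₁ ∘ₗ r₀ + r₁ ∘ₗ q₀) (q₀ ∘ₗ r₁ + r₀ ∘ₗ q₁) := by
  refine ⟨?_, fun v x => ?_, fun w x => ?_⟩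
  · simp [N2.acomm, hX.map_one, hY.map_one]
  · simp only [N2.acomm, LinearMap.add_apply, Module.End.mul_apply, LinearMap.comp_apply, hX.map_ev,
      hY.map_ev, hX.map_od, hY.map_od, map_add, mul_add, add_mul]
    abel
  · simp only [N2.acomm, LinearMap.add_apply, Module.End.mul_apply, LinearMap.comp_apply, hX.map_ev,
      hY.map_ev, hX.map_od, hY.map_od, map_add, map_neg, mul_add, add_mul, neg_neg, neg_add]
    abel

theorem comm_eq_zero_of_isOddDer_of_isEvenDer {X Y : Module.End ℂ (SuperWeyl ω₀ ω₁)}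
    {q₀ : V₀ →ₗ[ℂ] V₁} {q₁ : V₁ →ₗ[ℂ] V₀} {p₀ : V₀ →ₗ[ℂ] V₀} {p₁ : V₁ →ₗ[ℂ] V₁}
    (hX : IsOddDer X q₀ q₁) (hY : IsEvenDer Y p₀ p₁) (h₀ : ∀ v, q₀ (p₀ v) = p₁ (q₀ v))
    (h₁ : ∀ w, q₁ (p₁ w) = p₀ (q₁ w)) : comm X Y = 0 := by
  refine linearMap_eq_zero ?_ (fun v => ⟨ev v, fun x => ?_⟩) fun w => ⟨-od w, fun x => ?_⟩
  · simp [comm, hX.map_one, hY.map_one]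
  · simp only [comm, LinearMap.sub_apply, Module.End.mul_apply, hX.map_ev, hY.map_ev, hY.map_od, map_add,
      mul_sub, h₀]
    abel
  · simp only [comm, LinearMap.sub_apply, Module.End.mul_apply, hX.map_od, hY.map_ev, hY.map_od, map_add,
      map_neg, mul_sub, h₁, neg_mul]
    abel

/-- Intertwining of odd derivations. -/
theorem algHom_comp_isOddDer (φ : SuperWeyl ω₀ ω₁ →ₐ[ℂ] SuperWeyl ω₀ ω₁) {r₀ : V₀ →ₗ[ℂ] V₀}
    {r₁ : V₁ →ₗ[ℂ] V₁} (hφ₀ : ∀ v, φ (ev v) = ev (r₀ v)) (hφ₁ : ∀ w, φ (od w) = od (r₁ w))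
    {ι : Type*} (s : Finset ι) (c : ι → ℂ) {X : Module.End ℂ (SuperWeyl ω₀ ω₁)}
    {Y : ι → Module.End ℂ (SuperWeyl ω₀ ω₁)} {q₀ : V₀ →ₗ[ℂ] V₁} {q₁ : V₁ →ₗ[ℂ] V₀}
    {q₀' : ι → V₀ →ₗ[ℂ] V₁} {q₁' : ι → V₁ →ₗ[ℂ] V₀}
    (hX : IsOddDer X q₀ q₁) (hY : ∀ i, IsOddDer (Y i) (q₀' i) (q₁' i))
    (h₀ : ∀ v, r₁ (q₀ v) = ∑ i ∈ s, c i • q₀' i (r₀ v))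
    (h₁ : ∀ w, r₀ (q₁ w) = ∑ i ∈ s, c i • q₁' i (r₁ w)) :
    φ.toLinearMap ∘ₗ X = (∑ i ∈ s, c i • Y i) ∘ₗ φ.toLinearMap := by
  rw [← sub_eq_zero]
  refine linearMap_eq_zero ?_ (fun v => ⟨ev (r₀ v), fun x => ?_⟩)
    fun w => ⟨-od (r₁ w), fun x => ?_⟩
  · simp [hX.map_one, fun i => (hY i).map_one]
  · simp only [LinearMap.sub_apply, LinearMap.comp_apply, AlgHom.toLinearMap_apply, hX.map_ev, map_add,
      map_mul, hφ₀, hφ₁, LinearMap.sum_apply, LinearMap.smul_apply, (hY _).map_ev, smul_add,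
      Finset.sum_add_distrib, h₀, map_sum, map_smul, mul_sub, Finset.mul_sum, Finset.sum_mul,
      mul_smul_comm, smul_mul_assoc]
    abel
  · simp only [LinearMap.sub_apply, LinearMap.comp_apply, AlgHom.toLinearMap_apply, hX.map_od, map_add,
      map_neg, map_mul, hφ₀, hφ₁, LinearMap.sum_apply, LinearMap.smul_apply, (hY _).map_od, smul_add,
      smul_neg, Finset.sum_add_distrib, Finset.sum_neg_distrib, h₁, map_sum, map_smul, mul_sub,
      Finset.mul_sum, Finset.sum_mul, mul_smul_comm, smul_mul_assoc, neg_mul]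
    abel

theorem algHom_ext {B : Type*} [Ring B] [Algebra ℂ B] {φ ψ : SuperWeyl ω₀ ω₁ →ₐ[ℂ] B}
    (h₀ : ∀ v, φ (ev v) = ψ (ev v)) (h₁ : ∀ w, φ (od w) = ψ (od w)) : φ = ψ := by
  ext x
  refine induction (C := fun x => φ x = ψ x) (fun r => by simp) h₀ h₁ ?_ ?_ x
  · intro x y hx hy; rw [map_add, map_add, hx, hy]
  · intro x y hx hy; rw [map_mul, map_mul, hx, hy]

/-- The endomorphism induced by a pair of isometries. -/
theorem exists_map {r₀ : V₀ →ₗ[ℂ] V₀} {r₁ : V₁ →ₗ[ℂ] V₁} (h₀ : ∀ v w, ω₀ (r₀ v) (r₀ w) = ω₀ v w)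
    (h₁ : ∀ v w, ω₁ (r₁ v) (r₁ w) = ω₁ v w) : ∃ φ : SuperWeyl ω₀ ω₁ →ₐ[ℂ] SuperWeyl ω₀ ω₁,
      (∀ v, φ (ev v) = ev (r₀ v)) ∧ ∀ w, φ (od w) = od (r₁ w) :=
  exists_lift (ev ∘ₗ r₀) (od ∘ₗ r₁) (fun v w => by simp only [LinearMap.comp_apply, ev_ev, h₀])
    (fun v w => by simp only [LinearMap.comp_apply, ev_od])
    fun v w => by simp only [LinearMap.comp_apply, od_od, h₁]

/-- The Weyl algebra of an antisymmetric form acts on polynomials. -/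
theorem exists_weyl_representation (hω : ∀ v w, ω₀ v w = -ω₀ w v) :
    ∃ f : V₀ →ₗ[ℂ] Module.End ℂ (MvPolynomial (Module.Basis.ofVectorSpaceIndex ℂ V₀) ℂ),
      ∀ v w, comm (f v) (f w) = algebraMap ℂ _ (ω₀ v w) := by
  let b := Module.Basis.ofVectorSpace ℂ V₀
  let S := MvPolynomial (Module.Basis.ofVectorSpaceIndex ℂ V₀) ℂ
  let x : V₀ →ₗ[ℂ] S := b.constr ℂ fun i => MvPolynomial.X i
  let d : V₀ → Derivation ℂ S S := fun v =>
    -- Each v acts as multiplication by x_v plus d_v. The commutator is d_v(x_w) - d_w(x_v), and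
    -- antisymmetry makes the two halves add up to ω₀(v, w). No nondegeneracy is required.
    MvPolynomial.mkDerivation ℂ fun i => MvPolynomial.C ((1 / 2 : ℂ) * ω₀ v (b i))
  have hdx : ∀ v w, d v (x w) = MvPolynomial.C ((1 / 2 : ℂ) * ω₀ v w) := by
    intro v w
    have : (d v).toLinearMap ∘ₗ x
        = (Algebra.linearMap ℂ S) ∘ₗ ((1 / 2 : ℂ) • ω₀ v) := by
      refine b.ext fun i => ?_
      simp only [LinearMap.comp_apply, x, Module.Basis.constr_basis]
      exact MvPolynomial.mkDerivation_X _ _ _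
    exact congrArg (fun L => L w) this
  have hadd : ∀ v w, d (v + w) = d v + d w := fun v w =>
    MvPolynomial.derivation_ext fun i => by
      simp only [d, Derivation.add_apply, MvPolynomial.mkDerivation_X, map_add,
        LinearMap.add_apply, mul_add]
  have hsmul : ∀ (c : ℂ) v, d (c • v) = c • d v := fun c v =>
    MvPolynomial.derivation_ext fun i => by
      simp only [d, Derivation.smul_apply, MvPolynomial.mkDerivation_X, map_smul,
        LinearMap.smul_apply, smul_eq_mul]
      refine Eq.trans ?_ (MvPolynomial.smul_eq_C_mul _ c).symm
      rw [← map_mul]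
      congr 1; ring
  have hcomm : ∀ v w p, d v (d w p) = d w (d v p) := by
    intro v w p
    have : ⁅d v, d w⁆ = 0 := MvPolynomial.derivation_ext fun i => by
      rw [Derivation.commutator_apply]
      simp only [d, MvPolynomial.mkDerivation_X, MvPolynomial.derivation_C, sub_zero,
        Derivation.zero_apply]
    have h2 := congrArg (fun D => D p) this
    rw [Derivation.commutator_apply] at h2
    exact sub_eq_zero.1 h2
  let f : V₀ →ₗ[ℂ] Module.End ℂ S :=
    { toFun := fun v => LinearMap.mulLeft ℂ (x v) + (d v).toLinearMap
      map_add' := fun v w => by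
        refine LinearMap.ext fun p => ?_
        simp [hadd, add_mul]; abel
      map_smul' := fun c w => by
        refine LinearMap.ext fun p => ?_
        simp [hsmul] }
  refine ⟨f, fun v w => ?_⟩
  refine LinearMap.ext fun p => ?_
  have e : (algebraMap ℂ (Module.End ℂ S) (ω₀ v w)) p = MvPolynomial.C (ω₀ v w) * p := by
    rw [← MvPolynomial.smul_eq_C_mul]; rfl
  rw [e]
  simp only [comm, f, LinearMap.coe_mk, AddHom.coe_mk, LinearMap.sub_apply, Module.End.mul_apply,
    LinearMap.add_apply, LinearMap.mulLeft_apply, Derivation.coeFn_coe, map_add, Derivation.leibniz,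
    hdx, hcomm v w, smul_eq_mul]
  rw [hω w v]
  have : (MvPolynomial.C (ω₀ v w) : S) = MvPolynomial.C ((1 / 2 : ℂ) * ω₀ v w)
      - MvPolynomial.C ((1 / 2 : ℂ) * -ω₀ v w) := by
    rw [← map_sub]; congr 1; ring
  rw [this]
  ring

/-- The algebra maps to polynomial operators tensored with the Clifford algebra of ω₁/2, whose polar
form is ω₁. Even and odd generators commute, so the ordinary tensor product is the right target. A
ring with a unital map to a nonzero ring is nonzero. -/
theorem nontrivial (hω₀ : ∀ v w, ω₀ v w = -ω₀ w v) (hω₁ : ∀ v w, ω₁ v w = ω₁ w v) :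
    Nontrivial (SuperWeyl ω₀ ω₁) := by
  obtain ⟨f, hf⟩ := exists_weyl_representation hω₀
  let S := MvPolynomial (Module.Basis.ofVectorSpaceIndex ℂ V₀) ℂ
  let Qd : QuadraticForm ℂ V₁ := LinearMap.BilinMap.toQuadraticMap ((1 / 2 : ℂ) • ω₁)
  have : Invertible (2 : ℂ) := invertibleOfNonzero two_ne_zero
  obtain ⟨φ, -, -⟩ := exists_lift (ω₀ := ω₀) (ω₁ := ω₁)
    (B := TensorProduct ℂ (Module.End ℂ S) (CliffordAlgebra Qd))
    (Algebra.TensorProduct.includeLeft.toLinearMap ∘ₗ f)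
    (Algebra.TensorProduct.includeRight.toLinearMap ∘ₗ CliffordAlgebra.ι Qd)
    (fun v w => by
      have := congrArg (Algebra.TensorProduct.includeLeft (R := ℂ) (S := ℂ)
        (B := CliffordAlgebra Qd)) (hf v w)
      rw [comm, map_sub, map_mul, map_mul, AlgHom.commutes] at this
      exact this)
    (fun v w => by
      simp [comm])
    (fun v w => by
      have := congrArg (Algebra.TensorProduct.includeRight (R := ℂ) (A := Module.End ℂ S))
        (CliffordAlgebra.ι_mul_ι_add_swap (Q := Qd) v w)
      have e : QuadraticMap.polar Qd v w = ω₁ v w := by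
        simp only [Qd, QuadraticMap.polar, LinearMap.BilinMap.toQuadraticMap_apply, map_add,
          LinearMap.add_apply, LinearMap.smul_apply, smul_eq_mul, hω₁ w v]
        ring
      rw [e] at this
      rw [map_add, map_mul, map_mul, AlgHom.commutes] at this
      exact this)
  have : Nontrivial (TensorProduct ℂ (Module.End ℂ S) (CliffordAlgebra Qd)) :=
    Algebra.TensorProduct.nontrivial_of_algebraMap_injective_of_flat_left _ _ _
      (algebraMap ℂ (CliffordAlgebra Qd)).injective
  exact φ.toRingHom.domain_nontrivial

end SuperWeyl

end

end N2

namespace N2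

noncomputable section

open Complex

/-! ### The doubled `*`-algebra of operators -/

/-- The `*`-algebra `E ⊕ E^op`, with the conjugate scalar action on the second summand; the star
operation interchanges the summands. -/
def Dbl (E : Type*) : Type _ := E × Eᵐᵒᵖ

namespace Dbl

variable {E : Type*} [Ring E]

instance : Ring (Dbl E) := inferInstanceAs (Ring (E × Eᵐᵒᵖ))

/-- The element with components `x` and `y`. -/
def mk (x y : E) : Dbl E := (x, MulOpposite.op y)

theorem mk_mul (x y x' y' : E) : mk x y * mk x' y' = mk (x * x') (y' * y) := rfl

theorem mk_add (x y x' y' : E) : mk x y + mk x' y' = mk (x + x') (y + y') := rfl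

theorem mk_sub (x y x' y' : E) : mk x y - mk x' y' = mk (x - x') (y - y') := rfl

theorem mk_one : mk (1 : E) 1 = 1 := rfl

theorem mk_zero : mk (0 : E) 0 = 0 := rfl

instance : StarRing (Dbl E) where
  star p := (p.2.unop, MulOpposite.op p.1)
  star_involutive _ := rfl
  star_mul _ _ := rfl
  star_add _ _ := rfl

theorem star_mk (x y : E) : star (mk x y) = mk y x := rfl

instance [Nontrivial E] : Nontrivial (Dbl E) := inferInstanceAs (Nontrivial (E × Eᵐᵒᵖ))

/-- The opposite multiplication reverses commutators and preserves anticommutators. This accounts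
for the sign in the reality condition of charges on Bosonic, but not on Fermionic, vectors. -/
theorem comm_mk (x y x' y' : E) : comm (mk x y) (mk x' y') = mk (comm x x') (-comm y y') := by
  rw [comm, mk_mul, mk_mul, mk_sub, comm, comm, neg_sub]

theorem acomm_mk (x y x' y' : E) : acomm (mk x y) (mk x' y') = mk (acomm x x') (acomm y y') := by
  rw [acomm, mk_mul, mk_mul, mk_add, acomm, acomm, add_comm (y' * y)]

theorem sum_mk {ι : Type*} (s : Finset ι) (x y : ι → E) :
    ∑ i ∈ s, mk (x i) (y i) = mk (∑ i ∈ s, x i) (∑ i ∈ s, y i) := by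
  classical
  induction s using Finset.induction_on with
  | empty => simp [mk_zero]
  | insert i s hi ih => rw [Finset.sum_insert hi, ih, mk_add, Finset.sum_insert hi,
      Finset.sum_insert hi]

variable [Algebra ℂ E]

instance : Algebra ℂ (Dbl E) where
  smul c p := (c • p.1, MulOpposite.op ((starRingEnd ℂ) c • p.2.unop))
  algebraMap :=
    { toFun := fun c => mk (algebraMap ℂ E c) (algebraMap ℂ E ((starRingEnd ℂ) c))
      map_one' := by simp [mk_one]
      map_mul' := fun c d => by rw [mk_mul, map_mul, map_mul, map_mul, Algebra.commutes ((starRingEnd ℂ) c)]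
      map_zero' := by simp [mk_zero]
      map_add' := fun c d => by rw [mk_add, map_add, map_add, map_add] }
  commutes' c p := by
    obtain ⟨x, y⟩ := p
    exact Prod.ext (Algebra.commutes c x)
      (congrArg MulOpposite.op (Algebra.commutes ((starRingEnd ℂ) c) y.unop).symm)
  smul_def' c p := by
    obtain ⟨x, y⟩ := p
    refine Prod.ext (Algebra.smul_def c x) (congrArg MulOpposite.op ?_)
    exact (Algebra.smul_def _ y.unop).trans (Algebra.commutes _ _)

theorem smul_mk (c : ℂ) (x y : E) : c • mk x y = mk (c • x) ((starRingEnd ℂ) c • y) := rfl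

instance : StarModule ℂ (Dbl E) where
  star_smul c p := by
    obtain ⟨x, y⟩ := p
    refine Prod.ext rfl (congrArg MulOpposite.op ?_)
    change c • x = (starRingEnd ℂ) ((starRingEnd ℂ) c) • x
    rw [conj_conj]

end Dbl

/-- A super vector space with a real structure and compatible causal forms. -/
structure CausalSpace (V₀ V₁ : Type*) [AddCommGroup V₀] [Module ℂ V₀] [AddCommGroup V₁]
    [Module ℂ V₁] where
  ω₀ : V₀ →ₗ[ℂ] V₀ →ₗ[ℂ] ℂ
  ω₁ : V₁ →ₗ[ℂ] V₁ →ₗ[ℂ] ℂ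
  conj₀ : V₀ →ₛₗ[starRingEnd ℂ] V₀
  conj₁ : V₁ →ₛₗ[starRingEnd ℂ] V₁
  ω₀_swap : ∀ v w, ω₀ v w = -ω₀ w v
  ω₁_swap : ∀ v w, ω₁ v w = ω₁ w v
  conj₀_conj₀ : ∀ v, conj₀ (conj₀ v) = v
  conj₁_conj₁ : ∀ v, conj₁ (conj₁ v) = v
  ω₀_conj : ∀ v w, (starRingEnd ℂ) (ω₀ v w) = ω₀ (conj₀ w) (conj₀ v)
  ω₁_conj : ∀ v w, (starRingEnd ℂ) (ω₁ v w) = ω₁ (conj₁ w) (conj₁ v)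

namespace CausalSpace

open SuperWeyl

variable {V₀ V₁ : Type*} [AddCommGroup V₀] [Module ℂ V₀] [AddCommGroup V₁] [Module ℂ V₁]
  (S : CausalSpace V₀ V₁)

/-- The operators on the super Weyl algebra. -/
abbrev Ops : Type _ := Module.End ℂ (SuperWeyl S.ω₀ S.ω₁)

theorem nontrivial_ops : Nontrivial S.Ops := by
  have := SuperWeyl.nontrivial S.ω₀_swap S.ω₁_swap
  infer_instance

/-- The Bosonic field operators. -/
def even : V₀ →ₗ[ℂ] Dbl S.Ops where
  toFun v := Dbl.mk (LinearMap.mulLeft ℂ (ev v)) (LinearMap.mulLeft ℂ (ev (S.conj₀ v)))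
  map_add' v w := by
    rw [Dbl.mk_add]
    congr 1 <;> refine LinearMap.ext fun x => ?_ <;> simp [add_mul]
  map_smul' c v := by
    rw [RingHom.id_apply, Dbl.smul_mk]
    congr 1 <;> refine LinearMap.ext fun x => ?_ <;> simp

/-- The Fermionic field operators. -/
def odd : V₁ →ₗ[ℂ] Dbl S.Ops where
  toFun v := Dbl.mk (LinearMap.mulLeft ℂ (od v)) (LinearMap.mulLeft ℂ (od (S.conj₁ v)))
  map_add' v w := by
    rw [Dbl.mk_add]
    congr 1 <;> refine LinearMap.ext fun x => ?_ <;> simp [add_mul]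
  map_smul' c v := by
    rw [RingHom.id_apply, Dbl.smul_mk]
    congr 1 <;> refine LinearMap.ext fun x => ?_ <;> simp

theorem even_apply (v : V₀) : S.even v
    = Dbl.mk (LinearMap.mulLeft ℂ (ev v)) (LinearMap.mulLeft ℂ (ev (S.conj₀ v))) := rfl

theorem odd_apply (v : V₁) : S.odd v
    = Dbl.mk (LinearMap.mulLeft ℂ (od v)) (LinearMap.mulLeft ℂ (od (S.conj₁ v))) := rfl

theorem star_even (v : V₀) : star (S.even v) = S.even (S.conj₀ v) := by
  rw [even_apply, even_apply, conj₀_conj₀]; rfl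

theorem star_odd (v : V₁) : star (S.odd v) = S.odd (S.conj₁ v) := by
  rw [odd_apply, odd_apply, conj₁_conj₁]; rfl

theorem comm_mulLeft {A : Type*} [Ring A] [Algebra ℂ A] (x y : A) :
    comm (LinearMap.mulLeft ℂ x : Module.End ℂ A) (LinearMap.mulLeft ℂ y)
      = LinearMap.mulLeft ℂ (comm x y) := by
  refine LinearMap.ext fun t => ?_
  simp [comm, sub_mul, mul_assoc]

theorem acomm_mulLeft {A : Type*} [Ring A] [Algebra ℂ A] (x y : A) :
    acomm (LinearMap.mulLeft ℂ x : Module.End ℂ A) (LinearMap.mulLeft ℂ y)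
      = LinearMap.mulLeft ℂ (acomm x y) := by
  refine LinearMap.ext fun t => ?_
  simp [acomm, add_mul, mul_assoc]

theorem mulLeft_algebraMap {A : Type*} [Ring A] [Algebra ℂ A] (c : ℂ) :
    LinearMap.mulLeft ℂ (algebraMap ℂ A c) = c • (1 : Module.End ℂ A) := by
  refine LinearMap.ext fun t => ?_
  simp [Algebra.smul_def]

/-- The second summand must reproduce the conjugate scalar: the sign from the opposite product
cancels the one obtained from reordering the conjugated arguments of ω₀. -/
theorem comm_even_even (v w : V₀) : comm (S.even v) (S.even w) = S.ω₀ v w • 1 := by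
  rw [even_apply, even_apply, Dbl.comm_mk, comm_mulLeft, comm_mulLeft, ev_ev, ev_ev,
    mulLeft_algebraMap, mulLeft_algebraMap, ← Dbl.mk_one, Dbl.smul_mk, ω₀_conj,
    S.ω₀_swap (S.conj₀ w), neg_smul]

theorem acomm_odd_odd (v w : V₁) : acomm (S.odd v) (S.odd w) = S.ω₁ v w • 1 := by
  rw [odd_apply, odd_apply, Dbl.acomm_mk, acomm_mulLeft, acomm_mulLeft, od_od, od_od,
    mulLeft_algebraMap, mulLeft_algebraMap, ← Dbl.mk_one, Dbl.smul_mk, ω₁_conj,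
    S.ω₁_swap (S.conj₁ w)]

theorem comm_even_odd (v : V₀) (w : V₁) : comm (S.even v) (S.odd w) = 0 := by
  rw [even_apply, odd_apply, Dbl.comm_mk, comm_mulLeft, comm_mulLeft, ev_od, ev_od,
    ← Dbl.mk_zero, LinearMap.mulLeft_zero_eq_zero, neg_zero]

section Charges

variable {S} {X Y : S.Ops} {q₀ r₀ : V₀ →ₗ[ℂ] V₁} {q₁ r₁ : V₁ →ₗ[ℂ] V₀}

/-- The hypothesis h is what makes the second components agree: Y must act on conjugated vectors as
minus the conjugate of X. -/
theorem comm_charge_even (hX : IsOddDer X q₀ q₁) (hY : IsOddDer Y r₀ r₁)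
    (h : ∀ v, r₀ (S.conj₀ v) = -S.conj₁ (q₀ v)) (v : V₀) :
    comm (Dbl.mk X Y) (S.even v) = S.odd (q₀ v) := by
  rw [even_apply, odd_apply, Dbl.comm_mk]
  congr 1 <;> refine LinearMap.ext fun t => ?_
  · simp [comm, hX.map_ev]
  · simp [comm, hY.map_ev, h]

theorem acomm_charge_odd (hX : IsOddDer X q₀ q₁) (hY : IsOddDer Y r₀ r₁)
    (h : ∀ v, r₁ (S.conj₁ v) = S.conj₀ (q₁ v)) (v : V₁) :
    acomm (Dbl.mk X Y) (S.odd v) = S.even (q₁ v) := by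
  rw [even_apply, odd_apply, Dbl.acomm_mk]
  congr 1 <;> refine LinearMap.ext fun t => ?_
  · simp [acomm, hX.map_od]
  · simp [acomm, hY.map_od, h]

variable {p₀ : V₀ →ₗ[ℂ] V₀} {p₁ : V₁ →ₗ[ℂ] V₁}

theorem comm_generator_even (hX : IsEvenDer X p₀ p₁)
    (h : ∀ v, p₀ (S.conj₀ v) = -S.conj₀ (p₀ v)) (v : V₀) :
    comm (Dbl.mk X X) (S.even v) = S.even (p₀ v) := by
  rw [even_apply, even_apply, Dbl.comm_mk]
  congr 1 <;> refine LinearMap.ext fun t => ?_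
  · simp [comm, hX.map_ev]
  · simp [comm, hX.map_ev, h]

theorem comm_generator_odd (hX : IsEvenDer X p₀ p₁)
    (h : ∀ v, p₁ (S.conj₁ v) = -S.conj₁ (p₁ v)) (v : V₁) :
    comm (Dbl.mk X X) (S.odd v) = S.odd (p₁ v) := by
  rw [odd_apply, odd_apply, Dbl.comm_mk]
  congr 1 <;> refine LinearMap.ext fun t => ?_
  · simp [comm, hX.map_od]
  · simp [comm, hX.map_od, h]

end Charges

/-- The symmetries of a causal space. -/
structure Symm where
  r₀ : V₀ ≃ₗ[ℂ] V₀
  r₁ : V₁ ≃ₗ[ℂ] V₁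
  ω₀_map : ∀ v w, S.ω₀ (r₀ v) (r₀ w) = S.ω₀ v w
  ω₁_map : ∀ v w, S.ω₁ (r₁ v) (r₁ w) = S.ω₁ v w
  conj₀_map : ∀ v, S.conj₀ (r₀ v) = r₀ (S.conj₀ v)
  conj₁_map : ∀ v, S.conj₁ (r₁ v) = r₁ (S.conj₁ v)

namespace Symm

variable {S} (r s : S.Symm)

/-- The endomorphism of the super Weyl algebra induced by a symmetry. -/
def toAlgHom : SuperWeyl S.ω₀ S.ω₁ →ₐ[ℂ] SuperWeyl S.ω₀ S.ω₁ :=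
  (exists_map (r₀ := r.r₀.toLinearMap) (r₁ := r.r₁.toLinearMap) r.ω₀_map r.ω₁_map).choose

theorem toAlgHom_ev (v : V₀) : r.toAlgHom (ev v) = ev (r.r₀ v) :=
  (exists_map (r₀ := r.r₀.toLinearMap) (r₁ := r.r₁.toLinearMap) r.ω₀_map r.ω₁_map).choose_spec.1 v

theorem toAlgHom_od (v : V₁) : r.toAlgHom (od v) = od (r.r₁ v) :=
  (exists_map (r₀ := r.r₀.toLinearMap) (r₁ := r.r₁.toLinearMap) r.ω₀_map r.ω₁_map).choose_spec.2 v

/-- The inverse symmetry. -/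
def inv : S.Symm where
  r₀ := r.r₀.symm
  r₁ := r.r₁.symm
  ω₀_map v w := by rw [← r.ω₀_map, r.r₀.apply_symm_apply, r.r₀.apply_symm_apply]
  ω₁_map v w := by rw [← r.ω₁_map, r.r₁.apply_symm_apply, r.r₁.apply_symm_apply]
  conj₀_map v := by rw [LinearEquiv.eq_symm_apply, ← r.conj₀_map, r.r₀.apply_symm_apply]
  conj₁_map v := by rw [LinearEquiv.eq_symm_apply, ← r.conj₁_map, r.r₁.apply_symm_apply]

/-- The operator induced by a symmetry. -/
def op : S.Ops := r.toAlgHom.toLinearMap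

theorem op_mul_op {t : S.Symm} (h₀ : ∀ v, r.r₀ (s.r₀ v) = t.r₀ v)
    (h₁ : ∀ v, r.r₁ (s.r₁ v) = t.r₁ v) : r.op * s.op = t.op := by
  have : r.toAlgHom.comp s.toAlgHom = t.toAlgHom := by
    refine algHom_ext (fun v => ?_) fun v => ?_
    · rw [AlgHom.comp_apply, toAlgHom_ev, toAlgHom_ev, toAlgHom_ev, h₀]
    · rw [AlgHom.comp_apply, toAlgHom_od, toAlgHom_od, toAlgHom_od, h₁]
  exact congrArg AlgHom.toLinearMap this

theorem op_mul_inv : r.op * r.inv.op = 1 := by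
  have : r.toAlgHom.comp r.inv.toAlgHom = AlgHom.id ℂ _ := by
    refine algHom_ext (fun v => ?_) fun v => ?_
    · rw [AlgHom.comp_apply, toAlgHom_ev, toAlgHom_ev]
      exact congrArg ev (r.r₀.apply_symm_apply v)
    · rw [AlgHom.comp_apply, toAlgHom_od, toAlgHom_od]
      exact congrArg od (r.r₁.apply_symm_apply v)
  exact congrArg AlgHom.toLinearMap this

theorem inv_mul_op : r.inv.op * r.op = 1 := by
  have : r.inv.toAlgHom.comp r.toAlgHom = AlgHom.id ℂ _ := by
    refine algHom_ext (fun v => ?_) fun v => ?_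
    · rw [AlgHom.comp_apply, toAlgHom_ev, toAlgHom_ev]
      exact congrArg ev (r.r₀.symm_apply_apply v)
    · rw [AlgHom.comp_apply, toAlgHom_od, toAlgHom_od]
      exact congrArg od (r.r₁.symm_apply_apply v)
  exact congrArg AlgHom.toLinearMap this

/-- The unitary `U` with `U^* φ U = r φ`. -/
def toUnitary : unitary (Dbl S.Ops) :=
  ⟨Dbl.mk r.inv.op r.op, by
    rw [Unitary.mem_iff, Dbl.star_mk, Dbl.mk_mul, Dbl.mk_mul, op_mul_inv, inv_mul_op]
    exact ⟨rfl, rfl⟩⟩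

theorem coe_toUnitary : (r.toUnitary : Dbl S.Ops) = Dbl.mk r.inv.op r.op := rfl

/-- Fields transform as U*φU, so in a product of unitaries the left factor acts first. -/
theorem toUnitary_mul {t : S.Symm} (h₀ : ∀ v, s.r₀ (r.r₀ v) = t.r₀ v)
    (h₁ : ∀ v, s.r₁ (r.r₁ v) = t.r₁ v) : r.toUnitary * s.toUnitary = t.toUnitary := by
  apply Subtype.ext
  rw [Submonoid.coe_mul, coe_toUnitary, coe_toUnitary, coe_toUnitary, Dbl.mk_mul,
    op_mul_op s r h₀ h₁, op_mul_op r.inv s.inv (t := t.inv)]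
  · intro v
    change r.r₀.symm (s.r₀.symm v) = t.r₀.symm v
    rw [LinearEquiv.symm_apply_eq, LinearEquiv.symm_apply_eq, h₀, LinearEquiv.apply_symm_apply]
  · intro v
    change r.r₁.symm (s.r₁.symm v) = t.r₁.symm v
    rw [LinearEquiv.symm_apply_eq, LinearEquiv.symm_apply_eq, h₁, LinearEquiv.apply_symm_apply]

theorem conj_toUnitary (x y : S.Ops) :
    star (r.toUnitary : Dbl S.Ops) * Dbl.mk x y * (r.toUnitary : Dbl S.Ops)
      = Dbl.mk (r.op * x * r.inv.op) (r.op * y * r.inv.op) := by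
  rw [coe_toUnitary, Dbl.star_mk, Dbl.mk_mul, Dbl.mk_mul, mul_assoc r.op y]

theorem op_mulLeft (x : SuperWeyl S.ω₀ S.ω₁) :
    r.op * LinearMap.mulLeft ℂ x * r.inv.op = LinearMap.mulLeft ℂ (r.toAlgHom x) := by
  have : r.op * LinearMap.mulLeft ℂ x = LinearMap.mulLeft ℂ (r.toAlgHom x) * r.op := by
    refine LinearMap.ext fun t => ?_
    exact map_mul r.toAlgHom x t
  rw [this, mul_assoc, op_mul_inv, mul_one]

theorem conj_even (v : V₀) : star (r.toUnitary : Dbl S.Ops) * S.even v * (r.toUnitary : Dbl S.Ops)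
    = S.even (r.r₀ v) := by
  rw [even_apply, conj_toUnitary, op_mulLeft, op_mulLeft, toAlgHom_ev, toAlgHom_ev, even_apply,
    conj₀_map]

theorem conj_odd (v : V₁) : star (r.toUnitary : Dbl S.Ops) * S.odd v * (r.toUnitary : Dbl S.Ops)
    = S.odd (r.r₁ v) := by
  rw [odd_apply, conj_toUnitary, op_mulLeft, op_mulLeft, toAlgHom_od, toAlgHom_od, odd_apply,
    conj₁_map]

theorem op_isOddDer {ι : Type*} (s : Finset ι) (c : ι → ℂ) {X : S.Ops} {Y : ι → S.Ops}
    {q₀ : V₀ →ₗ[ℂ] V₁} {q₁ : V₁ →ₗ[ℂ] V₀} {q₀' : ι → V₀ →ₗ[ℂ] V₁} {q₁' : ι → V₁ →ₗ[ℂ] V₀}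
    (hX : IsOddDer X q₀ q₁) (hY : ∀ i, IsOddDer (Y i) (q₀' i) (q₁' i))
    (h₀ : ∀ v, r.r₁ (q₀ v) = ∑ i ∈ s, c i • q₀' i (r.r₀ v))
    (h₁ : ∀ w, r.r₀ (q₁ w) = ∑ i ∈ s, c i • q₁' i (r.r₁ w)) :
    r.op * X * r.inv.op = ∑ i ∈ s, c i • Y i := by
  have := algHom_comp_isOddDer r.toAlgHom (r₀ := r.r₀.toLinearMap) (r₁ := r.r₁.toLinearMap)
    r.toAlgHom_ev r.toAlgHom_od s c hX hY h₀ h₁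
  change r.op * X = (∑ i ∈ s, c i • Y i) * r.op at this
  rw [this, mul_assoc, op_mul_inv, mul_one]

end Symm

end CausalSpace

end

end N2

namespace N2

noncomputable section

open MeasureTheory Complex

/-! ### Test functions on the mass shell -/

/-- The two-sheeted mass hyperboloid. -/
abbrev Shell (m : ℝ) : Type := {k : Spacetime // mink k k = m ^ 2}

variable {m : ℝ}

/-- The antipodal point. -/
def Shell.neg (k : Shell m) : Shell m :=
  ⟨-k.1, by rw [mink_neg_left, mink_comm, mink_neg_left, neg_neg, k.2]⟩

/-- The action of the Lorentz group on the mass hyperboloid. -/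
def Shell.act (A : Matrix.SpecialLinearGroup (Fin 2) ℂ) (k : Shell m) : Shell m :=
  ⟨lorentzAct A k.1, by rw [mink_lorentzAct, k.2]⟩

theorem Shell.neg_neg (k : Shell m) : k.neg.neg = k := Subtype.ext (_root_.neg_neg k.1)

/-- Restriction of the Fourier transform to the mass shell. -/
def onShell (m : ℝ) : Test →ₗ[ℂ] (Shell m → ℂ) where
  toFun f k := minkFourier f k.1
  map_add' f h := funext fun k => minkFourier_add f h k.1
  map_smul' c f := funext fun k => minkFourier_smul c f k.1

/-- The space of on-shell test functions. -/
abbrev ShellTest (m : ℝ) : Type := LinearMap.range (onShell m)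

namespace ShellTest

instance : CoeFun (ShellTest m) fun _ => Shell m → ℂ := ⟨fun t => t.1⟩

@[ext] theorem ext {t t' : ShellTest m} (h : ∀ k, t k = t' k) : t = t' := Subtype.ext (funext h)

@[simp] theorem add_apply (t t' : ShellTest m) (k : Shell m) : (t + t') k = t k + t' k := rfl
@[simp] theorem sub_apply (t t' : ShellTest m) (k : Shell m) : (t - t') k = t k - t' k := rfl
@[simp] theorem neg_apply (t : ShellTest m) (k : Shell m) : (-t) k = -t k := rfl
@[simp] theorem smul_apply (c : ℂ) (t : ShellTest m) (k : Shell m) : (c • t) k = c * t k := rfl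
@[simp] theorem zero_apply (k : Shell m) : (0 : ShellTest m) k = 0 := rfl

@[simp] theorem sum_apply {ι : Type*} (s : Finset ι) (t : ι → ShellTest m) (k : Shell m) :
    (∑ i ∈ s, t i) k = ∑ i ∈ s, t i k := by
  rw [Submodule.coe_sum, Finset.sum_apply]

/-- The on-shell class of a test function. -/
def of (m : ℝ) : Test →ₗ[ℂ] ShellTest m := (onShell m).rangeRestrict

theorem of_apply (f : Test) (k : Shell m) : of m f k = minkFourier f k.1 := rfl

theorem of_surjective (t : ShellTest m) : ∃ f, of m f = t := by
  obtain ⟨f, hf⟩ := t.2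
  exact ⟨f, Subtype.ext hf⟩

/-- Multiplication by the symbol of an operator on test functions. -/
def mul (G : Shell m → ℂ) (X : Test → Test)
    (h : ∀ f (k : Shell m), minkFourier (X f) k.1 = G k * minkFourier f k.1) :
    ShellTest m →ₗ[ℂ] ShellTest m where
  toFun t := ⟨fun k => G k * t k, by
    obtain ⟨f, rfl⟩ := of_surjective t
    exact ⟨X f, funext fun k => h f k⟩⟩
  map_add' t t' := by ext k; exact mul_add _ _ _
  map_smul' c t := by ext k; exact mul_left_comm _ _ _

/-- The operator `σ^μ_{ab} ∂_μ`. -/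
def s (a b : Fin 2) : ShellTest m →ₗ[ℂ] ShellTest m :=
  mul (fun k => -I * sig k.1 a b) (slT a b) fun f k => minkFourier_slT a b f k.1

@[simp] theorem s_apply (a b : Fin 2) (t : ShellTest m) (k : Shell m) :
    s a b t k = -I * sig k.1 a b * t k := rfl

theorem s_of (a b : Fin 2) (f : Test) : s a b (of m f) = of m (slT a b f) := by
  ext k; rw [s_apply, of_apply, of_apply, minkFourier_slT]

/-- The momentum operator `P_μ`. -/
def mom (μ : Fin 4) : ShellTest m →ₗ[ℂ] ShellTest m :=
  mul (fun k => -(g μ * k.1 μ : ℝ)) (fun f => I • dTest μ f) fun f k => by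
    rw [minkFourier_smul, minkFourier_dTest, ← mul_assoc, ← mul_assoc, I_mul_I, neg_one_mul]

@[simp] theorem mom_apply (μ : Fin 4) (t : ShellTest m) (k : Shell m) :
    mom μ t k = -(g μ * k.1 μ : ℝ) * t k := rfl

theorem mom_of (μ : Fin 4) (f : Test) : mom μ (of m f) = of m (I • dTest μ f) := by
  ext k
  rw [mom_apply, of_apply, of_apply, minkFourier_smul, minkFourier_dTest, ← mul_assoc, ← mul_assoc,
    I_mul_I, neg_one_mul]

/-- Complex conjugation of test functions, on the mass shell. -/
def conj : ShellTest m →ₛₗ[starRingEnd ℂ] ShellTest m where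
  toFun t := ⟨fun k => (starRingEnd ℂ) (t k.neg), by
    obtain ⟨f, rfl⟩ := of_surjective t
    exact ⟨conjTest f, funext fun k => minkFourier_conjTest f k.1⟩⟩
  map_add' t t' := by ext k; exact map_add _ _ _
  map_smul' c t := by ext k; exact map_mul _ _ _

@[simp] theorem conj_apply (t : ShellTest m) (k : Shell m) :
    conj t k = (starRingEnd ℂ) (t k.neg) := rfl

theorem conj_of (f : Test) : conj (of m f) = of m (conjTest f) := by
  ext k; exact (minkFourier_conjTest f k.1).symm

@[simp] theorem conj_conj (t : ShellTest m) : conj (conj t) = t := by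
  ext k; simp [Shell.neg_neg]

/-- The action of the Poincaré group. -/
def poincare (a : Spacetime) (A : Matrix.SpecialLinearGroup (Fin 2) ℂ) :
    ShellTest m →ₗ[ℂ] ShellTest m where
  toFun t := ⟨fun k => cexp (I * (mink (lorentzAct A k.1) a : ℂ)) * t (k.act A), by
    obtain ⟨f, rfl⟩ := of_surjective t
    exact ⟨compPoincare a A f, funext fun k =>
      minkFourier_poincare a A f _ (compPoincare_apply a A f) k.1⟩⟩
  map_add' t t' := by ext k; exact mul_add _ _ _
  map_smul' c t := by ext k; exact mul_left_comm _ _ _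

theorem poincare_apply (a : Spacetime) (A : Matrix.SpecialLinearGroup (Fin 2) ℂ)
    (t : ShellTest m) (k : Shell m) : poincare a A t k
      = cexp (I * (mink (lorentzAct A k.1) a : ℂ)) * t (k.act A) := rfl

theorem poincare_of {a : Spacetime} {A : Matrix.SpecialLinearGroup (Fin 2) ℂ} {f h : Test}
    (hh : ∀ x, h x = f (poincareAct a A x)) : poincare a A (of m f) = of m h := by
  ext k; exact (minkFourier_poincare a A f h hh k.1).symm

/-- A right action, since test functions are pulled back; this is the order demanded by U*φU. -/
theorem poincare_poincare (a b : Spacetime) (A B : Matrix.SpecialLinearGroup (Fin 2) ℂ)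
    (t : ShellTest m) :
    poincare b B (poincare a A t) = poincare (a + lorentzAct A b) (A * B) t := by
  ext k
  have e : (k.act B).act A = k.act (A * B) := Subtype.ext (lorentzAct_mul A B k.1).symm
  rw [poincare_apply, poincare_apply, poincare_apply, ← mul_assoc, ← Complex.exp_add, e]
  congr 2
  change I * _ + I * (mink (lorentzAct A (lorentzAct B k.1)) a : ℂ) = _
  rw [lorentzAct_mul, mink_add_right, mink_lorentzAct A (lorentzAct B k.1)]
  push_cast
  ring

theorem poincare_zero_one (t : ShellTest m) : poincare 0 1 t = t := by
  ext k
  have e : k.act 1 = k := Subtype.ext (lorentzAct_one k.1)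
  rw [poincare_apply, e]
  simp [mink]

theorem conj_poincare (a : Spacetime) (A : Matrix.SpecialLinearGroup (Fin 2) ℂ)
    (t : ShellTest m) : conj (poincare a A t) = poincare a A (conj t) := by
  ext k
  have e : k.neg.act A = (k.act A).neg := Subtype.ext (lorentzAct_neg A k.1)
  rw [conj_apply, poincare_apply, poincare_apply, conj_apply, map_mul, ← Complex.exp_conj, e]
  congr 2
  change (starRingEnd ℂ) (I * (mink (lorentzAct A (-k.1)) a : ℂ)) = _
  rw [lorentzAct_neg, mink_neg_left]
  simp

theorem poincare_s (a : Spacetime) (A : Matrix.SpecialLinearGroup (Fin 2) ℂ) (b c : Fin 2)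
    (t : ShellTest m) : poincare a A (s b c t)
      = ∑ b', ∑ c', (A.1 b b' * (starRingEnd ℂ) (A.1 c c')) • s b' c' (poincare a A t) := by
  ext k
  simp only [poincare_apply, s_apply, sum_apply, smul_apply]
  change _ * (-I * sig (lorentzAct A k.1) b c * _) = _
  rw [sig_lorentzAct]
  simp only [Matrix.mul_apply, Matrix.conjTranspose_apply, Fin.sum_univ_two, star_def]
  ring

theorem conj_s (a b : Fin 2) (t : ShellTest m) : conj (s a b t) = s b a (conj t) := by
  ext k
  have h : (starRingEnd ℂ) (sig k.1 a b) = sig k.1 b a := by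
    have := congrFun (congrFun (sig_conjTranspose k.1) b) a
    rwa [Matrix.conjTranspose_apply] at this
  rw [conj_apply, s_apply, s_apply, conj_apply]
  change (starRingEnd ℂ) (-I * sig (-k.1) a b * _) = _
  rw [sig_neg]
  simp [h]

theorem conj_mom (μ : Fin 4) (t : ShellTest m) : conj (mom μ t) = -mom μ (conj t) := by
  ext k
  rw [conj_apply, mom_apply, neg_apply, mom_apply, conj_apply]
  change (starRingEnd ℂ) (-((g μ * (-k.1) μ : ℝ) : ℂ) * _) = _
  simp

theorem s_eq_sum_mom (a b : Fin 2) (t : ShellTest m) :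
    (-I) • s a b t = ∑ μ, sigma μ a b • mom μ t := by
  ext k
  simp only [smul_apply, s_apply, sum_apply, mom_apply, sig, Matrix.sum_apply, Matrix.smul_apply,
    smul_eq_mul]
  simp only [Fin.sum_univ_four]
  linear_combination (sigma 0 a b * ((g 0 * k.1 0 : ℝ) : ℂ) + sigma 1 a b * ((g 1 * k.1 1 : ℝ) : ℂ)
    + sigma 2 a b * ((g 2 * k.1 2 : ℝ) : ℂ) + sigma 3 a b * ((g 3 * k.1 3 : ℝ) : ℂ)) * t k * I_sq

theorem det_sig_shell (k : Shell m) :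
    sig k.1 0 0 * sig k.1 1 1 - sig k.1 0 1 * sig k.1 1 0 = (m : ℂ) ^ 2 := by
  rw [← Matrix.det_fin_two, det_sig, k.2]
  push_cast
  rfl

/-- Extension by zero off the mass shell. -/
def extend (t : ShellTest m) (k : Spacetime) : ℂ :=
  open Classical in if h : mink k k = m ^ 2 then t ⟨k, h⟩ else 0

theorem extend_of (f : Test) {k : Spacetime} (h : mink k k = m ^ 2) :
    extend (of m f) k = minkFourier f k := by
  rw [extend, dif_pos h, of_apply]

theorem shellPair_extend (f h : Test) :
    shellPair m (extend (of m f)) (extend (of m h)) = pauliJordan m f h :=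
  shellPair_congr (fun _ hk => extend_of f hk) fun _ hk => extend_of h hk

/-- The Pauli-Jordan form on the mass shell. -/
def J : ShellTest m →ₗ[ℂ] ShellTest m →ₗ[ℂ] ℂ :=
  LinearMap.mk₂ ℂ (fun t t' => shellPair m (extend t) (extend t'))
    (fun t t' w => by
      obtain ⟨f, rfl⟩ := of_surjective t
      obtain ⟨f', rfl⟩ := of_surjective t'
      obtain ⟨h, rfl⟩ := of_surjective w
      rw [← map_add, shellPair_extend, shellPair_extend, shellPair_extend]
      exact LinearMap.map_add₂ (pauliJordanForm m) f f' h)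
    (fun c t w => by
      obtain ⟨f, rfl⟩ := of_surjective t
      obtain ⟨h, rfl⟩ := of_surjective w
      rw [← map_smul, shellPair_extend, shellPair_extend]
      exact LinearMap.map_smul₂ (pauliJordanForm m) c f h)
    (fun w t t' => by
      obtain ⟨f, rfl⟩ := of_surjective t
      obtain ⟨f', rfl⟩ := of_surjective t'
      obtain ⟨h, rfl⟩ := of_surjective w
      rw [← map_add, shellPair_extend, shellPair_extend, shellPair_extend]
      exact map_add (pauliJordanForm m h) f f')
    (fun c w t => by
      obtain ⟨f, rfl⟩ := of_surjective t
      obtain ⟨h, rfl⟩ := of_surjective w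
      rw [← map_smul, shellPair_extend, shellPair_extend]
      exact map_smul (pauliJordanForm m h) c f)

theorem J_of (f h : Test) : J (of m f) (of m h) = pauliJordan m f h := shellPair_extend f h

theorem J_swap (t t' : ShellTest m) : J t t' = -J t' t := shellPair_swap m _ _

theorem J_s (a b : Fin 2) (t t' : ShellTest m) : J t (s a b t') = -J (s a b t) t' := by
  obtain ⟨f, rfl⟩ := of_surjective t
  obtain ⟨h, rfl⟩ := of_surjective t'
  rw [s_of, s_of, J_of, J_of, pauliJordan_slT]

theorem J_mom (μ : Fin 4) (t t' : ShellTest m) : J t (mom μ t') = -J (mom μ t) t' := by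
  obtain ⟨f, rfl⟩ := of_surjective t
  obtain ⟨h, rfl⟩ := of_surjective t'
  have h1 := shellPair_mul_odd m (fun k => -((g μ * k μ : ℝ) : ℂ)) (fun k => by simp)
    (extend (of m f)) (extend (of m h))
  change shellPair m _ _ = -shellPair m _ _
  have e : ∀ (t : ShellTest m) k, mink k k = m ^ 2 →
      extend (mom μ t) k = -((g μ * k μ : ℝ) : ℂ) * extend t k := by
    intro t k hk
    rw [extend, dif_pos hk, extend, dif_pos hk, mom_apply]
  rw [shellPair_congr (e (of m f)) (fun _ _ => rfl), h1, neg_neg]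
  exact shellPair_congr (fun _ _ => rfl) (e _)

theorem J_conj (t t' : ShellTest m) : (starRingEnd ℂ) (J t t') = J (conj t) (conj t') := by
  obtain ⟨f, rfl⟩ := of_surjective t
  obtain ⟨h, rfl⟩ := of_surjective t'
  rw [conj_of, conj_of, J_of, J_of, pauliJordan_conj]

/-- The translation phases at k and -k cancel, which leaves invariance under the homogeneous part.
-/
theorem J_poincare (a : Spacetime) (A : Matrix.SpecialLinearGroup (Fin 2) ℂ)
    (t t' : ShellTest m) : J (poincare a A t) (poincare a A t') = J t t' := by
  obtain ⟨f, rfl⟩ := of_surjective t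
  obtain ⟨h, rfl⟩ := of_surjective t'
  rw [poincare_of (compPoincare_apply a A f), poincare_of (compPoincare_apply a A h), J_of, J_of,
    ← pauliJordan_lorentz m A f h]
  change shellPair m _ _ = shellPair m _ _
  unfold shellPair
  congr 2
  ext q
  simp only [minkFourier_poincare a A f _ (compPoincare_apply a A f),
    minkFourier_poincare a A h _ (compPoincare_apply a A h), minkFourier_compPoincare_zero,
    lorentzAct_neg, mink_neg_left]
  have e1 : ∀ c : ℝ, cexp (I * (c : ℂ)) * cexp (I * ((-c : ℝ) : ℂ)) = 1 := by
    intro c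
    rw [← Complex.exp_add]
    simp
  linear_combination (1 / (2 * energy m q) : ℂ) *
    (minkFourier f (lorentzAct A (shell m q)) * minkFourier h (-lorentzAct A (shell m q))
      - minkFourier f (-lorentzAct A (shell m q)) * minkFourier h (lorentzAct A (shell m q))) *
    e1 (mink (lorentzAct A (shell m q)) a)

end ShellTest

end

end N2

namespace N2

noncomputable section

/-! ### Complexification of a chiral multiplet -/

/-- The span of the components of a multiplet (without adjoints): `A` collects the causal brackets
of the components, `H` those of components with adjoints, and `κ` is complex conjugation of test
functions. -/
structure ChiralSpace (M₀ M₁ : Type*) [AddCommGroup M₀] [Module ℂ M₀] [AddCommGroup M₁]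
    [Module ℂ M₁] where
  A₀ : M₀ →ₗ[ℂ] M₀ →ₗ[ℂ] ℂ
  A₁ : M₁ →ₗ[ℂ] M₁ →ₗ[ℂ] ℂ
  H₀ : M₀ →ₗ[ℂ] M₀ →ₗ[ℂ] ℂ
  H₁ : M₁ →ₗ[ℂ] M₁ →ₗ[ℂ] ℂ
  κ₀ : M₀ →ₛₗ[starRingEnd ℂ] M₀
  κ₁ : M₁ →ₛₗ[starRingEnd ℂ] M₁
  A₀_swap : ∀ x y, A₀ x y = -A₀ y x
  A₁_swap : ∀ x y, A₁ x y = A₁ y x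
  κ₀_κ₀ : ∀ x, κ₀ (κ₀ x) = x
  κ₁_κ₁ : ∀ x, κ₁ (κ₁ x) = x
  H₀_conj : ∀ x y, (starRingEnd ℂ) (H₀ x y) = H₀ (κ₀ y) (κ₀ x)
  H₁_conj : ∀ x y, (starRingEnd ℂ) (H₁ x y) = H₁ (κ₁ y) (κ₁ x)

namespace ChiralSpace

variable {M₀ M₁ : Type*} [AddCommGroup M₀] [Module ℂ M₀] [AddCommGroup M₁] [Module ℂ M₁]
  (S : ChiralSpace M₀ M₁)

/-- The components together with their adjoints. -/
def double : CausalSpace (M₀ × M₀) (M₁ × M₁) where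
  ω₀ := LinearMap.mk₂ ℂ (fun v w => S.A₀ v.1 w.1 + S.H₀ v.1 w.2 - S.H₀ w.1 v.2
      + (starRingEnd ℂ) (S.A₀ (S.κ₀ w.2) (S.κ₀ v.2)))
    (fun v v' w => by simp only [Prod.fst_add, Prod.snd_add, map_add, LinearMap.add_apply]; ring)
    (fun c v w => by
      simp only [Prod.smul_fst, Prod.smul_snd, map_smul, map_smulₛₗ, LinearMap.smul_apply,
        smul_eq_mul, map_mul, Complex.conj_conj]
      ring)
    (fun v w w' => by simp only [Prod.fst_add, Prod.snd_add, map_add, LinearMap.add_apply]; ring)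
    (fun c v w => by
      simp only [Prod.smul_fst, Prod.smul_snd, map_smul, map_smulₛₗ, LinearMap.smul_apply,
        smul_eq_mul, map_mul, Complex.conj_conj]
      ring)
  ω₁ := LinearMap.mk₂ ℂ (fun v w => S.A₁ v.1 w.1 + S.H₁ v.1 w.2 + S.H₁ w.1 v.2
      + (starRingEnd ℂ) (S.A₁ (S.κ₁ w.2) (S.κ₁ v.2)))
    (fun v v' w => by simp only [Prod.fst_add, Prod.snd_add, map_add, LinearMap.add_apply]; ring)
    (fun c v w => by
      simp only [Prod.smul_fst, Prod.smul_snd, map_smul, map_smulₛₗ, LinearMap.smul_apply,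
        smul_eq_mul, map_mul, Complex.conj_conj]
      ring)
    (fun v w w' => by simp only [Prod.fst_add, Prod.snd_add, map_add, LinearMap.add_apply]; ring)
    (fun c v w => by
      simp only [Prod.smul_fst, Prod.smul_snd, map_smul, map_smulₛₗ, LinearMap.smul_apply,
        smul_eq_mul, map_mul, Complex.conj_conj]
      ring)
  conj₀ :=
    { toFun := fun v => (S.κ₀ v.2, S.κ₀ v.1)
      map_add' := fun v w => by simp
      map_smul' := fun c v => by simp [map_smulₛₗ] }
  conj₁ :=
    { toFun := fun v => (S.κ₁ v.2, S.κ₁ v.1)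
      map_add' := fun v w => by simp
      map_smul' := fun c v => by simp [map_smulₛₗ] }
  ω₀_swap v w := by
    simp only [LinearMap.mk₂_apply]
    rw [S.A₀_swap v.1, S.A₀_swap (S.κ₀ w.2), map_neg]
    ring
  ω₁_swap v w := by
    simp only [LinearMap.mk₂_apply]
    rw [S.A₁_swap v.1, S.A₁_swap (S.κ₁ w.2)]
    ring
  conj₀_conj₀ v := Prod.ext (S.κ₀_κ₀ _) (S.κ₀_κ₀ _)
  conj₁_conj₁ v := Prod.ext (S.κ₁_κ₁ _) (S.κ₁_κ₁ _)
  ω₀_conj v w := by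
    simp only [LinearMap.mk₂_apply, LinearMap.coe_mk, AddHom.coe_mk, map_add, map_sub,
      Complex.conj_conj, S.κ₀_κ₀, S.H₀_conj]
    ring
  ω₁_conj v w := by
    simp only [LinearMap.mk₂_apply, LinearMap.coe_mk, AddHom.coe_mk, map_add,
      Complex.conj_conj, S.κ₁_κ₁, S.H₁_conj]
    ring

theorem double_ω₀ (v w : M₀ × M₀) : S.double.ω₀ v w = S.A₀ v.1 w.1 + S.H₀ v.1 w.2
    - S.H₀ w.1 v.2 + (starRingEnd ℂ) (S.A₀ (S.κ₀ w.2) (S.κ₀ v.2)) := rfl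

theorem double_ω₁ (v w : M₁ × M₁) : S.double.ω₁ v w = S.A₁ v.1 w.1 + S.H₁ v.1 w.2
    + S.H₁ w.1 v.2 + (starRingEnd ℂ) (S.A₁ (S.κ₁ w.2) (S.κ₁ v.2)) := rfl

theorem double_conj₀ (v : M₀ × M₀) : S.double.conj₀ v = (S.κ₀ v.2, S.κ₀ v.1) := rfl

theorem double_conj₁ (v : M₁ × M₁) : S.double.conj₁ v = (S.κ₁ v.2, S.κ₁ v.1) := rfl

section Odd

variable (Q₀ R₀ : M₀ →ₗ[ℂ] M₁) (Q₁ R₁ : M₁ →ₗ[ℂ] M₀)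

/-- The extension of a charge to the adjoint fields, on which it is the conjugate of `R₀`. -/
def charge₀ : M₀ × M₀ →ₗ[ℂ] M₁ × M₁ where
  toFun v := (Q₀ v.1, -S.κ₁ (R₀ (S.κ₀ v.2)))
  map_add' v w := by simp [add_comm]
  map_smul' c v := by simp [map_smulₛₗ]

/-- The extension of a charge to the adjoint fields, on which it is the conjugate of `R₁`. -/
def charge₁ : M₁ × M₁ →ₗ[ℂ] M₀ × M₀ where
  toFun v := (Q₁ v.1, S.κ₀ (R₁ (S.κ₁ v.2)))
  map_add' v w := by simp
  map_smul' c v := by simp [map_smulₛₗ]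

theorem charge₀_apply (v : M₀ × M₀) :
    S.charge₀ Q₀ R₀ v = (Q₀ v.1, -S.κ₁ (R₀ (S.κ₀ v.2))) := rfl

theorem charge₁_apply (v : M₁ × M₁) :
    S.charge₁ Q₁ R₁ v = (Q₁ v.1, S.κ₀ (R₁ (S.κ₁ v.2))) := rfl

theorem charge₀_conj (v : M₀ × M₀) :
    S.charge₀ R₀ Q₀ (S.double.conj₀ v) = -S.double.conj₁ (S.charge₀ Q₀ R₀ v) := by
  simp only [charge₀_apply, double_conj₀, double_conj₁, S.κ₀_κ₀, map_neg, S.κ₁_κ₁, Prod.neg_mk,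
    neg_neg]

theorem charge₁_conj (v : M₁ × M₁) :
    S.charge₁ R₁ Q₁ (S.double.conj₁ v) = S.double.conj₀ (S.charge₁ Q₁ R₁ v) := by
  simp only [charge₁_apply, double_conj₀, double_conj₁, S.κ₀_κ₀, S.κ₁_κ₁]

variable {Q₀ R₀ Q₁ R₁}

/-- Expanded in fields and adjoints the condition has four blocks. Two are `hA` and `hH` directly;
the other two are the complex conjugates of `hA'` and `hH'`, because the charge acts on adjoints
through the conjugate of R. -/
theorem charge_skew (hA : ∀ x y, S.A₁ (Q₀ x) y + S.A₀ x (Q₁ y) = 0)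
    (hA' : ∀ x y, S.A₁ (R₀ x) y + S.A₀ x (R₁ y) = 0)
    (hH : ∀ x y, S.H₁ (Q₀ x) y + S.H₀ x (S.κ₀ (R₁ (S.κ₁ y))) = 0)
    (hH' : ∀ x y, S.H₁ (R₀ x) y + S.H₀ x (S.κ₀ (Q₁ (S.κ₁ y))) = 0) (v : M₀ × M₀) (w : M₁ × M₁) :
    S.double.ω₁ (S.charge₀ Q₀ R₀ v) w + S.double.ω₀ v (S.charge₁ Q₁ R₁ w) = 0 := by
  have h1 := hA v.1 w.1
  have h2 := hH v.1 w.2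
  have h3 := congrArg (starRingEnd ℂ) (hH' (S.κ₀ v.2) (S.κ₁ w.1))
  have h4 := congrArg (starRingEnd ℂ) (hA' (S.κ₀ v.2) (S.κ₁ w.2))
  simp only [map_add, map_zero, S.H₀_conj, S.H₁_conj, S.κ₀_κ₀, S.κ₁_κ₁] at h3 h4
  simp only [double_ω₀, double_ω₁, charge₀_apply, charge₁_apply, map_neg, S.κ₀_κ₀, S.κ₁_κ₁]
  rw [S.A₁_swap (S.κ₁ w.2), S.A₀_swap (R₁ (S.κ₁ w.2)), map_neg]
  linear_combination h1 + h2 - h3 - h4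

end Odd

section Even

variable (p₀ : M₀ →ₗ[ℂ] M₀) (p₁ : M₁ →ₗ[ℂ] M₁)

/-- The extension of a real generator to the adjoint fields. -/
def generator₀ : M₀ × M₀ →ₗ[ℂ] M₀ × M₀ where
  toFun v := (p₀ v.1, -S.κ₀ (p₀ (S.κ₀ v.2)))
  map_add' v w := by simp [add_comm]
  map_smul' c v := by simp [map_smulₛₗ]

/-- The extension of a real generator to the adjoint fields. -/
def generator₁ : M₁ × M₁ →ₗ[ℂ] M₁ × M₁ where
  toFun v := (p₁ v.1, -S.κ₁ (p₁ (S.κ₁ v.2)))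
  map_add' v w := by simp [add_comm]
  map_smul' c v := by simp [map_smulₛₗ]

theorem generator₀_apply (v : M₀ × M₀) :
    S.generator₀ p₀ v = (p₀ v.1, -S.κ₀ (p₀ (S.κ₀ v.2))) := rfl

theorem generator₁_apply (v : M₁ × M₁) :
    S.generator₁ p₁ v = (p₁ v.1, -S.κ₁ (p₁ (S.κ₁ v.2))) := rfl

theorem generator₀_conj (v : M₀ × M₀) :
    S.generator₀ p₀ (S.double.conj₀ v) = -S.double.conj₀ (S.generator₀ p₀ v) := by
  simp only [generator₀_apply, double_conj₀, S.κ₀_κ₀, map_neg, Prod.neg_mk, neg_neg]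

theorem generator₁_conj (v : M₁ × M₁) :
    S.generator₁ p₁ (S.double.conj₁ v) = -S.double.conj₁ (S.generator₁ p₁ v) := by
  simp only [generator₁_apply, double_conj₁, S.κ₁_κ₁, map_neg, Prod.neg_mk, neg_neg]

variable {p₀ p₁}

/-- The relative sign in `hH` reflects that a self-adjoint generator acts on adjoint fields by minus
the conjugated map. -/
theorem generator₀_skew (hA : ∀ x y, S.A₀ (p₀ x) y + S.A₀ x (p₀ y) = 0)
    (hH : ∀ x y, S.H₀ (p₀ x) y - S.H₀ x (S.κ₀ (p₀ (S.κ₀ y))) = 0) (v w : M₀ × M₀) :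
    S.double.ω₀ (S.generator₀ p₀ v) w + S.double.ω₀ v (S.generator₀ p₀ w) = 0 := by
  have h1 := hA v.1 w.1
  have h2 := hH v.1 w.2
  have h3 := hH w.1 v.2
  have h4 := congrArg (starRingEnd ℂ) (hA (S.κ₀ w.2) (S.κ₀ v.2))
  simp only [map_add, map_zero] at h4
  simp only [double_ω₀, generator₀_apply, map_neg, LinearMap.neg_apply, S.κ₀_κ₀]
  linear_combination h1 + h2 - h3 - h4

theorem generator₁_skew (hA : ∀ x y, S.A₁ (p₁ x) y + S.A₁ x (p₁ y) = 0)
    (hH : ∀ x y, S.H₁ (p₁ x) y - S.H₁ x (S.κ₁ (p₁ (S.κ₁ y))) = 0) (v w : M₁ × M₁) :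
    S.double.ω₁ (S.generator₁ p₁ v) w + S.double.ω₁ v (S.generator₁ p₁ w) = 0 := by
  have h1 := hA v.1 w.1
  have h2 := hH v.1 w.2
  have h3 := hH w.1 v.2
  have h4 := congrArg (starRingEnd ℂ) (hA (S.κ₁ w.2) (S.κ₁ v.2))
  simp only [map_add, map_zero] at h4
  simp only [double_ω₁, generator₁_apply, map_neg, LinearMap.neg_apply, S.κ₁_κ₁]
  linear_combination h1 + h2 + h3 - h4

end Even

section Symm

/-- The extension of a symmetry to the adjoint fields. -/
def doubleMap {M : Type*} [AddCommGroup M] [Module ℂ M] (κ : M →ₛₗ[starRingEnd ℂ] M)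
    (r : M →ₗ[ℂ] M) : M × M →ₗ[ℂ] M × M where
  toFun v := (r v.1, κ (r (κ v.2)))
  map_add' v w := by simp
  map_smul' c v := by simp [map_smulₛₗ]

theorem doubleMap_apply {M : Type*} [AddCommGroup M] [Module ℂ M]
    (κ : M →ₛₗ[starRingEnd ℂ] M) (r : M →ₗ[ℂ] M) (v : M × M) :
    doubleMap κ r v = (r v.1, κ (r (κ v.2))) := rfl

/-- The extension of an invertible symmetry to the adjoint fields. -/
def doubleEquiv {M : Type*} [AddCommGroup M] [Module ℂ M] (κ : M →ₛₗ[starRingEnd ℂ] M)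
    (hκ : ∀ x, κ (κ x) = x) (r r' : M →ₗ[ℂ] M) (h : ∀ x, r (r' x) = x) (h' : ∀ x, r' (r x) = x) :
    (M × M) ≃ₗ[ℂ] M × M :=
  LinearEquiv.ofLinearMap (doubleMap κ r) (doubleMap κ r')
    (LinearMap.ext fun v => by
      simp only [LinearMap.comp_apply, doubleMap_apply, hκ, h, LinearMap.id_apply])
    (LinearMap.ext fun v => by
      simp only [LinearMap.comp_apply, doubleMap_apply, hκ, h', LinearMap.id_apply])

/-- The symmetry of the doubled space extending an invertible pair of isometries. -/
def symm (r₀ r₀' : M₀ →ₗ[ℂ] M₀) (r₁ r₁' : M₁ →ₗ[ℂ] M₁) (h₀ : ∀ x, r₀ (r₀' x) = x)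
    (h₀' : ∀ x, r₀' (r₀ x) = x) (h₁ : ∀ x, r₁ (r₁' x) = x) (h₁' : ∀ x, r₁' (r₁ x) = x)
    (hA₀ : ∀ x y, S.A₀ (r₀ x) (r₀ y) = S.A₀ x y) (hA₁ : ∀ x y, S.A₁ (r₁ x) (r₁ y) = S.A₁ x y)
    (hH₀ : ∀ x y, S.H₀ (r₀ x) (S.κ₀ (r₀ (S.κ₀ y))) = S.H₀ x y)
    (hH₁ : ∀ x y, S.H₁ (r₁ x) (S.κ₁ (r₁ (S.κ₁ y))) = S.H₁ x y) : S.double.Symm where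
  r₀ := doubleEquiv S.κ₀ S.κ₀_κ₀ r₀ r₀' h₀ h₀'
  r₁ := doubleEquiv S.κ₁ S.κ₁_κ₁ r₁ r₁' h₁ h₁'
  ω₀_map v w := by
    simp only [double_ω₀, doubleEquiv, LinearEquiv.coe_ofLinearMap, doubleMap_apply, S.κ₀_κ₀, hA₀,
      hH₀]
  ω₁_map v w := by
    simp only [double_ω₁, doubleEquiv, LinearEquiv.coe_ofLinearMap, doubleMap_apply, S.κ₁_κ₁, hA₁,
      hH₁]
  conj₀_map v := by
    simp only [double_conj₀, doubleEquiv, LinearEquiv.coe_ofLinearMap, doubleMap_apply, S.κ₀_κ₀]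
  conj₁_map v := by
    simp only [double_conj₁, doubleEquiv, LinearEquiv.coe_ofLinearMap, doubleMap_apply, S.κ₁_κ₁]

end Symm

end ChiralSpace

end

end N2

namespace N2

noncomputable section

open Complex

/-! ### The chiral multiplet on the mass shell -/

/-- Bosonic vectors: the coefficients of `z`, `D`, `F` and `C`. -/
abbrev Bos (m : ℝ) : Type :=
  ShellTest m × ShellTest m × (Fin 2 → Fin 2 → ShellTest m) × (Fin 2 → Fin 2 → ShellTest m)

/-- Fermionic vectors: the coefficients of `λ` and `χ`. -/
abbrev Fer (m : ℝ) : Type := (Fin 2 → Fin 2 → ShellTest m) × (Fin 2 → Fin 2 → ShellTest m)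

variable {m : ℝ}

theorem Bos.ext_apply {x y : Bos m} (hz : ∀ k, x.1 k = y.1 k) (hD : ∀ k, x.2.1 k = y.2.1 k)
    (hF : ∀ a b k, x.2.2.1 a b k = y.2.2.1 a b k) (hC : ∀ a b k, x.2.2.2 a b k = y.2.2.2 a b k) :
    x = y :=
  Prod.ext (ShellTest.ext hz) (Prod.ext (ShellTest.ext hD) (Prod.ext
    (funext fun a => funext fun b => ShellTest.ext (hF a b))
    (funext fun a => funext fun b => ShellTest.ext (hC a b))))

theorem Fer.ext_apply {x y : Fer m} (hl : ∀ a b k, x.1 a b k = y.1 a b k)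
    (hc : ∀ a b k, x.2 a b k = y.2 a b k) : x = y :=
  Prod.ext (funext fun a => funext fun b => ShellTest.ext (hl a b))
    (funext fun a => funext fun b => ShellTest.ext (hc a b))

namespace Bos

open ShellTest

/-- The supercharge `Q_{ja}` on Bosonic vectors. -/
def q (j a : Fin 2) : Bos m →ₗ[ℂ] Fer m where
  toFun x :=
    (fun l c => delta j l • ∑ b, eps a b • (x.2.2.1 b c + x.2.2.1 c b)
        - delta a c • ∑ k, eps j k • (x.2.2.2 k l + x.2.2.2 l k),
      fun l c => (-I * delta j l * delta a c) • x.1)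
  map_add' x y := by apply Fer.ext_apply <;> intros <;> simp <;> ring
  map_smul' c x := by apply Fer.ext_apply <;> intros <;> simp <;> ring

/-- The conjugate supercharge on Bosonic vectors. -/
def qbar (j a : Fin 2) : Bos m →ₗ[ℂ] Fer m where
  toFun x :=
    (fun k c => (2 * I * eps j k) • ∑ b, epsUp b c • s b a x.2.1,
      fun k b => (-I * eps j k) • ∑ c, s c a (x.2.2.1 b c + x.2.2.1 c b)
        + I • ∑ c, epsUp c b • s c a (x.2.2.2 j k + x.2.2.2 k j))
  map_add' x y := by apply Fer.ext_apply <;> intros <;> simp <;> ring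
  map_smul' c x := by apply Fer.ext_apply <;> intros <;> simp <;> ring

/-- The generator of translations on Bosonic vectors. -/
def mom (μ : Fin 4) : Bos m →ₗ[ℂ] Bos m where
  toFun x := (ShellTest.mom μ x.1, ShellTest.mom μ x.2.1,
    fun a b => (1 / 2 : ℂ) • ShellTest.mom μ (x.2.2.1 a b + x.2.2.1 b a),
    fun a b => (1 / 2 : ℂ) • ShellTest.mom μ (x.2.2.2 a b + x.2.2.2 b a))
  map_add' x y := by apply ext_apply <;> intros <;> simp <;> ring
  map_smul' c x := by apply ext_apply <;> intros <;> simp <;> ring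

/-- Complex conjugation of Bosonic vectors. -/
def conj : Bos m →ₛₗ[starRingEnd ℂ] Bos m where
  toFun x := (ShellTest.conj x.1, ShellTest.conj x.2.1, fun a b => ShellTest.conj (x.2.2.1 a b),
    fun a b => ShellTest.conj (x.2.2.2 a b))
  map_add' x y := by apply ext_apply <;> intros <;> simp
  map_smul' c x := by apply ext_apply <;> intros <;> simp

/-- A transformation acting by `τ` on test functions, by `A` on Weyl indices and by `B` on isospin
indices. -/
def rot (τ : ShellTest m →ₗ[ℂ] ShellTest m) (A B : Matrix (Fin 2) (Fin 2) ℂ) :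
    Bos m →ₗ[ℂ] Bos m where
  toFun x := (τ x.1, τ x.2.1, fun c d => ∑ a, ∑ b, (A a c * A b d) • τ (x.2.2.1 a b),
    fun l n => ∑ j, ∑ k, (B j l * B k n) • τ (x.2.2.2 j k))
  map_add' x y := by apply ext_apply <;> intros <;> simp <;> ring
  map_smul' c x := by apply ext_apply <;> intros <;> simp <;> ring

end Bos

namespace Fer

open ShellTest

/-- The supercharge `Q_{ja}` on Fermionic vectors. -/
def q (j a : Fin 2) : Fer m →ₗ[ℂ] Bos m where
  toFun x := (0, ∑ k, ∑ b, (eps j k * eps a b) • x.1 k b,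
    fun c d => (1 / 2 : ℂ) • ∑ k, eps j k • (delta a c • x.2 k d + delta a d • x.2 k c),
    fun k l => (1 / 2 : ℂ) • ∑ b, eps a b • (delta j k • x.2 l b + delta j l • x.2 k b))
  map_add' x y := by apply Bos.ext_apply <;> intros <;> simp <;> ring
  map_smul' c x := by apply Bos.ext_apply <;> intros <;> simp <;> ring

/-- The conjugate supercharge on Fermionic vectors. -/
def qbar (j a : Fin 2) : Fer m →ₗ[ℂ] Bos m where
  toFun x := ((2 : ℂ) • ∑ b, s b a (x.2 j b), 0,
    fun c f => (1 / 2 * I) • ∑ e, s e a (epsUp e f • x.1 j c + epsUp e c • x.1 j f),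
    fun l k => (1 / 2 * I) • ∑ c, s c a (eps j l • x.1 k c + eps j k • x.1 l c))
  map_add' x y := by apply Bos.ext_apply <;> intros <;> simp <;> ring
  map_smul' c x := by apply Bos.ext_apply <;> intros <;> simp <;> ring

/-- The generator of translations on Fermionic vectors. -/
def mom (μ : Fin 4) : Fer m →ₗ[ℂ] Fer m where
  toFun x := (fun j a => ShellTest.mom μ (x.1 j a), fun j a => ShellTest.mom μ (x.2 j a))
  map_add' x y := by apply ext_apply <;> intros <;> simp
  map_smul' c x := by apply ext_apply <;> intros <;> simp

/-- Complex conjugation of Fermionic vectors. -/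
def conj : Fer m →ₛₗ[starRingEnd ℂ] Fer m where
  toFun x := (fun j a => ShellTest.conj (x.1 j a), fun j a => ShellTest.conj (x.2 j a))
  map_add' x y := by apply ext_apply <;> intros <;> simp
  map_smul' c x := by apply ext_apply <;> intros <;> simp

/-- A transformation acting by `τ` on test functions, by `A` on Weyl indices and by `B` on isospin
indices. -/
def rot (τ : ShellTest m →ₗ[ℂ] ShellTest m) (A B : Matrix (Fin 2) (Fin 2) ℂ) :
    Fer m →ₗ[ℂ] Fer m where
  toFun x := (fun k c => ∑ j, ∑ a, (B j k * A a c) • τ (x.1 j a),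
    fun k c => ∑ j, ∑ a, (B j k * A a c) • τ (x.2 j a))
  map_add' x y := by apply ext_apply <;> intros <;> simp <;> ring
  map_smul' c x := by apply ext_apply <;> intros <;> simp <;> ring

end Fer

end

end N2

/-! ### The supersymmetry algebra on one-particle vectors. -/

namespace N2

noncomputable section

open Complex

set_option linter.unusedSimpArgs false
set_option linter.unnecessarySeqFocus false
set_option linter.unreachableTactic false
set_option linter.unusedTactic false

variable {m : ℝ}

section Algebra

theorem Bos.q_apply (j a : Fin 2) (x : Bos m) : Bos.q j a x =
    (fun l c => delta j l • ∑ b, eps a b • (x.2.2.1 b c + x.2.2.1 c b)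
        - delta a c • ∑ k, eps j k • (x.2.2.2 k l + x.2.2.2 l k),
      fun l c => (-I * delta j l * delta a c) • x.1) := rfl

theorem Bos.qbar_apply (j a : Fin 2) (x : Bos m) : Bos.qbar j a x =
    (fun k c => (2 * I * eps j k) • ∑ b, epsUp b c • ShellTest.s b a x.2.1,
      fun k b => (-I * eps j k) • ∑ c, ShellTest.s c a (x.2.2.1 b c + x.2.2.1 c b)
        + I • ∑ c, epsUp c b • ShellTest.s c a (x.2.2.2 j k + x.2.2.2 k j)) := rfl

theorem Bos.mom_apply (μ : Fin 4) (x : Bos m) : Bos.mom μ x =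
    (ShellTest.mom μ x.1, ShellTest.mom μ x.2.1,
    fun a b => (1 / 2 : ℂ) • ShellTest.mom μ (x.2.2.1 a b + x.2.2.1 b a),
    fun a b => (1 / 2 : ℂ) • ShellTest.mom μ (x.2.2.2 a b + x.2.2.2 b a)) := rfl

theorem Fer.q_apply (j a : Fin 2) (x : Fer m) : Fer.q j a x =
    (0, ∑ k, ∑ b, (eps j k * eps a b) • x.1 k b,
    fun c d => (1 / 2 : ℂ) • ∑ k, eps j k • (delta a c • x.2 k d + delta a d • x.2 k c),
    fun k l => (1 / 2 : ℂ) • ∑ b, eps a b • (delta j k • x.2 l b + delta j l • x.2 k b)) := rfl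

theorem Fer.qbar_apply (j a : Fin 2) (x : Fer m) : Fer.qbar j a x =
    ((2 : ℂ) • ∑ b, ShellTest.s b a (x.2 j b), 0,
    fun c f => (1 / 2 * I) • ∑ e, ShellTest.s e a (epsUp e f • x.1 j c + epsUp e c • x.1 j f),
    fun l k => (1 / 2 * I) • ∑ c, ShellTest.s c a (eps j l • x.1 k c + eps j k • x.1 l c)) := rfl

theorem Fer.mom_apply (μ : Fin 4) (x : Fer m) : Fer.mom μ x =
    (fun j a => ShellTest.mom μ (x.1 j a), fun j a => ShellTest.mom μ (x.2 j a)) := rfl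

/-- Bosonic vectors carry all four components of F and of C. The momentum acts through their
symmetric parts, as the charges do, so no symmetry constraint has to be imposed on vectors. -/
theorem Bos.sum_sigma_mom (a b : Fin 2) (x : Bos m) : ∑ μ, sigma μ a b • Bos.mom μ x =
    ((-I) • ShellTest.s a b x.1, (-I) • ShellTest.s a b x.2.1,
    fun c d => (-I) • ShellTest.s a b ((1 / 2 : ℂ) • (x.2.2.1 c d + x.2.2.1 d c)),
    fun c d => (-I) • ShellTest.s a b ((1 / 2 : ℂ) • (x.2.2.2 c d + x.2.2.2 d c))) := by
  simp only [ShellTest.s_eq_sum_mom]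
  apply Bos.ext_apply <;> intros <;>
    simp only [Bos.mom_apply, Prod.fst_sum, Prod.snd_sum, Finset.sum_apply, Prod.smul_fst,
      Prod.smul_snd, Pi.smul_apply, map_smul]

theorem Fer.sum_sigma_mom (a b : Fin 2) (x : Fer m) : ∑ μ, sigma μ a b • Fer.mom μ x =
    (fun c d => (-I) • ShellTest.s a b (x.1 c d), fun c d => (-I) • ShellTest.s a b (x.2 c d)) := by
  simp only [ShellTest.s_eq_sum_mom]
  apply Fer.ext_apply <;> intros <;>
    simp only [Fer.mom_apply, Prod.fst_sum, Prod.snd_sum, Finset.sum_apply, Prod.smul_fst,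
      Prod.smul_snd, Pi.smul_apply]

set_option maxHeartbeats 1000000 in
theorem Fer.q_q (j a k b : Fin 2) (x : Bos m) :
    Fer.q j a (Bos.q k b x) + Fer.q k b (Bos.q j a x) = 0 := by
  apply Bos.ext_apply
  · intros; simp [Fer.q_apply, Bos.q_apply]
  · intro p
    simp only [Fer.q_apply, Bos.q_apply, Prod.fst_add, Prod.snd_add, Pi.add_apply, Prod.fst_zero,
      Prod.snd_zero, Pi.zero_apply, Prod.smul_fst, Prod.smul_snd, Pi.smul_apply,
      ShellTest.add_apply, ShellTest.sub_apply, ShellTest.smul_apply,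
      ShellTest.zero_apply, ShellTest.sum_apply, ShellTest.s_apply, Fin.sum_univ_two]
    revert j a k b
    simp only [Fin.forall_fin_two, eps_00, eps_01, eps_10, eps_11, epsUp_00, epsUp_01, epsUp_10,
      epsUp_11, delta_self, delta_01, delta_10, mul_zero, zero_mul, mul_one, one_mul, add_zero,
      zero_add, sub_zero, zero_sub, true_and, and_true]
    repeat' apply And.intro
    all_goals ring
  · intro c d p
    simp only [Fer.q_apply, Bos.q_apply, Prod.fst_add, Prod.snd_add, Pi.add_apply, Prod.fst_zero,
      Prod.snd_zero, Pi.zero_apply, Prod.smul_fst, Prod.smul_snd, Pi.smul_apply,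
      ShellTest.add_apply, ShellTest.sub_apply, ShellTest.smul_apply,
      ShellTest.zero_apply, ShellTest.sum_apply, ShellTest.s_apply, Fin.sum_univ_two]
    revert j a k b
    simp only [Fin.forall_fin_two, eps_00, eps_01, eps_10, eps_11, epsUp_00, epsUp_01, epsUp_10,
      epsUp_11, delta_self, delta_01, delta_10, mul_zero, zero_mul, mul_one, one_mul, add_zero,
      zero_add, sub_zero, zero_sub, true_and, and_true]
    repeat' apply And.intro
    all_goals ring
  · intro c d p
    simp only [Fer.q_apply, Bos.q_apply, Prod.fst_add, Prod.snd_add, Pi.add_apply, Prod.fst_zero,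
      Prod.snd_zero, Pi.zero_apply, Prod.smul_fst, Prod.smul_snd, Pi.smul_apply,
      ShellTest.add_apply, ShellTest.sub_apply, ShellTest.smul_apply,
      ShellTest.zero_apply, ShellTest.sum_apply, ShellTest.s_apply, Fin.sum_univ_two]
    revert j a k b
    simp only [Fin.forall_fin_two, eps_00, eps_01, eps_10, eps_11, epsUp_00, epsUp_01, epsUp_10,
      epsUp_11, delta_self, delta_01, delta_10, mul_zero, zero_mul, mul_one, one_mul, add_zero,
      zero_add, sub_zero, zero_sub, true_and, and_true]
    repeat' apply And.intro
    all_goals ring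

set_option maxHeartbeats 1000000 in
theorem Bos.q_q (j a k b : Fin 2) (x : Fer m) :
    Bos.q j a (Fer.q k b x) + Bos.q k b (Fer.q j a x) = 0 := by
  apply Fer.ext_apply
  · intro c d p
    simp only [Fer.q_apply, Bos.q_apply, Prod.fst_add, Prod.snd_add, Pi.add_apply, Prod.fst_zero,
      Prod.snd_zero, Pi.zero_apply, Prod.smul_fst, Prod.smul_snd, Pi.smul_apply,
      ShellTest.add_apply, ShellTest.sub_apply, ShellTest.smul_apply,
      ShellTest.zero_apply, ShellTest.sum_apply, ShellTest.s_apply, Fin.sum_univ_two]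
    revert j a k b c d
    simp only [Fin.forall_fin_two, eps_00, eps_01, eps_10, eps_11, epsUp_00, epsUp_01, epsUp_10,
      epsUp_11, delta_self, delta_01, delta_10, mul_zero, zero_mul, mul_one, one_mul, add_zero,
      zero_add, sub_zero, zero_sub, true_and, and_true]
    repeat' apply And.intro
    all_goals ring
  · intros; simp [Fer.q_apply, Bos.q_apply]

set_option maxHeartbeats 1000000 in
-- Required alongside the relation for Q, because a charge acts on the adjoint fields through the
-- conjugate charge.
theorem Fer.qbar_qbar (j a k b : Fin 2) (x : Bos m) :
    Fer.qbar j a (Bos.qbar k b x) + Fer.qbar k b (Bos.qbar j a x) = 0 := by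
  apply Bos.ext_apply
  · intro p
    simp only [Fer.qbar_apply, Bos.qbar_apply, Prod.fst_add, Prod.snd_add, Pi.add_apply, Prod.fst_zero,
      Prod.snd_zero, Pi.zero_apply, Prod.smul_fst, Prod.smul_snd, Pi.smul_apply,
      ShellTest.add_apply, ShellTest.sub_apply, ShellTest.smul_apply,
      ShellTest.zero_apply, ShellTest.sum_apply, ShellTest.s_apply, Fin.sum_univ_two]
    revert j a k b
    simp only [Fin.forall_fin_two, eps_00, eps_01, eps_10, eps_11, epsUp_00, epsUp_01, epsUp_10,
      epsUp_11, delta_self, delta_01, delta_10, mul_zero, zero_mul, mul_one, one_mul, add_zero,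
      zero_add, sub_zero, zero_sub, true_and, and_true]
    repeat' apply And.intro
    all_goals ring
  · intros; simp [Fer.qbar_apply, Bos.qbar_apply]
  · intro c d p
    simp only [Fer.qbar_apply, Bos.qbar_apply, Prod.fst_add, Prod.snd_add, Pi.add_apply, Prod.fst_zero,
      Prod.snd_zero, Pi.zero_apply, Prod.smul_fst, Prod.smul_snd, Pi.smul_apply,
      ShellTest.add_apply, ShellTest.sub_apply, ShellTest.smul_apply,
      ShellTest.zero_apply, ShellTest.sum_apply, ShellTest.s_apply, Fin.sum_univ_two]
    revert j a k b
    simp only [Fin.forall_fin_two, eps_00, eps_01, eps_10, eps_11, epsUp_00, epsUp_01, epsUp_10,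
      epsUp_11, delta_self, delta_01, delta_10, mul_zero, zero_mul, mul_one, one_mul, add_zero,
      zero_add, sub_zero, zero_sub, true_and, and_true]
    repeat' apply And.intro
    all_goals ring
  · intro c d p
    simp only [Fer.qbar_apply, Bos.qbar_apply, Prod.fst_add, Prod.snd_add, Pi.add_apply, Prod.fst_zero,
      Prod.snd_zero, Pi.zero_apply, Prod.smul_fst, Prod.smul_snd, Pi.smul_apply,
      ShellTest.add_apply, ShellTest.sub_apply, ShellTest.smul_apply,
      ShellTest.zero_apply, ShellTest.sum_apply, ShellTest.s_apply, Fin.sum_univ_two]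
    revert j a k b
    simp only [Fin.forall_fin_two, eps_00, eps_01, eps_10, eps_11, epsUp_00, epsUp_01, epsUp_10,
      epsUp_11, delta_self, delta_01, delta_10, mul_zero, zero_mul, mul_one, one_mul, add_zero,
      zero_add, sub_zero, zero_sub, true_and, and_true]
    repeat' apply And.intro
    all_goals ring

set_option maxHeartbeats 1000000 in
theorem Bos.qbar_qbar (j a k b : Fin 2) (x : Fer m) :
    Bos.qbar j a (Fer.qbar k b x) + Bos.qbar k b (Fer.qbar j a x) = 0 := by
  apply Fer.ext_apply
  · intro c d p
    simp only [Fer.qbar_apply, Bos.qbar_apply, Prod.fst_add, Prod.snd_add, Pi.add_apply, Prod.fst_zero,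
      Prod.snd_zero, Pi.zero_apply, Prod.smul_fst, Prod.smul_snd, Pi.smul_apply,
      ShellTest.add_apply, ShellTest.sub_apply, ShellTest.smul_apply,
      ShellTest.zero_apply, ShellTest.sum_apply, ShellTest.s_apply, Fin.sum_univ_two]
    revert j a k b
    simp only [Fin.forall_fin_two, eps_00, eps_01, eps_10, eps_11, epsUp_00, epsUp_01, epsUp_10,
      epsUp_11, delta_self, delta_01, delta_10, mul_zero, zero_mul, mul_one, one_mul, add_zero,
      zero_add, sub_zero, zero_sub, true_and, and_true]
    repeat' apply And.intro
    all_goals ring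
  · intro c d p
    simp only [Fer.qbar_apply, Bos.qbar_apply, Prod.fst_add, Prod.snd_add, Pi.add_apply, Prod.fst_zero,
      Prod.snd_zero, Pi.zero_apply, Prod.smul_fst, Prod.smul_snd, Pi.smul_apply,
      ShellTest.add_apply, ShellTest.sub_apply, ShellTest.smul_apply,
      ShellTest.zero_apply, ShellTest.sum_apply, ShellTest.s_apply, Fin.sum_univ_two]
    revert j a k b c d
    simp only [Fin.forall_fin_two, eps_00, eps_01, eps_10, eps_11, epsUp_00, epsUp_01, epsUp_10,
      epsUp_11, delta_self, delta_01, delta_10, mul_zero, zero_mul, mul_one, one_mul, add_zero,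
      zero_add, sub_zero, zero_sub, true_and, and_true]
    repeat' apply And.intro
    all_goals ring

set_option maxHeartbeats 1000000 in
-- Valid on every vector: the products of charges and the momentum on the right both project onto
-- the symmetric parts of F and C. After evaluation at a shell point it is a finite identity, linear
-- in the entries of σ·k.
theorem Fer.q_qbar (j a k b : Fin 2) (x : Bos m) :
    Fer.q j a (Bos.qbar k b x) + Fer.qbar k b (Bos.q j a x)
      = (2 * delta j k) • ∑ μ, sigma μ a b • Bos.mom μ x := by
  rw [Bos.sum_sigma_mom]
  apply Bos.ext_apply
  · intro p
    simp only [Fer.q_apply, Bos.q_apply, Fer.qbar_apply, Bos.qbar_apply, Prod.fst_add, Prod.snd_add, Pi.add_apply, Prod.fst_zero,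
      Prod.snd_zero, Pi.zero_apply, Prod.smul_fst, Prod.smul_snd, Pi.smul_apply,
      ShellTest.add_apply, ShellTest.sub_apply, ShellTest.smul_apply,
      ShellTest.zero_apply, ShellTest.sum_apply, ShellTest.s_apply, Fin.sum_univ_two]
    revert j a k b
    simp only [Fin.forall_fin_two, eps_00, eps_01, eps_10, eps_11, epsUp_00, epsUp_01, epsUp_10,
      epsUp_11, delta_self, delta_01, delta_10, mul_zero, zero_mul, mul_one, one_mul, add_zero,
      zero_add, sub_zero, zero_sub, true_and, and_true]
    repeat' apply And.intro
    all_goals ring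
  · intro p
    simp only [Fer.q_apply, Bos.q_apply, Fer.qbar_apply, Bos.qbar_apply, Prod.fst_add, Prod.snd_add, Pi.add_apply, Prod.fst_zero,
      Prod.snd_zero, Pi.zero_apply, Prod.smul_fst, Prod.smul_snd, Pi.smul_apply,
      ShellTest.add_apply, ShellTest.sub_apply, ShellTest.smul_apply,
      ShellTest.zero_apply, ShellTest.sum_apply, ShellTest.s_apply, Fin.sum_univ_two]
    revert j a k b
    simp only [Fin.forall_fin_two, eps_00, eps_01, eps_10, eps_11, epsUp_00, epsUp_01, epsUp_10,
      epsUp_11, delta_self, delta_01, delta_10, mul_zero, zero_mul, mul_one, one_mul, add_zero,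
      zero_add, sub_zero, zero_sub, true_and, and_true]
    repeat' apply And.intro
    all_goals ring
  · intro c d p
    simp only [Fer.q_apply, Bos.q_apply, Fer.qbar_apply, Bos.qbar_apply, Prod.fst_add, Prod.snd_add, Pi.add_apply, Prod.fst_zero,
      Prod.snd_zero, Pi.zero_apply, Prod.smul_fst, Prod.smul_snd, Pi.smul_apply,
      ShellTest.add_apply, ShellTest.sub_apply, ShellTest.smul_apply,
      ShellTest.zero_apply, ShellTest.sum_apply, ShellTest.s_apply, Fin.sum_univ_two]
    revert j a k b c d
    simp only [Fin.forall_fin_two, eps_00, eps_01, eps_10, eps_11, epsUp_00, epsUp_01, epsUp_10,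
      epsUp_11, delta_self, delta_01, delta_10, mul_zero, zero_mul, mul_one, one_mul, add_zero,
      zero_add, sub_zero, zero_sub, true_and, and_true]
    repeat' apply And.intro
    all_goals ring
  · intro c d p
    simp only [Fer.q_apply, Bos.q_apply, Fer.qbar_apply, Bos.qbar_apply, Prod.fst_add, Prod.snd_add, Pi.add_apply, Prod.fst_zero,
      Prod.snd_zero, Pi.zero_apply, Prod.smul_fst, Prod.smul_snd, Pi.smul_apply,
      ShellTest.add_apply, ShellTest.sub_apply, ShellTest.smul_apply,
      ShellTest.zero_apply, ShellTest.sum_apply, ShellTest.s_apply, Fin.sum_univ_two]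
    revert j a k b c d
    simp only [Fin.forall_fin_two, eps_00, eps_01, eps_10, eps_11, epsUp_00, epsUp_01, epsUp_10,
      epsUp_11, delta_self, delta_01, delta_10, mul_zero, zero_mul, mul_one, one_mul, add_zero,
      zero_add, sub_zero, zero_sub, true_and, and_true]
    repeat' apply And.intro
    all_goals ring

set_option maxHeartbeats 1000000 in
theorem Bos.q_qbar (j a k b : Fin 2) (x : Fer m) :
    Bos.q j a (Fer.qbar k b x) + Bos.qbar k b (Fer.q j a x)
      = (2 * delta j k) • ∑ μ, sigma μ a b • Fer.mom μ x := by
  rw [Fer.sum_sigma_mom]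
  apply Fer.ext_apply
  · intro c d p
    simp only [Fer.q_apply, Bos.q_apply, Fer.qbar_apply, Bos.qbar_apply, Prod.fst_add, Prod.snd_add, Pi.add_apply, Prod.fst_zero,
      Prod.snd_zero, Pi.zero_apply, Prod.smul_fst, Prod.smul_snd, Pi.smul_apply,
      ShellTest.add_apply, ShellTest.sub_apply, ShellTest.smul_apply,
      ShellTest.zero_apply, ShellTest.sum_apply, ShellTest.s_apply, Fin.sum_univ_two]
    revert j a k b c d
    simp only [Fin.forall_fin_two, eps_00, eps_01, eps_10, eps_11, epsUp_00, epsUp_01, epsUp_10,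
      epsUp_11, delta_self, delta_01, delta_10, mul_zero, zero_mul, mul_one, one_mul, add_zero,
      zero_add, sub_zero, zero_sub, true_and, and_true]
    repeat' apply And.intro
    all_goals ring
  · intro c d p
    simp only [Fer.q_apply, Bos.q_apply, Fer.qbar_apply, Bos.qbar_apply, Prod.fst_add, Prod.snd_add, Pi.add_apply, Prod.fst_zero,
      Prod.snd_zero, Pi.zero_apply, Prod.smul_fst, Prod.smul_snd, Pi.smul_apply,
      ShellTest.add_apply, ShellTest.sub_apply, ShellTest.smul_apply,
      ShellTest.zero_apply, ShellTest.sum_apply, ShellTest.s_apply, Fin.sum_univ_two]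
    revert j a k b c d
    simp only [Fin.forall_fin_two, eps_00, eps_01, eps_10, eps_11, epsUp_00, epsUp_01, epsUp_10,
      epsUp_11, delta_self, delta_01, delta_10, mul_zero, zero_mul, mul_one, one_mul, add_zero,
      zero_add, sub_zero, zero_sub, true_and, and_true]
    repeat' apply And.intro
    all_goals ring

theorem Fer.mom_q (μ : Fin 4) (j a : Fin 2) (x : Bos m) :
    Fer.mom μ (Bos.q j a x) = Bos.q j a (Bos.mom μ x) := by
  apply Fer.ext_apply <;> intros <;>
    simp [Bos.q_apply, Bos.mom_apply, Fer.mom_apply] <;> ring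

theorem Bos.mom_q (μ : Fin 4) (j a : Fin 2) (x : Fer m) :
    Bos.mom μ (Fer.q j a x) = Fer.q j a (Fer.mom μ x) := by
  apply Bos.ext_apply <;> intros <;>
    simp [Fer.q_apply, Bos.mom_apply, Fer.mom_apply] <;> ring

theorem Fer.mom_qbar (μ : Fin 4) (j a : Fin 2) (x : Bos m) :
    Fer.mom μ (Bos.qbar j a x) = Bos.qbar j a (Bos.mom μ x) := by
  apply Fer.ext_apply <;> intros <;>
    simp [Bos.qbar_apply, Bos.mom_apply, Fer.mom_apply] <;> ring

theorem Bos.mom_qbar (μ : Fin 4) (j a : Fin 2) (x : Fer m) :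
    Bos.mom μ (Fer.qbar j a x) = Fer.qbar j a (Fer.mom μ x) := by
  apply Bos.ext_apply <;> intros <;>
    simp [Fer.qbar_apply, Bos.mom_apply, Fer.mom_apply] <;> ring

end Algebra

end

end N2

/-! ### Covariance of the charges under Lorentz and isospin transformations. -/

namespace N2

noncomputable section

open Complex

set_option linter.unusedSimpArgs false
set_option linter.unnecessarySeqFocus false

variable {m : ℝ}

section Covariance

variable {τ τ' : ShellTest m →ₗ[ℂ] ShellTest m} {A A' B B' : Matrix (Fin 2) (Fin 2) ℂ}

theorem Bos.rot_apply (τ : ShellTest m →ₗ[ℂ] ShellTest m) (A B : Matrix (Fin 2) (Fin 2) ℂ)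
    (x : Bos m) : Bos.rot τ A B x =
    (τ x.1, τ x.2.1, fun c d => ∑ a, ∑ b, (A a c * A b d) • τ (x.2.2.1 a b),
    fun l n => ∑ j, ∑ k, (B j l * B k n) • τ (x.2.2.2 j k)) := rfl

theorem Fer.rot_apply (τ : ShellTest m →ₗ[ℂ] ShellTest m) (A B : Matrix (Fin 2) (Fin 2) ℂ)
    (x : Fer m) : Fer.rot τ A B x = (fun k c => ∑ j, ∑ a, (B j k * A a c) • τ (x.1 j a),
    fun k c => ∑ j, ∑ a, (B j k * A a c) • τ (x.2 j a)) := rfl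

theorem Bos.rot_rot (x : Bos m) :
    Bos.rot τ A B (Bos.rot τ' A' B' x) = Bos.rot (τ ∘ₗ τ') (A' * A) (B' * B) x := by
  apply Bos.ext_apply <;> intros <;>
    simp [Bos.rot_apply, Matrix.mul_apply, Fin.sum_univ_two] <;> ring

theorem Fer.rot_rot (x : Fer m) :
    Fer.rot τ A B (Fer.rot τ' A' B' x) = Fer.rot (τ ∘ₗ τ') (A' * A) (B' * B) x := by
  apply Fer.ext_apply <;> intros <;>
    simp [Fer.rot_apply, Matrix.mul_apply, Fin.sum_univ_two] <;> ring

theorem Bos.rot_id (x : Bos m) : Bos.rot LinearMap.id 1 1 x = x := by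
  apply Bos.ext_apply <;> simp [Bos.rot_apply, Fin.forall_fin_two]

theorem Fer.rot_id (x : Fer m) : Fer.rot LinearMap.id 1 1 x = x := by
  apply Fer.ext_apply <;> simp [Fer.rot_apply, Fin.forall_fin_two]

/-- `τ`, acting on test functions, together with the actions of `A` on Weyl indices and of `B` on
isospin indices, is a symmetry of the one-particle structure. -/
structure IsSymmetry (τ : ShellTest m →ₗ[ℂ] ShellTest m) (A B : Matrix (Fin 2) (Fin 2) ℂ) :
    Prop where
  det_weyl : A.det = 1
  det_isospin : B.det = 1
  conj_isospin : ∀ j k, (starRingEnd ℂ) (B j k) = ∑ l, ∑ n, eps j l * B l n * eps k n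
  map_s : ∀ a b t, τ (ShellTest.s a b t)
    = ∑ a', ∑ b', (A a a' * (starRingEnd ℂ) (A b b')) • ShellTest.s a' b' (τ t)
  map_conj : ∀ t, τ (ShellTest.conj t) = ShellTest.conj (τ t)
  map_J : ∀ t t', ShellTest.J (τ t) (τ t') = ShellTest.J t t'

set_option maxHeartbeats 1000000 in
-- The tensors ε are preserved by matrices of determinant one, and the charge contains nothing else
-- that is sensitive to A or B.
theorem Fer.rot_q (h : IsSymmetry τ A B) (j a : Fin 2) (x : Bos m) :
    Fer.rot τ A B (Bos.q j a x) = ∑ k, ∑ b, (B j k * A a b) • Bos.q k b (Bos.rot τ A B x) := by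
  have hA := h.det_weyl
  have hB := h.det_isospin
  have hconj := h.conj_isospin
  simp only [Matrix.det_fin_two] at hA hB
  simp only [Fin.forall_fin_two, Fin.sum_univ_two, eps_00, eps_01, eps_10, eps_11, mul_zero,
    zero_mul, mul_one, one_mul, add_zero, zero_add, neg_mul, mul_neg, neg_neg] at hconj
  apply Fer.ext_apply
  · intro c d p
    simp only [Bos.q_apply, Bos.rot_apply, Fer.rot_apply, Fin.sum_univ_two, Prod.fst_add, Prod.snd_add, Prod.smul_fst,
      Prod.smul_snd, Pi.add_apply, Pi.smul_apply, map_add, map_sub, map_smul, map_zero, h.map_s,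
      ShellTest.add_apply, ShellTest.sub_apply, ShellTest.smul_apply, ShellTest.zero_apply,
      ShellTest.s_apply]
    -- The determinant relations replace A ε Aᵀ and B ε Bᵀ by ε; the multipliers are the F and C
    -- terms in which such a contraction occurs.
    linear_combination (norm := skip) -(B j c * ∑ e, ∑ f, eps a e * (τ (x.2.2.1 e f) p + τ (x.2.2.1 f e) p) * A f d) * hA
      + (A a d * ∑ e, ∑ f, eps j e * (τ (x.2.2.2 e f) p + τ (x.2.2.2 f e) p) * B f c) * hB
    simp only [Fin.sum_univ_two]
    revert j a c d
    simp only [Fin.forall_fin_two, hconj, eps_00, eps_01, eps_10, eps_11, epsUp_00, epsUp_01, epsUp_10,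
      epsUp_11, delta_self, delta_01, delta_10, mul_zero, zero_mul, mul_one, one_mul, add_zero,
      zero_add, sub_zero, zero_sub, neg_zero, true_and, and_true]
    repeat' apply And.intro
    all_goals ring
  · intro c d p
    simp only [Bos.q_apply, Bos.rot_apply, Fer.rot_apply, Fin.sum_univ_two, Prod.fst_add, Prod.snd_add, Prod.smul_fst,
      Prod.smul_snd, Pi.add_apply, Pi.smul_apply, map_add, map_sub, map_smul, map_zero, h.map_s,
      ShellTest.add_apply, ShellTest.sub_apply, ShellTest.smul_apply, ShellTest.zero_apply,
      ShellTest.s_apply]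
    revert j a c d
    simp only [Fin.forall_fin_two, hconj, eps_00, eps_01, eps_10, eps_11, epsUp_00, epsUp_01, epsUp_10,
      epsUp_11, delta_self, delta_01, delta_10, mul_zero, zero_mul, mul_one, one_mul, add_zero,
      zero_add, sub_zero, zero_sub, neg_zero, true_and, and_true]

set_option maxHeartbeats 1000000 in
-- Dotted indices rotate with the conjugate of A, supplied by the covariance of σ·∂. The conjugate
-- of B is rewritten as ε B εᵀ, which expresses that it is special unitary.
theorem Fer.rot_qbar (h : IsSymmetry τ A B) (j a : Fin 2) (x : Bos m) :
    Fer.rot τ A B (Bos.qbar j a x) = ∑ k, ∑ b,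
      ((starRingEnd ℂ) (B j k) * (starRingEnd ℂ) (A a b)) • Bos.qbar k b (Bos.rot τ A B x) := by
  have hA := h.det_weyl
  have hB := h.det_isospin
  have hconj := h.conj_isospin
  simp only [Matrix.det_fin_two] at hA hB
  simp only [Fin.forall_fin_two, Fin.sum_univ_two, eps_00, eps_01, eps_10, eps_11, mul_zero,
    zero_mul, mul_one, one_mul, add_zero, zero_add, neg_mul, mul_neg, neg_neg] at hconj
  apply Fer.ext_apply
  · intro c d p
    simp only [Bos.qbar_apply, Bos.rot_apply, Fer.rot_apply, Fin.sum_univ_two, Prod.fst_add, Prod.snd_add, Prod.smul_fst,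
      Prod.smul_snd, Pi.add_apply, Pi.smul_apply, map_add, map_sub, map_smul, map_zero, h.map_s,
      ShellTest.add_apply, ShellTest.sub_apply, ShellTest.smul_apply, ShellTest.zero_apply,
      ShellTest.s_apply]
    linear_combination (norm := skip) (2 * I * (∑ l, B l c * eps j l) * ∑ e, ∑ f,
      epsUp e d * (starRingEnd ℂ) (A a f) * (-I * sig p.1 e f * τ x.2.1 p)) * hA
    simp only [Fin.sum_univ_two]
    revert j a c d
    simp only [Fin.forall_fin_two, hconj, eps_00, eps_01, eps_10, eps_11, epsUp_00, epsUp_01, epsUp_10,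
      epsUp_11, delta_self, delta_01, delta_10, mul_zero, zero_mul, mul_one, one_mul, add_zero,
      zero_add, sub_zero, zero_sub, neg_zero, true_and, and_true]
    repeat' apply And.intro
    all_goals ring
  · intro c d p
    simp only [Bos.qbar_apply, Bos.rot_apply, Fer.rot_apply, Fin.sum_univ_two, Prod.fst_add, Prod.snd_add, Prod.smul_fst,
      Prod.smul_snd, Pi.add_apply, Pi.smul_apply, map_add, map_sub, map_smul, map_zero, h.map_s,
      ShellTest.add_apply, ShellTest.sub_apply, ShellTest.smul_apply, ShellTest.zero_apply,
      ShellTest.s_apply]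
    linear_combination (norm := skip) (∑ e, ∑ f, ∑ l, I * epsUp e d * (starRingEnd ℂ) (A a f) * B l c *
      (-I * sig p.1 e f * (τ (x.2.2.2 j l) p + τ (x.2.2.2 l j) p))) * (hA - hB)
    simp only [Fin.sum_univ_two]
    revert j a c d
    simp only [Fin.forall_fin_two, hconj, eps_00, eps_01, eps_10, eps_11, epsUp_00, epsUp_01, epsUp_10,
      epsUp_11, delta_self, delta_01, delta_10, mul_zero, zero_mul, mul_one, one_mul, add_zero,
      zero_add, sub_zero, zero_sub, neg_zero, true_and, and_true]
    repeat' apply And.intro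
    all_goals ring

set_option maxHeartbeats 1000000 in
theorem Bos.rot_q (h : IsSymmetry τ A B) (j a : Fin 2) (x : Fer m) :
    Bos.rot τ A B (Fer.q j a x) = ∑ k, ∑ b, (B j k * A a b) • Fer.q k b (Fer.rot τ A B x) := by
  have hA := h.det_weyl
  have hB := h.det_isospin
  have hconj := h.conj_isospin
  simp only [Matrix.det_fin_two] at hA hB
  simp only [Fin.forall_fin_two, Fin.sum_univ_two, eps_00, eps_01, eps_10, eps_11, mul_zero,
    zero_mul, mul_one, one_mul, add_zero, zero_add, neg_mul, mul_neg, neg_neg] at hconj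
  apply Bos.ext_apply
  · intro p
    simp only [Fer.q_apply, Bos.rot_apply, Fer.rot_apply, Fin.sum_univ_two, Prod.fst_add, Prod.snd_add, Prod.smul_fst,
      Prod.smul_snd, Pi.add_apply, Pi.smul_apply, map_add, map_sub, map_smul, map_zero, h.map_s,
      ShellTest.add_apply, ShellTest.sub_apply, ShellTest.smul_apply, ShellTest.zero_apply,
      ShellTest.s_apply]
    revert j a
    simp only [Fin.forall_fin_two, hconj, eps_00, eps_01, eps_10, eps_11, epsUp_00, epsUp_01, epsUp_10,
      epsUp_11, delta_self, delta_01, delta_10, mul_zero, zero_mul, mul_one, one_mul, add_zero,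
      zero_add, sub_zero, zero_sub, neg_zero, true_and, and_true]
  · intro p
    simp only [Fer.q_apply, Bos.rot_apply, Fer.rot_apply, Fin.sum_univ_two, Prod.fst_add, Prod.snd_add, Prod.smul_fst,
      Prod.smul_snd, Pi.add_apply, Pi.smul_apply, map_add, map_sub, map_smul, map_zero, h.map_s,
      ShellTest.add_apply, ShellTest.sub_apply, ShellTest.smul_apply, ShellTest.zero_apply,
      ShellTest.s_apply]
    linear_combination (norm := skip) -(∑ e, ∑ f, eps j e * eps a f * τ (x.1 e f) p) * (hA + (A 0 0 * A 1 1 - A 0 1 * A 1 0) * hB)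
    simp only [Fin.sum_univ_two]
    revert j a
    simp only [Fin.forall_fin_two, hconj, eps_00, eps_01, eps_10, eps_11, epsUp_00, epsUp_01, epsUp_10,
      epsUp_11, delta_self, delta_01, delta_10, mul_zero, zero_mul, mul_one, one_mul, add_zero,
      zero_add, sub_zero, zero_sub, neg_zero, true_and, and_true]
    repeat' apply And.intro
    all_goals ring
  · intro c d p
    simp only [Fer.q_apply, Bos.rot_apply, Fer.rot_apply, Fin.sum_univ_two, Prod.fst_add, Prod.snd_add, Prod.smul_fst,
      Prod.smul_snd, Pi.add_apply, Pi.smul_apply, map_add, map_sub, map_smul, map_zero, h.map_s,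
      ShellTest.add_apply, ShellTest.sub_apply, ShellTest.smul_apply, ShellTest.zero_apply,
      ShellTest.s_apply]
    linear_combination (norm := skip) -(1 / 2 * ∑ e, ∑ f, eps j e * (A a c * A f d + A a d * A f c) * τ (x.2 e f) p) * hB
    simp only [Fin.sum_univ_two]
    revert j a c d
    simp only [Fin.forall_fin_two, hconj, eps_00, eps_01, eps_10, eps_11, epsUp_00, epsUp_01, epsUp_10,
      epsUp_11, delta_self, delta_01, delta_10, mul_zero, zero_mul, mul_one, one_mul, add_zero,
      zero_add, sub_zero, zero_sub, neg_zero, true_and, and_true]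
    repeat' apply And.intro
    all_goals ring
  · intro c d p
    simp only [Fer.q_apply, Bos.rot_apply, Fer.rot_apply, Fin.sum_univ_two, Prod.fst_add, Prod.snd_add, Prod.smul_fst,
      Prod.smul_snd, Pi.add_apply, Pi.smul_apply, map_add, map_sub, map_smul, map_zero, h.map_s,
      ShellTest.add_apply, ShellTest.sub_apply, ShellTest.smul_apply, ShellTest.zero_apply,
      ShellTest.s_apply]
    linear_combination (norm := skip) -(1 / 2 * ∑ e, ∑ f, eps a f * (B j c * B e d + B j d * B e c) * τ (x.2 e f) p) * hA
    simp only [Fin.sum_univ_two]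
    revert j a c d
    simp only [Fin.forall_fin_two, hconj, eps_00, eps_01, eps_10, eps_11, epsUp_00, epsUp_01, epsUp_10,
      epsUp_11, delta_self, delta_01, delta_10, mul_zero, zero_mul, mul_one, one_mul, add_zero,
      zero_add, sub_zero, zero_sub, neg_zero, true_and, and_true]
    repeat' apply And.intro
    all_goals ring

set_option maxHeartbeats 1000000 in
theorem Bos.rot_qbar (h : IsSymmetry τ A B) (j a : Fin 2) (x : Fer m) :
    Bos.rot τ A B (Fer.qbar j a x) = ∑ k, ∑ b,
      ((starRingEnd ℂ) (B j k) * (starRingEnd ℂ) (A a b)) • Fer.qbar k b (Fer.rot τ A B x) := by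
  have hA := h.det_weyl
  have hB := h.det_isospin
  have hconj := h.conj_isospin
  simp only [Matrix.det_fin_two] at hA hB
  simp only [Fin.forall_fin_two, Fin.sum_univ_two, eps_00, eps_01, eps_10, eps_11, mul_zero,
    zero_mul, mul_one, one_mul, add_zero, zero_add, neg_mul, mul_neg, neg_neg] at hconj
  apply Bos.ext_apply
  · intro p
    simp only [Fer.qbar_apply, Bos.rot_apply, Fer.rot_apply, Fin.sum_univ_two, Prod.fst_add, Prod.snd_add, Prod.smul_fst,
      Prod.smul_snd, Pi.add_apply, Pi.smul_apply, map_add, map_sub, map_smul, map_zero, h.map_s,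
      ShellTest.add_apply, ShellTest.sub_apply, ShellTest.smul_apply, ShellTest.zero_apply,
      ShellTest.s_apply]
    linear_combination (norm := skip) -(2 * ∑ b, ∑ e, ∑ f, A b e * (starRingEnd ℂ) (A a f) * (-I * sig p.1 e f * τ (x.2 j b) p)) * hB
    simp only [Fin.sum_univ_two]
    revert j a
    simp only [Fin.forall_fin_two, hconj, eps_00, eps_01, eps_10, eps_11, epsUp_00, epsUp_01, epsUp_10,
      epsUp_11, delta_self, delta_01, delta_10, mul_zero, zero_mul, mul_one, one_mul, add_zero,
      zero_add, sub_zero, zero_sub, neg_zero, true_and, and_true]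
    repeat' apply And.intro
    all_goals ring
  · intro p
    simp only [Fer.qbar_apply, Bos.rot_apply, Fer.rot_apply, Fin.sum_univ_two, Prod.fst_add, Prod.snd_add, Prod.smul_fst,
      Prod.smul_snd, Pi.add_apply, Pi.smul_apply, map_add, map_sub, map_smul, map_zero, h.map_s,
      ShellTest.add_apply, ShellTest.sub_apply, ShellTest.smul_apply, ShellTest.zero_apply,
      ShellTest.s_apply]
    revert j a
    simp only [Fin.forall_fin_two, hconj, eps_00, eps_01, eps_10, eps_11, epsUp_00, epsUp_01, epsUp_10,
      epsUp_11, delta_self, delta_01, delta_10, mul_zero, zero_mul, mul_one, one_mul, add_zero,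
      zero_add, sub_zero, zero_sub, neg_zero, true_and, and_true]
  · intro c d p
    simp only [Fer.qbar_apply, Bos.rot_apply, Fer.rot_apply, Fin.sum_univ_two, Prod.fst_add, Prod.snd_add, Prod.smul_fst,
      Prod.smul_snd, Pi.add_apply, Pi.smul_apply, map_add, map_sub, map_smul, map_zero, h.map_s,
      ShellTest.add_apply, ShellTest.sub_apply, ShellTest.smul_apply, ShellTest.zero_apply,
      ShellTest.s_apply]
    linear_combination (norm := skip) (1 / 2 * I * ∑ e, ∑ f, ∑ b, (epsUp e d * A b c + epsUp e c * A b d) *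
      (starRingEnd ℂ) (A a f) * (-I * sig p.1 e f * τ (x.1 j b) p)) * (hA - hB)
    simp only [Fin.sum_univ_two]
    revert j a c d
    simp only [Fin.forall_fin_two, hconj, eps_00, eps_01, eps_10, eps_11, epsUp_00, epsUp_01, epsUp_10,
      epsUp_11, delta_self, delta_01, delta_10, mul_zero, zero_mul, mul_one, one_mul, add_zero,
      zero_add, sub_zero, zero_sub, neg_zero, true_and, and_true]
    repeat' apply And.intro
    all_goals ring
  · intro c d p
    simp only [Fer.qbar_apply, Bos.rot_apply, Fer.rot_apply, Fin.sum_univ_two, Prod.fst_add, Prod.snd_add, Prod.smul_fst,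
      Prod.smul_snd, Pi.add_apply, Pi.smul_apply, map_add, map_sub, map_smul, map_zero, h.map_s,
      ShellTest.add_apply, ShellTest.sub_apply, ShellTest.smul_apply, ShellTest.zero_apply,
      ShellTest.s_apply]
    revert j a c d
    simp only [Fin.forall_fin_two, hconj, eps_00, eps_01, eps_10, eps_11, epsUp_00, epsUp_01, epsUp_10,
      epsUp_11, delta_self, delta_01, delta_10, mul_zero, zero_mul, mul_one, one_mul, add_zero,
      zero_add, sub_zero, zero_sub, neg_zero, true_and, and_true]
    repeat' apply And.intro
    all_goals ring

end Covariance

end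

end N2

/-! ### The componentwise Pauli–Jordan pairing and its invariances. -/

namespace N2

noncomputable section

open Complex

set_option linter.unusedSimpArgs false
set_option linter.unnecessarySeqFocus false

variable {m : ℝ}

section Pairing

open ShellTest

/-- The sum of the Pauli-Jordan pairings of the components of Bosonic vectors. -/
def Bos.pair : Bos m →ₗ[ℂ] Bos m →ₗ[ℂ] ℂ :=
  LinearMap.mk₂ ℂ (fun x y => J x.1 y.1 + J x.2.1 y.2.1
      + ∑ a, ∑ b, J (x.2.2.1 a b) (y.2.2.1 a b) + ∑ j, ∑ k, J (x.2.2.2 j k) (y.2.2.2 j k))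
    (fun x x' y => by
      simp only [Prod.fst_add, Prod.snd_add, Pi.add_apply, map_add, LinearMap.add_apply,
        Fin.sum_univ_two]
      ring)
    (fun c x y => by
      simp only [Prod.smul_fst, Prod.smul_snd, Pi.smul_apply, map_smul, LinearMap.smul_apply,
        Fin.sum_univ_two, smul_eq_mul]
      ring)
    (fun x y y' => by
      simp only [Prod.fst_add, Prod.snd_add, Pi.add_apply, map_add, Fin.sum_univ_two]
      ring)
    (fun c x y => by
      simp only [Prod.smul_fst, Prod.smul_snd, Pi.smul_apply, map_smul, Fin.sum_univ_two,
        smul_eq_mul]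
      ring)

/-- The sum of the Pauli-Jordan pairings of the components of Fermionic vectors. -/
def Fer.pair : Fer m →ₗ[ℂ] Fer m →ₗ[ℂ] ℂ :=
  LinearMap.mk₂ ℂ (fun x y => ∑ j, ∑ a, J (x.1 j a) (y.1 j a) + ∑ j, ∑ a, J (x.2 j a) (y.2 j a))
    (fun x x' y => by
      simp only [Prod.fst_add, Prod.snd_add, Pi.add_apply, map_add, LinearMap.add_apply,
        Fin.sum_univ_two]
      ring)
    (fun c x y => by
      simp only [Prod.smul_fst, Prod.smul_snd, Pi.smul_apply, map_smul, LinearMap.smul_apply,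
        Fin.sum_univ_two, smul_eq_mul]
      ring)
    (fun x y y' => by
      simp only [Prod.fst_add, Prod.snd_add, Pi.add_apply, map_add, Fin.sum_univ_two]
      ring)
    (fun c x y => by
      simp only [Prod.smul_fst, Prod.smul_snd, Pi.smul_apply, map_smul, Fin.sum_univ_two,
        smul_eq_mul]
      ring)

theorem Bos.pair_apply (x y : Bos m) : Bos.pair x y = J x.1 y.1 + J x.2.1 y.2.1
    + ∑ a, ∑ b, J (x.2.2.1 a b) (y.2.2.1 a b) + ∑ j, ∑ k, J (x.2.2.2 j k) (y.2.2.2 j k) := rfl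

theorem Fer.pair_apply (x y : Fer m) : Fer.pair x y =
    ∑ j, ∑ a, J (x.1 j a) (y.1 j a) + ∑ j, ∑ a, J (x.2 j a) (y.2 j a) := rfl

theorem Bos.pair_swap (x y : Bos m) : Bos.pair x y = -Bos.pair y x := by
  simp only [Bos.pair_apply, neg_add, ← Finset.sum_neg_distrib, ← J_swap]

theorem Fer.pair_swap (x y : Fer m) : Fer.pair x y = -Fer.pair y x := by
  simp only [Fer.pair_apply, neg_add, ← Finset.sum_neg_distrib, ← J_swap]

theorem Bos.conj_apply (x : Bos m) : Bos.conj x = (ShellTest.conj x.1, ShellTest.conj x.2.1,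
    fun a b => ShellTest.conj (x.2.2.1 a b), fun a b => ShellTest.conj (x.2.2.2 a b)) := rfl

theorem Fer.conj_apply (x : Fer m) : Fer.conj x =
    (fun j a => ShellTest.conj (x.1 j a), fun j a => ShellTest.conj (x.2 j a)) := rfl

theorem Bos.conj_conj (x : Bos m) : Bos.conj (Bos.conj x) = x := by
  simp only [Bos.conj_apply, ShellTest.conj_conj]

theorem Fer.conj_conj (x : Fer m) : Fer.conj (Fer.conj x) = x := by
  simp only [Fer.conj_apply, ShellTest.conj_conj]

theorem Bos.pair_conj (x y : Bos m) :
    (starRingEnd ℂ) (Bos.pair x y) = Bos.pair (Bos.conj x) (Bos.conj y) := by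
  simp only [Bos.pair_apply, Bos.conj_apply, map_add, map_sum, J_conj]

theorem Fer.pair_conj (x y : Fer m) :
    (starRingEnd ℂ) (Fer.pair x y) = Fer.pair (Fer.conj x) (Fer.conj y) := by
  simp only [Fer.pair_apply, Fer.conj_apply, map_add, map_sum, J_conj]

theorem Bos.pair_mom (μ : Fin 4) (x y : Bos m) :
    Bos.pair x (Bos.mom μ y) = -Bos.pair (Bos.mom μ x) y := by
  simp only [Bos.pair_apply, Bos.mom_apply, map_add, map_smul, LinearMap.add_apply,
    LinearMap.smul_apply, J_mom, Fin.sum_univ_two, smul_eq_mul]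
  ring

theorem Fer.pair_mom (μ : Fin 4) (x y : Fer m) :
    Fer.pair x (Fer.mom μ y) = -Fer.pair (Fer.mom μ x) y := by
  simp only [Fer.pair_apply, Fer.mom_apply, J_mom, Fin.sum_univ_two]
  ring

theorem Bos.conj_mom (μ : Fin 4) (x : Bos m) :
    Bos.conj (Bos.mom μ x) = -Bos.mom μ (Bos.conj x) := by
  apply Bos.ext_apply <;> intros <;>
    simp [Bos.conj_apply, Bos.mom_apply, ShellTest.conj_mom, map_smulₛₗ, map_ofNat,
      -ShellTest.conj_apply] <;>
    ring

theorem Fer.conj_mom (μ : Fin 4) (x : Fer m) :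
    Fer.conj (Fer.mom μ x) = -Fer.mom μ (Fer.conj x) := by
  apply Fer.ext_apply <;> intros <;>
    simp [Fer.conj_apply, Fer.mom_apply, ShellTest.conj_mom, -ShellTest.conj_apply]

/-- The matrix `ε A εᵀ`, the inverse transpose of `A` if `det A = 1`. -/
def contragredient (A : Matrix (Fin 2) (Fin 2) ℂ) : Matrix (Fin 2) (Fin 2) ℂ :=
  !![A 1 1, -A 1 0; -A 0 1, A 0 0]

variable {τ : ShellTest m →ₗ[ℂ] ShellTest m} {A B : Matrix (Fin 2) (Fin 2) ℂ}

theorem Bos.pair_rot (hA : A.det = 1) (hB : B.det = 1) (hτ : ∀ t t', J (τ t) (τ t') = J t t')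
    (x y : Bos m) :
    Bos.pair (Bos.rot τ (contragredient A) (contragredient B) x) (Bos.rot τ A B y)
      = Bos.pair x y := by
  rw [Matrix.det_fin_two] at hA hB
  simp only [Bos.pair_apply, Bos.rot_apply, contragredient, Fin.sum_univ_two, map_add, map_smul,
    LinearMap.add_apply, LinearMap.smul_apply, hτ, smul_eq_mul, Matrix.of_apply, Matrix.cons_val',
    Matrix.cons_val_zero, Matrix.cons_val_one, Matrix.cons_val_fin_one]
  -- Two indices contract to the square of the determinant, and det² - 1 = (det + 1)(det - 1); hence
  -- the factor det + 1.
  linear_combination (A 0 0 * A 1 1 - A 0 1 * A 1 0 + 1) *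
    (J (x.2.2.1 0 0) (y.2.2.1 0 0) + J (x.2.2.1 0 1) (y.2.2.1 0 1) +
      J (x.2.2.1 1 0) (y.2.2.1 1 0) + J (x.2.2.1 1 1) (y.2.2.1 1 1)) * hA
    + (B 0 0 * B 1 1 - B 0 1 * B 1 0 + 1) *
    (J (x.2.2.2 0 0) (y.2.2.2 0 0) + J (x.2.2.2 0 1) (y.2.2.2 0 1) +
      J (x.2.2.2 1 0) (y.2.2.2 1 0) + J (x.2.2.2 1 1) (y.2.2.2 1 1)) * hB

theorem Fer.pair_rot (hA : A.det = 1) (hB : B.det = 1) (hτ : ∀ t t', J (τ t) (τ t') = J t t')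
    (x y : Fer m) :
    Fer.pair (Fer.rot τ (contragredient A) (contragredient B) x) (Fer.rot τ A B y)
      = Fer.pair x y := by
  rw [Matrix.det_fin_two] at hA hB
  simp only [Fer.pair_apply, Fer.rot_apply, contragredient, Fin.sum_univ_two, map_add, map_smul,
    LinearMap.add_apply, LinearMap.smul_apply, hτ, smul_eq_mul, Matrix.of_apply, Matrix.cons_val',
    Matrix.cons_val_zero, Matrix.cons_val_one, Matrix.cons_val_fin_one]
  linear_combination
    (J (x.1 0 0) (y.1 0 0) + J (x.1 0 1) (y.1 0 1) + J (x.1 1 0) (y.1 1 0) + J (x.1 1 1) (y.1 1 1)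
      + J (x.2 0 0) (y.2 0 0) + J (x.2 0 1) (y.2 0 1) + J (x.2 1 0) (y.2 1 0)
      + J (x.2 1 1) (y.2 1 1)) * (hA + (A 0 0 * A 1 1 - A 0 1 * A 1 0) * hB)

end Pairing

end

end N2

/-! ### Transposes of the charges and the forms defining the brackets. -/

namespace N2

noncomputable section

open Complex

set_option linter.unusedSimpArgs false
set_option linter.unnecessarySeqFocus false

variable {m : ℝ}

section Transpose

open ShellTest

/-- The transpose of the supercharge on Fermionic vectors. -/
def Bos.qT (j a : Fin 2) (x : Bos m) : Fer m :=
  (fun k b => (eps j k * eps a b) • x.2.1,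
    fun k b => (1 / 2 * eps j k) • (x.2.2.1 a b + x.2.2.1 b a)
      + (1 / 2 * eps a b) • (x.2.2.2 j k + x.2.2.2 k j))

/-- The transpose of the conjugate supercharge on Fermionic vectors. -/
def Bos.qbarT (j a : Fin 2) (x : Bos m) : Fer m :=
  (fun k c => (-1 / 2 * I * delta j k) • ∑ e, ∑ f, epsUp e f • s e a (x.2.2.1 c f + x.2.2.1 f c)
      - (1 / 2 * I) • s c a (∑ l, eps j l • (x.2.2.2 l k + x.2.2.2 k l)),
    fun k b => (-2 * delta j k) • s b a x.1)

/-- The transpose of the complex conjugate of the conjugate supercharge on Fermionic vectors. -/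
def Bos.conjQbarT (j a : Fin 2) (x : Bos m) : Fer m :=
  (fun k c => (1 / 2 * I * delta j k) • ∑ e, ∑ f, epsUp e f • s a e (x.2.2.1 c f + x.2.2.1 f c)
      + (1 / 2 * I) • s a c (∑ l, eps j l • (x.2.2.2 l k + x.2.2.2 k l)),
    fun k b => (-2 * delta j k) • s a b x.1)

/-- Moving the charge to the left argument turns invariance of a bracket form into an identity
between maps of vectors, which is checked pointwise on the shell without integrals or nondegeneracy.
-/
theorem Bos.pair_q (j a : Fin 2) (x : Bos m) (y : Fer m) :
    Bos.pair x (Fer.q j a y) = Fer.pair (Bos.qT j a x) y := by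
  simp only [Bos.pair_apply, Fer.pair_apply, Bos.qT, Fer.q_apply, map_add, map_smul, map_zero,
    LinearMap.add_apply, LinearMap.smul_apply, Fin.sum_univ_two, smul_eq_mul]
  revert j a
  simp only [Fin.forall_fin_two, eps_00, eps_01, eps_10, eps_11, delta_self, delta_01, delta_10]
  refine ⟨⟨?_, ?_⟩, ?_, ?_⟩ <;> ring

theorem Bos.pair_qbar (j a : Fin 2) (x : Bos m) (y : Fer m) :
    Bos.pair x (Fer.qbar j a y) = Fer.pair (Bos.qbarT j a x) y := by
  simp only [Bos.pair_apply, Fer.pair_apply, Bos.qbarT, Fer.qbar_apply, map_add, map_sub, map_smul,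
    map_zero, J_s, LinearMap.add_apply, LinearMap.sub_apply, LinearMap.smul_apply,
    Fin.sum_univ_two, smul_eq_mul]
  revert j a
  simp only [Fin.forall_fin_two, eps_00, eps_01, eps_10, eps_11, epsUp_00, epsUp_01, epsUp_10,
    epsUp_11, delta_self, delta_01, delta_10]
  refine ⟨⟨?_, ?_⟩, ?_, ?_⟩ <;> ring

/-- The charge Q on Fermionic vectors has real coefficients and no derivatives. -/
theorem Fer.conj_q (j a : Fin 2) (y : Fer m) :
    Bos.conj (Fer.q j a (Fer.conj y)) = Fer.q j a y := by
  simp only [Bos.conj_apply, Fer.conj_apply, Fer.q_apply, map_zero, map_sum, map_smulₛₗ, map_add,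
    map_mul, conj_eps, conj_delta, map_div₀, map_one, map_ofNat, ShellTest.conj_conj]

theorem Bos.pair_conj_qbar (j a : Fin 2) (x : Bos m) (y : Fer m) :
    Bos.pair x (Bos.conj (Fer.qbar j a (Fer.conj y))) = Fer.pair (Bos.conjQbarT j a x) y := by
  simp only [Bos.pair_apply, Fer.pair_apply, Bos.conjQbarT, Fer.qbar_apply, Bos.conj_apply,
    Fer.conj_apply, map_zero, map_sum, map_smulₛₗ, map_add, map_mul, conj_eps, conj_delta,
    conj_epsUp, map_div₀, map_one, map_ofNat, conj_I, ShellTest.conj_conj, conj_s, J_s,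
    LinearMap.add_apply, LinearMap.sub_apply, LinearMap.smul_apply, RingHom.id_apply,
    Fin.sum_univ_two, smul_eq_mul]
  revert j a
  simp only [Fin.forall_fin_two, eps_00, eps_01, eps_10, eps_11, epsUp_00, epsUp_01, epsUp_10,
    epsUp_11, delta_self, delta_01, delta_10]
  refine ⟨⟨?_, ?_⟩, ?_, ?_⟩ <;> ring

end Transpose

section Forms

open ShellTest

/-- The brackets of two components with test functions `x` are read off from `pair (chiral α x)`. -/
def Bos.chiral (α : ℂ) : Bos m →ₗ[ℂ] Bos m where
  toFun x := (α • x.2.1, α • x.1,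
    fun c d => (I * α) • ∑ a, ∑ b, (eps a c * eps b d + eps a d * eps b c) • x.2.2.1 a b,
    fun l n => (-I * α) • ∑ j, ∑ k, (eps j l * eps k n + eps j n * eps k l) • x.2.2.2 j k)
  map_add' x y := by apply Bos.ext_apply <;> intros <;> simp [-neg_add_rev] <;> ring
  map_smul' c x := by apply Bos.ext_apply <;> intros <;> simp <;> ring

/-- The Fermionic analogue of `Bos.chiral`. -/
def Fer.chiral (α : ℂ) : Fer m →ₗ[ℂ] Fer m where
  toFun x := (fun k b => (-I * α) • ∑ j, ∑ a, (eps a b * eps j k) • x.2 j a,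
    fun j a => (I * α) • ∑ k, ∑ b, (eps a b * eps j k) • x.1 k b)
  map_add' x y := by apply Fer.ext_apply <;> intros <;> simp <;> ring
  map_smul' c x := by apply Fer.ext_apply <;> intros <;> simp <;> ring

/-- The brackets of components with adjoint components are read off from `pair (mixed x)`. -/
def Bos.mixed : Bos m →ₗ[ℂ] Bos m where
  toFun x := ((-I) • x.1, (-4 * I * (m : ℂ) ^ 4) • x.2.1,
    fun c d => (2 * I) • ∑ a, ∑ b, (s a c (s b d (x.2.2.1 a b)) + s a d (s b c (x.2.2.1 a b))),
    fun l n => (-2 * I * (m : ℂ) ^ 2) • (x.2.2.2 l n + x.2.2.2 n l))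
  map_add' x y := by apply Bos.ext_apply <;> intros <;> simp <;> ring
  map_smul' c x := by apply Bos.ext_apply <;> intros <;> simp <;> ring

/-- The Fermionic analogue of `Bos.mixed`. -/
def Fer.mixed : Fer m →ₗ[ℂ] Fer m where
  toFun x := (fun j b => (2 * (m : ℂ) ^ 2) • ∑ a, s a b (x.1 j a),
    fun j b => (2 : ℂ) • ∑ a, s a b (x.2 j a))
  map_add' x y := by apply Fer.ext_apply <;> intros <;> simp <;> ring
  map_smul' c x := by apply Fer.ext_apply <;> intros <;> simp <;> ring

theorem Bos.chiral_apply (α : ℂ) (x : Bos m) : Bos.chiral α x = (α • x.2.1, α • x.1,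
    fun c d => (I * α) • ∑ a, ∑ b, (eps a c * eps b d + eps a d * eps b c) • x.2.2.1 a b,
    fun l n => (-I * α) • ∑ j, ∑ k, (eps j l * eps k n + eps j n * eps k l) • x.2.2.2 j k) := rfl

theorem Fer.chiral_apply (α : ℂ) (x : Fer m) : Fer.chiral α x =
    (fun k b => (-I * α) • ∑ j, ∑ a, (eps a b * eps j k) • x.2 j a,
    fun j a => (I * α) • ∑ k, ∑ b, (eps a b * eps j k) • x.1 k b) := rfl

theorem Bos.mixed_apply (x : Bos m) :
    Bos.mixed x = ((-I) • x.1, (-4 * I * (m : ℂ) ^ 4) • x.2.1,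
    fun c d => (2 * I) • ∑ a, ∑ b, (s a c (s b d (x.2.2.1 a b)) + s a d (s b c (x.2.2.1 a b))),
    fun l n => (-2 * I * (m : ℂ) ^ 2) • (x.2.2.2 l n + x.2.2.2 n l)) := rfl

theorem Fer.mixed_apply (x : Fer m) :
    Fer.mixed x = (fun j b => (2 * (m : ℂ) ^ 2) • ∑ a, s a b (x.1 j a),
    fun j b => (2 : ℂ) • ∑ a, s a b (x.2 j a)) := rfl

theorem Bos.pair_chiral (α : ℂ) (x y : Bos m) :
    Bos.pair x (Bos.chiral α y) = Bos.pair (Bos.chiral α x) y := by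
  simp only [Bos.pair_apply, Bos.chiral_apply, map_add, map_smul, LinearMap.add_apply,
    LinearMap.smul_apply, Fin.sum_univ_two, smul_eq_mul, eps_00, eps_01, eps_10, eps_11]
  ring

theorem Fer.pair_chiral (α : ℂ) (x y : Fer m) :
    Fer.pair x (Fer.chiral α y) = -Fer.pair (Fer.chiral α x) y := by
  simp only [Fer.pair_apply, Fer.chiral_apply, map_add, map_smul, LinearMap.add_apply,
    LinearMap.smul_apply, Fin.sum_univ_two, smul_eq_mul, eps_00, eps_01, eps_10, eps_11]
  ring

theorem s_s_comm (a b c d : Fin 2) (t : ShellTest m) : s a b (s c d t) = s c d (s a b t) := by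
  ext k
  simp only [s_apply]
  ring

/-- Together with antisymmetry of the pairing this is Hermiticity of the mixed form: [φ, ψ*] and [ψ,
φ*] are related by the adjoint. The minus sign comes from i for z, D, C and F; the two derivatives
in F produce none. -/
theorem Bos.pair_mixed (x y : Bos m) :
    Bos.pair x (Bos.mixed y) = -Bos.pair (Bos.conj (Bos.mixed (Bos.conj x))) y := by
  simp only [Bos.pair_apply, Bos.mixed_apply, Bos.conj_apply, map_add, map_smulₛₗ, map_mul, map_neg,
    map_pow, map_ofNat, conj_I, conj_ofReal, ShellTest.conj_conj, conj_s, J_s, LinearMap.add_apply,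
    LinearMap.smul_apply, RingHom.id_apply, Fin.sum_univ_two, smul_eq_mul]
  simp only [s_s_comm 0 1 0 0, s_s_comm 1 0 0 0, s_s_comm 1 1 0 0, s_s_comm 1 0 0 1, s_s_comm 1 1 0 1,
    s_s_comm 1 1 1 0]
  ring

theorem Fer.pair_mixed (x y : Fer m) :
    Fer.pair x (Fer.mixed y) = -Fer.pair (Fer.conj (Fer.mixed (Fer.conj x))) y := by
  simp only [Fer.pair_apply, Fer.mixed_apply, Fer.conj_apply, map_add, map_smulₛₗ, map_mul, map_neg,
    map_pow, map_ofNat, conj_I, conj_ofReal, ShellTest.conj_conj, conj_s, J_s, LinearMap.add_apply,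
    LinearMap.smul_apply, RingHom.id_apply, Fin.sum_univ_two, smul_eq_mul]
  ring

end Forms

end

end N2

/-! ### Invariance of the chiral and mixed forms under translations and charges. -/

namespace N2

noncomputable section

open Complex

set_option linter.unusedSimpArgs false
set_option linter.unnecessarySeqFocus false

variable {m : ℝ}

section Invariance

variable {τ : ShellTest m →ₗ[ℂ] ShellTest m} {A B : Matrix (Fin 2) (Fin 2) ℂ}

theorem Bos.chiral_mom (α : ℂ) (μ : Fin 4) (x : Bos m) :
    Bos.chiral α (Bos.mom μ x) = Bos.mom μ (Bos.chiral α x) := by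
  apply Bos.ext_apply <;> intros <;> simp [Bos.chiral_apply, Bos.mom_apply] <;> ring

theorem Fer.chiral_mom (α : ℂ) (μ : Fin 4) (x : Fer m) :
    Fer.chiral α (Fer.mom μ x) = Fer.mom μ (Fer.chiral α x) := by
  apply Fer.ext_apply <;> intros <;> simp [Fer.chiral_apply, Fer.mom_apply]

theorem Bos.mixed_mom (μ : Fin 4) (x : Bos m) :
    Bos.mixed (Bos.mom μ x) = Bos.mom μ (Bos.mixed x) := by
  apply Bos.ext_apply <;> intros <;> simp [Bos.mixed_apply, Bos.mom_apply] <;> ring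

theorem Fer.mixed_mom (μ : Fin 4) (x : Fer m) :
    Fer.mixed (Fer.mom μ x) = Fer.mom μ (Fer.mixed x) := by
  apply Fer.ext_apply <;> intros <;> simp [Fer.mixed_apply, Fer.mom_apply] <;> ring

theorem contragredient_00 (A : Matrix (Fin 2) (Fin 2) ℂ) : contragredient A 0 0 = A 1 1 := rfl
theorem contragredient_01 (A : Matrix (Fin 2) (Fin 2) ℂ) : contragredient A 0 1 = -A 1 0 := rfl
theorem contragredient_10 (A : Matrix (Fin 2) (Fin 2) ℂ) : contragredient A 1 0 = -A 0 1 := rfl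
theorem contragredient_11 (A : Matrix (Fin 2) (Fin 2) ℂ) : contragredient A 1 1 = A 0 0 := rfl

set_option maxHeartbeats 1000000 in
theorem Bos.chiral_rot (α : ℂ) (x : Bos m) : Bos.chiral α (Bos.rot τ A B x) =
    Bos.rot τ (contragredient A) (contragredient B) (Bos.chiral α x) := by
  apply Bos.ext_apply
  · intros; simp [Bos.chiral_apply, Bos.rot_apply]
  · intros; simp [Bos.chiral_apply, Bos.rot_apply]
  · intro c d p
    simp only [Bos.chiral_apply, Bos.rot_apply, Fin.sum_univ_two, Prod.fst_add, Prod.snd_add,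
      Prod.fst_zero, Prod.snd_zero, Prod.smul_fst, Prod.smul_snd, Pi.add_apply, Pi.zero_apply,
      Pi.smul_apply, map_add, map_sub, map_smul, ShellTest.add_apply, ShellTest.sub_apply,
      ShellTest.smul_apply, ShellTest.zero_apply, ShellTest.s_apply]
    revert c d
    simp only [Fin.forall_fin_two, contragredient_00, contragredient_01, contragredient_10,
      contragredient_11, eps_00, eps_01, eps_10, eps_11, epsUp_00, epsUp_01,
      epsUp_10, epsUp_11, delta_self, delta_01, delta_10, mul_zero, zero_mul, mul_one, one_mul,
      add_zero, zero_add, sub_zero, zero_sub, neg_zero, true_and, and_true]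
    repeat' apply And.intro
    all_goals ring
  · intro c d p
    simp only [Bos.chiral_apply, Bos.rot_apply, Fin.sum_univ_two, Prod.fst_add, Prod.snd_add,
      Prod.fst_zero, Prod.snd_zero, Prod.smul_fst, Prod.smul_snd, Pi.add_apply, Pi.zero_apply,
      Pi.smul_apply, map_add, map_sub, map_smul, ShellTest.add_apply, ShellTest.sub_apply,
      ShellTest.smul_apply, ShellTest.zero_apply, ShellTest.s_apply]
    revert c d
    simp only [Fin.forall_fin_two, contragredient_00, contragredient_01, contragredient_10,
      contragredient_11, eps_00, eps_01, eps_10, eps_11, epsUp_00, epsUp_01,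
      epsUp_10, epsUp_11, delta_self, delta_01, delta_10, mul_zero, zero_mul, mul_one, one_mul,
      add_zero, zero_add, sub_zero, zero_sub, neg_zero, true_and, and_true]
    repeat' apply And.intro
    all_goals ring

set_option maxHeartbeats 1000000 in
theorem Fer.chiral_rot (α : ℂ) (x : Fer m) : Fer.chiral α (Fer.rot τ A B x) =
    Fer.rot τ (contragredient A) (contragredient B) (Fer.chiral α x) := by
  apply Fer.ext_apply
  · intro c d p
    simp only [Fer.chiral_apply, Fer.rot_apply, Fin.sum_univ_two, Prod.fst_add, Prod.snd_add,
      Prod.fst_zero, Prod.snd_zero, Prod.smul_fst, Prod.smul_snd, Pi.add_apply, Pi.zero_apply,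
      Pi.smul_apply, map_add, map_sub, map_smul, ShellTest.add_apply, ShellTest.sub_apply,
      ShellTest.smul_apply, ShellTest.zero_apply, ShellTest.s_apply]
    revert c d
    simp only [Fin.forall_fin_two, contragredient_00, contragredient_01, contragredient_10,
      contragredient_11, eps_00, eps_01, eps_10, eps_11, epsUp_00, epsUp_01,
      epsUp_10, epsUp_11, delta_self, delta_01, delta_10, mul_zero, zero_mul, mul_one, one_mul,
      add_zero, zero_add, sub_zero, zero_sub, neg_zero, true_and, and_true]
    repeat' apply And.intro
    all_goals ring
  · intro c d p
    simp only [Fer.chiral_apply, Fer.rot_apply, Fin.sum_univ_two, Prod.fst_add, Prod.snd_add,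
      Prod.fst_zero, Prod.snd_zero, Prod.smul_fst, Prod.smul_snd, Pi.add_apply, Pi.zero_apply,
      Pi.smul_apply, map_add, map_sub, map_smul, ShellTest.add_apply, ShellTest.sub_apply,
      ShellTest.smul_apply, ShellTest.zero_apply, ShellTest.s_apply]
    revert c d
    simp only [Fin.forall_fin_two, contragredient_00, contragredient_01, contragredient_10,
      contragredient_11, eps_00, eps_01, eps_10, eps_11, epsUp_00, epsUp_01,
      epsUp_10, epsUp_11, delta_self, delta_01, delta_10, mul_zero, zero_mul, mul_one, one_mul,
      add_zero, zero_add, sub_zero, zero_sub, neg_zero, true_and, and_true]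
    repeat' apply And.intro
    all_goals ring

theorem Bos.conj_rot (hτ : ∀ t, τ (ShellTest.conj t) = ShellTest.conj (τ t)) (x : Bos m) :
    Bos.conj (Bos.rot τ A B (Bos.conj x))
      = Bos.rot τ (A.map (starRingEnd ℂ)) (B.map (starRingEnd ℂ)) x := by
  simp only [Bos.conj_apply, Bos.rot_apply, hτ, map_sum, map_smulₛₗ, map_mul, ShellTest.conj_conj,
    Matrix.map_apply]

theorem Fer.conj_rot (hτ : ∀ t, τ (ShellTest.conj t) = ShellTest.conj (τ t)) (x : Fer m) :
    Fer.conj (Fer.rot τ A B (Fer.conj x))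
      = Fer.rot τ (A.map (starRingEnd ℂ)) (B.map (starRingEnd ℂ)) x := by
  simp only [Fer.conj_apply, Fer.rot_apply, hτ, map_sum, map_smulₛₗ, map_mul, ShellTest.conj_conj,
    Matrix.map_apply]

end Invariance

section Skewness

theorem I_pow_five : I ^ 5 = I := by rw [pow_succ, I_pow_four, one_mul]

/-- With the mass eliminated in favour of the determinant, the invariance statements become
polynomial identities in the entries of σ·k. -/
theorem mass_pow_four (k : Shell m) :
    (m : ℂ) ^ 4 = (sig k.1 0 0 * sig k.1 1 1 - sig k.1 0 1 * sig k.1 1 0) ^ 2 := by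
  rw [ShellTest.det_sig_shell]
  ring

set_option maxHeartbeats 1000000 in
-- Each term is proportional to α, so invariance fixes only the ratios between the brackets of the
-- chiral form and leaves α free. This is the infinitesimal version of the Jacobi identities of the
-- uniqueness half.
theorem Bos.chiral_q (α : ℂ) (j a : Fin 2) (x : Bos m) :
    Fer.chiral α (Bos.q j a x) + Bos.qT j a (Bos.chiral α x) = 0 := by
  apply Fer.ext_apply
  · intro c d p
    simp only [Fer.chiral_apply, Bos.chiral_apply, Bos.q_apply, Bos.qT, Fin.sum_univ_two, Prod.fst_add, Prod.snd_add,
      Prod.fst_zero, Prod.snd_zero, Prod.smul_fst, Prod.smul_snd, Pi.add_apply, Pi.zero_apply,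
      Pi.smul_apply, map_add, map_sub, map_smul, ShellTest.add_apply, ShellTest.sub_apply,
      ShellTest.smul_apply, ShellTest.zero_apply, ShellTest.s_apply]
    linear_combination (norm := skip) (α * eps j c * eps a d * x.1 p) * I_sq
    revert j a c d
    simp only [Fin.forall_fin_two, eps_00, eps_01, eps_10, eps_11, epsUp_00, epsUp_01,
      epsUp_10, epsUp_11, delta_self, delta_01, delta_10, mul_zero, zero_mul, mul_one, one_mul,
      add_zero, zero_add, sub_zero, zero_sub, neg_zero, true_and, and_true]
    repeat' apply And.intro
    all_goals ring
  · intro c d p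
    simp only [Fer.chiral_apply, Bos.chiral_apply, Bos.q_apply, Bos.qT, Fin.sum_univ_two, Prod.fst_add, Prod.snd_add,
      Prod.fst_zero, Prod.snd_zero, Prod.smul_fst, Prod.smul_snd, Pi.add_apply, Pi.zero_apply,
      Pi.smul_apply, map_add, map_sub, map_smul, ShellTest.add_apply, ShellTest.sub_apply,
      ShellTest.smul_apply, ShellTest.zero_apply, ShellTest.s_apply]
    revert j a c d
    simp only [Fin.forall_fin_two, eps_00, eps_01, eps_10, eps_11, epsUp_00, epsUp_01,
      epsUp_10, epsUp_11, delta_self, delta_01, delta_10, mul_zero, zero_mul, mul_one, one_mul,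
      add_zero, zero_add, sub_zero, zero_sub, neg_zero, true_and, and_true]
    repeat' apply And.intro
    all_goals ring

set_option maxHeartbeats 1000000 in
theorem Bos.chiral_qbar (α : ℂ) (j a : Fin 2) (x : Bos m) :
    Fer.chiral α (Bos.qbar j a x) + Bos.qbarT j a (Bos.chiral α x) = 0 := by
  apply Fer.ext_apply
  · intro c d p
    simp only [Fer.chiral_apply, Bos.chiral_apply, Bos.qbar_apply, Bos.qbarT, Fin.sum_univ_two, Prod.fst_add, Prod.snd_add,
      Prod.fst_zero, Prod.snd_zero, Prod.smul_fst, Prod.smul_snd, Pi.add_apply, Pi.zero_apply,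
      Pi.smul_apply, map_add, map_sub, map_smul, ShellTest.add_apply, ShellTest.sub_apply,
      ShellTest.smul_apply, ShellTest.zero_apply, ShellTest.s_apply]
    revert j a c d
    simp only [Fin.forall_fin_two, eps_00, eps_01, eps_10, eps_11, epsUp_00, epsUp_01,
      epsUp_10, epsUp_11, delta_self, delta_01, delta_10, mul_zero, zero_mul, mul_one, one_mul,
      add_zero, zero_add, sub_zero, zero_sub, neg_zero, true_and, and_true]
    repeat' apply And.intro
    all_goals ring
  · intro c d p
    simp only [Fer.chiral_apply, Bos.chiral_apply, Bos.qbar_apply, Bos.qbarT, Fin.sum_univ_two, Prod.fst_add, Prod.snd_add,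
      Prod.fst_zero, Prod.snd_zero, Prod.smul_fst, Prod.smul_snd, Pi.add_apply, Pi.zero_apply,
      Pi.smul_apply, map_add, map_sub, map_smul, ShellTest.add_apply, ShellTest.sub_apply,
      ShellTest.smul_apply, ShellTest.zero_apply, ShellTest.s_apply]
    linear_combination (norm := skip) (2 * I * α * delta j c * sig p.1 d a * x.2.1 p) * I_sq
    revert j a c d
    simp only [Fin.forall_fin_two, eps_00, eps_01, eps_10, eps_11, epsUp_00, epsUp_01,
      epsUp_10, epsUp_11, delta_self, delta_01, delta_10, mul_zero, zero_mul, mul_one, one_mul,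
      add_zero, zero_add, sub_zero, zero_sub, neg_zero, true_and, and_true]
    repeat' apply And.intro
    all_goals ring

set_option maxHeartbeats 1000000 in
-- The bracket of F with F* contributes cubic terms in σ·k, which cancel against the mass terms of λ
-- only through det(σ·k) = m².
theorem Bos.mixed_q (j a : Fin 2) (x : Bos m) :
    Fer.mixed (Bos.q j a x) + Bos.conjQbarT j a (Bos.mixed x) = 0 := by
  apply Fer.ext_apply
  · intro c d p
    simp only [Fer.mixed_apply, Bos.mixed_apply, Bos.q_apply, Bos.conjQbarT, Fin.sum_univ_two, Prod.fst_add, Prod.snd_add,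
      Prod.fst_zero, Prod.snd_zero, Prod.smul_fst, Prod.smul_snd, Pi.add_apply, Pi.zero_apply,
      Pi.smul_apply, map_add, map_sub, map_smul, ShellTest.add_apply, ShellTest.sub_apply,
      ShellTest.smul_apply, ShellTest.zero_apply, ShellTest.s_apply]
    simp only [mass_pow_four p, ← ShellTest.det_sig_shell p]
    revert j a c d
    simp only [Fin.forall_fin_two, eps_00, eps_01, eps_10, eps_11, epsUp_00, epsUp_01,
      epsUp_10, epsUp_11, delta_self, delta_01, delta_10, mul_zero, zero_mul, mul_one, one_mul,
      add_zero, zero_add, sub_zero, zero_sub, neg_zero, true_and, and_true]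
    repeat' apply And.intro
    all_goals
      ring_nf
      try (simp only [I_sq, I_pow_three, I_pow_four, I_pow_five]; ring)
  · intro c d p
    simp only [Fer.mixed_apply, Bos.mixed_apply, Bos.q_apply, Bos.conjQbarT, Fin.sum_univ_two, Prod.fst_add, Prod.snd_add,
      Prod.fst_zero, Prod.snd_zero, Prod.smul_fst, Prod.smul_snd, Pi.add_apply, Pi.zero_apply,
      Pi.smul_apply, map_add, map_sub, map_smul, ShellTest.add_apply, ShellTest.sub_apply,
      ShellTest.smul_apply, ShellTest.zero_apply, ShellTest.s_apply]
    revert j a c d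
    simp only [Fin.forall_fin_two, eps_00, eps_01, eps_10, eps_11, epsUp_00, epsUp_01,
      epsUp_10, epsUp_11, delta_self, delta_01, delta_10, mul_zero, zero_mul, mul_one, one_mul,
      add_zero, zero_add, sub_zero, zero_sub, neg_zero, true_and, and_true]
    repeat' apply And.intro
    all_goals ring

set_option maxHeartbeats 1000000 in
-- Here the m⁴ in the bracket of D with D* has to match the m² of λ multiplied by two derivatives.
theorem Bos.mixed_qbar (j a : Fin 2) (x : Bos m) :
    Fer.mixed (Bos.qbar j a x) + Bos.qT j a (Bos.mixed x) = 0 := by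
  apply Fer.ext_apply
  · intro c d p
    simp only [Fer.mixed_apply, Bos.mixed_apply, Bos.qbar_apply, Bos.qT, Fin.sum_univ_two, Prod.fst_add, Prod.snd_add,
      Prod.fst_zero, Prod.snd_zero, Prod.smul_fst, Prod.smul_snd, Pi.add_apply, Pi.zero_apply,
      Pi.smul_apply, map_add, map_sub, map_smul, ShellTest.add_apply, ShellTest.sub_apply,
      ShellTest.smul_apply, ShellTest.zero_apply, ShellTest.s_apply]
    simp only [mass_pow_four p, ← ShellTest.det_sig_shell p]
    revert j a c d
    simp only [Fin.forall_fin_two, eps_00, eps_01, eps_10, eps_11, epsUp_00, epsUp_01,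
      epsUp_10, epsUp_11, delta_self, delta_01, delta_10, mul_zero, zero_mul, mul_one, one_mul,
      add_zero, zero_add, sub_zero, zero_sub, neg_zero, true_and, and_true]
    repeat' apply And.intro
    all_goals
      ring_nf
      try (simp only [I_sq, I_pow_three, I_pow_four, I_pow_five]; ring)
  · intro c d p
    simp only [Fer.mixed_apply, Bos.mixed_apply, Bos.qbar_apply, Bos.qT, Fin.sum_univ_two, Prod.fst_add, Prod.snd_add,
      Prod.fst_zero, Prod.snd_zero, Prod.smul_fst, Prod.smul_snd, Pi.add_apply, Pi.zero_apply,
      Pi.smul_apply, map_add, map_sub, map_smul, ShellTest.add_apply, ShellTest.sub_apply,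
      ShellTest.smul_apply, ShellTest.zero_apply, ShellTest.s_apply]
    simp only [mass_pow_four p, ← ShellTest.det_sig_shell p]
    revert j a c d
    simp only [Fin.forall_fin_two, eps_00, eps_01, eps_10, eps_11, epsUp_00, epsUp_01,
      epsUp_10, epsUp_11, delta_self, delta_01, delta_10, mul_zero, zero_mul, mul_one, one_mul,
      add_zero, zero_add, sub_zero, zero_sub, neg_zero, true_and, and_true]
    repeat' apply And.intro
    all_goals
      ring_nf
      try (simp only [I_sq, I_pow_three, I_pow_four, I_pow_five]; ring)

end Skewness

end

end N2

/-! ### Lorentz and isospin invariance of the mixed form; the resulting chiral space. -/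

namespace N2

noncomputable section

open Complex

set_option linter.unusedSimpArgs false
set_option linter.unnecessarySeqFocus false

variable {m : ℝ}

section Mixed

open ShellTest

variable {τ : ShellTest m →ₗ[ℂ] ShellTest m} {A B : Matrix (Fin 2) (Fin 2) ℂ}

theorem IsSymmetry.det_conj (h : IsSymmetry τ A B) : (A.map (starRingEnd ℂ)).det = 1 := by
  rw [← RingHom.mapMatrix_apply, ← RingHom.map_det, h.det_weyl, map_one]

theorem IsSymmetry.det_conj_isospin (h : IsSymmetry τ A B) :
    (B.map (starRingEnd ℂ)).det = 1 := by
  rw [← RingHom.mapMatrix_apply, ← RingHom.map_det, h.det_isospin, map_one]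

/-- Unitarity in disguise: for B in SU(2) the inverse transpose of the conjugate is B itself. Hence
isospin indices of the mixed form contract with δ. -/
theorem IsSymmetry.contragredient_conj (h : IsSymmetry τ A B) :
    contragredient (B.map (starRingEnd ℂ)) = B := by
  ext j k
  revert j k
  simp only [Fin.forall_fin_two, contragredient_00, contragredient_01, contragredient_10,
    contragredient_11, Matrix.map_apply, h.conj_isospin, Fin.sum_univ_two, eps_00, eps_01, eps_10,
    eps_11]
  refine ⟨⟨?_, ?_⟩, ?_, ?_⟩ <;> ring

/-- Covariance of σ·∂ produces a factor A for the undotted and its conjugate for the dotted index;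
the contragredient removes the latter. -/
theorem IsSymmetry.sum_map_s (h : IsSymmetry τ A B) (e c : Fin 2) (t : ShellTest m) :
    ∑ c', contragredient (A.map (starRingEnd ℂ)) c' c • τ (s e c' t)
      = ∑ a, A e a • s a c (τ t) := by
  have hd := h.det_conj
  simp only [Matrix.det_fin_two, Matrix.map_apply] at hd
  ext p
  simp only [h.map_s, Fin.sum_univ_two, ShellTest.add_apply, ShellTest.smul_apply, s_apply]
  linear_combination (norm := skip) (∑ a, A e a * (-I * sig p.1 a c * τ t p)) * hd
  revert c
  simp only [Fin.forall_fin_two, contragredient_00, contragredient_01, contragredient_10,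
    contragredient_11, Matrix.map_apply, Fin.sum_univ_two]
  constructor <;> ring

theorem IsSymmetry.sum_map_s_s (h : IsSymmetry τ A B) (e f c d : Fin 2) (t : ShellTest m) :
    ∑ c', ∑ d', (contragredient (A.map (starRingEnd ℂ)) c' c *
        contragredient (A.map (starRingEnd ℂ)) d' d) • τ (s e c' (s f d' t))
      = ∑ a, ∑ b, (A e a * A f b) • s a c (s b d (τ t)) := by
  calc _ = ∑ d', contragredient (A.map (starRingEnd ℂ)) d' d •
        ∑ c', contragredient (A.map (starRingEnd ℂ)) c' c • τ (s e c' (s f d' t)) := by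
        rw [Finset.sum_comm]
        simp only [Finset.smul_sum, smul_smul, mul_comm]
    _ = ∑ a, A e a • s a c (∑ d', contragredient (A.map (starRingEnd ℂ)) d' d • τ (s f d' t)) := by
        simp only [fun d' => h.sum_map_s e c (s f d' t), map_sum, map_smul, Finset.smul_sum,
          smul_smul]
        rw [Finset.sum_comm]
        simp only [mul_comm]
    _ = _ := by simp only [h.sum_map_s, map_sum, map_smul, Finset.smul_sum, smul_smul]

/-- After `Bos.mixed` the Weyl indices are dotted and rotate contragrediently to the conjugate of A,
so the pairing with an adjoint vector, rotated by that conjugate, is invariant. -/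
theorem Bos.mixed_rot (h : IsSymmetry τ A B) (x : Bos m) : Bos.mixed (Bos.rot τ A B x) =
    Bos.rot τ (contragredient (A.map (starRingEnd ℂ))) B (Bos.mixed x) := by
  apply Bos.ext_apply
  · intros; simp [Bos.mixed_apply, Bos.rot_apply]
  · intros; simp [Bos.mixed_apply, Bos.rot_apply]
  · intro c d p
    have key := fun e f c d => congrArg (fun t : ShellTest m => t p)
      (h.sum_map_s_s e f c d (x.2.2.1 e f))
    simp only [Fin.sum_univ_two, ShellTest.add_apply, ShellTest.smul_apply] at key
    simp only [Bos.mixed_apply, Bos.rot_apply, Fin.sum_univ_two, map_add, map_smul,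
      ShellTest.add_apply, ShellTest.smul_apply]
    linear_combination -2 * I * (key 0 0 c d + key 0 0 d c + key 0 1 c d + key 0 1 d c
      + key 1 0 c d + key 1 0 d c + key 1 1 c d + key 1 1 d c)
  · intro c d p
    simp only [Bos.mixed_apply, Bos.rot_apply, Fin.sum_univ_two, map_add, map_smul,
      ShellTest.add_apply, ShellTest.smul_apply]
    ring

theorem Fer.mixed_rot (h : IsSymmetry τ A B) (x : Fer m) : Fer.mixed (Fer.rot τ A B x) =
    Fer.rot τ (contragredient (A.map (starRingEnd ℂ))) B (Fer.mixed x) := by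
  apply Fer.ext_apply
  · intro j b p
    have key := fun l e => congrArg (fun t : ShellTest m => t p) (h.sum_map_s e b (x.1 l e))
    simp only [Fin.sum_univ_two, ShellTest.add_apply, ShellTest.smul_apply] at key
    simp only [Fer.mixed_apply, Fer.rot_apply, Fin.sum_univ_two, map_add, map_smul,
      ShellTest.add_apply, ShellTest.smul_apply]
    linear_combination -2 * (m : ℂ) ^ 2 * (B 0 j * (key 0 0 + key 0 1) + B 1 j * (key 1 0 + key 1 1))
  · intro j b p
    have key := fun l e => congrArg (fun t : ShellTest m => t p) (h.sum_map_s e b (x.2 l e))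
    simp only [Fin.sum_univ_two, ShellTest.add_apply, ShellTest.smul_apply] at key
    simp only [Fer.mixed_apply, Fer.rot_apply, Fin.sum_univ_two, map_add, map_smul,
      ShellTest.add_apply, ShellTest.smul_apply]
    linear_combination -2 * (B 0 j * (key 0 0 + key 0 1) + B 1 j * (key 1 0 + key 1 1))

end Mixed

/-- The chiral multiplet of mass `m` with parameter `α`. -/
def shellSpace (m : ℝ) (α : ℂ) : ChiralSpace (Bos m) (Fer m) where
  A₀ := Bos.pair ∘ₗ Bos.chiral α
  A₁ := Fer.pair ∘ₗ Fer.chiral α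
  H₀ := Bos.pair ∘ₗ Bos.mixed
  H₁ := Fer.pair ∘ₗ Fer.mixed
  κ₀ := Bos.conj
  κ₁ := Fer.conj
  A₀_swap x y := by
    rw [LinearMap.comp_apply, LinearMap.comp_apply, ← Bos.pair_chiral, Bos.pair_swap]
  A₁_swap x y := by
    rw [LinearMap.comp_apply, LinearMap.comp_apply, Fer.pair_swap, Fer.pair_chiral, neg_neg]
  κ₀_κ₀ := Bos.conj_conj
  κ₁_κ₁ := Fer.conj_conj
  H₀_conj x y := by
    rw [LinearMap.comp_apply, LinearMap.comp_apply, Bos.pair_conj, Bos.pair_swap (Bos.mixed _),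
      Bos.pair_mixed, neg_neg, Bos.conj_conj]
  H₁_conj x y := by
    rw [LinearMap.comp_apply, LinearMap.comp_apply, Fer.pair_conj, Fer.pair_swap (Fer.mixed _),
      Fer.pair_mixed, neg_neg, Fer.conj_conj]

namespace shellSpace

variable (α : ℂ)

theorem A₀_apply (x y : Bos m) :
    (shellSpace m α).A₀ x y = Bos.pair (Bos.chiral α x) y := rfl

theorem A₁_apply (x y : Fer m) :
    (shellSpace m α).A₁ x y = Fer.pair (Fer.chiral α x) y := rfl

theorem H₀_apply (x y : Bos m) : (shellSpace m α).H₀ x y = Bos.pair (Bos.mixed x) y := rfl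

theorem H₁_apply (x y : Fer m) : (shellSpace m α).H₁ x y = Fer.pair (Fer.mixed x) y := rfl

theorem κ₀_apply (x : Bos m) : (shellSpace m α).κ₀ x = Bos.conj x := rfl

theorem κ₁_apply (x : Fer m) : (shellSpace m α).κ₁ x = Fer.conj x := rfl

attribute [irreducible] shellSpace

theorem A_q (j a : Fin 2) (x : Bos m) (y : Fer m) :
    (shellSpace m α).A₁ (Bos.q j a x) y + (shellSpace m α).A₀ x (Fer.q j a y) = 0 := by
  rw [A₀_apply, A₁_apply, Bos.pair_q, ← LinearMap.add_apply, ← map_add, Bos.chiral_q, map_zero,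
    LinearMap.zero_apply]

theorem A_qbar (j a : Fin 2) (x : Bos m) (y : Fer m) :
    (shellSpace m α).A₁ (Bos.qbar j a x) y + (shellSpace m α).A₀ x (Fer.qbar j a y) = 0 := by
  rw [A₀_apply, A₁_apply, Bos.pair_qbar, ← LinearMap.add_apply, ← map_add, Bos.chiral_qbar,
    map_zero, LinearMap.zero_apply]

theorem H_q (j a : Fin 2) (x : Bos m) (y : Fer m) : (shellSpace m α).H₁ (Bos.q j a x) y
    + (shellSpace m α).H₀ x ((shellSpace m α).κ₀ (Fer.qbar j a ((shellSpace m α).κ₁ y))) = 0 := by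
  rw [H₀_apply, H₁_apply, κ₀_apply, κ₁_apply, Bos.pair_conj_qbar, ← LinearMap.add_apply,
    ← map_add, Bos.mixed_q, map_zero, LinearMap.zero_apply]

theorem H_qbar (j a : Fin 2) (x : Bos m) (y : Fer m) : (shellSpace m α).H₁ (Bos.qbar j a x) y
    + (shellSpace m α).H₀ x ((shellSpace m α).κ₀ (Fer.q j a ((shellSpace m α).κ₁ y))) = 0 := by
  rw [H₀_apply, H₁_apply, κ₀_apply, κ₁_apply, Fer.conj_q, Bos.pair_q, ← LinearMap.add_apply,
    ← map_add, Bos.mixed_qbar, map_zero, LinearMap.zero_apply]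

theorem A₀_mom (μ : Fin 4) (x y : Bos m) :
    (shellSpace m α).A₀ (Bos.mom μ x) y + (shellSpace m α).A₀ x (Bos.mom μ y) = 0 := by
  rw [A₀_apply, A₀_apply, Bos.pair_mom, Bos.chiral_mom, add_neg_cancel]

theorem A₁_mom (μ : Fin 4) (x y : Fer m) :
    (shellSpace m α).A₁ (Fer.mom μ x) y + (shellSpace m α).A₁ x (Fer.mom μ y) = 0 := by
  rw [A₁_apply, A₁_apply, Fer.pair_mom, Fer.chiral_mom, add_neg_cancel]

theorem H₀_mom (μ : Fin 4) (x y : Bos m) : (shellSpace m α).H₀ (Bos.mom μ x) y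
    - (shellSpace m α).H₀ x ((shellSpace m α).κ₀ (Bos.mom μ ((shellSpace m α).κ₀ y))) = 0 := by
  rw [H₀_apply, H₀_apply, κ₀_apply, κ₀_apply, Bos.conj_mom, Bos.conj_conj, map_neg, Bos.pair_mom,
    Bos.mixed_mom, neg_neg, sub_self]

theorem H₁_mom (μ : Fin 4) (x y : Fer m) : (shellSpace m α).H₁ (Fer.mom μ x) y
    - (shellSpace m α).H₁ x ((shellSpace m α).κ₁ (Fer.mom μ ((shellSpace m α).κ₁ y))) = 0 := by
  rw [H₁_apply, H₁_apply, κ₁_apply, κ₁_apply, Fer.conj_mom, Fer.conj_conj, map_neg, Fer.pair_mom,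
    Fer.mixed_mom, neg_neg, sub_self]

section Symm

variable {τ τ' : ShellTest m →ₗ[ℂ] ShellTest m} {A B : Matrix (Fin 2) (Fin 2) ℂ}

/-- The symmetry of the doubled space defined by a symmetry of the one-particle structure. -/
def symm (h : IsSymmetry τ A B) (hτ : τ ∘ₗ τ' = LinearMap.id) (hτ' : τ' ∘ₗ τ = LinearMap.id) :
    (shellSpace m α).double.Symm :=
  (shellSpace m α).symm (Bos.rot τ A B) (Bos.rot τ' A⁻¹ B⁻¹) (Fer.rot τ A B)
    (Fer.rot τ' A⁻¹ B⁻¹)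
    (fun x => by
      rw [Bos.rot_rot, hτ, Matrix.nonsing_inv_mul _ (by simp [h.det_weyl]),
        Matrix.nonsing_inv_mul _ (by simp [h.det_isospin]), Bos.rot_id])
    (fun x => by
      rw [Bos.rot_rot, hτ', Matrix.mul_nonsing_inv _ (by simp [h.det_weyl]),
        Matrix.mul_nonsing_inv _ (by simp [h.det_isospin]), Bos.rot_id])
    (fun x => by
      rw [Fer.rot_rot, hτ, Matrix.nonsing_inv_mul _ (by simp [h.det_weyl]),
        Matrix.nonsing_inv_mul _ (by simp [h.det_isospin]), Fer.rot_id])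
    (fun x => by
      rw [Fer.rot_rot, hτ', Matrix.mul_nonsing_inv _ (by simp [h.det_weyl]),
        Matrix.mul_nonsing_inv _ (by simp [h.det_isospin]), Fer.rot_id])
    (fun x y => by
      rw [A₀_apply, A₀_apply, Bos.chiral_rot, Bos.pair_rot h.det_weyl h.det_isospin h.map_J])
    (fun x y => by
      rw [A₁_apply, A₁_apply, Fer.chiral_rot, Fer.pair_rot h.det_weyl h.det_isospin h.map_J])
    (fun x y => by
      rw [H₀_apply, H₀_apply, κ₀_apply, κ₀_apply, Bos.conj_rot h.map_conj, Bos.mixed_rot h]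
      nth_rw 1 [← h.contragredient_conj]
      rw [Bos.pair_rot h.det_conj h.det_conj_isospin h.map_J])
    (fun x y => by
      rw [H₁_apply, H₁_apply, κ₁_apply, κ₁_apply, Fer.conj_rot h.map_conj, Fer.mixed_rot h]
      nth_rw 1 [← h.contragredient_conj]
      rw [Fer.pair_rot h.det_conj h.det_conj_isospin h.map_J])

end Symm

end shellSpace

end

end N2

/-! ### The geometric symmetries and the vectors of the individual components. -/

namespace N2

noncomputable section

open Complex

set_option linter.unusedSimpArgs false
set_option linter.unnecessarySeqFocus false

variable {m : ℝ}

section Symmetries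

theorem isSymmetry_poincare (a : Spacetime) (A : Matrix.SpecialLinearGroup (Fin 2) ℂ) :
    IsSymmetry (ShellTest.poincare (m := m) a A) A.1 1 where
  det_weyl := A.2
  det_isospin := Matrix.det_one
  conj_isospin := by
    simp [Fin.forall_fin_two]
  map_s := ShellTest.poincare_s a A
  map_conj t := (ShellTest.conj_poincare a A t).symm
  map_J := ShellTest.J_poincare a A

theorem isSymmetry_isospin (u : Matrix.specialUnitaryGroup (Fin 2) ℂ) :
    IsSymmetry (LinearMap.id (M := ShellTest m)) 1 u.1 where
  det_weyl := Matrix.det_one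
  det_isospin := (Matrix.mem_specialUnitaryGroup_iff.1 u.2).2
  conj_isospin := by
    have hu := Matrix.mem_specialUnitaryGroup_iff.1 u.2
    -- For determinant one the adjugate is the inverse, and it is ε uᵀ εᵀ in size two; unitarity
    -- identifies the inverse with the adjoint.
    have h : star u.1 = u.1.adjugate := by
      have h1 := Matrix.mul_adjugate u.1
      rw [hu.2, one_smul] at h1
      calc star u.1 = star u.1 * (u.1 * u.1.adjugate) := by rw [h1, mul_one]
        _ = u.1.adjugate := by
          rw [← mul_assoc, Matrix.mem_unitaryGroup_iff'.1 hu.1, one_mul]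
    intro j k
    have h2 : (starRingEnd ℂ) (u.1 j k) = u.1.adjugate k j := by
      rw [← h]; rfl
    rw [h2, Matrix.adjugate_fin_two]
    revert j k
    simp [Fin.forall_fin_two, Fin.sum_univ_two]
  map_s a b t := by
    revert a b
    simp [Fin.forall_fin_two, Fin.sum_univ_two]
  map_conj _ := rfl
  map_J _ _ := rfl

end Symmetries

section Components

/-- The vector of the field `z`. -/
def Bos.ez : ShellTest m →ₗ[ℂ] Bos m where
  toFun t := (t, 0, 0, 0)
  map_add' t t' := by simp
  map_smul' c t := by simp

/-- The vector of the field `D`. -/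
def Bos.eD : ShellTest m →ₗ[ℂ] Bos m where
  toFun t := (0, t, 0, 0)
  map_add' t t' := by simp
  map_smul' c t := by simp

/-- The vectors of the fields `F_{ab}`. -/
def Bos.eF (a b : Fin 2) : ShellTest m →ₗ[ℂ] Bos m where
  toFun t := (0, 0, fun c d => (1 / 2 * (delta a c * delta b d + delta a d * delta b c)) • t, 0)
  map_add' t t' := by apply Bos.ext_apply <;> intros <;> simp [mul_add]
  map_smul' c t := by apply Bos.ext_apply <;> intros <;> simp <;> ring

/-- The vectors of the fields `C_{jk}`. -/
def Bos.eC (j k : Fin 2) : ShellTest m →ₗ[ℂ] Bos m where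
  toFun t := (0, 0, 0, fun l n => (1 / 2 * (delta j l * delta k n + delta j n * delta k l)) • t)
  map_add' t t' := by apply Bos.ext_apply <;> intros <;> simp [mul_add]
  map_smul' c t := by apply Bos.ext_apply <;> intros <;> simp <;> ring

/-- The vectors of the fields `λ_{ja}`. -/
def Fer.elam (j a : Fin 2) : ShellTest m →ₗ[ℂ] Fer m where
  toFun t := (fun k b => (delta j k * delta a b) • t, 0)
  map_add' t t' := by apply Fer.ext_apply <;> intros <;> simp [mul_add]
  map_smul' c t := by apply Fer.ext_apply <;> intros <;> simp <;> ring

/-- The vectors of the fields `χ_{ja}`. -/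
def Fer.echi (j a : Fin 2) : ShellTest m →ₗ[ℂ] Fer m where
  toFun t := (0, fun k b => (delta j k * delta a b) • t)
  map_add' t t' := by apply Fer.ext_apply <;> intros <;> simp [mul_add]
  map_smul' c t := by apply Fer.ext_apply <;> intros <;> simp <;> ring

theorem Bos.ez_apply (t : ShellTest m) : Bos.ez t = (t, 0, 0, 0) := rfl

theorem Bos.eD_apply (t : ShellTest m) : Bos.eD t = (0, t, 0, 0) := rfl

theorem Bos.eF_apply (a b : Fin 2) (t : ShellTest m) : Bos.eF a b t =
    (0, 0, fun c d => (1 / 2 * (delta a c * delta b d + delta a d * delta b c)) • t, 0) := rfl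

theorem Bos.eC_apply (j k : Fin 2) (t : ShellTest m) : Bos.eC j k t =
    (0, 0, 0, fun l n => (1 / 2 * (delta j l * delta k n + delta j n * delta k l)) • t) := rfl

theorem Fer.elam_apply (j a : Fin 2) (t : ShellTest m) :
    Fer.elam j a t = (fun k b => (delta j k * delta a b) • t, 0) := rfl

theorem Fer.echi_apply (j a : Fin 2) (t : ShellTest m) :
    Fer.echi j a t = (0, fun k b => (delta j k * delta a b) • t) := rfl

theorem Bos.eF_symm (a b : Fin 2) : Bos.eF (m := m) a b = Bos.eF b a := by
  ext t : 1
  simp only [Bos.eF_apply, mul_comm, add_comm]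

theorem Bos.eC_symm (a b : Fin 2) : Bos.eC (m := m) a b = Bos.eC b a := by
  ext t : 1
  simp only [Bos.eC_apply, mul_comm, add_comm]

end Components

section ComponentConj

theorem Bos.conj_ez (t : ShellTest m) : Bos.conj (Bos.ez t) = Bos.ez (ShellTest.conj t) := by
  simp only [Bos.ez_apply, Bos.conj_apply, map_zero, Pi.zero_apply]; rfl

theorem Bos.conj_eD (t : ShellTest m) : Bos.conj (Bos.eD t) = Bos.eD (ShellTest.conj t) := by
  simp only [Bos.eD_apply, Bos.conj_apply, map_zero, Pi.zero_apply]; rfl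

theorem Bos.conj_eF (a b : Fin 2) (t : ShellTest m) :
    Bos.conj (Bos.eF a b t) = Bos.eF a b (ShellTest.conj t) := by
  simp only [Bos.eF_apply, Bos.conj_apply, map_zero, Pi.zero_apply, map_smulₛₗ, map_mul, map_add,
    conj_delta, map_div₀, map_one, map_ofNat]; rfl

theorem Bos.conj_eC (a b : Fin 2) (t : ShellTest m) :
    Bos.conj (Bos.eC a b t) = Bos.eC a b (ShellTest.conj t) := by
  simp only [Bos.eC_apply, Bos.conj_apply, map_zero, Pi.zero_apply, map_smulₛₗ, map_mul, map_add,
    conj_delta, map_div₀, map_one, map_ofNat]; rfl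

theorem Fer.conj_elam (a b : Fin 2) (t : ShellTest m) :
    Fer.conj (Fer.elam a b t) = Fer.elam a b (ShellTest.conj t) := by
  simp only [Fer.elam_apply, Fer.conj_apply, map_zero, Pi.zero_apply, map_smulₛₗ, map_mul,
    conj_delta]; rfl

theorem Fer.conj_echi (a b : Fin 2) (t : ShellTest m) :
    Fer.conj (Fer.echi a b t) = Fer.echi a b (ShellTest.conj t) := by
  simp only [Fer.echi_apply, Fer.conj_apply, map_zero, Pi.zero_apply, map_smulₛₗ, map_mul,
    conj_delta]; rfl

theorem Bos.mom_ez (μ : Fin 4) (t : ShellTest m) :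
    Bos.mom μ (Bos.ez t) = Bos.ez (ShellTest.mom μ t) := by
  apply Bos.ext_apply <;> intros <;> simp [Bos.ez_apply, Bos.mom_apply]

theorem Bos.mom_eD (μ : Fin 4) (t : ShellTest m) :
    Bos.mom μ (Bos.eD t) = Bos.eD (ShellTest.mom μ t) := by
  apply Bos.ext_apply <;> intros <;> simp [Bos.eD_apply, Bos.mom_apply]

theorem Bos.mom_eF (μ : Fin 4) (a b : Fin 2) (t : ShellTest m) :
    Bos.mom μ (Bos.eF a b t) = Bos.eF a b (ShellTest.mom μ t) := by
  apply Bos.ext_apply <;> intros <;> simp [Bos.eF_apply, Bos.mom_apply] <;> ring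

theorem Bos.mom_eC (μ : Fin 4) (a b : Fin 2) (t : ShellTest m) :
    Bos.mom μ (Bos.eC a b t) = Bos.eC a b (ShellTest.mom μ t) := by
  apply Bos.ext_apply <;> intros <;> simp [Bos.eC_apply, Bos.mom_apply] <;> ring

theorem Fer.mom_elam (μ : Fin 4) (a b : Fin 2) (t : ShellTest m) :
    Fer.mom μ (Fer.elam a b t) = Fer.elam a b (ShellTest.mom μ t) := by
  apply Fer.ext_apply <;> intros <;> simp [Fer.elam_apply, Fer.mom_apply]

theorem Fer.mom_echi (μ : Fin 4) (a b : Fin 2) (t : ShellTest m) :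
    Fer.mom μ (Fer.echi a b t) = Fer.echi a b (ShellTest.mom μ t) := by
  apply Fer.ext_apply <;> intros <;> simp [Fer.echi_apply, Fer.mom_apply]

end ComponentConj

end

end N2

/-! ### Action of charges and rotations on component vectors. -/

namespace N2

noncomputable section

open Complex

set_option linter.unusedSimpArgs false
set_option linter.unnecessarySeqFocus false

variable {m : ℝ}

section ChargesOnComponents

open ShellTest

theorem Bos.q_ez (j a : Fin 2) (t : ShellTest m) :
    Bos.q j a (Bos.ez t) = (-I) • Fer.echi j a t := by
  apply Fer.ext_apply
  · intros; simp [Bos.q_apply, Bos.ez_apply, Fer.echi_apply]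
  · intro u v p
    simp only [Bos.q_apply, Bos.ez_apply, Fer.echi_apply, Fin.sum_univ_two, Prod.fst_add, Prod.snd_add,
      Prod.fst_zero, Prod.snd_zero, Prod.fst_neg, Prod.snd_neg, Prod.smul_fst, Prod.smul_snd,
      Pi.add_apply, Pi.zero_apply, Pi.neg_apply, Pi.smul_apply, map_add, map_smul, map_zero,
      ShellTest.add_apply, ShellTest.sub_apply, ShellTest.neg_apply, ShellTest.smul_apply,
      ShellTest.zero_apply, ShellTest.s_apply]
    ring

theorem Bos.q_eD (j a : Fin 2) (t : ShellTest m) :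
    Bos.q j a (Bos.eD t) = 0 := by
  apply Fer.ext_apply
  · intros; simp [Bos.q_apply, Bos.eD_apply]
  · intros; simp [Bos.q_apply, Bos.eD_apply]

theorem Bos.q_eF (j a b c : Fin 2) (t : ShellTest m) :
    Bos.q j a (Bos.eF b c t) = eps a b • Fer.elam j c t + eps a c • Fer.elam j b t := by
  apply Fer.ext_apply
  · intro u v p
    simp only [Bos.q_apply, Bos.eF_apply, Fer.elam_apply, Fin.sum_univ_two, Prod.fst_add, Prod.snd_add,
      Prod.fst_zero, Prod.snd_zero, Prod.fst_neg, Prod.snd_neg, Prod.smul_fst, Prod.smul_snd,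
      Pi.add_apply, Pi.zero_apply, Pi.neg_apply, Pi.smul_apply, map_add, map_smul, map_zero,
      ShellTest.add_apply, ShellTest.sub_apply, ShellTest.neg_apply, ShellTest.smul_apply,
      ShellTest.zero_apply, ShellTest.s_apply]
    revert a b c
    simp only [Fin.forall_fin_two, eps_00, eps_01, eps_10, eps_11, epsUp_00, epsUp_01,
      epsUp_10, epsUp_11, delta_self, delta_01, delta_10, mul_zero, zero_mul, mul_one, one_mul,
      add_zero, zero_add, sub_zero, zero_sub, neg_zero, smul_zero, true_and, and_true, and_self,
      implies_true]
    repeat' apply And.intro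
    all_goals ring
  · intros; simp [Bos.q_apply, Bos.eF_apply, Fer.elam_apply]

theorem Bos.q_eC (j a k l : Fin 2) (t : ShellTest m) :
    Bos.q j a (Bos.eC k l t) = -(eps j k • Fer.elam l a t + eps j l • Fer.elam k a t) := by
  apply Fer.ext_apply
  · intro u v p
    simp only [Bos.q_apply, Bos.eC_apply, Fer.elam_apply, Fin.sum_univ_two, Prod.fst_add, Prod.snd_add,
      Prod.fst_zero, Prod.snd_zero, Prod.fst_neg, Prod.snd_neg, Prod.smul_fst, Prod.smul_snd,
      Pi.add_apply, Pi.zero_apply, Pi.neg_apply, Pi.smul_apply, map_add, map_smul, map_zero,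
      ShellTest.add_apply, ShellTest.sub_apply, ShellTest.neg_apply, ShellTest.smul_apply,
      ShellTest.zero_apply, ShellTest.s_apply]
    revert j k l
    simp only [Fin.forall_fin_two, eps_00, eps_01, eps_10, eps_11, epsUp_00, epsUp_01,
      epsUp_10, epsUp_11, delta_self, delta_01, delta_10, mul_zero, zero_mul, mul_one, one_mul,
      add_zero, zero_add, sub_zero, zero_sub, neg_zero, smul_zero, true_and, and_true, and_self,
      implies_true]
    repeat' apply And.intro
    all_goals ring
  · intros; simp [Bos.q_apply, Bos.eC_apply, Fer.elam_apply]

theorem Bos.qbar_ez (j a : Fin 2) (t : ShellTest m) :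
    Bos.qbar j a (Bos.ez t) = 0 := by
  apply Fer.ext_apply
  · intros; simp [Bos.qbar_apply, Bos.ez_apply]
  · intros; simp [Bos.qbar_apply, Bos.ez_apply]

theorem Bos.qbar_eD (j a : Fin 2) (t : ShellTest m) :
    Bos.qbar j a (Bos.eD t)
      = (2 * I) • ∑ k, eps j k • ∑ b, ∑ c, epsUp b c • Fer.elam k c (s b a t) := by
  apply Fer.ext_apply
  · intro u v p
    simp only [Bos.qbar_apply, Bos.eD_apply, Fer.elam_apply, Fin.sum_univ_two, Prod.fst_add, Prod.snd_add,
      Prod.fst_zero, Prod.snd_zero, Prod.fst_neg, Prod.snd_neg, Prod.smul_fst, Prod.smul_snd,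
      Pi.add_apply, Pi.zero_apply, Pi.neg_apply, Pi.smul_apply, map_add, map_smul, map_zero,
      ShellTest.add_apply, ShellTest.sub_apply, ShellTest.neg_apply, ShellTest.smul_apply,
      ShellTest.zero_apply, ShellTest.s_apply]
    revert u v
    simp only [Fin.forall_fin_two, eps_00, eps_01, eps_10, eps_11, epsUp_00, epsUp_01,
      epsUp_10, epsUp_11, delta_self, delta_01, delta_10, mul_zero, zero_mul, mul_one, one_mul,
      add_zero, zero_add, sub_zero, zero_sub, neg_zero, smul_zero, true_and, and_true, and_self,
      implies_true]
    repeat' apply And.intro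
    all_goals ring
  · intros; simp [Bos.qbar_apply, Bos.eD_apply, Fer.elam_apply]

theorem Bos.qbar_eF (j a b c : Fin 2) (t : ShellTest m) :
    Bos.qbar j a (Bos.eF b c t)
      = (-I) • ∑ k, eps j k • (Fer.echi k b (s c a t) + Fer.echi k c (s b a t)) := by
  apply Fer.ext_apply
  · intros; simp [Bos.qbar_apply, Bos.eF_apply, Fer.echi_apply]
  · intro u v p
    simp only [Bos.qbar_apply, Bos.eF_apply, Fer.echi_apply, Fin.sum_univ_two, Prod.fst_add, Prod.snd_add,
      Prod.fst_zero, Prod.snd_zero, Prod.fst_neg, Prod.snd_neg, Prod.smul_fst, Prod.smul_snd,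
      Pi.add_apply, Pi.zero_apply, Pi.neg_apply, Pi.smul_apply, map_add, map_smul, map_zero,
      ShellTest.add_apply, ShellTest.sub_apply, ShellTest.neg_apply, ShellTest.smul_apply,
      ShellTest.zero_apply, ShellTest.s_apply]
    revert b c u
    simp only [Fin.forall_fin_two, eps_00, eps_01, eps_10, eps_11, epsUp_00, epsUp_01,
      epsUp_10, epsUp_11, delta_self, delta_01, delta_10, mul_zero, zero_mul, mul_one, one_mul,
      add_zero, zero_add, sub_zero, zero_sub, neg_zero, smul_zero, true_and, and_true, and_self,
      implies_true]
    repeat' apply And.intro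
    all_goals ring

theorem Bos.qbar_eC (j a k l : Fin 2) (t : ShellTest m) :
    Bos.qbar j a (Bos.eC k l t) = I • ∑ b, ∑ c, epsUp b c •
      (delta j k • Fer.echi l c (s b a t) + delta j l • Fer.echi k c (s b a t)) := by
  apply Fer.ext_apply
  · intros; simp [Bos.qbar_apply, Bos.eC_apply, Fer.echi_apply]
  · intro u v p
    simp only [Bos.qbar_apply, Bos.eC_apply, Fer.echi_apply, Fin.sum_univ_two, Prod.fst_add, Prod.snd_add,
      Prod.fst_zero, Prod.snd_zero, Prod.fst_neg, Prod.snd_neg, Prod.smul_fst, Prod.smul_snd,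
      Pi.add_apply, Pi.zero_apply, Pi.neg_apply, Pi.smul_apply, map_add, map_smul, map_zero,
      ShellTest.add_apply, ShellTest.sub_apply, ShellTest.neg_apply, ShellTest.smul_apply,
      ShellTest.zero_apply, ShellTest.s_apply]
    revert j k l v
    simp only [Fin.forall_fin_two, eps_00, eps_01, eps_10, eps_11, epsUp_00, epsUp_01,
      epsUp_10, epsUp_11, delta_self, delta_01, delta_10, mul_zero, zero_mul, mul_one, one_mul,
      add_zero, zero_add, sub_zero, zero_sub, neg_zero, smul_zero, true_and, and_true, and_self,
      implies_true]
    repeat' apply And.intro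
    all_goals ring

theorem Fer.q_elam (j a k b : Fin 2) (t : ShellTest m) :
    Fer.q j a (Fer.elam k b t) = (eps j k * eps a b) • Bos.eD t := by
  apply Bos.ext_apply
  · intros; simp [Fer.q_apply, Fer.elam_apply, Bos.eD_apply]
  · intro p
    simp only [Fer.q_apply, Fer.elam_apply, Bos.eD_apply, Fin.sum_univ_two, Prod.fst_add, Prod.snd_add,
      Prod.fst_zero, Prod.snd_zero, Prod.fst_neg, Prod.snd_neg, Prod.smul_fst, Prod.smul_snd,
      Pi.add_apply, Pi.zero_apply, Pi.neg_apply, Pi.smul_apply, map_add, map_smul, map_zero,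
      ShellTest.add_apply, ShellTest.sub_apply, ShellTest.neg_apply, ShellTest.smul_apply,
      ShellTest.zero_apply, ShellTest.s_apply]
    revert k b
    simp only [Fin.forall_fin_two, eps_00, eps_01, eps_10, eps_11, epsUp_00, epsUp_01,
      epsUp_10, epsUp_11, delta_self, delta_01, delta_10, mul_zero, zero_mul, mul_one, one_mul,
      add_zero, zero_add, sub_zero, zero_sub, neg_zero, smul_zero, true_and, and_true, and_self,
      implies_true]
  · intros; simp [Fer.q_apply, Fer.elam_apply, Bos.eD_apply]
  · intros; simp [Fer.q_apply, Fer.elam_apply, Bos.eD_apply]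

theorem Fer.q_echi (j a k b : Fin 2) (t : ShellTest m) :
    Fer.q j a (Fer.echi k b t) = eps j k • Bos.eF a b t + eps a b • Bos.eC j k t := by
  apply Bos.ext_apply
  · intros; simp [Fer.q_apply, Fer.echi_apply, Bos.eF_apply, Bos.eC_apply]
  · intros; simp [Fer.q_apply, Fer.echi_apply, Bos.eF_apply, Bos.eC_apply]
  · intro u v p
    simp only [Fer.q_apply, Fer.echi_apply, Bos.eF_apply, Bos.eC_apply, Fin.sum_univ_two, Prod.fst_add, Prod.snd_add,
      Prod.fst_zero, Prod.snd_zero, Prod.fst_neg, Prod.snd_neg, Prod.smul_fst, Prod.smul_snd,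
      Pi.add_apply, Pi.zero_apply, Pi.neg_apply, Pi.smul_apply, map_add, map_smul, map_zero,
      ShellTest.add_apply, ShellTest.sub_apply, ShellTest.neg_apply, ShellTest.smul_apply,
      ShellTest.zero_apply, ShellTest.s_apply]
    revert k
    simp only [Fin.forall_fin_two, eps_00, eps_01, eps_10, eps_11, epsUp_00, epsUp_01,
      epsUp_10, epsUp_11, delta_self, delta_01, delta_10, mul_zero, zero_mul, mul_one, one_mul,
      add_zero, zero_add, sub_zero, zero_sub, neg_zero, smul_zero, true_and, and_true, and_self,
      implies_true]
    repeat' apply And.intro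
    all_goals ring
  · intro u v p
    simp only [Fer.q_apply, Fer.echi_apply, Bos.eF_apply, Bos.eC_apply, Fin.sum_univ_two, Prod.fst_add, Prod.snd_add,
      Prod.fst_zero, Prod.snd_zero, Prod.fst_neg, Prod.snd_neg, Prod.smul_fst, Prod.smul_snd,
      Pi.add_apply, Pi.zero_apply, Pi.neg_apply, Pi.smul_apply, map_add, map_smul, map_zero,
      ShellTest.add_apply, ShellTest.sub_apply, ShellTest.neg_apply, ShellTest.smul_apply,
      ShellTest.zero_apply, ShellTest.s_apply]
    revert b
    simp only [Fin.forall_fin_two, eps_00, eps_01, eps_10, eps_11, epsUp_00, epsUp_01,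
      epsUp_10, epsUp_11, delta_self, delta_01, delta_10, mul_zero, zero_mul, mul_one, one_mul,
      add_zero, zero_add, sub_zero, zero_sub, neg_zero, smul_zero, true_and, and_true, and_self,
      implies_true]
    repeat' apply And.intro
    all_goals ring

theorem Fer.qbar_elam (j b k a : Fin 2) (t : ShellTest m) :
    Fer.qbar j b (Fer.elam k a t) = I • (delta j k • ∑ c, ∑ d, epsUp c d • Bos.eF a d (s c b t)
      + ∑ l, eps j l • Bos.eC l k (s a b t)) := by
  apply Bos.ext_apply
  · intros; simp [Fer.qbar_apply, Fer.elam_apply, Bos.eF_apply, Bos.eC_apply]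
  · intros; simp [Fer.qbar_apply, Fer.elam_apply, Bos.eF_apply, Bos.eC_apply]
  · intro u v p
    simp only [Fer.qbar_apply, Fer.elam_apply, Bos.eF_apply, Bos.eC_apply, Fin.sum_univ_two, Prod.fst_add, Prod.snd_add,
      Prod.fst_zero, Prod.snd_zero, Prod.fst_neg, Prod.snd_neg, Prod.smul_fst, Prod.smul_snd,
      Pi.add_apply, Pi.zero_apply, Pi.neg_apply, Pi.smul_apply, map_add, map_smul, map_zero,
      ShellTest.add_apply, ShellTest.sub_apply, ShellTest.neg_apply, ShellTest.smul_apply,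
      ShellTest.zero_apply, ShellTest.s_apply]
    revert j k u v
    simp only [Fin.forall_fin_two, eps_00, eps_01, eps_10, eps_11, epsUp_00, epsUp_01,
      epsUp_10, epsUp_11, delta_self, delta_01, delta_10, mul_zero, zero_mul, mul_one, one_mul,
      add_zero, zero_add, sub_zero, zero_sub, neg_zero, smul_zero, true_and, and_true, and_self,
      implies_true]
    repeat' apply And.intro
    all_goals ring
  · intro u v p
    simp only [Fer.qbar_apply, Fer.elam_apply, Bos.eF_apply, Bos.eC_apply, Fin.sum_univ_two, Prod.fst_add, Prod.snd_add,
      Prod.fst_zero, Prod.snd_zero, Prod.fst_neg, Prod.snd_neg, Prod.smul_fst, Prod.smul_snd,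
      Pi.add_apply, Pi.zero_apply, Pi.neg_apply, Pi.smul_apply, map_add, map_smul, map_zero,
      ShellTest.add_apply, ShellTest.sub_apply, ShellTest.neg_apply, ShellTest.smul_apply,
      ShellTest.zero_apply, ShellTest.s_apply]
    revert a u v
    simp only [Fin.forall_fin_two, eps_00, eps_01, eps_10, eps_11, epsUp_00, epsUp_01,
      epsUp_10, epsUp_11, delta_self, delta_01, delta_10, mul_zero, zero_mul, mul_one, one_mul,
      add_zero, zero_add, sub_zero, zero_sub, neg_zero, smul_zero, true_and, and_true, and_self,
      implies_true]
    repeat' apply And.intro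
    all_goals ring

theorem Fer.qbar_echi (j a k b : Fin 2) (t : ShellTest m) :
    Fer.qbar j a (Fer.echi k b t) = (2 * delta j k) • Bos.ez (s b a t) := by
  apply Bos.ext_apply
  · intro p
    simp only [Fer.qbar_apply, Fer.echi_apply, Bos.ez_apply, Fin.sum_univ_two, Prod.fst_add, Prod.snd_add,
      Prod.fst_zero, Prod.snd_zero, Prod.fst_neg, Prod.snd_neg, Prod.smul_fst, Prod.smul_snd,
      Pi.add_apply, Pi.zero_apply, Pi.neg_apply, Pi.smul_apply, map_add, map_smul, map_zero,
      ShellTest.add_apply, ShellTest.sub_apply, ShellTest.neg_apply, ShellTest.smul_apply,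
      ShellTest.zero_apply, ShellTest.s_apply]
    revert j k b
    simp only [Fin.forall_fin_two, eps_00, eps_01, eps_10, eps_11, epsUp_00, epsUp_01,
      epsUp_10, epsUp_11, delta_self, delta_01, delta_10, mul_zero, zero_mul, mul_one, one_mul,
      add_zero, zero_add, sub_zero, zero_sub, neg_zero, smul_zero, true_and, and_true, and_self,
      implies_true]
  · intros; simp [Fer.qbar_apply, Fer.echi_apply, Bos.ez_apply]
  · intros; simp [Fer.qbar_apply, Fer.echi_apply, Bos.ez_apply]
  · intros; simp [Fer.qbar_apply, Fer.echi_apply, Bos.ez_apply]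

end ChargesOnComponents

section RotationsOfComponents

variable {τ : ShellTest m →ₗ[ℂ] ShellTest m} {A B : Matrix (Fin 2) (Fin 2) ℂ}

theorem Bos.rot_ez (t : ShellTest m) :
    Bos.rot τ A B (Bos.ez t) = Bos.ez (τ t) := by
  apply Bos.ext_apply
  · intros; simp [Bos.rot_apply, Bos.ez_apply]
  · intros; simp [Bos.rot_apply, Bos.ez_apply]
  · intros; simp [Bos.rot_apply, Bos.ez_apply]
  · intros; simp [Bos.rot_apply, Bos.ez_apply]

theorem Bos.rot_eD (t : ShellTest m) :
    Bos.rot τ A B (Bos.eD t) = Bos.eD (τ t) := by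
  apply Bos.ext_apply
  · intros; simp [Bos.rot_apply, Bos.eD_apply]
  · intros; simp [Bos.rot_apply, Bos.eD_apply]
  · intros; simp [Bos.rot_apply, Bos.eD_apply]
  · intros; simp [Bos.rot_apply, Bos.eD_apply]

theorem Bos.rot_eF (b c : Fin 2) (t : ShellTest m) :
    Bos.rot τ A B (Bos.eF b c t) = ∑ b', ∑ c', (A b b' * A c c') • Bos.eF b' c' (τ t) := by
  apply Bos.ext_apply
  · intros; simp [Bos.rot_apply, Bos.eF_apply]
  · intros; simp [Bos.rot_apply, Bos.eF_apply]
  · intro u v p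
    simp only [Bos.rot_apply, Bos.eF_apply, Fin.sum_univ_two, Prod.fst_add, Prod.snd_add,
      Prod.fst_zero, Prod.snd_zero, Prod.fst_neg, Prod.snd_neg, Prod.smul_fst, Prod.smul_snd,
      Pi.add_apply, Pi.zero_apply, Pi.neg_apply, Pi.smul_apply, map_add, map_smul, map_zero,
      ShellTest.add_apply, ShellTest.sub_apply, ShellTest.neg_apply, ShellTest.smul_apply,
      ShellTest.zero_apply, ShellTest.s_apply]
    revert b c u v
    simp only [Fin.forall_fin_two, eps_00, eps_01, eps_10, eps_11, epsUp_00, epsUp_01,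
      epsUp_10, epsUp_11, delta_self, delta_01, delta_10, mul_zero, zero_mul, mul_one, one_mul,
      add_zero, zero_add, sub_zero, zero_sub, neg_zero, smul_zero, true_and, and_true, and_self,
      implies_true]
    repeat' apply And.intro
    all_goals ring
  · intros; simp [Bos.rot_apply, Bos.eF_apply]

theorem Bos.rot_eC (j k : Fin 2) (t : ShellTest m) :
    Bos.rot τ A B (Bos.eC j k t) = ∑ l, ∑ n, (B j l * B k n) • Bos.eC l n (τ t) := by
  apply Bos.ext_apply
  · intros; simp [Bos.rot_apply, Bos.eC_apply]
  · intros; simp [Bos.rot_apply, Bos.eC_apply]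
  · intros; simp [Bos.rot_apply, Bos.eC_apply]
  · intro u v p
    simp only [Bos.rot_apply, Bos.eC_apply, Fin.sum_univ_two, Prod.fst_add, Prod.snd_add,
      Prod.fst_zero, Prod.snd_zero, Prod.fst_neg, Prod.snd_neg, Prod.smul_fst, Prod.smul_snd,
      Pi.add_apply, Pi.zero_apply, Pi.neg_apply, Pi.smul_apply, map_add, map_smul, map_zero,
      ShellTest.add_apply, ShellTest.sub_apply, ShellTest.neg_apply, ShellTest.smul_apply,
      ShellTest.zero_apply, ShellTest.s_apply]
    revert j k u v
    simp only [Fin.forall_fin_two, eps_00, eps_01, eps_10, eps_11, epsUp_00, epsUp_01,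
      epsUp_10, epsUp_11, delta_self, delta_01, delta_10, mul_zero, zero_mul, mul_one, one_mul,
      add_zero, zero_add, sub_zero, zero_sub, neg_zero, smul_zero, true_and, and_true, and_self,
      implies_true]
    repeat' apply And.intro
    all_goals ring

theorem Fer.rot_elam (j a : Fin 2) (t : ShellTest m) :
    Fer.rot τ A B (Fer.elam j a t) = ∑ k, ∑ b, (B j k * A a b) • Fer.elam k b (τ t) := by
  apply Fer.ext_apply
  · intro u v p
    simp only [Fer.rot_apply, Fer.elam_apply, Fin.sum_univ_two, Prod.fst_add, Prod.snd_add,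
      Prod.fst_zero, Prod.snd_zero, Prod.fst_neg, Prod.snd_neg, Prod.smul_fst, Prod.smul_snd,
      Pi.add_apply, Pi.zero_apply, Pi.neg_apply, Pi.smul_apply, map_add, map_smul, map_zero,
      ShellTest.add_apply, ShellTest.sub_apply, ShellTest.neg_apply, ShellTest.smul_apply,
      ShellTest.zero_apply, ShellTest.s_apply]
    revert j a u v
    simp only [Fin.forall_fin_two, eps_00, eps_01, eps_10, eps_11, epsUp_00, epsUp_01,
      epsUp_10, epsUp_11, delta_self, delta_01, delta_10, mul_zero, zero_mul, mul_one, one_mul,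
      add_zero, zero_add, sub_zero, zero_sub, neg_zero, smul_zero, true_and, and_true, and_self,
      implies_true]
  · intros; simp [Fer.rot_apply, Fer.elam_apply]

theorem Fer.rot_echi (j a : Fin 2) (t : ShellTest m) :
    Fer.rot τ A B (Fer.echi j a t) = ∑ k, ∑ b, (B j k * A a b) • Fer.echi k b (τ t) := by
  apply Fer.ext_apply
  · intros; simp [Fer.rot_apply, Fer.echi_apply]
  · intro u v p
    simp only [Fer.rot_apply, Fer.echi_apply, Fin.sum_univ_two, Prod.fst_add, Prod.snd_add,
      Prod.fst_zero, Prod.snd_zero, Prod.fst_neg, Prod.snd_neg, Prod.smul_fst, Prod.smul_snd,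
      Pi.add_apply, Pi.zero_apply, Pi.neg_apply, Pi.smul_apply, map_add, map_smul, map_zero,
      ShellTest.add_apply, ShellTest.sub_apply, ShellTest.neg_apply, ShellTest.smul_apply,
      ShellTest.zero_apply, ShellTest.s_apply]
    revert j a u v
    simp only [Fin.forall_fin_two, eps_00, eps_01, eps_10, eps_11, epsUp_00, epsUp_01,
      epsUp_10, epsUp_11, delta_self, delta_01, delta_10, mul_zero, zero_mul, mul_one, one_mul,
      add_zero, zero_add, sub_zero, zero_sub, neg_zero, smul_zero, true_and, and_true, and_self,
      implies_true]

end RotationsOfComponents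

end

end N2

/-! ### Relations of the charges extended to adjoint fields. -/

namespace N2

noncomputable section

open Complex

namespace ChiralSpace

variable {M₀ M₁ : Type*} [AddCommGroup M₀] [Module ℂ M₀] [AddCommGroup M₁] [Module ℂ M₁]
  (S : ChiralSpace M₀ M₁) {Q₀ R₀ Q₀' R₀' : M₀ →ₗ[ℂ] M₁} {Q₁ R₁ Q₁' R₁' : M₁ →ₗ[ℂ] M₀}

/-- On the adjoint half the charges act through the antilinear conjugation, which is why the
relation for R is needed with conjugated coefficients. -/
theorem acomm_charge_even {ι : Type*} (s : Finset ι) (c : ι → ℂ) {p : ι → M₀ →ₗ[ℂ] M₀}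
    (hQ : ∀ x, Q₁ (Q₀' x) + Q₁' (Q₀ x) = ∑ i ∈ s, c i • p i x)
    (hR : ∀ x, R₁ (R₀' x) + R₁' (R₀ x) = ∑ i ∈ s, (starRingEnd ℂ) (c i) • p i x) :
    S.charge₁ Q₁ R₁ ∘ₗ S.charge₀ Q₀' R₀' + S.charge₁ Q₁' R₁' ∘ₗ S.charge₀ Q₀ R₀
      = ∑ i ∈ s, c i • S.generator₀ (p i) := by
  refine LinearMap.ext fun v => Prod.ext ?_ ?_
  · simp only [LinearMap.add_apply, LinearMap.comp_apply, charge₀_apply, charge₁_apply,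
      LinearMap.sum_apply, LinearMap.smul_apply, generator₀_apply, Prod.fst_add, Prod.fst_sum,
      Prod.smul_fst, hQ]
  · have h := congrArg S.κ₀ (hR (S.κ₀ v.2))
    simp only [map_add, map_sum, map_smulₛₗ, Complex.conj_conj] at h
    simp only [LinearMap.add_apply, LinearMap.comp_apply, charge₀_apply, charge₁_apply,
      LinearMap.sum_apply, LinearMap.smul_apply, generator₀_apply, Prod.snd_add, Prod.snd_sum,
      Prod.smul_snd, map_neg, S.κ₁_κ₁, ← neg_add, h, smul_neg, Finset.sum_neg_distrib]

theorem acomm_charge_odd {ι : Type*} (s : Finset ι) (c : ι → ℂ) {p : ι → M₁ →ₗ[ℂ] M₁}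
    (hQ : ∀ x, Q₀ (Q₁' x) + Q₀' (Q₁ x) = ∑ i ∈ s, c i • p i x)
    (hR : ∀ x, R₀ (R₁' x) + R₀' (R₁ x) = ∑ i ∈ s, (starRingEnd ℂ) (c i) • p i x) :
    S.charge₀ Q₀ R₀ ∘ₗ S.charge₁ Q₁' R₁' + S.charge₀ Q₀' R₀' ∘ₗ S.charge₁ Q₁ R₁
      = ∑ i ∈ s, c i • S.generator₁ (p i) := by
  refine LinearMap.ext fun v => Prod.ext ?_ ?_
  · simp only [LinearMap.add_apply, LinearMap.comp_apply, charge₀_apply, charge₁_apply,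
      LinearMap.sum_apply, LinearMap.smul_apply, generator₁_apply, Prod.fst_add, Prod.fst_sum,
      Prod.smul_fst, hQ]
  · have h := congrArg S.κ₁ (hR (S.κ₁ v.2))
    simp only [map_add, map_sum, map_smulₛₗ, Complex.conj_conj] at h
    simp only [LinearMap.add_apply, LinearMap.comp_apply, charge₀_apply, charge₁_apply,
      LinearMap.sum_apply, LinearMap.smul_apply, generator₁_apply, Prod.snd_add, Prod.snd_sum,
      Prod.smul_snd, S.κ₀_κ₀, ← neg_add, h, smul_neg, Finset.sum_neg_distrib]

theorem charge₀_generator {p₀ : M₀ →ₗ[ℂ] M₀} {p₁ : M₁ →ₗ[ℂ] M₁}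
    (hQ : ∀ x, p₁ (Q₀ x) = Q₀ (p₀ x)) (hR : ∀ x, p₁ (R₀ x) = R₀ (p₀ x)) (v : M₀ × M₀) :
    S.charge₀ Q₀ R₀ (S.generator₀ p₀ v) = S.generator₁ p₁ (S.charge₀ Q₀ R₀ v) := by
  simp only [charge₀_apply, generator₀_apply, generator₁_apply, map_neg, S.κ₀_κ₀, S.κ₁_κ₁, hQ, hR]

theorem charge₁_generator {p₀ : M₀ →ₗ[ℂ] M₀} {p₁ : M₁ →ₗ[ℂ] M₁}
    (hQ : ∀ x, p₀ (Q₁ x) = Q₁ (p₁ x)) (hR : ∀ x, p₀ (R₁ x) = R₁ (p₁ x)) (v : M₁ × M₁) :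
    S.charge₁ Q₁ R₁ (S.generator₁ p₁ v) = S.generator₀ p₀ (S.charge₁ Q₁ R₁ v) := by
  simp only [charge₁_apply, generator₀_apply, generator₁_apply, map_neg, S.κ₀_κ₀, S.κ₁_κ₁, hQ, hR]

theorem doubleMap_charge₀ {ι : Type*} (s : Finset ι) (c : ι → ℂ) {r₀ : M₀ →ₗ[ℂ] M₀}
    {r₁ : M₁ →ₗ[ℂ] M₁} {q q' : ι → M₀ →ₗ[ℂ] M₁} (hQ : ∀ x, r₁ (Q₀ x) = ∑ i ∈ s, c i • q i (r₀ x))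
    (hR : ∀ x, r₁ (R₀ x) = ∑ i ∈ s, (starRingEnd ℂ) (c i) • q' i (r₀ x)) (v : M₀ × M₀) :
    doubleMap S.κ₁ r₁ (S.charge₀ Q₀ R₀ v)
      = ∑ i ∈ s, c i • S.charge₀ (q i) (q' i) (doubleMap S.κ₀ r₀ v) := by
  refine Prod.ext ?_ ?_
  · simp only [doubleMap_apply, charge₀_apply, Prod.fst_sum, Prod.smul_fst, hQ]
  · simp only [doubleMap_apply, charge₀_apply, Prod.snd_sum, Prod.smul_snd, map_neg, S.κ₁_κ₁,
      S.κ₀_κ₀, hR, map_sum, map_smulₛₗ, Complex.conj_conj, smul_neg, Finset.sum_neg_distrib]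

theorem doubleMap_charge₁ {ι : Type*} (s : Finset ι) (c : ι → ℂ) {r₀ : M₀ →ₗ[ℂ] M₀}
    {r₁ : M₁ →ₗ[ℂ] M₁} {q q' : ι → M₁ →ₗ[ℂ] M₀} (hQ : ∀ x, r₀ (Q₁ x) = ∑ i ∈ s, c i • q i (r₁ x))
    (hR : ∀ x, r₀ (R₁ x) = ∑ i ∈ s, (starRingEnd ℂ) (c i) • q' i (r₁ x)) (v : M₁ × M₁) :
    doubleMap S.κ₀ r₀ (S.charge₁ Q₁ R₁ v)
      = ∑ i ∈ s, c i • S.charge₁ (q i) (q' i) (doubleMap S.κ₁ r₁ v) := by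
  refine Prod.ext ?_ ?_
  · simp only [doubleMap_apply, charge₁_apply, Prod.fst_sum, Prod.smul_fst, hQ]
  · simp only [doubleMap_apply, charge₁_apply, Prod.snd_sum, Prod.smul_snd, S.κ₁_κ₁,
      S.κ₀_κ₀, hR, map_sum, map_smulₛₗ, Complex.conj_conj]

end ChiralSpace

end

end N2

/-! ### Fields, supercharges and momenta as elements of the *-algebra. -/

namespace N2

noncomputable section

open Complex

theorem delta_comm (j k : Fin 2) : delta j k = delta k j := by
  simp only [delta, eq_comm]

theorem Dbl.acomm_mk_eq_smul_sum {E ι : Type*} [Ring E] [Algebra ℂ E] [Fintype ι] {X Y X' Y' : E}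
    (c : ℂ) (d : ι → ℂ) (p p' : ι → E) (h : acomm X X' = ∑ i, (c * d i) • p i)
    (h' : acomm Y Y' = ∑ i, (starRingEnd ℂ) (c * d i) • p' i) :
    acomm (Dbl.mk X Y) (Dbl.mk X' Y') = c • ∑ i, d i • Dbl.mk (p i) (p' i) := by
  simp only [Dbl.acomm_mk, h, h', Finset.smul_sum, smul_smul, Dbl.smul_mk, Dbl.sum_mk, map_mul]

namespace ChiralSpace

open SuperWeyl

variable {M₀ M₁ : Type*} [AddCommGroup M₀] [Module ℂ M₀] [AddCommGroup M₁] [Module ℂ M₁]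
  (S : ChiralSpace M₀ M₁)

/-- The `*`-algebra in which the fields take their values. -/
abbrev Alg : Type _ := Dbl S.double.Ops

/-- Bosonic fields. -/
def bose : M₀ →ₗ[ℂ] S.Alg := S.double.even ∘ₗ LinearMap.inl ℂ _ _

/-- Fermionic fields. -/
def fermi : M₁ →ₗ[ℂ] S.Alg := S.double.odd ∘ₗ LinearMap.inl ℂ _ _

/-- Adjoint Bosonic fields. -/
def boseBar : M₀ →ₗ[ℂ] S.Alg := S.double.even ∘ₗ LinearMap.inr ℂ _ _

/-- Adjoint Fermionic fields. -/
def fermiBar : M₁ →ₗ[ℂ] S.Alg := S.double.odd ∘ₗ LinearMap.inr ℂ _ _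

theorem bose_apply (x : M₀) : S.bose x = S.double.even (x, 0) := rfl

theorem fermi_apply (x : M₁) : S.fermi x = S.double.odd (x, 0) := rfl

theorem boseBar_apply (x : M₀) : S.boseBar x = S.double.even (0, x) := rfl

theorem fermiBar_apply (x : M₁) : S.fermiBar x = S.double.odd (0, x) := rfl

theorem star_bose (x : M₀) : star (S.bose x) = S.boseBar (S.κ₀ x) := by
  rw [bose_apply, CausalSpace.star_even, double_conj₀, boseBar_apply, map_zero]

theorem star_fermi (x : M₁) : star (S.fermi x) = S.fermiBar (S.κ₁ x) := by
  rw [fermi_apply, CausalSpace.star_odd, double_conj₁, fermiBar_apply, map_zero]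

section Brackets

theorem comm_bose_bose (x y : M₀) : comm (S.bose x) (S.bose y) = S.A₀ x y • (1 : S.Alg) := by
  rw [bose_apply, bose_apply, CausalSpace.comm_even_even, double_ω₀]
  simp only [map_zero, add_zero, sub_zero]

theorem comm_bose_boseBar (x y : M₀) :
    comm (S.bose x) (S.boseBar y) = S.H₀ x y • (1 : S.Alg) := by
  rw [bose_apply, boseBar_apply, CausalSpace.comm_even_even, double_ω₀]
  simp only [map_zero, add_zero, zero_add, sub_zero]

theorem acomm_fermi_fermi (x y : M₁) :
    acomm (S.fermi x) (S.fermi y) = S.A₁ x y • (1 : S.Alg) := by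
  rw [fermi_apply, fermi_apply, CausalSpace.acomm_odd_odd, double_ω₁]
  simp only [map_zero, add_zero]

theorem acomm_fermi_fermiBar (x y : M₁) :
    acomm (S.fermi x) (S.fermiBar y) = S.H₁ x y • (1 : S.Alg) := by
  rw [fermi_apply, fermiBar_apply, CausalSpace.acomm_odd_odd, double_ω₁]
  simp only [map_zero, add_zero, zero_add]

theorem comm_bose_fermi (x : M₀) (y : M₁) : comm (S.bose x) (S.fermi y) = 0 :=
  CausalSpace.comm_even_odd _ _ _

theorem comm_bose_fermiBar (x : M₀) (y : M₁) : comm (S.bose x) (S.fermiBar y) = 0 :=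
  CausalSpace.comm_even_odd _ _ _

end Brackets

section Charges

variable {S} {X Y : S.double.Ops} {Q₀ R₀ : M₀ →ₗ[ℂ] M₁} {Q₁ R₁ : M₁ →ₗ[ℂ] M₀}
  {p₀ : M₀ →ₗ[ℂ] M₀} {p₁ : M₁ →ₗ[ℂ] M₁}

theorem comm_charge_bose (hX : IsOddDer X (S.charge₀ Q₀ R₀) (S.charge₁ Q₁ R₁))
    (hY : IsOddDer Y (S.charge₀ R₀ Q₀) (S.charge₁ R₁ Q₁)) (x : M₀) :
    comm (Dbl.mk X Y) (S.bose x) = S.fermi (Q₀ x) := by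
  rw [bose_apply, CausalSpace.comm_charge_even hX hY (S.charge₀_conj _ _), charge₀_apply,
    fermi_apply]
  simp only [map_zero, neg_zero]

theorem acomm_charge_fermi (hX : IsOddDer X (S.charge₀ Q₀ R₀) (S.charge₁ Q₁ R₁))
    (hY : IsOddDer Y (S.charge₀ R₀ Q₀) (S.charge₁ R₁ Q₁)) (x : M₁) :
    acomm (Dbl.mk X Y) (S.fermi x) = S.bose (Q₁ x) := by
  rw [fermi_apply, CausalSpace.acomm_charge_odd hX hY (S.charge₁_conj _ _), charge₁_apply,
    bose_apply]
  simp only [map_zero]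

theorem acomm_charge_fermiBar (hX : IsOddDer X (S.charge₀ Q₀ R₀) (S.charge₁ Q₁ R₁))
    (hY : IsOddDer Y (S.charge₀ R₀ Q₀) (S.charge₁ R₁ Q₁)) (x : M₁) :
    acomm (Dbl.mk X Y) (S.fermiBar x) = S.boseBar (S.κ₀ (R₁ (S.κ₁ x))) := by
  rw [fermiBar_apply, CausalSpace.acomm_charge_odd hX hY (S.charge₁_conj _ _), charge₁_apply,
    boseBar_apply, map_zero]

theorem comm_generator_bose (hX : IsEvenDer X (S.generator₀ p₀) (S.generator₁ p₁)) (x : M₀) :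
    comm (Dbl.mk X X) (S.bose x) = S.bose (p₀ x) := by
  rw [bose_apply, CausalSpace.comm_generator_even hX (S.generator₀_conj _), generator₀_apply,
    bose_apply]
  simp only [map_zero, neg_zero]

theorem comm_generator_fermi (hX : IsEvenDer X (S.generator₀ p₀) (S.generator₁ p₁)) (x : M₁) :
    comm (Dbl.mk X X) (S.fermi x) = S.fermi (p₁ x) := by
  rw [fermi_apply, CausalSpace.comm_generator_odd hX (S.generator₁_conj _), generator₁_apply,
    fermi_apply]
  simp only [map_zero, neg_zero]

end Charges

end ChiralSpace

namespace shellSpace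

open SuperWeyl

variable {m : ℝ} (α : ℂ)

theorem exists_charge (j a : Fin 2) : ∃ X : (shellSpace m α).double.Ops,
    IsOddDer X ((shellSpace m α).charge₀ (Bos.q j a) (Bos.qbar j a))
      ((shellSpace m α).charge₁ (Fer.q j a) (Fer.qbar j a)) :=
  exists_isOddDer ((shellSpace m α).charge_skew (A_q α j a) (A_qbar α j a) (H_q α j a)
    (H_qbar α j a))

theorem exists_conjCharge (j a : Fin 2) : ∃ X : (shellSpace m α).double.Ops,
    IsOddDer X ((shellSpace m α).charge₀ (Bos.qbar j a) (Bos.q j a))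
      ((shellSpace m α).charge₁ (Fer.qbar j a) (Fer.q j a)) :=
  exists_isOddDer ((shellSpace m α).charge_skew (A_qbar α j a) (A_q α j a) (H_qbar α j a)
    (H_q α j a))

theorem exists_momentum (μ : Fin 4) : ∃ X : (shellSpace m α).double.Ops,
    IsEvenDer X ((shellSpace m α).generator₀ (Bos.mom μ))
      ((shellSpace m α).generator₁ (Fer.mom μ)) :=
  exists_isEvenDer ((shellSpace m α).generator₀_skew (A₀_mom α μ) (H₀_mom α μ))
    ((shellSpace m α).generator₁_skew (A₁_mom α μ) (H₁_mom α μ))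

/-- The derivation implementing the supercharge. -/
def chargeOp (j a : Fin 2) : (shellSpace m α).double.Ops := (exists_charge α j a).choose

/-- The derivation implementing the conjugate supercharge. -/
def conjChargeOp (j a : Fin 2) : (shellSpace m α).double.Ops := (exists_conjCharge α j a).choose

/-- The derivation implementing translations. -/
def momentumOp (μ : Fin 4) : (shellSpace m α).double.Ops := (exists_momentum α μ).choose

theorem isOddDer_chargeOp (j a : Fin 2) : IsOddDer (chargeOp (m := m) α j a)
    ((shellSpace m α).charge₀ (Bos.q j a) (Bos.qbar j a))
    ((shellSpace m α).charge₁ (Fer.q j a) (Fer.qbar j a)) :=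
  (exists_charge α j a).choose_spec

theorem isOddDer_conjChargeOp (j a : Fin 2) : IsOddDer (conjChargeOp (m := m) α j a)
    ((shellSpace m α).charge₀ (Bos.qbar j a) (Bos.q j a))
    ((shellSpace m α).charge₁ (Fer.qbar j a) (Fer.q j a)) :=
  (exists_conjCharge α j a).choose_spec

theorem isEvenDer_momentumOp (μ : Fin 4) : IsEvenDer (momentumOp (m := m) α μ)
    ((shellSpace m α).generator₀ (Bos.mom μ)) ((shellSpace m α).generator₁ (Fer.mom μ)) :=
  (exists_momentum α μ).choose_spec

/-- The supercharges. -/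
def Q (j a : Fin 2) : (shellSpace m α).Alg := Dbl.mk (chargeOp α j a) (conjChargeOp α j a)

/-- The generators of translations. -/
def P (μ : Fin 4) : (shellSpace m α).Alg := Dbl.mk (momentumOp α μ) (momentumOp α μ)

theorem star_Q (j a : Fin 2) :
    star (Q (m := m) α j a) = Dbl.mk (conjChargeOp α j a) (chargeOp α j a) := rfl

theorem star_P (μ : Fin 4) : star (P (m := m) α μ) = P α μ := rfl

section Brackets

theorem comm_Q_bose (j a : Fin 2) (x : Bos m) :
    comm (Q α j a) ((shellSpace m α).bose x) = (shellSpace m α).fermi (Bos.q j a x) :=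
  ChiralSpace.comm_charge_bose (isOddDer_chargeOp α j a) (isOddDer_conjChargeOp α j a) x

theorem comm_star_Q_bose (j a : Fin 2) (x : Bos m) :
    comm (star (Q α j a)) ((shellSpace m α).bose x) = (shellSpace m α).fermi (Bos.qbar j a x) :=
  ChiralSpace.comm_charge_bose (isOddDer_conjChargeOp α j a) (isOddDer_chargeOp α j a) x

theorem acomm_Q_fermi (j a : Fin 2) (x : Fer m) :
    acomm (Q α j a) ((shellSpace m α).fermi x) = (shellSpace m α).bose (Fer.q j a x) :=
  ChiralSpace.acomm_charge_fermi (isOddDer_chargeOp α j a) (isOddDer_conjChargeOp α j a) x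

theorem acomm_star_Q_fermi (j a : Fin 2) (x : Fer m) :
    acomm (star (Q α j a)) ((shellSpace m α).fermi x) = (shellSpace m α).bose (Fer.qbar j a x) :=
  ChiralSpace.acomm_charge_fermi (isOddDer_conjChargeOp α j a) (isOddDer_chargeOp α j a) x

theorem acomm_Q_fermiBar (j a : Fin 2) (x : Fer m) : acomm (Q α j a) ((shellSpace m α).fermiBar x)
    = (shellSpace m α).boseBar
        ((shellSpace m α).κ₀ (Fer.qbar j a ((shellSpace m α).κ₁ x))) :=
  ChiralSpace.acomm_charge_fermiBar (isOddDer_chargeOp α j a) (isOddDer_conjChargeOp α j a) x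

theorem comm_P_bose (μ : Fin 4) (x : Bos m) :
    comm (P α μ) ((shellSpace m α).bose x) = (shellSpace m α).bose (Bos.mom μ x) :=
  ChiralSpace.comm_generator_bose (isEvenDer_momentumOp α μ) x

theorem comm_P_fermi (μ : Fin 4) (x : Fer m) :
    comm (P α μ) ((shellSpace m α).fermi x) = (shellSpace m α).fermi (Fer.mom μ x) :=
  ChiralSpace.comm_generator_fermi (isEvenDer_momentumOp α μ) x

end Brackets

section Algebra

theorem comm_Q_P (j a : Fin 2) (μ : Fin 4) : comm (Q (m := m) α j a) (P α μ) = 0 := by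
  rw [Q, P, Dbl.comm_mk, comm_eq_zero_of_isOddDer_of_isEvenDer (isOddDer_chargeOp α j a)
      (isEvenDer_momentumOp α μ)
      ((shellSpace m α).charge₀_generator (Fer.mom_q μ j a) (Fer.mom_qbar μ j a))
      ((shellSpace m α).charge₁_generator (Bos.mom_q μ j a) (Bos.mom_qbar μ j a)),
    comm_eq_zero_of_isOddDer_of_isEvenDer (isOddDer_conjChargeOp α j a)
      (isEvenDer_momentumOp α μ)
      ((shellSpace m α).charge₀_generator (Fer.mom_qbar μ j a) (Fer.mom_q μ j a))
      ((shellSpace m α).charge₁_generator (Bos.mom_qbar μ j a) (Bos.mom_q μ j a)), neg_zero]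
  rfl

/-- The anticommutator of odd derivations is an even derivation, determined by its action on
generators; the sum over the empty set presents that action as zero. Both summands of the doubled
algebra are checked. -/
theorem acomm_Q_Q (j a k b : Fin 2) : acomm (Q (m := m) α j a) (Q α k b) = 0 := by
  have h1 : acomm (chargeOp (m := m) α j a) (chargeOp α k b) = 0 := by
    refine IsEvenDer.unique ?_ IsEvenDer.zero
    have := (isOddDer_chargeOp (m := m) α j a).acomm (isOddDer_chargeOp α k b)
    rwa [(shellSpace m α).acomm_charge_even (ι := Fin 4) ∅ 0 (p := 0)
        (fun x => by simpa using Fer.q_q j a k b x) (fun x => by simpa using Fer.qbar_qbar j a k b x),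
      (shellSpace m α).acomm_charge_odd (ι := Fin 4) ∅ 0 (p := 0)
        (fun x => by simpa using Bos.q_q j a k b x)
        (fun x => by simpa using Bos.qbar_qbar j a k b x)] at this
  have h2 : acomm (conjChargeOp (m := m) α j a) (conjChargeOp α k b) = 0 := by
    refine IsEvenDer.unique ?_ IsEvenDer.zero
    have := (isOddDer_conjChargeOp (m := m) α j a).acomm (isOddDer_conjChargeOp α k b)
    rwa [(shellSpace m α).acomm_charge_even (ι := Fin 4) ∅ 0 (p := 0)
        (fun x => by simpa using Fer.qbar_qbar j a k b x) (fun x => by simpa using Fer.q_q j a k b x),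
      (shellSpace m α).acomm_charge_odd (ι := Fin 4) ∅ 0 (p := 0)
        (fun x => by simpa using Bos.qbar_qbar j a k b x)
        (fun x => by simpa using Bos.q_q j a k b x)] at this
  rw [Q, Q, Dbl.acomm_mk, h1, h2]
  rfl

/-- Both sides are even derivations, so the one-particle algebra suffices. On adjoint fields the
roles of the two charges are exchanged, and Hermiticity of σ^μ makes the coefficients match. -/
theorem acomm_chargeOp_conjChargeOp (j a k b : Fin 2) :
    acomm (chargeOp (m := m) α j a) (conjChargeOp α k b)
      = ∑ μ, (2 * delta j k * sigma μ a b) • momentumOp α μ := by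
  refine IsEvenDer.unique ?_ (IsEvenDer.sum _ fun μ => (isEvenDer_momentumOp α μ).smul _)
  have := (isOddDer_chargeOp (m := m) α j a).acomm (isOddDer_conjChargeOp α k b)
  rwa [(shellSpace m α).acomm_charge_even Finset.univ (fun μ => 2 * delta j k * sigma μ a b)
      (p := Bos.mom), (shellSpace m α).acomm_charge_odd Finset.univ
        (fun μ => 2 * delta j k * sigma μ a b) (p := Fer.mom)] at this
  · intro x
    rw [Bos.q_qbar, Finset.smul_sum]
    simp only [smul_smul]
  · intro x
    rw [add_comm, Bos.q_qbar, Finset.smul_sum]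
    simp only [smul_smul, map_mul, map_ofNat, conj_delta, conj_sigma, delta_comm k j]
  · intro x
    rw [Fer.q_qbar, Finset.smul_sum]
    simp only [smul_smul]
  · intro x
    rw [add_comm, Fer.q_qbar, Finset.smul_sum]
    simp only [smul_smul, map_mul, map_ofNat, conj_delta, conj_sigma, delta_comm k j]

theorem acomm_Q_star_Q (j a k b : Fin 2) : acomm (Q (m := m) α j a) (star (Q α k b))
    = (2 * delta j k) • ∑ μ, sigma μ a b • P (m := m) α μ := by
  rw [star_Q]
  refine Dbl.acomm_mk_eq_smul_sum _ _ _ _ (acomm_chargeOp_conjChargeOp α j a k b) ?_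
  rw [acomm_swap, acomm_chargeOp_conjChargeOp]
  simp only [map_mul, map_ofNat, conj_delta, conj_sigma, delta_comm k j]

end Algebra

end shellSpace

end

end N2

/-! ### From a representation of the one-particle structure to a multiplet. -/

namespace N2

noncomputable section

open Complex ShellTest

/-- A representation, in a `*`-algebra, of the one-particle structure of mass `m` with parameter
`α`. -/
structure ShellRep (m : ℝ) (α : ℂ) (𝒜 : Type*) [Ring 𝒜] [StarRing 𝒜] [Algebra ℂ 𝒜]
    [StarModule ℂ 𝒜] where
  bose : Bos m →ₗ[ℂ] 𝒜
  fermi : Fer m →ₗ[ℂ] 𝒜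
  boseBar : Bos m →ₗ[ℂ] 𝒜
  fermiBar : Fer m →ₗ[ℂ] 𝒜
  star_bose : ∀ x, star (bose x) = boseBar (Bos.conj x)
  star_fermi : ∀ x, star (fermi x) = fermiBar (Fer.conj x)
  comm_bose_bose : ∀ x y, comm (bose x) (bose y) = Bos.pair (Bos.chiral α x) y • (1 : 𝒜)
  comm_bose_boseBar : ∀ x y, comm (bose x) (boseBar y) = Bos.pair (Bos.mixed x) y • (1 : 𝒜)
  acomm_fermi_fermi : ∀ x y, acomm (fermi x) (fermi y) = Fer.pair (Fer.chiral α x) y • (1 : 𝒜)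
  acomm_fermi_fermiBar : ∀ x y, acomm (fermi x) (fermiBar y) = Fer.pair (Fer.mixed x) y • (1 : 𝒜)
  comm_bose_fermi : ∀ x y, comm (bose x) (fermi y) = 0
  comm_bose_fermiBar : ∀ x y, comm (bose x) (fermiBar y) = 0
  U : Spacetime → Matrix.SpecialLinearGroup (Fin 2) ℂ → unitary 𝒜
  V : Matrix.specialUnitaryGroup (Fin 2) ℂ →* unitary 𝒜
  U_mul : ∀ a A b B, U a A * U b B = U (a + lorentzAct A b) (A * B)
  U_V_comm : ∀ a A u, U a A * V u = V u * U a A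
  U_bose : ∀ a A x, star (U a A : 𝒜) * bose x * (U a A : 𝒜)
    = bose (Bos.rot (poincare a A) A.1 1 x)
  U_fermi : ∀ a A x, star (U a A : 𝒜) * fermi x * (U a A : 𝒜)
    = fermi (Fer.rot (poincare a A) A.1 1 x)
  V_bose : ∀ u x, star (V u : 𝒜) * bose x * (V u : 𝒜) = bose (Bos.rot LinearMap.id 1 u.1 x)
  V_fermi : ∀ u x, star (V u : 𝒜) * fermi x * (V u : 𝒜) = fermi (Fer.rot LinearMap.id 1 u.1 x)
  P : Fin 4 → 𝒜
  Q : Fin 2 → Fin 2 → 𝒜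
  star_P : ∀ μ, star (P μ) = P μ
  comm_P_bose : ∀ μ x, comm (P μ) (bose x) = bose (Bos.mom μ x)
  comm_P_fermi : ∀ μ x, comm (P μ) (fermi x) = fermi (Fer.mom μ x)
  comm_Q_P : ∀ j a μ, comm (Q j a) (P μ) = 0
  U_Q : ∀ A j a, star (U 0 A : 𝒜) * Q j a * (U 0 A : 𝒜)
    = ∑ i : Fin 2 × Fin 2, ((1 : Matrix (Fin 2) (Fin 2) ℂ) j i.1 * A.1 a i.2) • Q i.1 i.2
  V_Q : ∀ u j a, star (V u : 𝒜) * Q j a * (V u : 𝒜)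
    = ∑ i : Fin 2 × Fin 2, (u.1 j i.1 * (1 : Matrix (Fin 2) (Fin 2) ℂ) a i.2) • Q i.1 i.2
  acomm_Q_Q : ∀ j a k b, acomm (Q j a) (Q k b) = 0
  acomm_Q_star_Q : ∀ j a k b,
    acomm (Q j a) (star (Q k b)) = (2 * delta j k) • ∑ μ, sigma μ a b • P μ
  comm_Q_bose : ∀ j a x, comm (Q j a) (bose x) = fermi (Bos.q j a x)
  comm_star_Q_bose : ∀ j a x, comm (star (Q j a)) (bose x) = fermi (Bos.qbar j a x)
  acomm_Q_fermi : ∀ j a x, acomm (Q j a) (fermi x) = bose (Fer.q j a x)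
  acomm_star_Q_fermi : ∀ j a x, acomm (star (Q j a)) (fermi x) = bose (Fer.qbar j a x)
  acomm_Q_fermiBar : ∀ j a x,
    acomm (Q j a) (fermiBar x) = boseBar (Bos.conj (Fer.qbar j a (Fer.conj x)))

namespace ShellRep

theorem sum_one_mul {X : Type*} [AddCommGroup X] [Module ℂ X] (j : Fin 2) (c : Fin 2 → ℂ)
    (x : Fin 2 → Fin 2 → X) : ∑ k, ∑ b, ((1 : Matrix (Fin 2) (Fin 2) ℂ) j k * c b) • x k b
      = ∑ b, c b • x j b := by
  rw [Finset.sum_eq_single j (fun k _ hk => by simp [Matrix.one_apply_ne hk.symm]) (by simp)]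
  simp

theorem sum_mul_one {X : Type*} [AddCommGroup X] [Module ℂ X] (a : Fin 2) (c : Fin 2 → ℂ)
    (x : Fin 2 → Fin 2 → X) : ∑ k, ∑ b, (c k * (1 : Matrix (Fin 2) (Fin 2) ℂ) a b) • x k b
      = ∑ k, c k • x k a := by
  refine Finset.sum_congr rfl fun k _ => ?_
  rw [Finset.sum_eq_single a (fun b _ hb => by simp [Matrix.one_apply_ne hb.symm]) (by simp)]
  simp

theorem sum_one_mul_one {X : Type*} [AddCommGroup X] [Module ℂ X] (j k : Fin 2)
    (x : Fin 2 → Fin 2 → X) : ∑ l, ∑ n, ((1 : Matrix (Fin 2) (Fin 2) ℂ) j l *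
      (1 : Matrix (Fin 2) (Fin 2) ℂ) k n) • x l n = x j k := by
  rw [sum_one_mul, Finset.sum_eq_single k (fun b _ hb => by simp [Matrix.one_apply_ne hb.symm])
    (by simp)]
  simp

theorem dField_apply {𝒜 : Type*} [Ring 𝒜] [Algebra ℂ 𝒜] (μ : Fin 4) (φ : Test →ₗ[ℂ] 𝒜) (f : Test) :
    -I • dField μ φ f = φ (I • dTest μ f) := by
  simp [dField]

variable {m : ℝ} {α : ℂ} {𝒜 : Type*} [Ring 𝒜] [StarRing 𝒜] [Algebra ℂ 𝒜] [StarModule ℂ 𝒜]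
  (R : ShellRep m α 𝒜)

/-- The multiplet defined by a representation. -/
def multiplet : Multiplet 𝒜 where
  z := R.bose ∘ₗ Bos.ez ∘ₗ of m
  D := R.bose ∘ₗ Bos.eD ∘ₗ of m
  F a b := R.bose ∘ₗ Bos.eF a b ∘ₗ of m
  C j k := R.bose ∘ₗ Bos.eC j k ∘ₗ of m
  lam j a := R.fermi ∘ₗ Fer.elam j a ∘ₗ of m
  chi j a := R.fermi ∘ₗ Fer.echi j a ∘ₗ of m
  F_symm a b := by rw [Bos.eF_symm]
  C_symm j k := by rw [Bos.eC_symm]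
  U := R.U
  V := R.V
  U_mul := R.U_mul
  U_V_comm := R.U_V_comm
  P := R.P
  Q := R.Q
  z_poincare a A f h hh := by
    simp only [LinearMap.comp_apply, R.U_bose, Bos.rot_ez, poincare_of hh]
  D_poincare a A f h hh := by
    simp only [LinearMap.comp_apply, R.U_bose, Bos.rot_eD, poincare_of hh]
  F_poincare a A f h hh b c := by
    simp only [LinearMap.comp_apply, R.U_bose, Bos.rot_eF, poincare_of hh, map_sum, map_smul]
  C_poincare a A f h hh j k := by
    simp only [LinearMap.comp_apply, R.U_bose, Bos.rot_eC, poincare_of hh]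
    rw [sum_one_mul_one j k fun l n => Bos.eC l n (of m h)]
  lam_poincare a A f h hh j b := by
    simp only [LinearMap.comp_apply, R.U_fermi, Fer.rot_elam, poincare_of hh, sum_one_mul, map_sum,
      map_smul]
  chi_poincare a A f h hh j b := by
    simp only [LinearMap.comp_apply, R.U_fermi, Fer.rot_echi, poincare_of hh, sum_one_mul, map_sum,
      map_smul]
  z_su2 u f := by simp only [LinearMap.comp_apply, R.V_bose, Bos.rot_ez, LinearMap.id_apply]
  D_su2 u f := by simp only [LinearMap.comp_apply, R.V_bose, Bos.rot_eD, LinearMap.id_apply]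
  F_su2 u f a b := by
    simp only [LinearMap.comp_apply, R.V_bose, Bos.rot_eF, LinearMap.id_apply]
    rw [sum_one_mul_one a b fun c d => Bos.eF c d (of m f)]
  C_su2 u f j k := by
    simp only [LinearMap.comp_apply, R.V_bose, Bos.rot_eC, LinearMap.id_apply, map_sum, map_smul]
  lam_su2 u f j a := by
    simp only [LinearMap.comp_apply, R.V_fermi, Fer.rot_elam, LinearMap.id_apply, sum_mul_one,
      map_sum, map_smul]
  chi_su2 u f j a := by
    simp only [LinearMap.comp_apply, R.V_fermi, Fer.rot_echi, LinearMap.id_apply, sum_mul_one,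
      map_sum, map_smul]
  P_star := R.star_P
  P_z μ f := by
    simp only [dField_apply, LinearMap.comp_apply, R.comm_P_bose, Bos.mom_ez, mom_of]
  P_D μ f := by
    simp only [dField_apply, LinearMap.comp_apply, R.comm_P_bose, Bos.mom_eD, mom_of]
  P_F μ f a b := by
    simp only [dField_apply, LinearMap.comp_apply, R.comm_P_bose, Bos.mom_eF, mom_of]
  P_C μ f j k := by
    simp only [dField_apply, LinearMap.comp_apply, R.comm_P_bose, Bos.mom_eC, mom_of]
  P_lam μ f j a := by
    simp only [dField_apply, LinearMap.comp_apply, R.comm_P_fermi, Fer.mom_elam, mom_of]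
  P_chi μ f j a := by
    simp only [dField_apply, LinearMap.comp_apply, R.comm_P_fermi, Fer.mom_echi, mom_of]
  Q_P := R.comm_Q_P
  Q_lorentz A j a := by rw [R.U_Q, Fintype.sum_prod_type, sum_one_mul]
  Q_su2 u j a := by rw [R.V_Q, Fintype.sum_prod_type, sum_mul_one]
  Q_Q := R.acomm_Q_Q
  Q_Qbar := R.acomm_Q_star_Q
  Q_z j a f := by
    simp only [LinearMap.comp_apply, R.comm_Q_bose, Bos.q_ez, map_smul, smul_smul]
    rw [mul_neg, I_mul_I, neg_neg, one_smul]
  Qbar_z j a f := by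
    simp only [LinearMap.comp_apply, R.comm_star_Q_bose, Bos.qbar_ez, map_zero]
  Q_F j a b c f := by
    simp only [LinearMap.comp_apply, R.comm_Q_bose, Bos.q_eF, map_add, map_smul]
  Qbar_F j a b c f := by
    simp only [slash_apply, LinearMap.comp_apply, R.comm_star_Q_bose, Bos.qbar_eF, map_add,
      map_smul, map_sum, s_of]
  Q_C j a k l f := by
    simp only [LinearMap.comp_apply, R.comm_Q_bose, Bos.q_eC, map_add, map_smul, map_neg]
  Qbar_C j a k l f := by
    simp only [slash_apply, LinearMap.comp_apply, R.comm_star_Q_bose, Bos.qbar_eC, map_add,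
      map_smul, map_sum, s_of]
  Q_D j a f := by simp only [LinearMap.comp_apply, R.comm_Q_bose, Bos.q_eD, map_zero]
  Qbar_D j a f := by
    simp only [slash_apply, LinearMap.comp_apply, R.comm_star_Q_bose, Bos.qbar_eD, map_smul,
      map_sum, s_of]
  Q_chi j a k b f := by
    simp only [LinearMap.comp_apply, R.acomm_Q_fermi, Fer.q_echi, map_add, map_smul]
  Q_chibar j a k b f := by
    simp only [slash_apply, adj_apply, LinearMap.comp_apply, R.star_bose, R.star_fermi,
      R.acomm_Q_fermiBar, Fer.conj_conj, Fer.qbar_echi, map_smulₛₗ, map_mul, conj_delta, map_ofNat,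
      Bos.conj_ez, ← conj_of, conj_s, ShellTest.conj_conj, s_of, RingHom.id_apply]
  Q_lam j a k b f := by
    simp only [LinearMap.comp_apply, R.acomm_Q_fermi, Fer.q_elam, map_smul]
  Qbar_lam j b k a f := by
    simp only [slash_apply, LinearMap.comp_apply, R.acomm_star_Q_fermi, Fer.qbar_elam, map_add,
      map_smul, map_sum, s_of]

end ShellRep

end

end N2

namespace N2

noncomputable section

open Complex

/-! ### Brackets obeying the causal relations are those of free fields -/

/-- The kernel is of the form `p(∂) D_m(x-y)`. -/
def IsPolyKernel (m : ℝ) (K : Kernel) : Prop :=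
  ∃ p : MvPolynomial (Fin 4) ℂ, ∀ f h, K f h = pauliJordan m (polyTest p f) h

namespace IsPolyKernel

variable {m : ℝ} {K K' : Kernel}

/-- An operator on test functions enters a kernel only through its multiplier, so closure of the
class under algebraic operations is checked on symbols. -/
theorem of_symbol (p : MvPolynomial (Fin 4) ℂ) (X : Test → Test)
    (hX : ∀ f k, minkFourier (X f) k = symbol p k * minkFourier f k)
    (hK : ∀ f h, K f h = pauliJordan m (X f) h) : IsPolyKernel m K :=
  ⟨p, fun f h => (hK f h).trans
    (pauliJordan_congr (fun k _ => by rw [hX, minkFourier_polyTest]) fun _ _ => rfl)⟩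

theorem pauliJordan (m : ℝ) : IsPolyKernel m (N2.pauliJordan m) :=
  of_symbol 1 id (fun f k => by simp [symbol]) fun _ _ => rfl

theorem add (hK : IsPolyKernel m K) (hK' : IsPolyKernel m K') :
    IsPolyKernel m fun f h => K f h + K' f h := by
  obtain ⟨p, hp⟩ := hK
  obtain ⟨p', hp'⟩ := hK'
  refine of_symbol (p + p') (fun f => polyTest p f + polyTest p' f) (fun f k => ?_) fun f h => ?_
  · rw [minkFourier_add, minkFourier_polyTest, minkFourier_polyTest, symbol, symbol, symbol,
      map_add, add_mul]
  · rw [hp, hp', ← pauliJordanForm_apply, ← pauliJordanForm_apply, ← pauliJordanForm_apply, map_add,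
      LinearMap.add_apply]

theorem const_mul (c : ℂ) (hK : IsPolyKernel m K) : IsPolyKernel m fun f h => c * K f h := by
  obtain ⟨p, hp⟩ := hK
  refine of_symbol (MvPolynomial.C c * p) (fun f => c • polyTest p f) (fun f k => ?_) fun f h => ?_
  · rw [minkFourier_smul, minkFourier_polyTest, symbol, symbol, map_mul, MvPolynomial.eval_C,
      mul_assoc]
  · rw [hp, ← pauliJordanForm_apply, ← pauliJordanForm_apply, map_smul, LinearMap.smul_apply,
      smul_eq_mul]

theorem sum {ι : Type*} (s : Finset ι) {K : ι → Kernel} (hK : ∀ i, IsPolyKernel m (K i)) :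
    IsPolyKernel m fun f h => ∑ i ∈ s, K i f h := by
  classical
  induction s using Finset.induction_on with
  | empty => simpa using const_mul 0 (pauliJordan m)
  | insert i s hi ih =>
    simp only [Finset.sum_insert hi]
    exact (hK i).add ih

theorem dKer (μ : Fin 4) (hK : IsPolyKernel m K) : IsPolyKernel m (N2.dKer μ K) := by
  obtain ⟨p, hp⟩ := hK
  refine of_symbol (MvPolynomial.X μ * p) (fun f => -polyTest p (dTest μ f)) (fun f k => ?_)
    fun f h => ?_
  · rw [minkFourier_neg, minkFourier_polyTest, minkFourier_dTest, symbol, symbol, map_mul,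
      MvPolynomial.eval_X]
    ring
  · rw [N2.dKer, hp, ← pauliJordanForm_apply, ← pauliJordanForm_apply, map_neg,
      LinearMap.neg_apply]

theorem neg (hK : IsPolyKernel m K) : IsPolyKernel m fun f h => -K f h := by
  simpa using hK.const_mul (-1)

theorem swap (hK : IsPolyKernel m K) : IsPolyKernel m fun f h => K h f := by
  obtain ⟨p, hp⟩ := hK
  have := neg (K := fun f h => -K h f) ⟨MvPolynomial.bind₁ (fun i => -MvPolynomial.X i) p,
    fun f h => by rw [pauliJordan_polyTest_bind_neg, ← hp]⟩
  simpa only [neg_neg] using this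

/-- The symbol substitutes -ik for ∂; conjugation of that imaginary value amounts to k ↦ -k. -/
theorem symbol_map_conj (p : MvPolynomial (Fin 4) ℂ) (k : Spacetime) :
    symbol (MvPolynomial.map (starRingEnd ℂ) p) k = (starRingEnd ℂ) (symbol p (-k)) := by
  unfold symbol
  rw [MvPolynomial.eval_map, MvPolynomial.eval, MvPolynomial.coe_eval₂Hom,
    MvPolynomial.eval₂_comp_left]
  congr 1
  ext μ
  simp

theorem conj (hK : IsPolyKernel m K) :
    IsPolyKernel m fun f h => (starRingEnd ℂ) (K (conjTest f) (conjTest h)) := by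
  obtain ⟨p, hp⟩ := hK
  refine of_symbol (MvPolynomial.map (starRingEnd ℂ) p)
    (fun f => conjTest (polyTest p (conjTest f))) (fun f k => ?_) fun f h => ?_
  · rw [minkFourier_conjTest, minkFourier_polyTest, map_mul, ← minkFourier_conjTest,
      conjTest_conjTest, symbol_map_conj]
  · rw [hp, pauliJordan_conj, conjTest_conjTest]

end IsPolyKernel

namespace Multiplet

variable {𝒜 : Type*} [Ring 𝒜] [StarRing 𝒜] [Algebra ℂ 𝒜] [StarModule ℂ 𝒜] {M : Multiplet 𝒜}
  {m : ℝ} {α : ℂ}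

/-- The bracket of the two fields is `p(∂) D_m(x-y)` times the identity. -/
def IsFreeBracket (M : Multiplet 𝒜) (m : ℝ) (a b : FieldName) : Prop :=
  ∃ K, IsPolyKernel m K ∧ ∀ f h, M.bracket a b f h = K f h • (1 : 𝒜)

theorem IsFreeBracket.swap {a b : FieldName} (h : M.IsFreeBracket m a b) :
    M.IsFreeBracket m b a := by
  obtain ⟨K, hK, h⟩ := h
  cases hc : a.1.fermi && b.1.fermi
  · refine ⟨_, hK.swap.neg, fun f w => ?_⟩
    have := h w f
    unfold bracket at *
    rw [hc] at this
    rw [Bool.and_comm, hc]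
    simp only [Bool.false_eq_true, if_false] at *
    rw [comm_swap, this, neg_smul]
  · refine ⟨_, hK.swap, fun f w => ?_⟩
    have := h w f
    unfold bracket at *
    rw [hc] at this
    rw [Bool.and_comm, hc]
    simp only [if_true] at *
    rw [acomm_swap, this]

theorem IsFreeBracket.adj {c d : Comp} {s t : Bool} (h : M.IsFreeBracket m (c, s) (d, t)) :
    M.IsFreeBracket m (c, !s) (d, !t) := by
  obtain ⟨K, hK, h⟩ := h
  cases hc : c.fermi && d.fermi
  · refine ⟨_, hK.conj.neg, fun f w => ?_⟩
    have := h (conjTest f) (conjTest w)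
    unfold bracket at *
    rw [field_not, field_not]
    simp only [hc, Bool.false_eq_true, if_false] at *
    rw [← star_comm_eq, comm_swap, this, star_neg, star_smul, star_one, neg_smul]
    rfl
  · refine ⟨_, hK.conj, fun f w => ?_⟩
    have := h (conjTest f) (conjTest w)
    unfold bracket at *
    rw [field_not, field_not]
    simp only [hc, if_true] at *
    rw [← star_acomm_eq, this, star_smul, star_one]
    rfl

/-- The listed right-hand sides are constant coefficient derivatives of D_m, and the unlisted ones
are 0 · D_m. Only [z, z*] has to be taken from the hypothesis on z. -/
theorem CausalRelations.isFreeBracket (hM : M.CausalRelations m α) (hz : M.IsScalarOfMass m)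
    (a b : FieldName) :
    M.IsFreeBracket m a b := by
  have hJ := IsPolyKernel.pauliJordan m
  by_cases hab : listed a b
  · have hff : ∀ c d, c.listedPair d → M.IsFreeBracket m (c, false) (d, false) := by
      intro c d hcd
      cases c <;> cases d <;> try exact absurd hcd id
      · exact ⟨_, hJ.const_mul α, hM.z_D⟩
      · exact IsFreeBracket.swap ⟨_, hJ.const_mul α, hM.z_D⟩
      · exact ⟨_, hJ.const_mul _, hM.F_F _ _ _ _⟩
      · exact ⟨_, hJ.const_mul _, hM.C_C _ _ _ _⟩
      · exact IsFreeBracket.swap ⟨_, hJ.const_mul _, hM.chi_lam _ _ _ _⟩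
      · exact ⟨_, hJ.const_mul _, hM.chi_lam _ _ _ _⟩
    have hft : ∀ c d, c.sameKind d → M.IsFreeBracket m (c, false) (d, true) := by
      intro c d hcd
      cases c <;> cases d <;> try exact absurd hcd id
      · exact ⟨_, hJ.const_mul _, hz.z_zstar⟩
      · exact ⟨_, hJ.const_mul _, hM.D_Dstar⟩
      · exact ⟨_, .const_mul _ (.sum _ fun μ => .sum _ fun ν => ((hJ.dKer ν).dKer μ).const_mul _),
          hM.F_Fstar _ _ _ _⟩
      · exact ⟨_, hJ.const_mul _, hM.C_Cstar _ _ _ _⟩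
      · exact ⟨_, .const_mul _ (.sum _ fun μ => (hJ.dKer μ).const_mul _), hM.lam_lambar _ _ _ _⟩
      · exact ⟨_, .const_mul _ (.sum _ fun μ => (hJ.dKer μ).const_mul _), hM.chi_chibar _ _ _ _⟩
    obtain ⟨c, s⟩ := a
    obtain ⟨d, t⟩ := b
    cases s <;> cases t <;> simp only [listed, if_true, Bool.false_eq_true, Bool.true_eq_false,
      if_false] at hab
    · exact hff c d hab
    · exact hft c d hab
    · exact (hft c d hab).adj
    · exact (hff c d hab).adj
  · exact ⟨_, hJ.const_mul 0, fun f h => by rw [hM.others a b hab, zero_mul, zero_smul]⟩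

theorem CausalRelations.isFree (hM : M.CausalRelations m α) (hz : M.IsScalarOfMass m) :
    M.IsFree m := fun a b => by
  obtain ⟨K, ⟨p, hp⟩, hK⟩ := hM.isFreeBracket hz a b
  exact ⟨p, fun f h => by rw [hK, hp, polyKer_pauliJordan]⟩

end Multiplet

end

end N2

/-! ### Evaluation of the forms on components: the causal relations of the constructed multiplet. -/

namespace N2

noncomputable section

open Complex ShellTest

set_option linter.unusedSimpArgs false

section ComponentPairings

variable {m : ℝ}

theorem Bos.pair_ez (x : Bos m) (t : ShellTest m) : Bos.pair x (Bos.ez t) = J x.1 t := by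
  simp [Bos.pair_apply, Bos.ez_apply]

theorem Bos.pair_eD (x : Bos m) (t : ShellTest m) : Bos.pair x (Bos.eD t) = J x.2.1 t := by
  simp [Bos.pair_apply, Bos.eD_apply]

theorem sum_sum_delta_symm (c d : Fin 2) (x : Fin 2 → Fin 2 → ℂ) :
    ∑ a, ∑ b, 1 / 2 * (delta c a * delta d b + delta c b * delta d a) * x a b
      = 1 / 2 * (x c d + x d c) := by
  revert c d
  simp only [Fin.forall_fin_two, Fin.sum_univ_two, delta_self, delta_01, delta_10]
  refine ⟨⟨?_, ?_⟩, ?_, ?_⟩ <;> ring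

theorem sum_sum_delta (c d : Fin 2) (x : Fin 2 → Fin 2 → ℂ) :
    ∑ a, ∑ b, delta c a * delta d b * x a b = x c d := by
  revert c d
  simp only [Fin.forall_fin_two, Fin.sum_univ_two, delta_self, delta_01, delta_10]
  refine ⟨⟨?_, ?_⟩, ?_, ?_⟩ <;> ring

theorem Bos.pair_eF (c d : Fin 2) (x : Bos m) (t : ShellTest m) :
    Bos.pair x (Bos.eF c d t) = 1 / 2 * (J (x.2.2.1 c d) t + J (x.2.2.1 d c) t) := by
  simp only [Bos.pair_apply, Bos.eF_apply, map_zero, Pi.zero_apply, map_smul, smul_eq_mul,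
    Finset.sum_const_zero, zero_add, add_zero, sum_sum_delta_symm c d fun a b => J (x.2.2.1 a b) t]

theorem Bos.pair_eC (c d : Fin 2) (x : Bos m) (t : ShellTest m) :
    Bos.pair x (Bos.eC c d t) = 1 / 2 * (J (x.2.2.2 c d) t + J (x.2.2.2 d c) t) := by
  simp only [Bos.pair_apply, Bos.eC_apply, map_zero, Pi.zero_apply, map_smul, smul_eq_mul,
    Finset.sum_const_zero, zero_add, add_zero, sum_sum_delta_symm c d fun a b => J (x.2.2.2 a b) t]

theorem Fer.pair_elam (j a : Fin 2) (x : Fer m) (t : ShellTest m) :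
    Fer.pair x (Fer.elam j a t) = J (x.1 j a) t := by
  simp only [Fer.pair_apply, Fer.elam_apply, map_zero, Pi.zero_apply, map_smul, smul_eq_mul,
    Finset.sum_const_zero, add_zero, sum_sum_delta j a fun a b => J (x.1 a b) t]

theorem Fer.pair_echi (j a : Fin 2) (x : Fer m) (t : ShellTest m) :
    Fer.pair x (Fer.echi j a t) = J (x.2 j a) t := by
  simp only [Fer.pair_apply, Fer.echi_apply, map_zero, Pi.zero_apply, map_smul, smul_eq_mul,
    Finset.sum_const_zero, zero_add, sum_sum_delta j a fun a b => J (x.2 a b) t]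

theorem sum_delta_symm_eps (a b c d : Fin 2) :
    ∑ e, ∑ f, (eps e c * eps f d + eps e d * eps f c) *
      (1 / 2 * (delta a e * delta b f + delta a f * delta b e))
      = eps a c * eps b d + eps a d * eps b c := by
  refine (Finset.sum_congr rfl fun e _ => Finset.sum_congr rfl fun f _ => mul_comm _ _).trans ?_
  rw [sum_sum_delta_symm a b fun e f => eps e c * eps f d + eps e d * eps f c]
  ring

theorem Bos.chiral_eF (α : ℂ) (a b c d : Fin 2) (t : ShellTest m) :
    (Bos.chiral α (Bos.eF a b t)).2.2.1 c d
      = (I * α * (eps a c * eps b d + eps a d * eps b c)) • t := by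
  simp only [Bos.chiral_apply, Bos.eF_apply, smul_smul, ← Finset.sum_smul, sum_delta_symm_eps]

theorem Bos.chiral_eC (α : ℂ) (a b c d : Fin 2) (t : ShellTest m) :
    (Bos.chiral α (Bos.eC a b t)).2.2.2 c d
      = (-I * α * (eps a c * eps b d + eps a d * eps b c)) • t := by
  simp only [Bos.chiral_apply, Bos.eC_apply, smul_smul, ← Finset.sum_smul, sum_delta_symm_eps]

theorem Fer.chiral_echi (α : ℂ) (j a k b : Fin 2) (t : ShellTest m) :
    (Fer.chiral α (Fer.echi j a t)).1 k b = (-I * α * (eps a b * eps j k)) • t := by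
  have := sum_sum_delta j a fun l c => eps c b * eps l k
  simp only [Fer.chiral_apply, Fer.echi_apply, smul_smul, ← Finset.sum_smul]
  simp only [mul_comm (eps _ b * _) (delta _ _ * _), this]

theorem Bos.mixed_eF (a b c d : Fin 2) (t : ShellTest m) :
    (Bos.mixed (Bos.eF a b t)).2.2.1 c d = (2 * I) • (s a c (s b d t) + s a d (s b c t)) := by
  ext k
  have := sum_sum_delta_symm a b fun e f => (s e c (s f d t) + s e d (s f c t)) k
  simp only [Bos.mixed_apply, Bos.eF_apply, map_smul, smul_apply, sum_apply, ← smul_add, this]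
  simp only [add_apply, s_apply]
  ring

theorem Bos.mixed_eC (a b c d : Fin 2) (t : ShellTest m) :
    (Bos.mixed (Bos.eC a b t)).2.2.2 c d
      = (-2 * I * (m : ℂ) ^ 2 * (delta a c * delta b d + delta a d * delta b c)) • t := by
  simp only [Bos.mixed_apply, Bos.eC_apply, ← add_smul, smul_smul]
  congr 1
  ring

theorem sum_delta_s (j k a b : Fin 2) (t : ShellTest m) :
    ∑ c, s c b ((delta j k * delta a c) • t) = delta j k • s a b t := by
  revert a
  simp [Fin.forall_fin_two, Fin.sum_univ_two]

theorem Fer.mixed_elam (j a k b : Fin 2) (t : ShellTest m) :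
    (Fer.mixed (Fer.elam j a t)).1 k b = (2 * delta j k * (m : ℂ) ^ 2) • s a b t := by
  simp only [Fer.mixed_apply, Fer.elam_apply, sum_delta_s, smul_smul]
  congr 1
  ring

theorem Fer.mixed_echi (j a k b : Fin 2) (t : ShellTest m) :
    (Fer.mixed (Fer.echi j a t)).2 k b = (2 * delta j k) • s a b t := by
  simp only [Fer.mixed_apply, Fer.echi_apply, sum_delta_s, smul_smul]

end ComponentPairings

namespace ShellRep

variable {m : ℝ} {α : ℂ} {𝒜 : Type*} [Ring 𝒜] [StarRing 𝒜] [Algebra ℂ 𝒜] [StarModule ℂ 𝒜]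
  (R : ShellRep m α 𝒜)

theorem adj_z (f : Test) : adj R.multiplet.z f = R.boseBar (Bos.ez (of m f)) := by
  simp only [adj_apply, multiplet, LinearMap.comp_apply, R.star_bose, Bos.conj_ez, ← conj_of,
    ShellTest.conj_conj]

theorem adj_D (f : Test) : adj R.multiplet.D f = R.boseBar (Bos.eD (of m f)) := by
  simp only [adj_apply, multiplet, LinearMap.comp_apply, R.star_bose, Bos.conj_eD, ← conj_of,
    ShellTest.conj_conj]

theorem adj_F (a b : Fin 2) (f : Test) :
    adj (R.multiplet.F a b) f = R.boseBar (Bos.eF a b (of m f)) := by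
  simp only [adj_apply, multiplet, LinearMap.comp_apply, R.star_bose, Bos.conj_eF, ← conj_of,
    ShellTest.conj_conj]

theorem adj_C (j k : Fin 2) (f : Test) :
    adj (R.multiplet.C j k) f = R.boseBar (Bos.eC j k (of m f)) := by
  simp only [adj_apply, multiplet, LinearMap.comp_apply, R.star_bose, Bos.conj_eC, ← conj_of,
    ShellTest.conj_conj]

theorem adj_lam (j a : Fin 2) (f : Test) :
    adj (R.multiplet.lam j a) f = R.fermiBar (Fer.elam j a (of m f)) := by
  simp only [adj_apply, multiplet, LinearMap.comp_apply, R.star_fermi, Fer.conj_elam, ← conj_of,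
    ShellTest.conj_conj]

theorem adj_chi (j a : Fin 2) (f : Test) :
    adj (R.multiplet.chi j a) f = R.fermiBar (Fer.echi j a (of m f)) := by
  simp only [adj_apply, multiplet, LinearMap.comp_apply, R.star_fermi, Fer.conj_echi, ← conj_of,
    ShellTest.conj_conj]

/-- The chiral form couples only z to D, F to F, C to C and χ to λ, and the mixed form is diagonal
in the kinds. Brackets between even and odd vectors vanish by construction. -/
theorem bracket_others (a b : FieldName) (hab : ¬ listed a b) (f h : Test) :
    R.multiplet.bracket a b f h = 0 := by
  have hfb : ∀ x y, comm (R.fermi x) (R.bose y) = 0 := fun x y => by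
    rw [comm_swap, R.comm_bose_fermi, neg_zero]
  have hfb' : ∀ x y, comm (R.fermi x) (R.boseBar y) = 0 := fun x y => by
    have := congrArg star (R.comm_bose_fermiBar (Bos.conj y) (Fer.conj x))
    rw [star_comm_eq, ← R.star_fermi, star_star, R.star_bose, Bos.conj_conj, star_zero] at this
    exact this
  refine Multiplet.bracket_eq_zero_of ?_ ?_ a b hab f h
  · intro c d hcd f w
    cases c <;> cases d <;> first
      | exact absurd trivial hcd
      | simp only [Multiplet.bracket, Comp.fermi, Bool.and_true, Bool.and_false, Bool.and_self,
          Bool.false_eq_true, if_true, if_false, Multiplet.field, Multiplet.comp, multiplet,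
          LinearMap.comp_apply, hfb, R.comm_bose_fermi, R.comm_bose_bose, R.acomm_fermi_fermi,
          Bos.pair_ez, Bos.pair_eD, Bos.pair_eF, Bos.pair_eC, Fer.pair_elam, Fer.pair_echi,
          Bos.chiral_apply, Fer.chiral_apply]
        try simp only [Bos.ez_apply, Bos.eD_apply, Bos.eF_apply, Bos.eC_apply, Fer.elam_apply,
          Fer.echi_apply, Pi.zero_apply, smul_zero, map_zero, LinearMap.zero_apply, add_zero,
          Finset.sum_const_zero, mul_zero, zero_smul]
  · intro c d hcd f w
    cases c <;> cases d <;> first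
      | exact absurd trivial hcd
      | simp only [Multiplet.bracket, Comp.fermi, Bool.and_true, Bool.and_false, Bool.and_self,
          Bool.false_eq_true, if_true, if_false, Multiplet.field, Multiplet.comp, adj_z, adj_D,
          adj_F, adj_C, adj_lam, adj_chi]
        simp only [multiplet, LinearMap.comp_apply, hfb', R.comm_bose_fermiBar, R.comm_bose_boseBar,
          R.acomm_fermi_fermiBar, Bos.pair_ez, Bos.pair_eD, Bos.pair_eF, Bos.pair_eC, Fer.pair_elam,
          Fer.pair_echi, Bos.mixed_apply, Fer.mixed_apply]
        try simp only [Bos.ez_apply, Bos.eD_apply, Bos.eF_apply, Bos.eC_apply, Fer.elam_apply,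
          Fer.echi_apply, Pi.zero_apply, smul_zero, map_zero, LinearMap.zero_apply, add_zero,
          Finset.sum_const_zero, mul_zero, zero_smul]

theorem causalRelations : R.multiplet.CausalRelations m α where
  F_F a b c d f h := by
    refine (R.comm_bose_bose _ _).trans (congrArg (· • (1 : 𝒜)) ?_)
    simp only [LinearMap.comp_apply, Bos.pair_eF, Bos.chiral_eF, map_smul, LinearMap.smul_apply,
      J_of, smul_eq_mul]
    ring
  F_Fstar a b c d f h := by
    rw [adj_F]
    refine (R.comm_bose_boseBar _ _).trans (congrArg (· • (1 : 𝒜)) ?_)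
    simp only [LinearMap.comp_apply, Bos.pair_eF, Bos.mixed_eF, map_smul, map_add,
      LinearMap.smul_apply, LinearMap.add_apply, s_of, J_of, smul_eq_mul, add_mul,
      Finset.sum_add_distrib, sum_sigma_sigma_dKer]
    ring
  C_C j k l n f h := by
    refine (R.comm_bose_bose _ _).trans (congrArg (· • (1 : 𝒜)) ?_)
    simp only [LinearMap.comp_apply, Bos.pair_eC, Bos.chiral_eC, map_smul, LinearMap.smul_apply,
      J_of, smul_eq_mul]
    ring
  C_Cstar j k l n f h := by
    rw [adj_C]
    refine (R.comm_bose_boseBar _ _).trans (congrArg (· • (1 : 𝒜)) ?_)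
    simp only [LinearMap.comp_apply, Bos.pair_eC, Bos.mixed_eC, map_smul, LinearMap.smul_apply,
      J_of, smul_eq_mul]
    ring
  D_Dstar f h := by
    rw [adj_D]
    refine (R.comm_bose_boseBar _ _).trans (congrArg (· • (1 : 𝒜)) ?_)
    simp only [LinearMap.comp_apply, Bos.pair_eD]
    simp only [Bos.mixed_apply, Bos.eD_apply, map_smul, LinearMap.smul_apply, J_of, smul_eq_mul]
  z_D f h := by
    refine (R.comm_bose_bose _ _).trans (congrArg (· • (1 : 𝒜)) ?_)
    simp only [LinearMap.comp_apply, Bos.pair_eD]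
    simp only [Bos.chiral_apply, Bos.ez_apply, map_smul, LinearMap.smul_apply, J_of, smul_eq_mul]
  chi_chibar j a k b f h := by
    rw [adj_chi]
    refine (R.acomm_fermi_fermiBar _ _).trans (congrArg (· • (1 : 𝒜)) ?_)
    simp only [LinearMap.comp_apply, Fer.pair_echi, Fer.mixed_echi, map_smul, LinearMap.smul_apply,
      s_of, J_of, smul_eq_mul, sum_sigma_dKer]
  lam_lambar j a k b f h := by
    rw [adj_lam]
    refine (R.acomm_fermi_fermiBar _ _).trans (congrArg (· • (1 : 𝒜)) ?_)
    simp only [LinearMap.comp_apply, Fer.pair_elam, Fer.mixed_elam, map_smul, LinearMap.smul_apply,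
      s_of, J_of, smul_eq_mul, sum_sigma_dKer]
  chi_lam j a k b f h := by
    refine (R.acomm_fermi_fermi _ _).trans (congrArg (· • (1 : 𝒜)) ?_)
    simp only [LinearMap.comp_apply, Fer.pair_elam, Fer.chiral_echi, map_smul, LinearMap.smul_apply,
      J_of, smul_eq_mul]
    ring
  others := R.bracket_others

theorem isScalarOfMass : R.multiplet.IsScalarOfMass m where
  klein_gordon f := by
    -- The field depends only on the on-shell class of the test function, where □ + m² is
    -- multiplication by m² - k² = 0.
    have key : of m (∑ μ, (g μ : ℂ) • dTest μ (dTest μ f) + ((m ^ 2 : ℝ) : ℂ) • f) = 0 := by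
      ext k
      simp only [of_apply, minkFourier_add, minkFourier_sum, minkFourier_smul, minkFourier_dTest,
        zero_apply, ← k.2, mink, Fin.sum_univ_four, g]
      push_cast
      simp
      ring_nf; simp; ring
    have : ∀ μ, dField μ (dField μ R.multiplet.z) f = R.multiplet.z (dTest μ (dTest μ f)) :=
      fun μ => by simp [dField]
    have h0 : R.multiplet.z (∑ μ, (g μ : ℂ) • dTest μ (dTest μ f) + ((m ^ 2 : ℝ) : ℂ) • f) = 0 := by
      change R.bose (Bos.ez (of m _)) = 0
      rw [key, map_zero, map_zero]
    rw [← h0]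
    simp only [this, map_smul, map_sum, map_add]
  z_z f h := by
    refine (R.comm_bose_bose _ _).trans ?_
    simp only [LinearMap.comp_apply, Bos.pair_ez]
    simp only [Bos.chiral_apply, Bos.ez_apply, smul_zero, map_zero, LinearMap.zero_apply, zero_smul]
  z_zstar f h := by
    rw [adj_z]
    refine (R.comm_bose_boseBar _ _).trans (congrArg (· • (1 : 𝒜)) ?_)
    simp only [LinearMap.comp_apply, Bos.pair_ez]
    simp only [Bos.mixed_apply, Bos.ez_apply, map_smul, LinearMap.smul_apply, J_of, smul_eq_mul]

end ShellRep

end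

end N2

/-! ### The symmetry unitaries and the completed representation. -/

namespace N2

noncomputable section

open Complex

namespace ChiralSpace

open SuperWeyl

variable {M₀ M₁ : Type*} [AddCommGroup M₀] [Module ℂ M₀] [AddCommGroup M₁] [Module ℂ M₁]
  (S : ChiralSpace M₀ M₁)

/-- The symmetry `r` of the doubled space extends `r₀` and `r₁`. -/
structure Extends (r : S.double.Symm) (r₀ : M₀ →ₗ[ℂ] M₀) (r₁ : M₁ →ₗ[ℂ] M₁) : Prop where
  even : ∀ v, r.r₀ v = doubleMap S.κ₀ r₀ v
  odd : ∀ v, r.r₁ v = doubleMap S.κ₁ r₁ v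

namespace Extends

variable {S} {r s t : S.double.Symm} {r₀ s₀ t₀ : M₀ →ₗ[ℂ] M₀} {r₁ s₁ t₁ : M₁ →ₗ[ℂ] M₁}

theorem conj_bose (h : S.Extends r r₀ r₁) (x : M₀) :
    star (r.toUnitary : S.Alg) * S.bose x * (r.toUnitary : S.Alg) = S.bose (r₀ x) := by
  rw [bose_apply, r.conj_even, h.even, doubleMap_apply, bose_apply]
  simp only [map_zero]

theorem conj_fermi (h : S.Extends r r₀ r₁) (x : M₁) :
    star (r.toUnitary : S.Alg) * S.fermi x * (r.toUnitary : S.Alg) = S.fermi (r₁ x) := by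
  rw [fermi_apply, r.conj_odd, h.odd, doubleMap_apply, fermi_apply]
  simp only [map_zero]

theorem toUnitary_mul (hr : S.Extends r r₀ r₁) (hs : S.Extends s s₀ s₁) (ht : S.Extends t t₀ t₁)
    (h₀ : ∀ x, s₀ (r₀ x) = t₀ x) (h₁ : ∀ x, s₁ (r₁ x) = t₁ x) :
    r.toUnitary * s.toUnitary = t.toUnitary :=
  CausalSpace.Symm.toUnitary_mul _ _
    (fun v => by simp only [hr.even, hs.even, ht.even, doubleMap_apply, S.κ₀_κ₀, h₀])
    fun v => by simp only [hr.odd, hs.odd, ht.odd, doubleMap_apply, S.κ₁_κ₁, h₁]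

/-- The unitary is idempotent in a group, hence trivial. -/
theorem toUnitary_eq_one (hr : S.Extends r r₀ r₁) (h₀ : ∀ x, r₀ x = x) (h₁ : ∀ x, r₁ x = x) :
    r.toUnitary = 1 :=
  mul_eq_left.1 (hr.toUnitary_mul hr hr (fun x => by rw [h₀]) fun x => by rw [h₁])

theorem conj_charge (h : S.Extends r r₀ r₁) {ι : Type*} (I : Finset ι) (c : ι → ℂ)
    {X Y : S.double.Ops} {X' Y' : ι → S.double.Ops} {Q₀ R₀ : M₀ →ₗ[ℂ] M₁} {Q₁ R₁ : M₁ →ₗ[ℂ] M₀}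
    {Q₀' R₀' : ι → M₀ →ₗ[ℂ] M₁} {Q₁' R₁' : ι → M₁ →ₗ[ℂ] M₀}
    (hX : IsOddDer X (S.charge₀ Q₀ R₀) (S.charge₁ Q₁ R₁))
    (hY : IsOddDer Y (S.charge₀ R₀ Q₀) (S.charge₁ R₁ Q₁))
    (hX' : ∀ i, IsOddDer (X' i) (S.charge₀ (Q₀' i) (R₀' i)) (S.charge₁ (Q₁' i) (R₁' i)))
    (hY' : ∀ i, IsOddDer (Y' i) (S.charge₀ (R₀' i) (Q₀' i)) (S.charge₁ (R₁' i) (Q₁' i)))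
    (hQ₀ : ∀ x, r₁ (Q₀ x) = ∑ i ∈ I, c i • Q₀' i (r₀ x))
    (hR₀ : ∀ x, r₁ (R₀ x) = ∑ i ∈ I, (starRingEnd ℂ) (c i) • R₀' i (r₀ x))
    (hQ₁ : ∀ x, r₀ (Q₁ x) = ∑ i ∈ I, c i • Q₁' i (r₁ x))
    (hR₁ : ∀ x, r₀ (R₁ x) = ∑ i ∈ I, (starRingEnd ℂ) (c i) • R₁' i (r₁ x)) :
    star (r.toUnitary : S.Alg) * Dbl.mk X Y * (r.toUnitary : S.Alg)
      = ∑ i ∈ I, c i • Dbl.mk (X' i) (Y' i) := by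
  have hX'' := r.op_isOddDer I c hX hX'
    (fun v => by rw [h.even, h.odd, S.doubleMap_charge₀ I c hQ₀ hR₀])
    (fun v => by rw [h.even, h.odd, S.doubleMap_charge₁ I c hQ₁ hR₁])
  have hY'' := r.op_isOddDer I (fun i => (starRingEnd ℂ) (c i)) hY hY'
    (fun v => by
      rw [h.even, h.odd, S.doubleMap_charge₀ I (fun i => (starRingEnd ℂ) (c i)) hR₀ (q' := Q₀')]
      simpa only [Complex.conj_conj] using hQ₀)
    (fun v => by
      rw [h.even, h.odd, S.doubleMap_charge₁ I (fun i => (starRingEnd ℂ) (c i)) hR₁ (q' := Q₁')]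
      simpa only [Complex.conj_conj] using hQ₁)
  rw [r.conj_toUnitary, hX'', hY'']
  simp only [Dbl.smul_mk, Dbl.sum_mk]

end Extends

end ChiralSpace

namespace shellSpace

open ShellTest

variable {m : ℝ} (α : ℂ)

section Symm

variable {τ τ' : ShellTest m →ₗ[ℂ] ShellTest m} {A B : Matrix (Fin 2) (Fin 2) ℂ}

theorem extends_symm (h : IsSymmetry τ A B) (hτ : τ ∘ₗ τ' = LinearMap.id)
    (hτ' : τ' ∘ₗ τ = LinearMap.id) :
    (shellSpace m α).Extends (symm α h hτ hτ') (Bos.rot τ A B) (Fer.rot τ A B) :=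
  ⟨fun _ => rfl, fun _ => rfl⟩

theorem conj_Q {r : (shellSpace m α).double.Symm} (h : IsSymmetry τ A B)
    (hr : (shellSpace m α).Extends r (Bos.rot τ A B) (Fer.rot τ A B)) (j a : Fin 2) :
    star (r.toUnitary : (shellSpace m α).Alg) * Q α j a * (r.toUnitary : (shellSpace m α).Alg)
      = ∑ i : Fin 2 × Fin 2, (B j i.1 * A a i.2) • Q (m := m) α i.1 i.2 :=
  hr.conj_charge Finset.univ (fun i : Fin 2 × Fin 2 => B j i.1 * A a i.2)
    (isOddDer_chargeOp α j a) (isOddDer_conjChargeOp α j a)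
    (fun i => isOddDer_chargeOp α i.1 i.2) (fun i => isOddDer_conjChargeOp α i.1 i.2)
    (fun x => by rw [Fer.rot_q h, Fintype.sum_prod_type])
    (fun x => by simp only [Fer.rot_qbar h, Fintype.sum_prod_type, map_mul])
    (fun x => by rw [Bos.rot_q h, Fintype.sum_prod_type])
    (fun x => by simp only [Bos.rot_qbar h, Fintype.sum_prod_type, map_mul])

end Symm

theorem poincare_comp_inv (a : Spacetime) (A : Matrix.SpecialLinearGroup (Fin 2) ℂ) :
    poincare (m := m) a A ∘ₗ poincare (-lorentzAct A⁻¹ a) A⁻¹ = LinearMap.id := by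
  refine LinearMap.ext fun t => ?_
  rw [LinearMap.comp_apply, poincare_poincare, neg_add_cancel, inv_mul_cancel, poincare_zero_one]
  rfl

theorem inv_comp_poincare (a : Spacetime) (A : Matrix.SpecialLinearGroup (Fin 2) ℂ) :
    poincare (m := m) (-lorentzAct A⁻¹ a) A⁻¹ ∘ₗ poincare a A = LinearMap.id := by
  refine LinearMap.ext fun t => ?_
  rw [LinearMap.comp_apply, poincare_poincare, lorentzAct_neg, ← lorentzAct_mul, mul_inv_cancel,
    lorentzAct_one, add_neg_cancel, poincare_zero_one]
  rfl

/-- The Poincaré symmetries. -/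
def poincareSymm (a : Spacetime) (A : Matrix.SpecialLinearGroup (Fin 2) ℂ) :
    (shellSpace m α).double.Symm :=
  symm α (isSymmetry_poincare a A) (poincare_comp_inv a A) (inv_comp_poincare a A)

/-- The `SU(2)` symmetries. -/
def isospinSymm (u : Matrix.specialUnitaryGroup (Fin 2) ℂ) : (shellSpace m α).double.Symm :=
  symm α (isSymmetry_isospin u) (τ' := LinearMap.id) rfl rfl

theorem extends_poincareSymm (a : Spacetime) (A : Matrix.SpecialLinearGroup (Fin 2) ℂ) :
    (shellSpace m α).Extends (poincareSymm α a A) (Bos.rot (poincare a A) A.1 1)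
      (Fer.rot (poincare a A) A.1 1) :=
  extends_symm α _ _ _

theorem extends_isospinSymm (u : Matrix.specialUnitaryGroup (Fin 2) ℂ) :
    (shellSpace m α).Extends (isospinSymm α u) (Bos.rot LinearMap.id 1 u.1)
      (Fer.rot LinearMap.id 1 u.1) :=
  extends_symm α _ _ _

theorem poincareSymm_mul (a : Spacetime) (A : Matrix.SpecialLinearGroup (Fin 2) ℂ) (b : Spacetime)
    (B : Matrix.SpecialLinearGroup (Fin 2) ℂ) :
    (poincareSymm (m := m) α a A).toUnitary * (poincareSymm α b B).toUnitary
      = (poincareSymm α (a + lorentzAct A b) (A * B)).toUnitary := by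
  have hτ : poincare (m := m) b B ∘ₗ poincare a A = poincare (a + lorentzAct A b) (A * B) :=
    LinearMap.ext fun t => poincare_poincare a b A B t
  refine (extends_poincareSymm α a A).toUnitary_mul (extends_poincareSymm α b B)
    (extends_poincareSymm α _ _) (fun x => ?_) fun x => ?_
  · rw [Bos.rot_rot, hτ, one_mul]; rfl
  · rw [Fer.rot_rot, hτ, one_mul]; rfl

theorem isospinSymm_mul (u v : Matrix.specialUnitaryGroup (Fin 2) ℂ) :
    (isospinSymm (m := m) α u).toUnitary * (isospinSymm α v).toUnitary
      = (isospinSymm α (u * v)).toUnitary := by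
  refine (extends_isospinSymm α u).toUnitary_mul (extends_isospinSymm α v)
    (extends_isospinSymm α _) (fun x => ?_) fun x => ?_
  · rw [Bos.rot_rot, one_mul]; rfl
  · rw [Fer.rot_rot, one_mul]; rfl

theorem isospinSymm_one : (isospinSymm (m := m) α 1).toUnitary = 1 :=
  (extends_isospinSymm α 1).toUnitary_eq_one Bos.rot_id Fer.rot_id

/-- Both orders give the unitary of the joint symmetry that rotates Weyl indices by A and isospin
indices by u at once. -/
theorem poincareSymm_isospinSymm (a : Spacetime) (A : Matrix.SpecialLinearGroup (Fin 2) ℂ)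
    (u : Matrix.specialUnitaryGroup (Fin 2) ℂ) :
    (poincareSymm (m := m) α a A).toUnitary * (isospinSymm α u).toUnitary
      = (isospinSymm α u).toUnitary * (poincareSymm α a A).toUnitary := by
  have h : IsSymmetry (poincare (m := m) a A) A.1 u.1 :=
    { isSymmetry_poincare a A with
      det_isospin := (isSymmetry_isospin (m := m) u).det_isospin
      conj_isospin := (isSymmetry_isospin (m := m) u).conj_isospin }
  have ht := extends_symm α h (poincare_comp_inv a A) (inv_comp_poincare a A)
  exact ((extends_poincareSymm α a A).toUnitary_mul (extends_isospinSymm α u) ht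
      (fun x => by rw [Bos.rot_rot, one_mul, mul_one]; rfl)
      (fun x => by rw [Fer.rot_rot, one_mul, mul_one]; rfl)).trans
    ((extends_isospinSymm α u).toUnitary_mul (extends_poincareSymm α a A) ht
      (fun x => by rw [Bos.rot_rot, one_mul, mul_one]; rfl)
      (fun x => by rw [Fer.rot_rot, one_mul, mul_one]; rfl)).symm

/-- The representation of the one-particle structure in the algebra generated by its fields, its
symmetries and its charges. -/
def rep : ShellRep m α (shellSpace m α).Alg where
  bose := (shellSpace m α).bose
  fermi := (shellSpace m α).fermi
  boseBar := (shellSpace m α).boseBar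
  fermiBar := (shellSpace m α).fermiBar
  star_bose x := ((shellSpace m α).star_bose x).trans (congrArg _ (κ₀_apply α x))
  star_fermi x := ((shellSpace m α).star_fermi x).trans (congrArg _ (κ₁_apply α x))
  comm_bose_bose x y := ((shellSpace m α).comm_bose_bose x y).trans
    (congrArg (· • (1 : (shellSpace m α).Alg)) (A₀_apply α x y))
  comm_bose_boseBar x y := ((shellSpace m α).comm_bose_boseBar x y).trans
    (congrArg (· • (1 : (shellSpace m α).Alg)) (H₀_apply α x y))
  acomm_fermi_fermi x y := ((shellSpace m α).acomm_fermi_fermi x y).trans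
    (congrArg (· • (1 : (shellSpace m α).Alg)) (A₁_apply α x y))
  acomm_fermi_fermiBar x y := ((shellSpace m α).acomm_fermi_fermiBar x y).trans
    (congrArg (· • (1 : (shellSpace m α).Alg)) (H₁_apply α x y))
  comm_bose_fermi := (shellSpace m α).comm_bose_fermi
  comm_bose_fermiBar := (shellSpace m α).comm_bose_fermiBar
  U a A := (poincareSymm α a A).toUnitary
  V :=
    { toFun := fun u => (isospinSymm α u).toUnitary
      map_one' := isospinSymm_one α
      map_mul' := fun u v => (isospinSymm_mul α u v).symm }
  U_mul := poincareSymm_mul α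
  U_V_comm := poincareSymm_isospinSymm α
  U_bose a A := (extends_poincareSymm α a A).conj_bose
  U_fermi a A := (extends_poincareSymm α a A).conj_fermi
  V_bose u := (extends_isospinSymm α u).conj_bose
  V_fermi u := (extends_isospinSymm α u).conj_fermi
  P := P α
  Q := Q α
  star_P := star_P α
  comm_P_bose := comm_P_bose α
  comm_P_fermi := comm_P_fermi α
  comm_Q_P := comm_Q_P α
  U_Q A := conj_Q α (isSymmetry_poincare 0 A) (extends_poincareSymm α 0 A)
  V_Q u := conj_Q α (isSymmetry_isospin u) (extends_isospinSymm α u)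
  acomm_Q_Q := acomm_Q_Q α
  acomm_Q_star_Q := acomm_Q_star_Q α
  comm_Q_bose := comm_Q_bose α
  comm_star_Q_bose := comm_star_Q_bose α
  acomm_Q_fermi := acomm_Q_fermi α
  acomm_star_Q_fermi := acomm_star_Q_fermi α
  acomm_Q_fermiBar j a x := (acomm_Q_fermiBar α j a x).trans (congrArg _
    ((κ₀_apply α _).trans (congrArg (fun y => Bos.conj (Fer.qbar j a y)) (κ₁_apply α x))))

theorem nontrivial_alg : Nontrivial (shellSpace m α).Alg :=
  have := (shellSpace m α).double.nontrivial_ops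
  inferInstance

end shellSpace

theorem exists_multiplet (m : ℝ) (α : ℂ) : ∃ (𝒜 : Type) (_ : Ring 𝒜) (_ : StarRing 𝒜)
    (_ : Algebra ℂ 𝒜) (_ : StarModule ℂ 𝒜) (_ : Nontrivial 𝒜) (M : Multiplet 𝒜),
    M.IsFree m ∧ M.IsScalarOfMass m ∧ M.CausalRelations m α :=
  ⟨(shellSpace m α).Alg, inferInstance, inferInstance, inferInstance, inferInstance,
    shellSpace.nontrivial_alg α, (shellSpace.rep α).multiplet,
    (shellSpace.rep α).causalRelations.isFree (shellSpace.rep α).isScalarOfMass,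
    (shellSpace.rep α).isScalarOfMass, (shellSpace.rep α).causalRelations⟩

end

end N2

theorem mainTheorem2 (m : ℝ) (hm : 0 ≤ m) :
    (∀ (𝒜 : Type*) [Ring 𝒜] [StarRing 𝒜] [Algebra ℂ 𝒜] [StarModule ℂ 𝒜] (M : N2.Multiplet 𝒜),
      M.IsFree m → M.IsScalarOfMass m → ∃ α : ℂ, M.CausalRelations m α) ∧
    (∀ α : ℂ, ∃ (𝒜 : Type) (_ : Ring 𝒜) (_ : StarRing 𝒜) (_ : Algebra ℂ 𝒜)
      (_ : StarModule ℂ 𝒜) (_ : Nontrivial 𝒜) (M : N2.Multiplet 𝒜),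
      M.IsFree m ∧ M.IsScalarOfMass m ∧ M.CausalRelations m α) := by
  exact ⟨fun 𝒜 _ _ _ _ _ hM hz => N2.Multiplet.exists_causalRelations hM hz,
    N2.exists_multiplet m⟩
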